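/- **Setting.** Let $d\ge 0$, $\epsilon>0$, $\lambda>0$, $\omega(\xi)=\omega_0+\frac{|\xi|^2}{2}$ on $\mathbb R^d$ with $\omega_0=0$ or $\omega_0=\epsilon^{-2}$, and $M=m(\epsilon D)$ with $m:\mathbb R^d\to\mathbb R$ smooth and even. Write $\widehat f(\xi)=(2\pi)^{-d/2}\int f(x)e^{-ix\cdot\xi}dx$. Let $a(x,\xi)$ be such that its Fourier transform in the first variable, $\widehat a(\eta,\xi)$, is in $C_0^\infty(\mathbb R^{2d})$, and let $u_0$ be a (jointly measurable) centred complex Gaussian field on $\mathbb R^d$ with $\mathbb E[\overline{u_0(x)}u_0(x')]=\int\overline{a(x,\xi)}a(x',\xi)e^{-i\frac\xi\epsilon\cdot(x-x')}d\xi$ and $\mathbb E[u_0(x)u_0(x')]=0$. Define $u^0(t)=e^{it\omega(D)}u_0$ and, for $n\ge1$, let $u^n$ be the (Duhamel) solution of $$ i\partial_tu^n+\omega(D)u^n=\lambda\sum_{j+k=n-1}M\big((Mu^j+M\overline{u^j})(Mu^k+M\overline{u^k})\big),\qquad u^n(0)=0 .$$ Let $W_0^\epsilon(x,v)=(2\pi)^{-d}\,\mathbb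 E\int\overline{u_0(x+\frac{\epsilon y}2)}u_0(x-\frac{\epsilon y}2)e^{iv\cdot y}dy$, and let $\widehat{W_0^\epsilon}(\eta,v)$ be its Fourier transform in $x$. **Paired graphs.** An interaction graph of depth $n$ is a planar binary tree with $n$ interaction vertices (those with two vertices below), $n+1$ initial vertices, and a parity $\sigma_v\in\{\pm1\}$ at each vertex, equal to $+1$ at the top vertex. A paired graph $G\in\mathcal G^p_n$ consists of two interaction graphs $G^l,G^r$ of depth $n$, whose top vertices $v^l_{\rm top},v^r_{\rm top}$ are attached on the left and on the right below a common root vertex $v_R$, the parities of $G^l$ being flipped, and of a partition $P$ of $\{1,\dots,2n+2\}$ into pairs such that $\sigma_{0,i}=-\sigma_{0,j}$ for $\{i,j\}\in P$; here $v_{0,1},\dots,v_{0,2n+2}$ are the initial vertices from left to right and $\sigma_{0,i}$ their (flipped, on the left) parities. $\mathcal V_i$ is the set of the $2n$ interaction vertices of $G$, and $\sigma_G$ is the number of interaction vertices of $G^l$ and $G^r$ with parity $-1$ before flipping. Each vertex $v\ne v_R$ carries the frequency $\xi_v\in\mathbb R^d$ of the edge above it; $v_l(v)$, $v_r(v)$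 are the vertices below $v$ on the left and right; $\xi_{0,i}=\xi_{v_{0,i}}$. The Kirchhoff laws are $$\xi_v=\xi_{v_l(v)}+\xi_{v_r(v)}\ (v\in\mathcal V_i),\qquad \xi_{0,i}+\xi_{0,j}=\eta_{i,j}\ (\{i,j\}\in P),\qquad \textstyle\sum_{\{i,j\}\in P}\eta_{i,j}=0 .$$ The resonance moduli are $\Omega_v=\sigma_v\omega(\xi_v)-\sigma_{v_l(v)}\omega(\xi_{v_l(v)})-\sigma_{v_r(v)}\omega(\xi_{v_r(v)})$, and $$M_G(\underline\xi)=\prod_{v\in\mathcal V_i}m(\epsilon\xi_v)\,m(\epsilon\xi_{v_l(v)})\,m(\epsilon\xi_{v_r(v)}).$$ For a vertex $v\neq v_R$, $\mathcal p^+(v)$ (resp. $\mathcal p^-(v)$) is the set of $w\in\mathcal V_i$ such that $v$ is reached from $w$ (resp. $w$ is reached from $v$) by going down to the left a number ($\ge0$) of times. For $\underline s=(s_v)_{v\in\mathcal V_i}\in\mathbb R_+^{2n}$ let $\Delta_t(\underline s)=1$ if $\sum_{w\in\mathcal p^-(v_r(v))}s_w\le\sum_{w\in\mathcal p^-(v)}s_w$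 for all $v\in\mathcal V_i$ and $\sum_{w\in\mathcal p^-(v)}s_w\le t$ for $v\in\{v^l_{\rm top},v^r_{\rm top}\}$, and $\Delta_t(\underline s)=0$ otherwise. An integration order is an enumeration $v_1,\dots,v_{2n+1}$ of $\mathcal V_i\cup\{v_R\}$ such that $v_i$ is not above $v_j$ for $i<j$ (so $v_{2n+1}=v_R$). A vertex $v\in\mathcal V_i$ is linear if $\sigma_{v_l(v)}\sigma_{v_r(v)}=-1$, quadratic if $\sigma_{v_l(v)}\sigma_{v_r(v)}=1$. Let $\mathbb R^{d(n+1)}_0=\{\underline\eta=(\eta_{i,j})_{\{i,j\}\in P}:\sum\eta_{i,j}=0\}$, with the measure $d\underline\eta=\delta(\sum\eta_{i,j})\prod d\eta_{i,j}$ (Lebesgue measure in all but one of the $\eta_{i,j}$). **Proposition 6.1.** Let $n\ge0$. The set $\mathcal G^p_n$ is finite. Fix any integration order on each $G\in\mathcal G^p_n$. Then for each $G$ there are indices $1\le k_1<\dots<k_{n+1}\le 2n+1$ and coefficients in $\{-1,0,1\}$, depending only on $G$ and its integration order, such that, with the interaction free variables $\underline{\xi^f}=(\xi^f_1,\dots,\xi^f_{n+1})\in\mathbb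 R^{d(n+1)}$, $\xi^f_i$ being the frequency of the left edge below $v_{k_i}$, and the slow variables $\underline\eta\in\mathbb R^{d(n+1)}_0$: * The solutions $(\underline\xi,\underline\eta)$ of the Kirchhoff laws are parametrized bijectively by $(\underline{\xi^f},\underline\eta)\in\mathbb R^{d(n+1)}\times\mathbb R_0^{d(n+1)}$, each frequency being a linear combination of the $\xi^f_j$, $1\le j\le n+1$, and of the $\eta_{i',j'}$ with these coefficients. * $\mathcal V^1=\{v_{k_1},\dots,v_{k_n}\}\subset\mathcal V_i$ (degree one vertices) and $\mathcal V^0=\mathcal V_i\setminus\mathcal V^1$ (degree zero vertices) both have $n$ elements, and $\mathcal V^1$ is the disjoint union of its subsets of linear vertices $\mathcal V^1_l$ and quadratic vertices $\mathcal V^1_q$. If some pair of $P$ joins an initial vertex of the left subtree to one of the right subtree, then $k_{n+1}=2n+1$, i.e. $\xi^f_{n+1}=\xi_{v^l_{\rm top}}$. * $v\in\mathcal p^+(v)$ for $v\in\mathcal V_i$, and $v_k\notin\mathcal p^+(v_{k'})$ for $1\le k<k'\le 2n$. * (i) For $1\le k\le2n$, the frequency $\tilde\xi_k=\xi_{v_k}$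 above $v_k$ depends only on $\underline\eta$ and on the $\xi^f_j$ with $k_j>k$. * (ii) The map $(\underline{\xi^f},\underline\eta)\mapsto(\sigma_{0,i}\xi_{0,i}+\sigma_{0,j}\xi_{0,j},\eta_{i,j})_{\{i,j\}\in P}$ is a bijection from $\mathbb R^{d(n+1)}\times\mathbb R^{d(n+1)}_0$ onto $\mathbb R^{d(n+1)}\times\mathbb R^{d(n+1)}_0$. * (iii) If $k=k_i\le 2n$ (in particular for $1\le i\le n$), then with $\sigma_k=\sigma_{v_l(v_k)}$, $\tilde\sigma_k=\sigma_{v_k}$: if $v_k$ is linear, $$\Omega_{v_k}=-\sigma_k\,\tilde\xi_k\cdot\xi^f_i+\tilde\sigma_k\omega_0+\tfrac12(\tilde\sigma_k+\sigma_k)|\tilde\xi_k|^2,$$ and if $v_k$ is quadratic, $$\Omega_{v_k}=-\sigma_k\,\xi^f_i\cdot(\xi^f_i-\tilde\xi_k)+(\tilde\sigma_k-2\sigma_k)\omega_0+\tfrac12(\tilde\sigma_k-\sigma_k)|\tilde\xi_k|^2 .$$ * (iv) If $v_k\in\mathcal V^0$, then $\Omega_{v_k}$ is a polynomial of degree at most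 two which depends only on $\underline\eta$ and on the $\xi^f_j$ with $k_j\ge k$. * For all data as in the setting and all $t\ge0$, $\mathbb E\|u^n(t)\|_{L^2}^2$ is finite and $$\mathbb E\|u^n(t)\|_{L^2}^2=\sum_{G\in\mathcal G^p_n}\mathcal F_t(G),$$ where, the integral being absolutely convergent, $$\mathcal F_t(G)=(-1)^{\sigma_G}(2\pi)^{\frac{d(1-n)}2}\lambda^{2n}\epsilon^{d(n+1)}\int_{\mathbb R^{d(n+1)}_0}\int_{\mathbb R^{d(n+1)}}\int_{\mathbb R_+^{2n}}\Delta_t(\underline s)\,M_G(\underline\xi)\prod_{\{i,j\}\in P}\widehat{W_0^\epsilon}\Big(\eta_{i,j},\tfrac\epsilon2(\sigma_{0,i}\xi_{0,i}+\sigma_{0,j}\xi_{0,j})\Big)\prod_{v\in\mathcal V_i}e^{-is_v\sum_{\tilde v\in\mathcal p^+(v)}\Omega_{\tilde v}}\,d\underline s\,d\underline{\xi^f}\,d\underline\eta .$$ -/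

import Mathlib

open MeasureTheory ProbabilityTheory

noncomputable section

namespace WaveKinetic

/-- The space `ℝᵈ` with its Euclidean norm. -/
abbrev Space (d : ℕ) := EuclideanSpace ℝ (Fin d)

/-! ### Fourier multipliers, the equation and its iterates -/

/-- `f̂(ξ) = (2π)^{-d/2} ∫ f(x) e^{-i x·ξ} dx`. -/
def ft {d : ℕ} (f : Space d → ℂ) (ξ : Space d) : ℂ :=
  (((2 * Real.pi) ^ (-(d : ℝ) / 2) : ℝ) : ℂ) *
    ∫ x, f x * Complex.exp (-Complex.I * ((inner ℝ x ξ : ℝ) : ℂ))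

/-- `f(x) = (2π)^{-d/2} ∫ f̂(ξ) e^{i x·ξ} dξ`. -/
def ift {d : ℕ} (g : Space d → ℂ) (x : Space d) : ℂ :=
  (((2 * Real.pi) ^ (-(d : ℝ) / 2) : ℝ) : ℂ) *
    ∫ ξ, g ξ * Complex.exp (Complex.I * ((inner ℝ x ξ : ℝ) : ℂ))

/-- The Fourier multiplier `q(D)`. -/
def fourierMul {d : ℕ} (q : Space d → ℂ) (f : Space d → ℂ) : Space d → ℂ :=
  ift fun ξ => q ξ * ft f ξ

/-- The dispersion relation `ω(ξ) = ω₀ + |ξ|²/2`. -/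
def disp {d : ℕ} (ω₀ : ℝ) (ξ : Space d) : ℝ := ω₀ + ‖ξ‖ ^ 2 / 2

/-- The multiplier `M = m(εD)`. -/
def opM {d : ℕ} (ε : ℝ) (m : Space d → ℝ) (f : Space d → ℂ) : Space d → ℂ :=
  fourierMul (fun ξ => ((m (ε • ξ) : ℝ) : ℂ)) f

/-- The free propagator `e^{itω(D)}` of the equation `i ∂ₜ u + ω(D) u = 0`. -/
def propagator {d : ℕ} (ω₀ t : ℝ) (f : Space d → ℂ) : Space d → ℂ :=
  fourierMul (fun ξ => Complex.exp (Complex.I * ((t * disp ω₀ ξ : ℝ) : ℂ))) f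

/-- Complex conjugate of a function. -/
def conjFun {d : ℕ} (f : Space d → ℂ) : Space d → ℂ := fun x => starRingEnd ℂ (f x)

/-- The bilinear form `M ((M f + M f̄) (M g + M ḡ))` of the nonlinearity. -/
def nonlin {d : ℕ} (ε : ℝ) (m : Space d → ℝ) (f g : Space d → ℂ) : Space d → ℂ :=
  opM ε m fun x =>
    (opM ε m f x + opM ε m (conjFun f) x) * (opM ε m g x + opM ε m (conjFun g) x)

/-- The iterates `uⁿ(t, x)`: `u⁰ = e^{itω(D)} u₀` and, for `n ≥ 1`, `uⁿ` is the (Duhamel) solution of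
`i ∂ₜ uⁿ + ω(D) uⁿ = λ ∑_{j+k=n-1} M((M uʲ + M ūʲ)(M uᵏ + M ūᵏ))`, `uⁿ(t = 0) = 0`. -/
def iterate {d : ℕ} (ε lam ω₀ : ℝ) (m : Space d → ℝ) (u₀ : Space d → ℂ) :
    ℕ → ℝ → Space d → ℂ
  | 0 => fun t => propagator ω₀ t u₀
  | n + 1 => fun t x =>
      -Complex.I * (lam : ℂ) * ∫ s in (0 : ℝ)..t,
        propagator ω₀ (t - s) (fun y => ∑ j : Fin (n + 1),
          nonlin ε m (iterate ε lam ω₀ m u₀ j s) (iterate ε lam ω₀ m u₀ (n - j) s) y) x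
  termination_by n => n
  decreasing_by all_goals omega

/-! ### The random data and its Wigner transform -/

/-- `a(x, ξ)`, recovered from its Fourier transform `â(η, ξ)` in the first variable. -/
def envelope {d : ℕ} (ahat : Space d × Space d → ℂ) (x ξ : Space d) : ℂ :=
  ift (fun η => ahat (η, ξ)) x

/-- `u₀` is (a jointly measurable version of) the centred circular complex Gaussian field
`u₀(x) = ∫ a(x, ξ) e^{i ξ·x/ε} dW(ξ)`, `W` a complex Wiener process: it is characterized
by being Gaussian and by its covariances. -/
structure IsInitialField {d : ℕ} {Ω : Type*} [MeasurableSpace Ω] (P : Measure Ω)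
    (ε : ℝ) (a : Space d → Space d → ℂ) (u₀ : Ω → Space d → ℂ) : Prop where
  measurable : Measurable (Function.uncurry u₀)
  gaussian : IsGaussianProcess (fun x ω => u₀ ω x) P
  mean : ∀ x, ∫ ω, u₀ ω x ∂P = 0
  covariance : ∀ x x', ∫ ω, starRingEnd ℂ (u₀ ω x) * u₀ ω x' ∂P =
    ∫ ξ, starRingEnd ℂ (a x ξ) * a x' ξ *
      Complex.exp (-Complex.I * ((inner ℝ (ε⁻¹ • ξ) (x - x') : ℝ) : ℂ))
  pseudocovariance : ∀ x x', ∫ ω, u₀ ω x * u₀ ω x' ∂P = 0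

/-- The rescaled averaged Wigner transform
`W^ε[u](x, v) = (2π)^{-d} 𝔼 ∫ ū(x + εy/2) u(x - εy/2) e^{i v·y} dy`. -/
def wigner {d : ℕ} {Ω : Type*} [MeasurableSpace Ω] (P : Measure Ω)
    (ε : ℝ) (u : Ω → Space d → ℂ) (x v : Space d) : ℂ :=
  (((2 * Real.pi) ^ (-(d : ℝ)) : ℝ) : ℂ) *
    ∫ ω, (∫ y, starRingEnd ℂ (u ω (x + (ε / 2) • y)) * u ω (x - (ε / 2) • y) *
      Complex.exp (Complex.I * ((inner ℝ v y : ℝ) : ℂ))) ∂P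

/-- The Fourier transform of the Wigner transform in its first variable. -/
def wignerHat {d : ℕ} {Ω : Type*} [MeasurableSpace Ω] (P : Measure Ω)
    (ε : ℝ) (u : Ω → Space d → ℂ) (η v : Space d) : ℂ :=
  ft (fun x => wigner P ε u x v) η

/-! ### Interaction graphs

An interaction graph is a planar binary tree with a parity on each vertex. A vertex is
given by its address, the list of turns (`false` for left, `true` for right) from the top vertex
down to it. So the vertices below `v` on the left and on the right are `v ++ [false]` and
`v ++ [true]`, and `w` is equal to or below `v` iff `v` is a prefix of `w`. Each vertex other than
the root vertex is identified with the edge `e_a(v)` above it. -/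

/-- Planar binary trees with parities in `{±1}` on all vertices. -/
inductive STree : Type
  | leaf (σ : ℤˣ) : STree
  | node (σ : ℤˣ) (l r : STree) : STree

namespace STree

/-- The depth: the number of interaction vertices. -/
def depth : STree → ℕ
  | leaf _ => 0
  | node _ l r => l.depth + r.depth + 1

/-- The parity of the vertex with a given address. -/
def parity : STree → List Bool → ℤˣ
  | leaf σ, _ => σ
  | node σ _ _, [] => σ
  | node _ l _, false :: v => l.parity v
  | node _ _ r, true :: v => r.parity v

/-- All parities flipped. -/
def flip : STree → STree
  | leaf σ => leaf (-σ)
  | node σ l r => node (-σ) l.flip r.flip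

/-- The addresses of the vertices that have two vertices below them. -/
def inner : STree → Finset (List Bool)
  | leaf _ => ∅
  | node _ l r =>
      insert [] (l.inner.image (List.cons false) ∪ r.inner.image (List.cons true))

/-- The addresses of the initial vertices, from left to right. -/
def leaves : STree → List (List Bool)
  | leaf _ => [[]]
  | node _ l r => l.leaves.map (List.cons false) ++ r.leaves.map (List.cons true)

/-- The product of the parities of the interaction vertices, that is `-1` to the number
of complex conjugations taken in the interactions. -/
def interactionSign : STree → ℤˣ
  | leaf _ => 1
  | node σ l r => σ * l.interactionSign * r.interactionSign

theorem length_leaves (T : STree) : T.leaves.length = T.depth + 1 := by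
  induction T with
  | leaf => rfl
  | node σ l r hl hr => simp only [leaves, depth, List.length_append, List.length_map, hl, hr]; omega

theorem depth_flip (T : STree) : T.flip.depth = T.depth := by
  induction T with
  | leaf => rfl
  | node σ l r hl hr => simp only [flip, depth, hl, hr]

end STree

/-- The interaction graphs of depth `n`: the parity of the top vertex is `+1`. -/
def InteractionGraph (n : ℕ) : Type := {T : STree // T.depth = n ∧ T.parity [] = 1}

/-- The tree obtained by merging the roots of the left and right subtrees, the parities of the
left one being flipped. The address `[]` is the merged root vertex, and `[false]`, `[true]` are the
left and right top vertices. The parity written at the root vertex is a dummy, never used. -/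
def mergedTree {n : ℕ} (Gl Gr : InteractionGraph n) : STree := STree.node 1 Gl.1.flip Gr.1

theorem length_leaves_mergedTree {n : ℕ} (Gl Gr : InteractionGraph n) :
    (mergedTree Gl Gr).leaves.length = 2 * n + 2 := by
  rw [STree.length_leaves]
  simp only [mergedTree, STree.depth, STree.depth_flip, Gl.2.1, Gr.2.1]
  omega

/-- The address of the `i`-th initial vertex of the merged tree (from the left). -/
def initialVertex {n : ℕ} (Gl Gr : InteractionGraph n) (i : Fin (2 * n + 2)) : List Bool :=
  (mergedTree Gl Gr).leaves.get (i.cast (length_leaves_mergedTree Gl Gr).symm)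

/-- Paired graphs of depth `n`: two interaction graphs and a pairing of the `2n+2` initial vertices
which is consistent with the parities. The pairing, a partition into pairs, is given as the map
which exchanges the two elements of each pair. -/
structure PairedGraph (n : ℕ) where
  left : InteractionGraph n
  right : InteractionGraph n
  pair : Fin (2 * n + 2) → Fin (2 * n + 2)
  pair_pair : ∀ i, pair (pair i) = i
  pair_ne : ∀ i, pair i ≠ i
  consistent : ∀ i, (mergedTree left right).parity (initialVertex left right (pair i)) =
    -(mergedTree left right).parity (initialVertex left right i)

namespace PairedGraph

variable {n : ℕ} (G : PairedGraph n)

/-- The underlying tree. -/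
def tree : STree := mergedTree G.left G.right

/-- The `i`-th initial vertex `v_{0,i}`. -/
def initial (i : Fin (2 * n + 2)) : List Bool := initialVertex G.left G.right i

/-- The parity `σ_v`, as a real number. -/
def sgn (v : List Bool) : ℝ := ((G.tree.parity v : ℤ) : ℝ)

/-- The set `𝒱ᵢ` of interaction vertices. -/
def interaction : Finset (List Bool) := G.tree.inner.erase []

/-- The edges of the tree: each `v ∈ 𝒱ᵢ ∪ 𝒱₀` stands for the edge above it. -/
def edges : Finset (List Bool) := G.interaction ∪ G.tree.leaves.toFinset

/-- The pairs `{i, j} ∈ P`, represented by their smaller element `i`. -/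
abbrev Pairs : Type := {i : Fin (2 * n + 2) // i < G.pair i}

/-- The pair that contains the first initial vertex. -/
def firstPair : G.Pairs := ⟨0, Fin.pos_of_ne_zero (G.pair_ne 0)⟩

/-- The left and the right subtree are linked: some pair joins an initial vertex of the former
to one of the latter. -/
def Linked : Prop := ∃ i : Fin (2 * n + 2), (i : ℕ) < n + 1 ∧ n + 1 ≤ (G.pair i : ℕ)

/-! #### Upright paths and time constraints -/

open Classical in
/-- `𝓅⁺(v)`: the interaction vertices from which `v` is reached by going down to the left only,
i.e. `v` itself and the vertices up on the right of `v` on its maximal upright path. -/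
def pPlus (v : List Bool) : Finset (List Bool) :=
  G.interaction.filter fun w => ∃ k : ℕ, v = w ++ List.replicate k false

open Classical in
/-- `𝓅⁻(v)`: the interaction vertices of the upright path leading to `v`. If `v` is a top vertex or
is below another vertex on the right, this is the whole maximal upright path ending at `v`
(without its initial vertex, whose time slice is `0`). -/
def pMinus (v : List Bool) : Finset (List Bool) :=
  G.interaction.filter fun w => ∃ k : ℕ, w = v ++ List.replicate k false

/-- Time slices, indexed by the interaction vertices. -/
abbrev Slices : Type := {v : List Bool // v ∈ G.interaction} → ℝ

/-- The sum of the time slices along the upright path leading to `v`. -/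
def sliceSum (s : G.Slices) (v : List Bool) : ℝ :=
  ∑ w : {v : List Bool // v ∈ G.interaction}, if w.1 ∈ G.pMinus v then s w else 0

/-- The time constraints: the slices are nonnegative, and for each maximal upright path, the sum
of its slices is at most the sum of the slices on the upright path leading to its junction vertex,
which is `t` if the junction vertex is the root vertex. -/
def TimeConstraint (t : ℝ) (s : G.Slices) : Prop :=
  (∀ v, 0 ≤ s v) ∧
  (∀ v ∈ G.interaction, G.sliceSum s (v ++ [true]) ≤ G.sliceSum s v) ∧
  G.sliceSum s [false] ≤ t ∧ G.sliceSum s [true] ≤ t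

/-! #### Frequencies -/

/-- The Kirchhoff laws of the paired graph, for frequencies `ξ` of the edges and slow
variables `η` of the pairs. -/
def Kirchhoff {d : ℕ} (ξ : List Bool → Space d) (η : G.Pairs → Space d) : Prop :=
  (∀ v ∈ G.interaction, ξ v = ξ (v ++ [false]) + ξ (v ++ [true])) ∧
  (∀ p : G.Pairs, ξ (G.initial p.1) + ξ (G.initial (G.pair p.1)) = η p) ∧
  ∑ p, η p = 0

/-- The resonance modulus `Ω_v`. -/
def resonance {d : ℕ} (ω₀ : ℝ) (ξ : List Bool → Space d) (v : List Bool) : ℝ :=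
  G.sgn v * disp ω₀ (ξ v) - G.sgn (v ++ [false]) * disp ω₀ (ξ (v ++ [false])) -
    G.sgn (v ++ [true]) * disp ω₀ (ξ (v ++ [true]))

/-- The product `M_G` of Fourier multipliers: each interaction contributes `m` at its output and
at its two inputs. -/
def multiplier {d : ℕ} (ε : ℝ) (m : Space d → ℝ) (ξ : List Bool → Space d) : ℝ :=
  ∏ v ∈ G.interaction, m (ε • ξ v) * m (ε • ξ (v ++ [false])) * m (ε • ξ (v ++ [true]))

/-- `σ_{0,i} ξ_{0,i} + σ_{0,j} ξ_{0,j}` for the pair `p = {i, j}`. -/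
def pairFreq {d : ℕ} (ξ : List Bool → Space d) (p : G.Pairs) : Space d :=
  G.sgn (G.initial p.1) • ξ (G.initial p.1) +
    G.sgn (G.initial (G.pair p.1)) • ξ (G.initial (G.pair p.1))

/-- Integration orders: enumerations `v₁, …, v_{2n+1}` of the interaction vertices and the root
vertex such that `vᵢ` is not above `vⱼ` for `i < j`. -/
structure IntegrationOrder where
  vertex : Fin (2 * n + 1) ≃ {v : List Bool // v ∈ G.tree.inner}
  not_above : ∀ i j, i < j → ¬ (vertex i).1 <+: (vertex j).1

/-- A choice of indices `k₁ < … < k_{n+1}` (those of the vertices whose lower left edges are free),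
and of the coefficients which express the frequency of each edge through the interaction free
variables and the slow variables. -/
structure FreeData where
  k : Fin (n + 1) → Fin (2 * n + 1)
  coefFree : List Bool → Fin (n + 1) → ℤ
  coefSlow : List Bool → G.Pairs → ℤ

variable {G}

/-- The `k`-th vertex. -/
def IntegrationOrder.at (V : G.IntegrationOrder) (k : Fin (2 * n + 1)) : List Bool :=
  (V.vertex k).1

/-- The frequencies of the edges as functions of the free variables. -/
def FreeData.freq {d : ℕ} (D : G.FreeData) (ξf : Fin (n + 1) → Space d) (η : G.Pairs → Space d)
    (v : List Bool) : Space d :=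
  ∑ j, (D.coefFree v j : ℝ) • ξf j + ∑ p, (D.coefSlow v p : ℝ) • η p

/-- The `i`-th free edge: the left edge below the vertex `v_{kᵢ}`. -/
def FreeData.freeEdge (D : G.FreeData) (V : G.IntegrationOrder) (i : Fin (n + 1)) : List Bool :=
  V.at (D.k i) ++ [false]

/-- The degree one vertices `𝒱¹ = {v_{k₁}, …, v_{kₙ}}`. -/
def FreeData.degreeOne (D : G.FreeData) (V : G.IntegrationOrder) : Finset (List Bool) :=
  Finset.univ.image fun i : Fin n => V.at (D.k i.castSucc)

/-- The degree zero vertices `𝒱⁰ = 𝒱ᵢ \ 𝒱¹`. -/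
def FreeData.degreeZero (D : G.FreeData) (V : G.IntegrationOrder) : Finset (List Bool) :=
  G.interaction \ D.degreeOne V

variable (G)

/-- A vertex is linear if the two vertices below it have opposite parities. -/
def IsLinear (v : List Bool) : Prop :=
  G.tree.parity (v ++ [false]) * G.tree.parity (v ++ [true]) = -1

/-- A vertex is quadratic if the two vertices below it have the same parity. -/
def IsQuadratic (v : List Bool) : Prop :=
  G.tree.parity (v ++ [false]) * G.tree.parity (v ++ [true]) = 1

/-! #### The oscillatory integral of a paired graph -/

/-- The measure `δ(∑ η) dη` carried by `ℝ^{d(n+1)}₀ = {η : ∑ η = 0}`: the image of Lebesgue measure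
in all the slow variables but one, the last one being minus the sum of the others. -/
def slowMeasure (d : ℕ) : Measure (G.Pairs → Space d) :=
  (volume : Measure ({p : G.Pairs // p ≠ G.firstPair} → Space d)).map fun η p =>
    if h : p = G.firstPair then -∑ q, η q else η ⟨p, h⟩

/-- The measure `dη dξᶠ ds`. -/
def paramMeasure (d : ℕ) :
    Measure ((G.Pairs → Space d) × (Fin (n + 1) → Space d) × G.Slices) :=
  (G.slowMeasure d).prod ((volume : Measure (Fin (n + 1) → Space d)).prod volume)

open Classical in
/-- The integrand, with `Ŵ` standing for the Fourier transform of the Wigner transform of the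
initial data. -/
def integrand {d : ℕ} (D : G.FreeData) (ε ω₀ : ℝ) (m : Space d → ℝ)
    (What : Space d → Space d → ℂ) (t : ℝ)
    (q : (G.Pairs → Space d) × (Fin (n + 1) → Space d) × G.Slices) : ℂ :=
  let η := q.1
  let ξ := D.freq q.2.1 η
  let s := q.2.2
  (if G.TimeConstraint t s then 1 else 0) * (G.multiplier ε m ξ : ℂ) *
    (∏ p : G.Pairs, What (η p) ((ε / 2) • G.pairFreq ξ p)) *
    ∏ v : {v : List Bool // v ∈ G.interaction},
      Complex.exp (-Complex.I * ((s v * ∑ w ∈ G.pPlus v.1, G.resonance ω₀ ξ w : ℝ) : ℂ))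

/-- `(-1)^{σ_G}`, where `σ_G` is the number of complex conjugations taken in the interactions of the
left and of the right interaction graph. -/
def totalSign : ℝ :=
  ((G.left.1.interactionSign * G.right.1.interactionSign : ℤˣ) : ℤ)

/-- The oscillatory integral `ℱ_t(G)`. -/
def graphIntegral {d : ℕ} (D : G.FreeData) (ε lam ω₀ : ℝ) (m : Space d → ℝ)
    (What : Space d → Space d → ℂ) (t : ℝ) : ℂ :=
  ((G.totalSign * (2 * Real.pi) ^ ((d : ℝ) * (1 - (n : ℝ)) / 2) *
      lam ^ (2 * n) * ε ^ (d * (n + 1)) : ℝ) : ℂ) *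
    ∫ q, G.integrand D ε ω₀ m What t q ∂(G.paramMeasure d)

end PairedGraph

end WaveKinetic

end

/-! Two arguments meet in the final formula: a spanning tree provides the coordinates, and Duhamel's
formula combined with Wick's provides the integral.

Coordinates. Glue the two initial vertices of each pair into one vertex. The frequencies then form a
flow on the glued graph, with the slow variables as sources; the law at the root is not imposed but
follows from the vanishing of their sum. There are `3n+2` vertices (`2n+1` inner ones and `n+1`
glued ones) and `4n+2` edges, so the cycle space has dimension `n+1`. Visit the vertices from the
root on, against the integration order, and call the left edge below a vertex free if it is not a
bridge once the earlier free edges are removed; `IsCut` says that an edge is a bridge. A right edge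
is then automatically a bridge, since the cuts for the upper and the left edge at the same vertex
combine into one for the right edge (`IsGreedy.exists_isCut`). Removing an edge that is not a bridge
preserves connectedness (`IsGreedy.mem_iff`), so the edges left over form a spanning tree. Two
injective linear maps turn this into the count `n+1` of free edges. The flux through a cut
(`IsFlow.sum_boundary`) gives each remaining frequency as a combination of slow and free variables
with coefficients in `{-1, 0, 1}`. Only free edges at or after the vertex above the given edge can
cross its cut, which is the triangular structure needed for the resonance moduli. Both this change
of variables and its inverse have integer matrices, so it preserves Lebesgue measure
(`measurePreserving_leftFreq`).

Expansion. Almost surely the Fourier transform of the field is smooth with compact support: smooth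
because the field decays fast in mean, compactly supported because its variance vanishes outside a
ball (`exists_band`). On the Fourier side, after removal of the free phase, the iterate is a sum of
tree amplitudes (`profile_eq_sum_amp`), by induction with Duhamel's formula at the top vertex
(`amp_node`). The time of an interaction is the sum of the slices along the upright path leading to
it, and passing from slices to times is a shear. Flipping parities is complex conjugation
(`amp_flip`), so Plancherel turns the squared norm into a sum over pairs of trees whose root
frequencies are opposite.

Expectation. If two independent copies of a centred Gaussian family are rotated by an angle, their
joint law is unchanged. Only one multilinear consequence is retained, `IsRotationInvariant`; being
multilinear, it passes from the field to its Fourier transform by Fubini, with no need to show that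
the latter is Gaussian. Its derivative at angle zero is Gaussian integration by parts, whose
iteration is the sum over pairings. Pairs of equal parity have zero covariance, pairs of opposite
parity yield the Wigner transform (`wignerHat_eq`), and what remains is indexed by the paired
graphs. Domination by a product of indicators of balls justifies every exchange of integrals,
including the absolute convergence claimed. -/

noncomputable section

namespace WaveKinetic

/-! ### Addresses in a parity tree, and how sums over them split at the top vertex -/

namespace STree

@[simp] theorem mem_inner_leaf (σ : ℤˣ) (v : List Bool) : v ∉ (leaf σ).inner := by simp [inner]

@[simp] theorem nil_mem_inner_node (σ : ℤˣ) (l r : STree) : [] ∈ (node σ l r).inner := by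
  simp [inner]

@[simp] theorem false_mem_inner_node {σ : ℤˣ} {l r : STree} {v : List Bool} :
    false :: v ∈ (node σ l r).inner ↔ v ∈ l.inner := by simp [inner]

@[simp] theorem true_mem_inner_node {σ : ℤˣ} {l r : STree} {v : List Bool} :
    true :: v ∈ (node σ l r).inner ↔ v ∈ r.inner := by simp [inner]

@[simp] theorem mem_leaves_leaf {σ : ℤˣ} {v : List Bool} : v ∈ (leaf σ).leaves ↔ v = [] := by
  simp [leaves]

@[simp] theorem nil_mem_leaves_node {σ : ℤˣ} {l r : STree} : [] ∉ (node σ l r).leaves := by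
  simp [leaves]

@[simp] theorem false_mem_leaves_node {σ : ℤˣ} {l r : STree} {v : List Bool} :
    false :: v ∈ (node σ l r).leaves ↔ v ∈ l.leaves := by simp [leaves]

@[simp] theorem true_mem_leaves_node {σ : ℤˣ} {l r : STree} {v : List Bool} :
    true :: v ∈ (node σ l r).leaves ↔ v ∈ r.leaves := by simp [leaves]

theorem append_mem_of_mem_inner {T : STree} {v : List Bool} (b : Bool) (hv : v ∈ T.inner) :
    v ++ [b] ∈ T.inner ∨ v ++ [b] ∈ T.leaves := by
  induction T generalizing v with
  | leaf σ => simp at hv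
  | node σ l r hl hr =>
    rcases v with _ | ⟨_ | _, v⟩
    · cases b
      · cases l <;> simp
      · cases r <;> simp
    · simpa using hl (by simpa using hv)
    · simpa using hr (by simpa using hv)

theorem mem_inner_of_append {T : STree} {v : List Bool} {b : Bool}
    (h : v ++ [b] ∈ T.inner ∨ v ++ [b] ∈ T.leaves) : v ∈ T.inner := by
  induction T generalizing v with
  | leaf σ => simp at h
  | node σ l r hl hr =>
    rcases v with _ | ⟨_ | _, v⟩
    · simp
    · simpa using hl (by simpa using h)
    · simpa using hr (by simpa using h)

theorem not_mem_leaves_of_mem_inner {T : STree} {v : List Bool} (hv : v ∈ T.inner) :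
    v ∉ T.leaves := by
  induction T generalizing v with
  | leaf σ => simp at hv
  | node σ l r hl hr =>
    rcases v with _ | ⟨_ | _, v⟩
    · simp
    · simpa using hl (by simpa using hv)
    · simpa using hr (by simpa using hv)

theorem nodup_leaves (T : STree) : T.leaves.Nodup := by
  induction T with
  | leaf σ => simp [leaves]
  | node σ l r hl hr =>
    rw [leaves, List.nodup_append]
    refine ⟨hl.map (List.cons_injective), hr.map (List.cons_injective), ?_⟩
    rintro a ha b hb rfl
    simp only [List.mem_map] at ha hb
    obtain ⟨_, _, rfl⟩ := ha
    obtain ⟨_, _, h⟩ := hb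
    simp at h

theorem prod_inner_node {M : Type*} [CommMonoid M] (σ : ℤˣ) (l r : STree) (f : List Bool → M) :
    ∏ v ∈ (node σ l r).inner, f v =
      f [] * ((∏ v ∈ l.inner, f (false :: v)) * ∏ v ∈ r.inner, f (true :: v)) := by
  rw [inner, Finset.prod_insert (by simp), Finset.prod_union, Finset.prod_image, Finset.prod_image]
  · exact List.cons_injective.injOn
  · exact List.cons_injective.injOn
  · rw [Finset.disjoint_left]
    intro a ha hb
    simp only [Finset.mem_image] at ha hb
    obtain ⟨_, _, rfl⟩ := ha
    obtain ⟨_, _, h⟩ := hb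
    simp at h

theorem sum_inner_node {M : Type*} [AddCommMonoid M] (σ : ℤˣ) (l r : STree)
    (f : List Bool → M) : ∑ v ∈ (node σ l r).inner, f v =
      f [] + ((∑ v ∈ l.inner, f (false :: v)) + ∑ v ∈ r.inner, f (true :: v)) :=
  prod_inner_node (M := Multiplicative M) σ l r f

theorem card_inner (T : STree) : T.inner.card = T.depth := by
  induction T with
  | leaf σ => simp [inner, depth]
  | node σ l r hl hr =>
    rw [Finset.card_eq_sum_ones, sum_inner_node, ← Finset.card_eq_sum_ones,
      ← Finset.card_eq_sum_ones, hl, hr, depth]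
    omega

/-- The edges of a tree are counted both by their upper and by their lower endpoints. -/
theorem sum_children {M : Type*} [AddCommMonoid M] (T : STree) (f : List Bool → M) :
    (∑ v ∈ T.inner, (f (v ++ [false]) + f (v ++ [true]))) + f [] =
      (∑ v ∈ T.inner, f v) + (T.leaves.map f).sum := by
  induction T generalizing f with
  | leaf σ => simp [inner, leaves]
  | node σ l r hl hr =>
    have h1 := hl (fun v => f (false :: v))
    have h2 := hr (fun v => f (true :: v))
    simp only [sum_inner_node, leaves, List.map_append, List.map_map, List.sum_append,
      List.nil_append, List.cons_append] at h1 h2 ⊢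
    calc _ = f [] + ((∑ v ∈ l.inner, (f (false :: (v ++ [false])) + f (false :: (v ++ [true]))) +
          f [false]) + (∑ v ∈ r.inner, (f (true :: (v ++ [false])) + f (true :: (v ++ [true]))) +
          f [true])) := by abel
      _ = _ := by rw [h1, h2]; simp only [Function.comp_def]; abel

end STree

/-! ### Counting the vertices and the pairs of a paired graph -/

namespace PairedGraph

variable {n : ℕ} (G : PairedGraph n)

theorem nil_mem_inner : [] ∈ G.tree.inner := by simp [tree, mergedTree]

theorem card_inner : G.tree.inner.card = 2 * n + 1 := by
  rw [STree.card_inner]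
  have := length_leaves_mergedTree G.left G.right
  rw [STree.length_leaves] at this
  simp only [tree]
  omega

theorem card_interaction : G.interaction.card = 2 * n := by
  rw [interaction, Finset.card_erase_of_mem G.nil_mem_inner, card_inner]
  rfl

theorem initial_injective : Function.Injective G.initial := by
  intro i j h
  have := (List.nodup_iff_injective_get.1 (G.tree.nodup_leaves)) h
  exact Fin.cast_injective _ this

theorem initial_mem (i : Fin (2 * n + 2)) : G.initial i ∈ G.tree.leaves := List.get_mem _ _

theorem exists_initial {v : List Bool} (hv : v ∈ G.tree.leaves) : ∃ i, G.initial i = v := by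
  obtain ⟨i, hi⟩ := List.mem_iff_get.1 hv
  exact ⟨i.cast (length_leaves_mergedTree G.left G.right), hi⟩

theorem prod_map_leaves {M : Type*} [CommMonoid M] (f : List Bool → M) :
    (G.tree.leaves.map f).prod = ∏ i, f (G.initial i) := by
  rw [← Fin.prod_univ_fun_getElem]
  exact Fintype.prod_equiv (finCongr (length_leaves_mergedTree G.left G.right)) _ _
    fun i => rfl

theorem sum_map_leaves {M : Type*} [AddCommMonoid M] (f : List Bool → M) :
    (G.tree.leaves.map f).sum = ∑ i, f (G.initial i) :=
  G.prod_map_leaves (M := Multiplicative M) f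

/-- The involution `G.pair` maps the indices that are the smaller element of their pair bijectively
onto the other ones, so the second half of the product can be moved onto the first. -/
theorem prod_pairs {M : Type*} [CommMonoid M] (f : Fin (2 * n + 2) → M) :
    ∏ i, f i = ∏ p : G.Pairs, (f p.1 * f (G.pair p.1)) := by
  classical
  rw [← Finset.prod_filter_mul_prod_filter_not Finset.univ (fun i => i < G.pair i),
    Finset.prod_mul_distrib]
  congr 1
  · rw [Finset.prod_subtype (p := fun i => i < G.pair i)]
    simp
  · have h : ∏ i ∈ Finset.univ.filter (fun i => i < G.pair i), f (G.pair i) =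
        ∏ p : G.Pairs, f (G.pair p.1) := by
      rw [Finset.prod_subtype (p := fun i => i < G.pair i)]
      simp
    rw [← h]
    refine Finset.prod_nbij' G.pair G.pair ?_ ?_ ?_ ?_ ?_
    · intro i hi
      simp only [Finset.mem_filter, Finset.mem_univ, true_and, G.pair_pair] at hi ⊢
      exact lt_of_le_of_ne (not_lt.1 hi) (G.pair_ne i)
    · intro i hi
      simp only [Finset.mem_filter, Finset.mem_univ, true_and, G.pair_pair] at hi ⊢
      exact not_lt.2 hi.le
    · intro i _; exact G.pair_pair i
    · intro i _; exact G.pair_pair i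
    · intro i _; rw [G.pair_pair]

theorem sum_pairs {M : Type*} [AddCommMonoid M] (f : Fin (2 * n + 2) → M) :
    ∑ i, f i = ∑ p : G.Pairs, (f p.1 + f (G.pair p.1)) :=
  G.prod_pairs (M := Multiplicative M) f

theorem card_pairs : Fintype.card G.Pairs = n + 1 := by
  have := G.sum_pairs (fun _ => 1)
  simp at this
  omega

end PairedGraph

end WaveKinetic

/-! ### Flows on the glued graph, and their flux through cuts -/

namespace WaveKinetic

/-- The frequencies of all edges below an edge of frequency `ξ`, if the left edge below the vertex
`v` has frequency `z v`. -/
def freqOf {M : Type*} [AddCommGroup M] : M → (List Bool → M) → List Bool → M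
  | ξ, _, [] => ξ
  | _, z, false :: v => freqOf (z []) (fun w => z (false :: w)) v
  | ξ, z, true :: v => freqOf (ξ - z []) (fun w => z (true :: w)) v

@[simp] theorem freqOf_append_false {M : Type*} [AddCommGroup M] (ξ : M) (z : List Bool → M)
    (v : List Bool) : freqOf ξ z (v ++ [false]) = z v := by
  induction v generalizing ξ z with
  | nil => simp [freqOf]
  | cons b v ih => cases b <;> simp [freqOf, ih]

@[simp] theorem freqOf_append_true {M : Type*} [AddCommGroup M] (ξ : M) (z : List Bool → M)
    (v : List Bool) : freqOf ξ z (v ++ [true]) = freqOf ξ z v - z v := by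
  induction v generalizing ξ z with
  | nil => simp [freqOf]
  | cons b v ih => cases b <;> simp [freqOf, ih]

@[simp] theorem freqOf_nil {M : Type*} [AddCommGroup M] (ξ : M) (z : List Bool → M) :
    freqOf ξ z [] = ξ := by simp [freqOf]

theorem freqOf_congr {M : Type*} [AddCommGroup M] {T : STree} (ξ : M) {z z' : List Bool → M}
    (h : ∀ v ∈ T.inner, z v = z' v) {v : List Bool} (hv : v ∈ T.inner ∨ v ∈ T.leaves) :
    freqOf ξ z v = freqOf ξ z' v := by
  induction v using List.reverseRecOn with
  | nil => simp
  | append_singleton v b ih =>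
    have hv' := STree.mem_inner_of_append hv
    cases b
    · simp [h v hv']
    · simp [h v hv', ih (Or.inl hv')]

/-- The frequencies are integral combinations of those of the left edges. -/
theorem freqOf_eq_sum {M : Type*} [AddCommGroup M] {T : STree} (z : List Bool → M)
    {v : List Bool} (hv : v ∈ T.inner ∨ v ∈ T.leaves) :
    freqOf 0 z v = ∑ w ∈ T.inner, freqOf (0 : ℤ) (Pi.single w 1) v • z w := by
  induction v using List.reverseRecOn with
  | nil => simp
  | append_singleton v b ih =>
    have hv' := STree.mem_inner_of_append hv
    have hz : ∑ w ∈ T.inner, (Pi.single w (1 : ℤ) : List Bool → ℤ) v • z w = z v := by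
      rw [Finset.sum_eq_single v]
      · simp
      · intro w _ hw; simp [hw.symm]
      · intro h; exact absurd hv' h
    cases b
    · simp only [freqOf_append_false, hz]
    · simp only [freqOf_append_true, sub_smul, Finset.sum_sub_distrib, hz, ih (Or.inl hv')]

namespace PairedGraph

variable {n : ℕ} (G : PairedGraph n)

/-- The Kirchhoff laws with values in an additive group, including the law at the root vertex. -/
structure IsFlow {M : Type*} [AddCommGroup M] (ξ : List Bool → M) (η : G.Pairs → M) : Prop where
  root : ξ [] = 0
  add : ∀ v ∈ G.tree.inner, ξ v = ξ (v ++ [false]) + ξ (v ++ [true])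
  pair : ∀ p : G.Pairs, ξ (G.initial p.1) + ξ (G.initial (G.pair p.1)) = η p

variable {G}

/-- When the laws at all inner vertices are added, every edge between two of them cancels. Only the
root, where the value is zero, and the leaves remain, and the leaves group into pairs. -/
theorem IsFlow.sum_eq_zero {M : Type*} [AddCommGroup M] {ξ : List Bool → M} {η : G.Pairs → M}
    (h : G.IsFlow ξ η) : ∑ p, η p = 0 := by
  have h1 := G.tree.sum_children ξ
  rw [← Finset.sum_congr rfl h.add, h.root, G.sum_map_leaves, G.sum_pairs,
    Finset.sum_congr rfl (fun p _ => h.pair p)] at h1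
  simpa using h1.symm

theorem mem_interaction {v : List Bool} : v ∈ G.interaction ↔ v ≠ [] ∧ v ∈ G.tree.inner := by
  simp [interaction]

theorem mem_edges {v : List Bool} :
    v ∈ G.edges ↔ v ≠ [] ∧ (v ∈ G.tree.inner ∨ v ∈ G.tree.leaves) := by
  simp only [edges, Finset.mem_union, mem_interaction, List.mem_toFinset]
  constructor
  · rintro (h | h)
    · exact ⟨h.1, Or.inl h.2⟩
    · refine ⟨?_, Or.inr h⟩
      rintro rfl
      exact STree.not_mem_leaves_of_mem_inner G.nil_mem_inner h
  · rintro ⟨h, h' | h'⟩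
    · exact Or.inl ⟨h, h'⟩
    · exact Or.inr h'

theorem initial_ne_nil (i : Fin (2 * n + 2)) : G.initial i ≠ [] := fun h =>
  STree.not_mem_leaves_of_mem_inner G.nil_mem_inner (h ▸ G.initial_mem i)

theorem append_mem_edges {v : List Bool} (hv : v ∈ G.tree.inner) (b : Bool) :
    v ++ [b] ∈ G.edges :=
  mem_edges.2 ⟨by simp, STree.append_mem_of_mem_inner b hv⟩

theorem exists_of_mem_edges {e : List Bool} (he : e ∈ G.edges) :
    ∃ v ∈ G.tree.inner, ∃ b, e = v ++ [b] := by
  obtain ⟨h, h'⟩ := mem_edges.1 he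
  rcases List.eq_nil_or_concat e with rfl | ⟨v, b, rfl⟩
  · exact absurd rfl h
  · rw [List.concat_eq_append] at h' ⊢
    exact ⟨v, STree.mem_inner_of_append h', b, rfl⟩

theorem initial_mem_edges (i : Fin (2 * n + 2)) : G.initial i ∈ G.edges :=
  mem_edges.2 ⟨initial_ne_nil i, Or.inr (G.initial_mem i)⟩

/-- `Kirchhoff` leaves `ξ []` arbitrary and imposes no law there. With that value reset to zero, the
missing law is a consequence of the other ones and of the vanishing sum of the slow variables, so
that the root can be treated like any other vertex. -/
theorem isFlow_of_law {M : Type*} [AddCommGroup M] {ξ : List Bool → M} {η : G.Pairs → M}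
    (h1 : ∀ v ∈ G.interaction, ξ v = ξ (v ++ [false]) + ξ (v ++ [true]))
    (h2 : ∀ p : G.Pairs, ξ (G.initial p.1) + ξ (G.initial (G.pair p.1)) = η p)
    (h3 : ∑ p, η p = 0) : G.IsFlow (fun v => if v = [] then 0 else ξ v) η := by
  have hp : ∀ p : G.Pairs, (if G.initial p.1 = [] then 0 else ξ (G.initial p.1)) +
      (if G.initial (G.pair p.1) = [] then 0 else ξ (G.initial (G.pair p.1))) = η p := by
    intro p
    rw [if_neg (initial_ne_nil _), if_neg (initial_ne_nil _), h2]
  have h := G.tree.sum_children (fun v => if v = [] then 0 else ξ v)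
  rw [sum_map_leaves, sum_pairs, Finset.sum_congr rfl (fun p _ => hp p), h3, ← Finset.insert_erase
    G.nil_mem_inner, Finset.sum_insert (by simp), Finset.sum_insert (by simp)] at h
  -- The imposed laws cancel the terms of all vertices but the root in `h`, which thereby becomes
  -- the law at the root.
  have h4 : ∑ v ∈ G.tree.inner.erase [], ((if v ++ [false] = [] then 0 else ξ (v ++ [false])) +
      (if v ++ [true] = [] then 0 else ξ (v ++ [true]))) =
      ∑ v ∈ G.tree.inner.erase [], if v = [] then 0 else ξ v := by
    refine Finset.sum_congr rfl fun v hv => ?_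
    rw [h1 v hv]
    simp [(mem_interaction.1 hv).1]
  rw [h4] at h
  refine ⟨by simp, fun v hv => ?_, hp⟩
  by_cases hv0 : v = []
  · subst hv0
    have h5 : ξ [false] + ξ [true] = 0 := by simpa using h
    simpa using h5.symm
  · simp only [hv0, if_false, List.append_eq_nil_iff, List.cons_ne_nil, and_false]
    exact h1 v (mem_interaction.2 ⟨hv0, hv⟩)

theorem isFlow_freqOf {M : Type*} [AddCommGroup M] (z : List Bool → M) :
    G.IsFlow (freqOf 0 z) (fun p => freqOf 0 z (G.initial p.1) +
      freqOf 0 z (G.initial (G.pair p.1))) where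
  root := by simp
  add v _ := by simp
  pair _ := rfl

variable (G)

/-- Sets of vertices which contain both or none of the two initial vertices of each pair. -/
def PairClosed (C : Set (List Bool)) : Prop := ∀ i, G.initial i ∈ C ↔ G.initial (G.pair i) ∈ C

variable {G}

/-- The indicator function of a set of vertices. -/
def ind (C : Set (List Bool)) : List Bool → ℤ := C.indicator 1

theorem ind_of_mem {C : Set (List Bool)} {v : List Bool} (h : v ∈ C) : ind C v = 1 := by
  simp [ind, h]

theorem ind_of_notMem {C : Set (List Bool)} {v : List Bool} (h : v ∉ C) : ind C v = 0 := by
  simp [ind, h]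

theorem ind_congr {C : Set (List Bool)} {v w : List Bool} (h : v ∈ C ↔ w ∈ C) :
    ind C v = ind C w := by
  by_cases hw : w ∈ C
  · rw [ind_of_mem hw, ind_of_mem (h.2 hw)]
  · rw [ind_of_notMem hw, ind_of_notMem (fun h' => hw (h.1 h'))]

/-- The flux through the boundary of a set of vertices. -/
theorem IsFlow.sum_boundary {M : Type*} [AddCommGroup M] {ξ : List Bool → M} {η : G.Pairs → M}
    (h : G.IsFlow ξ η) {C : Set (List Bool)} (hC : G.PairClosed C) :
    ∑ v ∈ G.tree.inner, ((ind C (v ++ [false]) - ind C v) • ξ (v ++ [false]) +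
      (ind C (v ++ [true]) - ind C v) • ξ (v ++ [true])) = ∑ p, ind C (G.initial p.1) • η p := by
  have h1 := G.tree.sum_children (fun v => ind C v • ξ v)
  rw [sum_map_leaves, sum_pairs, h.root, smul_zero, add_zero] at h1
  -- Since `C` does not separate the leaves of a pair, both carry the same indicator, and their
  -- frequencies enter only through the slow variable.
  have h2 : ∀ p : G.Pairs, ind C (G.initial p.1) • ξ (G.initial p.1) +
      ind C (G.initial (G.pair p.1)) • ξ (G.initial (G.pair p.1)) =
      ind C (G.initial p.1) • η p := by
    intro p
    rw [← ind_congr (hC p.1), ← smul_add, h.pair]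
  rw [Finset.sum_congr rfl (fun p _ => h2 p)] at h1
  rw [← sub_eq_iff_eq_add'] at h1
  rw [← h1, ← Finset.sum_sub_distrib]
  refine Finset.sum_congr rfl fun v hv => ?_
  conv_rhs => rw [h.add v hv]
  module

/-- `C` contains the lower but not the upper endpoint of the edge `v ++ [b]`, and no edge outside
`S` other than this one crosses the boundary of `C`. -/
structure IsCut (G : PairedGraph n) (C : Set (List Bool)) (v : List Bool) (b : Bool)
    (S : Set (List Bool)) : Prop where
  pairClosed : G.PairClosed C
  mem : v ++ [b] ∈ C
  notMem : v ∉ C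
  closed : ∀ w ∈ G.tree.inner, ∀ c, w ++ [c] ≠ v ++ [b] → w ++ [c] ∉ S → (w ++ [c] ∈ C ↔ w ∈ C)

theorem IsCut.mono {C S S' : Set (List Bool)} {v : List Bool} {b : Bool} (h : G.IsCut C v b S)
    (hS : S ⊆ S') : G.IsCut C v b S' :=
  ⟨h.pairClosed, h.mem, h.notMem, fun w hw c h1 h2 => h.closed w hw c h1 fun h3 => h2 (hS h3)⟩

/-- A closed set without boundary is trivial. -/
theorem mem_iff_of_closed {C : Set (List Bool)}
    (h : ∀ w ∈ G.tree.inner, ∀ c, (w ++ [c] ∈ C ↔ w ∈ C)) {v : List Bool}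
    (hv : v ∈ G.tree.inner ∨ v ∈ G.tree.leaves) : v ∈ C ↔ [] ∈ C := by
  induction v using List.reverseRecOn with
  | nil => rfl
  | append_singleton v b ih =>
    have hv' := STree.mem_inner_of_append hv
    rw [h v hv' b, ih (Or.inl hv')]

/-! #### The choice of the free edges -/

namespace IntegrationOrder

variable (V : G.IntegrationOrder)

theorem at_mem (k : Fin (2 * n + 1)) : V.at k ∈ G.tree.inner := (V.vertex k).2

theorem exists_at {v : List Bool} (hv : v ∈ G.tree.inner) : ∃ k, V.at k = v :=
  ⟨V.vertex.symm ⟨v, hv⟩, by simp [IntegrationOrder.at]⟩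

theorem at_injective : Function.Injective V.at := fun i j h =>
  V.vertex.injective (Subtype.ext h)

theorem not_isPrefix {i j : Fin (2 * n + 1)} (h : i < j) : ¬ V.at i <+: V.at j :=
  V.not_above _ _ h

theorem lt_of_at_eq_append {j k : Fin (2 * n + 1)} {b : Bool} (h : V.at k = V.at j ++ [b]) :
    k < j := by
  by_contra hk
  rcases (not_lt.1 hk).lt_or_eq with h1 | h1
  · exact V.not_isPrefix h1 ⟨[b], h.symm⟩
  · rw [h1] at h
    simpa using congrArg List.length h

theorem at_last : V.at (Fin.last (2 * n)) = [] := by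
  obtain ⟨k, hk⟩ := V.exists_at G.nil_mem_inner
  rcases (Fin.le_last k).lt_or_eq with h | h
  · exact absurd (hk ▸ List.nil_prefix) (V.not_isPrefix h)
  · rw [← h, hk]

theorem at_mem_interaction {k : Fin (2 * n + 1)} : V.at k ∈ G.interaction ↔ k ≠ Fin.last (2 * n) := by
  rw [mem_interaction]
  constructor
  · rintro ⟨h, _⟩ rfl; exact h V.at_last
  · intro h
    refine ⟨fun h' => h (V.at_injective ?_), V.at_mem k⟩
    rw [h', V.at_last]

/-- The left edges below the vertices of a set of indices, from some index on. -/
def leftEdges (F : Set (Fin (2 * n + 1))) (m : ℕ) : Set (List Bool) :=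
  {e | ∃ j ∈ F, m ≤ (j : ℕ) ∧ e = V.at j ++ [false]}

theorem leftEdges_anti (F : Set (Fin (2 * n + 1))) {m m' : ℕ} (h : m ≤ m') :
    V.leftEdges F m' ⊆ V.leftEdges F m := by
  rintro e ⟨j, hj, hm, rfl⟩
  exact ⟨j, hj, h.trans hm, rfl⟩

theorem append_true_notMem_leftEdges (F : Set (Fin (2 * n + 1))) (m : ℕ) (v : List Bool) :
    v ++ [true] ∉ V.leftEdges F m := by
  rintro ⟨j, _, _, h⟩
  simpa using (List.append_inj' h rfl).2

theorem at_append_false_mem {F : Set (Fin (2 * n + 1))} {m : ℕ} {k : Fin (2 * n + 1)} :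
    V.at k ++ [false] ∈ V.leftEdges F m ↔ k ∈ F ∧ m ≤ (k : ℕ) := by
  constructor
  · rintro ⟨j, hj, hm, h⟩
    obtain rfl := V.at_injective (List.append_inj' h rfl).1
    exact ⟨hj, hm⟩
  · rintro ⟨h1, h2⟩
    exact ⟨k, h1, h2, rfl⟩

/-- The free indices, chosen greedily from the root vertex on: an edge is free if its frequency is
not determined by the slow variables and by the free edges chosen before. -/
def IsGreedy (F : Set (Fin (2 * n + 1))) : Prop :=
  ∀ k, k ∈ F ↔ ¬ ∃ C, G.IsCut C (V.at k) false (V.leftEdges F (k + 1))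

/-- The criterion for `k` involves only the membership of larger indices, so it defines a set by
well-founded recursion on `>`. -/
theorem exists_isGreedy : ∃ F, V.IsGreedy F := by
  let step : (k : Fin (2 * n + 1)) → ((j : Fin (2 * n + 1)) → j > k → Prop) → Prop := fun k f =>
    ¬ ∃ C, G.IsCut C (V.at k) false {e | ∃ j, ∃ h : j > k, f j h ∧ e = V.at j ++ [false]}
  have wf : WellFounded (fun a b : Fin (2 * n + 1) => a > b) := wellFounded_gt
  refine ⟨{k | wf.fix step k}, fun k => ?_⟩
  rw [Set.mem_ofPred_eq, wf.fix_eq]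
  have : V.leftEdges {k | wf.fix step k} (k + 1) =
      {e | ∃ j, ∃ _ : j > k, wf.fix step j ∧ e = V.at j ++ [false]} := by
    ext e
    constructor
    · rintro ⟨j, h1, h2, h3⟩
      exact ⟨j, h2, h1, h3⟩
    · rintro ⟨j, h1, h2, h3⟩
      exact ⟨j, h2, h1, h3⟩
  rw [this]

variable {V} {F : Set (Fin (2 * n + 1))}

/-- Every edge which is not free is separated by a cut from the other edges that are not free. -/
theorem IsGreedy.exists_isCut (hF : V.IsGreedy F) (k : Fin (2 * n + 1)) (b : Bool)
    (hk : V.at k ++ [b] ∉ V.leftEdges F k) : ∃ C, G.IsCut C (V.at k) b (V.leftEdges F k) := by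
  induction k using WellFoundedGT.induction generalizing b with
  | ind k ih =>
  -- A left edge that was not chosen has a cut by the greedy criterion itself.
  have hfree : k ∉ F → ∃ C, G.IsCut C (V.at k) false (V.leftEdges F k) := by
    intro h
    obtain ⟨C, hC⟩ := not_not.1 (fun h' => h ((hF k).2 h'))
    exact ⟨C, hC.mono (V.leftEdges_anti F (Nat.le_succ _))⟩
  cases b with
  | false => exact hfree fun h => hk (V.at_append_false_mem.2 ⟨h, le_rfl⟩)
  | true =>
  -- `A` is the side of the vertex in a cut for the edge above it. That edge hangs below a vertex of
  -- larger index, so the induction hypothesis applies. If the edge is free, or if there is none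
  -- because the vertex is the root, the whole set of addresses serves.
  obtain ⟨A, hA, hvA, hAcl, hAa⟩ : ∃ A : Set (List Bool), G.PairClosed A ∧ V.at k ∈ A ∧
      (∀ w ∈ G.tree.inner, ∀ c, w ++ [c] ≠ V.at k → w ++ [c] ∉ V.leftEdges F k →
        (w ++ [c] ∈ A ↔ w ∈ A)) ∧
      (∀ w c, w ++ [c] = V.at k → w ++ [c] ∉ V.leftEdges F k → w ∉ A) := by
    by_cases ha : ∃ w c, w ++ [c] = V.at k ∧ w ++ [c] ∉ V.leftEdges F k
    · obtain ⟨w, c, hw, hwc⟩ := ha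
      obtain ⟨j, rfl⟩ := V.exists_at (STree.mem_inner_of_append (Or.inl (hw ▸ V.at_mem k)))
      have hkj := V.lt_of_at_eq_append hw.symm
      have hsub := V.leftEdges_anti F (show (k : ℕ) ≤ j from hkj.le)
      obtain ⟨A, hA⟩ := ih j hkj c fun h => hwc (hsub h)
      refine ⟨A, hA.pairClosed, hw ▸ hA.mem, fun w' hw' c' h1 h2 => ?_, fun w' c' h1 _ => ?_⟩
      · exact hA.closed w' hw' c' (by rwa [hw]) fun h => h2 (hsub h)
      · rw [← hw] at h1
        rw [(List.append_inj' h1 rfl).1]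
        exact hA.notMem
    · refine ⟨Set.univ, fun _ => by simp, Set.mem_univ _, fun _ _ _ _ _ => by simp, ?_⟩
      intro w c h1 h2
      exact absurd ⟨w, c, h1, h2⟩ ha
  -- `L` is the lower side of a cut for the left edge, and is empty if this edge is free.
  obtain ⟨L, hL, hvL, hLcl, hLl⟩ : ∃ L : Set (List Bool), G.PairClosed L ∧ V.at k ∉ L ∧
      (∀ w ∈ G.tree.inner, ∀ c, w ++ [c] ≠ V.at k ++ [false] → w ++ [c] ∉ V.leftEdges F k →
        (w ++ [c] ∈ L ↔ w ∈ L)) ∧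
      (V.at k ++ [false] ∉ V.leftEdges F k → V.at k ++ [false] ∈ L) := by
    by_cases h : k ∈ F
    · exact ⟨∅, fun _ => by simp, by simp, fun _ _ _ _ _ => by simp,
        fun h' => absurd (V.at_append_false_mem.2 ⟨h, le_rfl⟩) h'⟩
    · obtain ⟨C, hC⟩ := hfree h
      exact ⟨C, hC.pairClosed, hC.notMem, hC.closed, fun _ => hC.mem⟩
  have hne : ∀ i, G.initial i ≠ V.at k := fun i h =>
    STree.not_mem_leaves_of_mem_inner (V.at_mem k) (h ▸ G.initial_mem i)
  -- Taking `L` and the vertex itself away from `A` moves both endpoints of the upper and of the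
  -- left edge to the same side whenever these edges are not free. Of the three edges at the vertex,
  -- only the right one still crosses.
  refine ⟨A \ (L ∪ {V.at k}), fun i => ?_, ?_, by simp, fun w hw c h1 h2 => ?_⟩
  · simp only [Set.mem_sdiff, Set.mem_union, Set.mem_singleton_iff, hne, or_false, hA i, hL i]
  · refine ⟨(hAcl _ (V.at_mem k) true (by simp) hk).2 hvA, ?_⟩
    rintro (h | h)
    · exact hvL ((hLcl _ (V.at_mem k) true (by simp) hk).1 h)
    · simp at h
  · by_cases hwk : w ++ [c] = V.at k
    · have := hAa w c hwk h2
      rw [hwk]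
      simp [this]
    · by_cases hwk' : w = V.at k
      · subst hwk'
        cases c
        · simp [hLl h2]
        · exact absurd rfl h1
      · have h3 : w ++ [c] ≠ V.at k ++ [false] := fun h => hwk' (List.append_inj' h rfl).1
        simp only [Set.mem_sdiff, Set.mem_union, Set.mem_singleton_iff, hwk, hwk', or_false,
          hAcl w hw c hwk h2, hLcl w hw c h3 h2]

/-- The edges that are not free connect all vertices. -/
theorem IsGreedy.mem_iff (hF : V.IsGreedy F) {C : Set (List Bool)} (hC : G.PairClosed C)
    (hcl : ∀ w ∈ G.tree.inner, ∀ c, w ++ [c] ∉ V.leftEdges F 0 → (w ++ [c] ∈ C ↔ w ∈ C))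
    {v : List Bool} (hv : v ∈ G.tree.inner ∨ v ∈ G.tree.leaves) : v ∈ C ↔ [] ∈ C := by
  -- The free edges are put back one at a time, by increasing index. When all are back, the boundary
  -- of `C` is empty, and the tree is connected.
  have main : ∀ m : ℕ, m ≤ 2 * n + 1 →
      ∀ w ∈ G.tree.inner, ∀ c, w ++ [c] ∉ V.leftEdges F m → (w ++ [c] ∈ C ↔ w ∈ C) := by
    intro m
    induction m with
    | zero => exact fun _ => hcl
    | succ m ih =>
      intro hm w hw c hwc
      have ih' := ih (by omega)
      by_cases h : w ++ [c] ∈ V.leftEdges F m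
      · obtain ⟨j, hj, hmj, hwj⟩ := h
        obtain ⟨rfl, hc⟩ := List.append_inj' hwj rfl
        simp only [List.cons.injEq, and_true] at hc
        subst hc
        have hjm : (j : ℕ) = m := by
          by_contra hne
          exact hwc (V.at_append_false_mem.2 ⟨hj, by omega⟩)
        subst hjm
        have hno := (hF j).1 hj
        have key : ∀ w ∈ G.tree.inner, ∀ c, w ++ [c] ≠ V.at j ++ [false] →
            w ++ [c] ∉ V.leftEdges F (j + 1) → (w ++ [c] ∈ C ↔ w ∈ C) := by
          intro w hw c h1 h2
          refine ih' w hw c ?_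
          rintro ⟨i, hi, hji, hwi⟩
          obtain ⟨rfl, hc⟩ := List.append_inj' hwi rfl
          simp only [List.cons.injEq, and_true] at hc
          subst hc
          rcases hji.lt_or_eq with h | h
          · exact h2 (V.at_append_false_mem.2 ⟨hi, h⟩)
          · exact h1 (by rw [Fin.ext h])
        -- If the restored edge crossed the boundary of `C`, then `C` or its complement, whichever
        -- contains the lower endpoint, would be a cut of the kind whose absence put `j` into `F`.
        by_contra hcross
        by_cases hin : V.at j ∈ C
        · refine hno ⟨Cᶜ, fun i => not_congr (hC i), ?_, by simpa using hin, ?_⟩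
          · intro h; exact hcross (by simp [h, hin])
          · intro w hw c h1 h2
            exact not_congr (key w hw c h1 h2)
        · refine hno ⟨C, hC, ?_, hin, key⟩
          by_contra h; exact hcross (by simp [h, hin])
      · exact ih' w hw c h
  refine mem_iff_of_closed (fun w hw c => main (2 * n + 1) le_rfl w hw c ?_) hv
  rintro ⟨j, _, hj, _⟩
  omega

end IntegrationOrder

end PairedGraph

end WaveKinetic

/-! ### The number of free edges, by linear algebra -/

namespace WaveKinetic

namespace PairedGraph

variable {n : ℕ} {G : PairedGraph n}

/-- The pair that contains a given initial vertex. -/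
def pairOf (G : PairedGraph n) (i : Fin (2 * n + 2)) : G.Pairs :=
  if h : i < G.pair i then ⟨i, h⟩
  else ⟨G.pair i, by rw [G.pair_pair]; exact lt_of_le_of_ne (not_lt.1 h) (G.pair_ne i)⟩

theorem pairOf_pair (i : Fin (2 * n + 2)) : G.pairOf (G.pair i) = G.pairOf i := by
  unfold pairOf
  by_cases h : i < G.pair i
  · have h' : ¬ G.pair i < G.pair (G.pair i) := by rw [G.pair_pair]; exact not_lt.2 h.le
    rw [dif_pos h, dif_neg h']
    simp [G.pair_pair]
  · have h' : G.pair i < G.pair (G.pair i) := by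
      rw [G.pair_pair]; exact lt_of_le_of_ne (not_lt.1 h) (G.pair_ne i)
    rw [dif_neg h, dif_pos h']

theorem pairOf_coe (p : G.Pairs) : G.pairOf p.1 = p := by
  unfold pairOf
  rw [dif_pos p.2]

theorem card_slow : Fintype.card {p : G.Pairs // p ≠ G.firstPair} = n := by
  rw [Fintype.card_subtype_compl, card_pairs]
  simp

theorem eq_of_sum_eq_zero {M : Type*} [AddCommGroup M] {η η' : G.Pairs → M}
    (h : ∑ p, η p = 0) (h' : ∑ p, η' p = 0) (heq : ∀ p, p ≠ G.firstPair → η p = η' p) :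
    η = η' := by
  funext p
  by_cases hp : p = G.firstPair
  · subst hp
    rw [← h', ← Finset.add_sum_erase _ _ (Finset.mem_univ G.firstPair),
      ← Finset.add_sum_erase _ η' (Finset.mem_univ G.firstPair), Finset.sum_congr rfl
      fun p hp => heq p (Finset.ne_of_mem_erase hp)] at h
    exact add_right_cancel h
  · exact heq p hp

theorem freqOf_map {M N : Type*} [AddCommGroup M] [AddCommGroup N] (f : M →+ N) (ξ : M)
    (z : List Bool → M) (v : List Bool) : f (freqOf ξ z v) = freqOf (f ξ) (fun w => f (z w)) v := by
  induction v using List.reverseRecOn with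
  | nil => simp
  | append_singleton v b ih => cases b <;> simp [ih]

/-- Left edge frequencies, extended by zero. -/
def zeroExtend {M : Type*} [Zero M] {s : Finset (List Bool)} (z : {v // v ∈ s} → M) (v : List Bool) :
    M := if h : v ∈ s then z ⟨v, h⟩ else 0

theorem zeroExtend_coe {M : Type*} [Zero M] {s : Finset (List Bool)} (z : {v // v ∈ s} → M)
    (v : {v // v ∈ s}) : zeroExtend z v.1 = z v := by
  simp [zeroExtend]

theorem zeroExtend_of_mem {M : Type*} [Zero M] {s : Finset (List Bool)} (z : {v // v ∈ s} → M)
    {v : List Bool} (hv : v ∈ s) : zeroExtend z v = z ⟨v, hv⟩ := by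
  simp [zeroExtend, hv]

namespace IntegrationOrder

variable {V : G.IntegrationOrder} {F : Set (Fin (2 * n + 1))}

theorem sum_at {M : Type*} [AddCommMonoid M] (V : G.IntegrationOrder) (f : List Bool → M) :
    ∑ v ∈ G.tree.inner, f v = ∑ k, f (V.at k) := by
  rw [← Finset.sum_coe_sort]
  exact (Fintype.sum_equiv V.vertex _ _ fun k => rfl).symm

open Classical in
/-- The frequency of an edge in terms of those of the free edges, by the flux through a cut. -/
theorem eq_of_isCut {M : Type*} [AddCommGroup M] {ξ : List Bool → M}
    {η : G.Pairs → M} (h : G.IsFlow ξ η) {C : Set (List Bool)} {k : Fin (2 * n + 1)} {b : Bool}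
    (hk : V.at k ++ [b] ∉ V.leftEdges F k) (hC : G.IsCut C (V.at k) b (V.leftEdges F k)) :
    ξ (V.at k ++ [b]) = ∑ p, ind C (G.initial p.1) • η p -
      ∑ j, if j ∈ F then (ind C (V.at j ++ [false]) - ind C (V.at j)) • ξ (V.at j ++ [false])
        else 0 := by
  have h1 := h.sum_boundary hC.pairClosed
  rw [V.sum_at] at h1
  rw [← h1, eq_sub_iff_add_eq']
  have hs : ξ (V.at k ++ [b]) = ∑ j, if j = k then ξ (V.at k ++ [b]) else 0 := by simp
  rw [hs, ← Finset.sum_add_distrib]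
  refine Finset.sum_congr rfl fun j _ => ?_
  -- Edges that do not cross the boundary of `C` have coefficient zero. Thus all right edges drop
  -- out, except possibly the edge to be expressed, and so do all left edges that are neither free
  -- nor this edge.
  have hclosed : ∀ c, ¬ (j = k ∧ c = b) → V.at j ++ [c] ∉ V.leftEdges F k →
      ind C (V.at j ++ [c]) = ind C (V.at j) := fun c hc hcF =>
    ind_congr (hC.closed _ (V.at_mem j) c (fun h => hc ⟨V.at_injective (List.append_inj' h rfl).1,
      by simpa using (List.append_inj' h rfl).2⟩) hcF)
  by_cases hjk : j = k
  · subst hjk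
    cases b with
    | false =>
      have hjF : j ∉ F := fun h => hk (V.at_append_false_mem.2 ⟨h, le_rfl⟩)
      rw [hclosed true (by simp) (V.append_true_notMem_leftEdges _ _ _), ind_of_mem hC.mem,
        ind_of_notMem hC.notMem]
      simp [hjF]
    | true =>
      rw [ind_of_mem hC.mem, ind_of_notMem hC.notMem]
      by_cases hjF : j ∈ F
      · simp [hjF]
      · have := hclosed false (by simp) fun h => hjF (V.at_append_false_mem.1 h).1
        rw [ind_of_notMem hC.notMem] at this
        simp [hjF, this]
  · rw [hclosed true (fun h => hjk h.1) (V.append_true_notMem_leftEdges _ _ _)]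
    by_cases hjF : j ∈ F
    · simp [hjF, hjk]
    · have := hclosed false (fun h => hjk h.1) fun h => hjF (V.at_append_false_mem.1 h).1
      simp [hjF, hjk, this]

/-- Every edge is free or is given by the flux through a cut in terms of free and slow variables.
This is the uniqueness half of the parametrization, in homogeneous form. -/
theorem IsGreedy.eq_zero (hF : V.IsGreedy F) {M : Type*} [AddCommGroup M] {ξ : List Bool → M}
    {η : G.Pairs → M} (h : G.IsFlow ξ η) (hη : ∀ p, η p = 0)
    (hf : ∀ j ∈ F, ξ (V.at j ++ [false]) = 0) {e : List Bool} (he : e ∈ G.edges) : ξ e = 0 := by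
  classical
  obtain ⟨v, hv, b, rfl⟩ := exists_of_mem_edges he
  obtain ⟨k, rfl⟩ := V.exists_at hv
  by_cases hk : V.at k ++ [b] ∈ V.leftEdges F k
  · obtain ⟨j, hj, _, hjk⟩ := hk
    rw [hjk, hf j hj]
  · obtain ⟨C, hC⟩ := hF.exists_isCut k b hk
    rw [eq_of_isCut h hk hC, Finset.sum_eq_zero fun p _ => by rw [hη, smul_zero],
      Finset.sum_eq_zero, sub_zero]
    intro j _
    split_ifs with hj
    · rw [hf j hj, smul_zero]
    · rfl

/-- A flow is given freely by the frequencies of its `2n+1` left edges, and is determined by the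
free edges together with the `n` slow variables other than that of the first pair, which is minus
the sum of the others. Injectivity gives `2n+1 ≤ |F| + n`. -/
theorem IsGreedy.le_ncard (hF : V.IsGreedy F) : n + 1 ≤ F.ncard := by
  classical
  let Φ : ({v // v ∈ G.tree.inner} → ℝ) →ₗ[ℝ] ({j // j ∈ F} ⊕ {p : G.Pairs // p ≠ G.firstPair} → ℝ) :=
    { toFun := fun z => Sum.elim (fun j => freqOf 0 (zeroExtend z) (V.at j.1 ++ [false]))
        (fun p => freqOf 0 (zeroExtend z) (G.initial p.1.1) +
          freqOf 0 (zeroExtend z) (G.initial (G.pair p.1.1)))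
      map_add' := by
        intro z z'
        have h : ∀ v, freqOf 0 (zeroExtend (z + z')) v =
            freqOf 0 (zeroExtend z) v + freqOf 0 (zeroExtend z') v := by
          intro v
          induction v using List.reverseRecOn with
          | nil => simp
          | append_singleton v b ih =>
            have : zeroExtend (z + z') v = zeroExtend z v + zeroExtend z' v := by
              by_cases hv : v ∈ G.tree.inner <;> simp [zeroExtend, hv]
            cases b <;> (simp [this, ih]; try ring)
        ext (j | p)
        · simp only [h, Sum.elim_inl, Pi.add_apply]
        · simp only [h, Sum.elim_inr, Pi.add_apply]; ring
      map_smul' := by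
        intro c z
        have h : ∀ v, freqOf 0 (zeroExtend (c • z)) v = c * freqOf 0 (zeroExtend z) v := by
          intro v
          induction v using List.reverseRecOn with
          | nil => simp
          | append_singleton v b ih =>
            have : zeroExtend (c • z) v = c * zeroExtend z v := by
              by_cases hv : v ∈ G.tree.inner <;> simp [zeroExtend, hv]
            cases b <;> (simp [this, ih]; try ring)
        ext (j | p)
        · simp only [h, Sum.elim_inl, Pi.smul_apply, RingHom.id_apply, smul_eq_mul]
        · simp only [h, Sum.elim_inr, Pi.smul_apply, RingHom.id_apply, smul_eq_mul]; ring }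
  have hinj : Function.Injective Φ := by
    rw [injective_iff_map_eq_zero]
    intro z hz
    have hfl := isFlow_freqOf (G := G) (zeroExtend z)
    have hη : (fun p : G.Pairs => freqOf 0 (zeroExtend z) (G.initial p.1) +
        freqOf 0 (zeroExtend z) (G.initial (G.pair p.1))) = 0 :=
      eq_of_sum_eq_zero hfl.sum_eq_zero (by simp) fun p hp => congrFun hz (Sum.inr ⟨p, hp⟩)
    funext v
    have := hF.eq_zero hfl (fun p => congrFun hη p) (fun j hj => congrFun hz (Sum.inl ⟨j, hj⟩))
      (append_mem_edges v.2 false)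
    simpa [zeroExtend_coe] using this
  have := LinearMap.finrank_le_finrank_of_injective hinj
  rw [Module.finrank_fintype_fun_eq_card, Module.finrank_fintype_fun_eq_card, Fintype.card_sum,
    card_slow, Fintype.card_coe, card_inner, ← Nat.card_eq_fintype_card, Nat.card_coe_set_eq]
    at this
  omega

/-- The dual count, with potentials on the vertices in place of flows on the edges. A potential that
vanishes at the root has `3n+1` parameters and is determined by its increments along the `4n+2 -
|F|` edges that are not free, because these connect all vertices. -/
theorem IsGreedy.ncard_le (hF : V.IsGreedy F) : F.ncard ≤ n + 1 := by
  classical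
  -- The potential takes a common value at the two leaves of a pair, and the default value zero at
  -- the root.
  let ext : ({v // v ∈ G.interaction} ⊕ G.Pairs → ℝ) → List Bool → ℝ := fun ψ v =>
    if h : v ∈ G.interaction then ψ (Sum.inl ⟨v, h⟩)
    else if h : ∃ i, G.initial i = v then ψ (Sum.inr (G.pairOf h.choose)) else 0
  have hext : ∀ ψ i, ext ψ (G.initial i) = ψ (Sum.inr (G.pairOf i)) := by
    intro ψ i
    have h1 : G.initial i ∉ G.interaction := fun h =>
      STree.not_mem_leaves_of_mem_inner (mem_interaction.1 h).2 (G.initial_mem i)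
    have h2 : ∃ j, G.initial j = G.initial i := ⟨i, rfl⟩
    simp only [ext, dif_neg h1, dif_pos h2]
    rw [G.initial_injective h2.choose_spec]
  let Φ : ({v // v ∈ G.interaction} ⊕ G.Pairs → ℝ) →ₗ[ℝ] ({j // j ∉ F} ⊕ Fin (2 * n + 1) → ℝ) :=
    { toFun := fun ψ => Sum.elim (fun j => ext ψ (V.at j.1 ++ [false]) - ext ψ (V.at j.1))
        (fun j => ext ψ (V.at j ++ [true]) - ext ψ (V.at j))
      map_add' := by
        intro z z'
        have h : ∀ v, ext (z + z') v = ext z v + ext z' v := by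
          intro v
          simp only [ext]
          split_ifs <;> simp
        ext (j | p) <;> simp [h] <;> ring
      map_smul' := by
        intro c z
        have h : ∀ v, ext (c • z) v = c * ext z v := by
          intro v
          simp only [ext]
          split_ifs <;> simp
        ext (j | p) <;> simp [h] <;> ring }
  have hinj : Function.Injective Φ := by
    rw [injective_iff_map_eq_zero]
    intro ψ hψ
    have h0 : ext ψ [] = 0 := by
      have h1 : [] ∉ G.interaction := fun h => (mem_interaction.1 h).1 rfl
      have h2 : ¬ ∃ i, G.initial i = [] := fun ⟨i, hi⟩ => initial_ne_nil i hi
      simp only [ext, dif_neg h1, dif_neg h2]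
    -- The zero set of the potential contains the root and no edge outside the free ones leaves it,
    -- so it is everything.
    have key : ∀ v, v ∈ G.tree.inner ∨ v ∈ G.tree.leaves → ext ψ v = 0 := by
      intro v hv
      refine (hF.mem_iff (C := {v | ext ψ v = 0}) (fun i => ?_) (fun w hw c hwc => ?_) hv).2 h0
      · simp only [Set.mem_ofPred_eq, hext, pairOf_pair]
      · obtain ⟨k, rfl⟩ := V.exists_at hw
        have : ext ψ (V.at k ++ [c]) = ext ψ (V.at k) := by
          cases c with
          | false =>
            have hk : k ∉ F := fun h => hwc (V.at_append_false_mem.2 ⟨h, Nat.zero_le _⟩)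
            exact sub_eq_zero.1 (congrFun hψ (Sum.inl ⟨k, hk⟩))
          | true => exact sub_eq_zero.1 (congrFun hψ (Sum.inr k))
        simp only [Set.mem_ofPred_eq, this]
    funext x
    rcases x with v | p
    · have := key v.1 (Or.inl (mem_interaction.1 v.2).2)
      simpa [ext, v.2] using this
    · have := key _ (Or.inr (G.initial_mem p.1))
      rwa [hext, pairOf_coe] at this
  have h1 := LinearMap.finrank_le_finrank_of_injective hinj
  rw [Module.finrank_fintype_fun_eq_card, Module.finrank_fintype_fun_eq_card, Fintype.card_sum,
    Fintype.card_sum, card_pairs, Fintype.card_coe, card_interaction, Fintype.card_fin,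
    Fintype.card_subtype_compl, Fintype.card_fin, ← Nat.card_eq_fintype_card,
    Nat.card_coe_set_eq] at h1
  have h2 : F.ncard ≤ 2 * n + 1 := by
    have := Set.ncard_le_card F
    simpa using this
  omega

theorem IsGreedy.ncard_eq (hF : V.IsGreedy F) : F.ncard = n + 1 := le_antisymm hF.ncard_le hF.le_ncard

end IntegrationOrder

end PairedGraph

end WaveKinetic

/-! ### The parametrization of the frequencies by free and slow variables -/

namespace WaveKinetic

namespace STree

/-- Frequencies are determined by those at the initial vertices. -/
theorem eq_zero_of_law {M : Type*} [AddCommGroup M] {T : STree} {ξ : List Bool → M}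
    (h : ∀ v ∈ T.inner, ξ v = ξ (v ++ [false]) + ξ (v ++ [true]))
    (hl : ∀ v ∈ T.leaves, ξ v = 0) : ∀ v ∈ T.inner, ξ v = 0 := by
  have main : ∀ v, (v ∈ T.inner ∨ v ∈ T.leaves) → ξ v = 0 := by
    induction T generalizing ξ with
    | leaf σ =>
      rintro v (hv | hv)
      · simp at hv
      · exact hl v hv
    | node σ l r ihl ihr =>
      have h1 := ihl (ξ := fun v => ξ (false :: v)) (fun v hv => h (false :: v) (by simpa using hv))
        fun v hv => hl (false :: v) (by simpa using hv)
      have h2 := ihr (ξ := fun v => ξ (true :: v)) (fun v hv => h (true :: v) (by simpa using hv))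
        fun v hv => hl (true :: v) (by simpa using hv)
      have h3 : ∀ T : STree, [] ∈ T.inner ∨ [] ∈ T.leaves := by
        intro T; cases T <;> simp
      rintro (_ | ⟨_ | _, v⟩) hv
      · rw [h [] (by simp)]
        simp [h1 [] (h3 l), h2 [] (h3 r)]
      · exact h1 v (by simpa using hv)
      · exact h2 v (by simpa using hv)
  exact fun v hv => main v (Or.inl hv)

/-- The values at the leaves are unconstrained; those above are obtained by adding from the bottom
to the top. -/
theorem exists_law {M : Type*} [AddCommGroup M] (T : STree) (x : List Bool → M) :
    ∃ ξ : List Bool → M, (∀ v ∈ T.inner, ξ v = ξ (v ++ [false]) + ξ (v ++ [true])) ∧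
      ∀ v ∈ T.leaves, ξ v = x v := by
  induction T generalizing x with
  | leaf σ => exact ⟨x, by simp, fun _ _ => rfl⟩
  | node σ l r hl hr =>
    obtain ⟨ξl, hl1, hl2⟩ := hl fun v => x (false :: v)
    obtain ⟨ξr, hr1, hr2⟩ := hr fun v => x (true :: v)
    refine ⟨fun v => match v with
      | [] => ξl [] + ξr []
      | false :: v => ξl v
      | true :: v => ξr v, ?_, ?_⟩
    · rintro (_ | ⟨_ | _, v⟩) hv
      · rfl
      · exact hl1 v (by simpa using hv)
      · exact hr1 v (by simpa using hv)
    · rintro (_ | ⟨_ | _, v⟩) hv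
      · simp at hv
      · exact hl2 v (by simpa using hv)
      · exact hr2 v (by simpa using hv)

end STree

namespace PairedGraph

variable {n : ℕ} {G : PairedGraph n}

namespace IntegrationOrder

variable (V : G.IntegrationOrder)

/-- The indices of the free edges. -/
def freeSet : Set (Fin (2 * n + 1)) := V.exists_isGreedy.choose

theorem isGreedy_freeSet : V.IsGreedy V.freeSet := V.exists_isGreedy.choose_spec

open Classical in
theorem card_freeSet : V.freeSet.toFinset.card = n + 1 := by
  rw [← Set.ncard_eq_toFinset_card', V.isGreedy_freeSet.ncard_eq]

open Classical in
/-- The increasing enumeration of the free indices. -/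
def freeIndex : Fin (n + 1) ↪o Fin (2 * n + 1) :=
  V.freeSet.toFinset.orderEmbOfFin V.card_freeSet

theorem freeIndex_mem (i : Fin (n + 1)) : V.freeIndex i ∈ V.freeSet := by
  classical
  exact Set.mem_toFinset.1 (V.freeSet.toFinset.orderEmbOfFin_mem V.card_freeSet i)

theorem exists_freeIndex {k : Fin (2 * n + 1)} (hk : k ∈ V.freeSet) : ∃ i, V.freeIndex i = k := by
  classical
  have := V.freeSet.toFinset.range_orderEmbOfFin V.card_freeSet
  have hk' : k ∈ Set.range V.freeIndex := by
    rw [show Set.range V.freeIndex = _ from this]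
    simpa using hk
  exact hk'

open Classical in
theorem sum_freeSet {M : Type*} [AddCommMonoid M] (f : Fin (2 * n + 1) → M) :
    (∑ j, if j ∈ V.freeSet then f j else 0) = ∑ i, f (V.freeIndex i) := by
  rw [← Finset.sum_filter]
  refine (Finset.sum_bij' (fun i _ => V.freeIndex i)
    (fun k hk => (V.exists_freeIndex (Finset.mem_filter.1 hk).2).choose) ?_ ?_ ?_ ?_ ?_).symm
  · intro i _; simp [V.freeIndex_mem]
  · intros; simp
  · intro i hi
    exact V.freeIndex.injective (V.exists_freeIndex (V.freeIndex_mem i)).choose_spec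
  · intro k hk
    exact (V.exists_freeIndex (Finset.mem_filter.1 hk).2).choose_spec
  · intros; rfl

/-- `C` is a cut that expresses the frequency of the edge `e`. -/
def Expresses (e : List Bool) (C : Set (List Bool)) : Prop :=
  ∃ k b, e = V.at k ++ [b] ∧ G.IsCut C (V.at k) b (V.leftEdges V.freeSet k)

open Classical in
/-- A cut that expresses the frequency of the edge `e`, if there is one. -/
def cutSet (e : List Bool) : Set (List Bool) :=
  if h : ∃ C, V.Expresses e C then h.choose else ∅

theorem isCut_cutSet {k : Fin (2 * n + 1)} {b : Bool}
    (hk : V.at k ++ [b] ∉ V.leftEdges V.freeSet k) :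
    G.IsCut (V.cutSet (V.at k ++ [b])) (V.at k) b (V.leftEdges V.freeSet k) := by
  obtain ⟨C, hC⟩ := V.isGreedy_freeSet.exists_isCut k b hk
  have h : ∃ C, V.Expresses (V.at k ++ [b]) C := ⟨C, k, b, rfl, hC⟩
  rw [cutSet, dif_pos h]
  obtain ⟨k', b', h', hC'⟩ := h.choose_spec
  obtain ⟨h1, h2⟩ := List.append_inj' h' rfl
  obtain rfl := V.at_injective h1
  simp only [List.cons.injEq, and_true] at h2
  subst h2
  exact hC'

open Classical in
/-- The free indices, and the coefficients of the frequencies given by fluxes through cuts. -/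
def freeData : G.FreeData where
  k := V.freeIndex
  coefFree e j :=
    if e ∈ V.leftEdges V.freeSet 0 then (if e = V.at (V.freeIndex j) ++ [false] then 1 else 0)
    else ind (V.cutSet e) (V.at (V.freeIndex j)) -
      ind (V.cutSet e) (V.at (V.freeIndex j) ++ [false])
  coefSlow e p :=
    if e ∈ V.leftEdges V.freeSet 0 then 0 else ind (V.cutSet e) (G.initial p.1)

theorem ind_eq_zero_or_one (C : Set (List Bool)) (v : List Bool) : ind C v = 0 ∨ ind C v = 1 := by
  by_cases h : v ∈ C
  · exact Or.inr (ind_of_mem h)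
  · exact Or.inl (ind_of_notMem h)

theorem coefFree_mem (e : List Bool) (j : Fin (n + 1)) :
    V.freeData.coefFree e j ∈ ({-1, 0, 1} : Set ℤ) := by
  simp only [freeData]
  split_ifs
  · simp
  · simp
  · rcases ind_eq_zero_or_one (V.cutSet e) (V.at (V.freeIndex j)) with h | h <;>
      rcases ind_eq_zero_or_one (V.cutSet e) (V.at (V.freeIndex j) ++ [false]) with h' | h' <;>
      simp [h, h']

theorem coefSlow_mem (e : List Bool) (p : G.Pairs) :
    V.freeData.coefSlow e p ∈ ({-1, 0, 1} : Set ℤ) := by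
  simp only [freeData]
  split_ifs
  · simp
  · rcases ind_eq_zero_or_one (V.cutSet e) (G.initial p.1) with h | h <;> simp [h]

/-- The cut for an edge below the vertex of index `k` is crossed by no free edge of smaller index,
and a coefficient is nonzero only if the corresponding free edge crosses. -/
theorem le_freeIndex_of_coefFree {k : Fin (2 * n + 1)} {b : Bool} {j : Fin (n + 1)}
    (h : V.freeData.coefFree (V.at k ++ [b]) j ≠ 0) : k ≤ V.freeIndex j := by
  simp only [freeData] at h
  split_ifs at h with h1 h2
  · exact (V.at_injective (List.append_inj' h2 rfl).1).le
  · exact absurd rfl h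
  · have hk : V.at k ++ [b] ∉ V.leftEdges V.freeSet k := fun h' =>
      h1 (V.leftEdges_anti _ (Nat.zero_le _) h')
    by_contra hlt
    refine h ?_
    rw [sub_eq_zero]
    refine (ind_congr ((V.isCut_cutSet hk).closed _ (V.at_mem _) _ (fun h3 => ?_) fun h3 => ?_)).symm
    · exact hlt (V.at_injective (List.append_inj' h3 rfl).1).ge
    · exact hlt (V.at_append_false_mem.1 h3).2

/-- The edge above a vertex is an edge below its parent, whose index is strictly larger. -/
theorem lt_freeIndex_of_coefFree {k : Fin (2 * n + 1)} (hk : V.at k ∈ G.interaction)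
    {j : Fin (n + 1)} (h : V.freeData.coefFree (V.at k) j ≠ 0) : k < V.freeIndex j := by
  obtain ⟨v, hv, b, hvb⟩ := exists_of_mem_edges (Finset.mem_union_left _ hk)
  obtain ⟨k', rfl⟩ := V.exists_at hv
  rw [hvb] at h
  exact (V.lt_of_at_eq_append hvb).trans_le (V.le_freeIndex_of_coefFree h)

/-- A free edge is its own coordinate; any other one is solved for in the flux identity of its
chosen cut, which reverses the sign of the jumps of the indicator across the free edges. -/
theorem eq_sum_coef {M : Type*} [AddCommGroup M] {ξ : List Bool → M} {η : G.Pairs → M}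
    (h : G.IsFlow ξ η) {e : List Bool} (he : e ∈ G.edges) :
    ξ e = ∑ j, V.freeData.coefFree e j • ξ (V.at (V.freeIndex j) ++ [false]) +
      ∑ p, V.freeData.coefSlow e p • η p := by
  classical
  simp only [freeData]
  by_cases h1 : e ∈ V.leftEdges V.freeSet 0
  · simp only [h1, if_true]
    obtain ⟨k, hk, _, rfl⟩ := h1
    obtain ⟨i, rfl⟩ := V.exists_freeIndex hk
    rw [Finset.sum_eq_single i]
    · simp
    · intro j _ hj
      have : ¬ V.at (V.freeIndex i) ++ [false] = V.at (V.freeIndex j) ++ [false] := fun h =>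
        hj (V.freeIndex.injective (V.at_injective (List.append_inj' h rfl).1)).symm
      simp only [this, if_false, zero_smul]
    · simp
  · simp only [h1, if_false]
    obtain ⟨v, hv, b, rfl⟩ := exists_of_mem_edges he
    obtain ⟨k, rfl⟩ := V.exists_at hv
    have hk : V.at k ++ [b] ∉ V.leftEdges V.freeSet k := fun h' =>
      h1 (V.leftEdges_anti _ (Nat.zero_le _) h')
    rw [eq_of_isCut h hk (V.isCut_cutSet hk), V.sum_freeSet, sub_eq_neg_add,
      ← Finset.sum_neg_distrib]
    congr 1
    refine Finset.sum_congr rfl fun j _ => ?_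
    rw [← neg_smul, neg_sub]

theorem eq_freq {d : ℕ} {ξ : List Bool → Space d} {η : G.Pairs → Space d}
    (h : G.IsFlow ξ η) {e : List Bool} (he : e ∈ G.edges) :
    ξ e = V.freeData.freq (fun i => ξ (V.freeData.freeEdge V i)) η e := by
  rw [V.eq_sum_coef h he, FreeData.freq]
  simp only [Int.cast_smul_eq_zsmul]
  rfl

/-- With exactly `n+1` free edges, the injective map used for `IsGreedy.le_ncard` goes between
spaces of the same dimension `2n+1`, hence is onto: all values of the free and slow variables occur.
-/
theorem exists_real_flow (x : Fin (n + 1) → ℝ) {y : G.Pairs → ℝ} (hy : ∑ p, y p = 0) :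
    ∃ z : List Bool → ℝ, G.IsFlow (freqOf 0 z) y ∧ ∀ i, z (V.at (V.freeIndex i)) = x i := by
  classical
  let Φ : ({v // v ∈ G.tree.inner} → ℝ) →ₗ[ℝ]
      (Fin (n + 1) ⊕ {p : G.Pairs // p ≠ G.firstPair} → ℝ) :=
    { toFun := fun z => Sum.elim (fun i => zeroExtend z (V.at (V.freeIndex i)))
        (fun p => freqOf 0 (zeroExtend z) (G.initial p.1.1) +
          freqOf 0 (zeroExtend z) (G.initial (G.pair p.1.1)))
      map_add' := by
        intro z z'
        have h0 : ∀ v, zeroExtend (z + z') v = zeroExtend z v + zeroExtend z' v := by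
          intro v
          by_cases hv : v ∈ G.tree.inner <;> simp [zeroExtend, hv]
        have h : ∀ v, freqOf 0 (zeroExtend (z + z')) v =
            freqOf 0 (zeroExtend z) v + freqOf 0 (zeroExtend z') v := by
          intro v
          induction v using List.reverseRecOn with
          | nil => simp
          | append_singleton v b ih => cases b <;> (simp [h0, ih]; try ring)
        ext (j | p)
        · simp only [h0, Sum.elim_inl, Pi.add_apply]
        · simp only [h, Sum.elim_inr, Pi.add_apply]; ring
      map_smul' := by
        intro c z
        have h0 : ∀ v, zeroExtend (c • z) v = c * zeroExtend z v := by
          intro v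
          by_cases hv : v ∈ G.tree.inner <;> simp [zeroExtend, hv]
        have h : ∀ v, freqOf 0 (zeroExtend (c • z)) v = c * freqOf 0 (zeroExtend z) v := by
          intro v
          induction v using List.reverseRecOn with
          | nil => simp
          | append_singleton v b ih => cases b <;> (simp [h0, ih]; try ring)
        ext (j | p)
        · simp only [h0, Sum.elim_inl, Pi.smul_apply, RingHom.id_apply, smul_eq_mul]
        · simp only [h, Sum.elim_inr, Pi.smul_apply, RingHom.id_apply, smul_eq_mul]; ring }
  have hinj : Function.Injective Φ := by
    rw [injective_iff_map_eq_zero]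
    intro z hz
    have hfl := isFlow_freqOf (G := G) (zeroExtend z)
    have hη : (fun p : G.Pairs => freqOf 0 (zeroExtend z) (G.initial p.1) +
        freqOf 0 (zeroExtend z) (G.initial (G.pair p.1))) = 0 :=
      eq_of_sum_eq_zero hfl.sum_eq_zero (by simp) fun p hp => congrFun hz (Sum.inr ⟨p, hp⟩)
    funext v
    have := V.isGreedy_freeSet.eq_zero hfl (fun p => congrFun hη p) (fun j hj => by
        obtain ⟨i, rfl⟩ := V.exists_freeIndex hj
        rw [freqOf_append_false]
        exact congrFun hz (Sum.inl i))
      (append_mem_edges v.2 false)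
    simpa [zeroExtend_coe] using this
  have hsurj : Function.Surjective Φ := by
    refine (LinearMap.injective_iff_surjective_of_finrank_eq_finrank ?_).1 hinj
    rw [Module.finrank_fintype_fun_eq_card, Module.finrank_fintype_fun_eq_card, Fintype.card_sum,
      card_slow, Fintype.card_coe, card_inner, Fintype.card_fin]
    omega
  obtain ⟨z, hz⟩ := hsurj (Sum.elim x fun p => y p.1)
  have hfl := isFlow_freqOf (G := G) (zeroExtend z)
  refine ⟨zeroExtend z, ?_, fun i => congrFun hz (Sum.inl i)⟩
  convert hfl using 1
  exact eq_of_sum_eq_zero hy hfl.sum_eq_zero fun p hp => (congrFun hz (Sum.inr ⟨p, hp⟩)).symm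

/-- The laws do not mix coordinates, so the real case is applied to each coordinate separately. -/
theorem exists_flow {d : ℕ} (x : Fin (n + 1) → Space d) {y : G.Pairs → Space d}
    (hy : ∑ p, y p = 0) :
    ∃ z : List Bool → Space d, G.IsFlow (freqOf 0 z) y ∧ ∀ i, z (V.at (V.freeIndex i)) = x i := by
  have hy' : ∀ a, ∑ p, y p a = 0 := by
    intro a
    have := congrArg (fun v : Space d => v a) hy
    simpa using this
  choose z hz hzx using fun a => V.exists_real_flow (fun i => x i a) (hy' a)
  have hf : ∀ v a, freqOf 0 (fun w => WithLp.toLp 2 fun a => z a w : List Bool → Space d) v a =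
      freqOf 0 (z a) v := by
    intro v a
    have := freqOf_map ((EuclideanSpace.proj (𝕜 := ℝ) a : Space d →L[ℝ] ℝ).toLinearMap.toAddMonoidHom)
      0 (fun w => WithLp.toLp 2 fun a => z a w : List Bool → Space d) v
    simpa using this
  refine ⟨fun w => WithLp.toLp 2 fun a => z a w, ⟨by simp, fun v hv => by simp, fun p => ?_⟩,
    fun i => ?_⟩
  · ext a
    rw [PiLp.add_apply, hf, hf]
    exact (hz a).pair p
  · ext a
    exact hzx a i

/-- The formula `freq` is defined at every address but meaningful only on edges, where it agrees
with the flow that has the prescribed free and slow variables. -/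
theorem isFlow_freq {d : ℕ} (x : Fin (n + 1) → Space d) {y : G.Pairs → Space d}
    (hy : ∑ p, y p = 0) :
    ∃ z : List Bool → Space d, G.IsFlow (freqOf 0 z) y ∧ (∀ i, z (V.at (V.freeIndex i)) = x i) ∧
      ∀ e ∈ G.edges, V.freeData.freq x y e = freqOf 0 z e := by
  obtain ⟨z, hz, hzx⟩ := V.exists_flow x hy
  refine ⟨z, hz, hzx, fun e he => ?_⟩
  rw [V.eq_freq hz he]
  congr 1
  funext i
  rw [← hzx i]
  exact (freqOf_append_false 0 z _).symm

theorem kirchhoff_freq {d : ℕ} (x : Fin (n + 1) → Space d) {y : G.Pairs → Space d}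
    (hy : ∑ p, y p = 0) :
    G.Kirchhoff (V.freeData.freq x y) y ∧
      ∀ i, V.freeData.freq x y (V.freeData.freeEdge V i) = x i := by
  obtain ⟨z, hz, hzx, he⟩ := V.isFlow_freq x hy
  refine ⟨⟨fun v hv => ?_, fun p => ?_, hy⟩, fun i => ?_⟩
  · have hv' := (mem_interaction.1 hv).2
    rw [he _ (append_mem_edges hv' _), he _ (append_mem_edges hv' _),
      he _ (Finset.mem_union_left _ hv), hz.add v hv']
  · rw [he _ (initial_mem_edges _), he _ (initial_mem_edges _), hz.pair]
  · rw [FreeData.freeEdge, he _ (append_mem_edges (V.at_mem _) _), freqOf_append_false]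
    exact hzx i

theorem eq_freq_of_kirchhoff {d : ℕ} {ξ : List Bool → Space d} {η : G.Pairs → Space d}
    (h : G.Kirchhoff ξ η) {e : List Bool} (he : e ∈ G.edges) :
    ξ e = V.freeData.freq (fun i => ξ (V.freeData.freeEdge V i)) η e := by
  have := V.eq_freq (isFlow_of_law h.1 h.2.1 h.2.2) he
  simpa only [(mem_edges.1 he).1, FreeData.freeEdge, if_false, List.append_eq_nil_iff,
    List.cons_ne_nil, and_false] using this

/-- If the left root edge were a bridge of the whole graph, the cut would contain all of the left
subtree and nothing of the right one, and a pair with a leaf in each would be separated. So the root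
index is free, and it is the largest index of all. -/
theorem freeIndex_last_of_linked (hG : G.Linked) : V.freeIndex (Fin.last n) = Fin.last (2 * n) := by
  have hmem : Fin.last (2 * n) ∈ V.freeSet := by
    rw [V.isGreedy_freeSet]
    rintro ⟨C, hC⟩
    rw [V.at_last] at hC
    -- No index exceeds that of the root, hence no other edge is exempt from closedness.
    have hcl : ∀ w ∈ G.tree.inner, ∀ c, w ++ [c] ≠ [false] → (w ++ [c] ∈ C ↔ w ∈ C) := by
      intro w hw c hwc
      refine hC.closed w hw c (by simpa using hwc) ?_
      rintro ⟨j, _, hj, _⟩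
      have := j.2
      simp only [Fin.val_last] at hj
      omega
    have hleft : ∀ v, (false :: v ∈ G.tree.inner ∨ false :: v ∈ G.tree.leaves) → false :: v ∈ C := by
      intro v
      induction v using List.reverseRecOn with
      | nil => exact fun _ => hC.mem
      | append_singleton v b ih =>
        intro h
        have hv : false :: v ∈ G.tree.inner := STree.mem_inner_of_append h
        exact (hcl _ hv b (by simp)).2 (ih (Or.inl hv))
    have hright : ∀ v, (true :: v ∈ G.tree.inner ∨ true :: v ∈ G.tree.leaves) → true :: v ∉ C := by
      intro v
      induction v using List.reverseRecOn with
      | nil => exact fun _ => fun h => hC.notMem ((hcl [] G.nil_mem_inner true (by simp)).1 h)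
      | append_singleton v b ih =>
        intro h h'
        have hv : true :: v ∈ G.tree.inner := STree.mem_inner_of_append h
        exact ih (Or.inl hv) ((hcl _ hv b (by simp)).1 h')
    obtain ⟨i, hi, hpi⟩ := hG
    have hlen : (G.left.1.flip.leaves.map (List.cons false)).length = n + 1 := by
      rw [List.length_map, STree.length_leaves, STree.depth_flip, G.left.2.1]
    have hget : ∀ j, G.initial j = (G.left.1.flip.leaves.map (List.cons false) ++
        G.right.1.leaves.map (List.cons true))[(j : ℕ)]'(by
          have := length_leaves_mergedTree G.left G.right
          simp only [mergedTree, STree.leaves] at this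
          omega) := fun j => rfl
    have h1 : G.initial i ∈ C := by
      have h := G.initial_mem i
      rw [hget, List.getElem_append_left (by omega), List.getElem_map] at h ⊢
      exact hleft _ (Or.inr h)
    have h2 : G.initial (G.pair i) ∉ C := by
      have h := G.initial_mem (G.pair i)
      rw [hget, List.getElem_append_right (by omega), List.getElem_map] at h ⊢
      exact hright _ (Or.inr h)
    exact h2 ((hC.pairClosed i).1 h1)
  obtain ⟨i, hi⟩ := V.exists_freeIndex hmem
  refine le_antisymm (Fin.le_last _) ?_
  rw [← hi]
  exact V.freeIndex.monotone (Fin.le_last i)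

theorem freeIndex_castSucc_ne_last (i : Fin n) : V.freeIndex i.castSucc ≠ Fin.last (2 * n) :=
  ((V.freeIndex.strictMono (Fin.castSucc_lt_last i)).trans_le (Fin.le_last _)).ne

theorem degreeOne_subset : V.freeData.degreeOne V ⊆ G.interaction := by
  intro v hv
  simp only [FreeData.degreeOne, Finset.mem_image, Finset.mem_univ, true_and] at hv
  obtain ⟨i, rfl⟩ := hv
  exact V.at_mem_interaction.2 (V.freeIndex_castSucc_ne_last i)

theorem card_degreeOne : (V.freeData.degreeOne V).card = n := by
  rw [FreeData.degreeOne, Finset.card_image_of_injective, Finset.card_univ, Fintype.card_fin]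
  intro i j h
  exact Fin.castSucc_injective _ (V.freeIndex.injective (V.at_injective h))

theorem card_degreeZero : (V.freeData.degreeZero V).card = n := by
  rw [FreeData.degreeZero, Finset.card_sdiff_of_subset V.degreeOne_subset, card_interaction,
    card_degreeOne]
  omega

end IntegrationOrder

theorem sgn_mul_self (v : List Bool) : G.sgn v * G.sgn v = 1 := by
  rcases Int.units_eq_one_or (G.tree.parity v) with h | h <;> simp [sgn, h]

theorem sgn_initial_pair (i : Fin (2 * n + 2)) :
    G.sgn (G.initial (G.pair i)) = - G.sgn (G.initial i) := by
  have : G.tree.parity (G.initial (G.pair i)) = -G.tree.parity (G.initial i) := G.consistent i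
  rw [sgn, sgn, this]
  simp

/-- The parities of a pair being opposite, the velocity argument of the Wigner transform is a signed
difference, complementary to the sum recorded by the slow variable. -/
theorem pairFreq_eq {d : ℕ} (ξ : List Bool → Space d) (p : G.Pairs) :
    G.pairFreq ξ p =
      G.sgn (G.initial p.1) • (ξ (G.initial p.1) - ξ (G.initial (G.pair p.1))) := by
  rw [pairFreq, sgn_initial_pair, smul_sub, neg_smul, sub_eq_add_neg]

/-- Leaf frequencies extend upwards in any case; the condition on their sum is what makes the value
at the root zero. -/
theorem exists_isFlow_of_leaves {M : Type*} [AddCommGroup M] (x : Fin (2 * n + 2) → M)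
    (hx : ∑ i, x i = 0) :
    ∃ ξ : List Bool → M, G.IsFlow ξ (fun p => x p.1 + x (G.pair p.1)) ∧
      ∀ i, ξ (G.initial i) = x i := by
  classical
  obtain ⟨ξ, h1, h2⟩ := G.tree.exists_law
    (fun v => if h : ∃ i, G.initial i = v then x h.choose else 0)
  have h3 : ∀ i, ξ (G.initial i) = x i := by
    intro i
    have h : ∃ j, G.initial j = G.initial i := ⟨i, rfl⟩
    rw [h2 _ (G.initial_mem i), dif_pos h, G.initial_injective h.choose_spec]
  refine ⟨ξ, ⟨?_, h1, fun p => by rw [h3, h3]⟩, h3⟩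
  have := G.tree.sum_children ξ
  rw [Finset.sum_congr rfl fun v hv => (h1 v hv).symm, sum_map_leaves] at this
  simpa [h3, hx] using this

namespace IntegrationOrder

variable (V : G.IntegrationOrder)

/-- The sum and the difference of the two leaf frequencies of a pair determine both of them, the
leaves determine all frequencies, and the latter correspond to the free and slow variables. -/
theorem bijOn_pairFreq (d : ℕ) : Set.BijOn
    (fun q : (Fin (n + 1) → Space d) × (G.Pairs → Space d) =>
      ((fun p => G.pairFreq (V.freeData.freq q.1 q.2) p, q.2) :
        (G.Pairs → Space d) × (G.Pairs → Space d)))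
    {q | ∑ p, q.2 p = 0} {q | ∑ p, q.2 p = 0} := by
  refine ⟨fun q hq => hq, ?_, ?_⟩
  · rintro ⟨x, η⟩ hη ⟨x', η'⟩ hη' heq
    simp only [Prod.mk.injEq] at heq
    obtain ⟨hf, rfl⟩ := heq
    obtain ⟨z, hz, hzx, he⟩ := V.isFlow_freq x hη
    obtain ⟨z', hz', hzx', he'⟩ := V.isFlow_freq x' hη
    have hpair : ∀ p : G.Pairs, freqOf 0 z (G.initial p.1) = freqOf 0 z' (G.initial p.1) ∧
        freqOf 0 z (G.initial (G.pair p.1)) = freqOf 0 z' (G.initial (G.pair p.1)) := by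
      intro p
      have h1 := congrFun hf p
      simp only [pairFreq_eq, he _ (initial_mem_edges _), he' _ (initial_mem_edges _)] at h1
      have h2 := congrArg (fun v => G.sgn (G.initial p.1) • v) h1
      simp only [smul_smul, sgn_mul_self, one_smul] at h2
      have h3 := (hz.pair p).trans (hz'.pair p).symm
      have h4 : (2 : ℝ) • freqOf 0 z (G.initial p.1) = (2 : ℝ) • freqOf 0 z' (G.initial p.1) := by
        calc (2 : ℝ) • freqOf 0 z (G.initial p.1)
            = (freqOf 0 z (G.initial p.1) - freqOf 0 z (G.initial (G.pair p.1))) +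
              (freqOf 0 z (G.initial p.1) + freqOf 0 z (G.initial (G.pair p.1))) := by
              rw [two_smul]; abel
          _ = _ := by rw [h2, h3, two_smul]; abel
      have h5 := smul_right_injective _ (two_ne_zero' ℝ) h4
      exact ⟨h5, by rw [h5] at h3; exact add_left_cancel h3⟩
    have hleaf : ∀ i, freqOf 0 z (G.initial i) = freqOf 0 z' (G.initial i) := by
      intro i
      by_cases hi : i < G.pair i
      · exact (hpair ⟨i, hi⟩).1
      · have := (hpair ⟨G.pair i, by
          rw [G.pair_pair]; exact lt_of_le_of_ne (not_lt.1 hi) (G.pair_ne i)⟩).2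
        simpa only [G.pair_pair] using this
    have hall : ∀ v ∈ G.tree.inner, freqOf 0 z v - freqOf 0 z' v = 0 := by
      refine STree.eq_zero_of_law (fun v hv => ?_) fun v hv => ?_
      · rw [hz.add v hv, hz'.add v hv]; abel
      · obtain ⟨i, rfl⟩ := G.exists_initial hv
        rw [hleaf, sub_self]
    have hedge : ∀ e ∈ G.edges, freqOf 0 z e = freqOf 0 z' e := by
      intro e h
      rcases (mem_edges.1 h).2 with h | h
      · exact sub_eq_zero.1 (hall e h)
      · obtain ⟨i, rfl⟩ := G.exists_initial h
        exact hleaf i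
    congr 1
    funext i
    rw [← hzx i, ← hzx' i]
    simpa using hedge _ (append_mem_edges (V.at_mem (V.freeIndex i)) false)
  · rintro ⟨a, η⟩ hη
    -- The leaf values solve `ξᵢ + ξⱼ = η` and `σᵢ (ξᵢ - ξⱼ) = a` for each pair, which explains the
    -- factor `1/2`.
    obtain ⟨ξ, hξ, hξi⟩ := G.exists_isFlow_of_leaves
      (fun i => (1 / 2 : ℝ) • (η (G.pairOf i) + G.sgn (G.initial i) • a (G.pairOf i))) (by
        rw [sum_pairs, ← (show ∑ p, η p = 0 from hη)]
        refine Finset.sum_congr rfl fun p _ => ?_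
        rw [pairOf_pair, pairOf_coe, sgn_initial_pair]
        module)
    have hη' : (fun p : G.Pairs =>
        (1 / 2 : ℝ) • (η (G.pairOf p.1) + G.sgn (G.initial p.1) • a (G.pairOf p.1)) +
        (1 / 2 : ℝ) • (η (G.pairOf (G.pair p.1)) +
          G.sgn (G.initial (G.pair p.1)) • a (G.pairOf (G.pair p.1)))) = η := by
      funext p
      rw [pairOf_pair, pairOf_coe, sgn_initial_pair]
      module
    rw [hη'] at hξ
    refine ⟨(fun i => ξ (V.freeData.freeEdge V i), η), hη, ?_⟩
    simp only [Prod.mk.injEq, and_true]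
    funext p
    rw [pairFreq_eq, ← V.eq_freq hξ (initial_mem_edges _), ← V.eq_freq hξ (initial_mem_edges _),
      hξi, hξi, pairOf_pair, pairOf_coe, sgn_initial_pair]
    have := sgn_mul_self (G := G) (G.initial p.1)
    rw [← smul_sub, neg_smul, add_sub_add_left_eq_sub, sub_neg_eq_add, ← two_smul ℝ, smul_smul,
      smul_smul, smul_smul]
    rw [show G.sgn (G.initial p.1) * (1 / 2) * 2 * G.sgn (G.initial p.1) = 1 by linarith, one_smul]

end IntegrationOrder

end PairedGraph

end WaveKinetic

/-! ### Resonance moduli in terms of the free variables -/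

namespace WaveKinetic

namespace PairedGraph

variable {n : ℕ} {G : PairedGraph n}

theorem mem_pPlus_self {v : List Bool} (hv : v ∈ G.interaction) : v ∈ G.pPlus v := by
  simp only [pPlus, Finset.mem_filter]
  exact ⟨hv, 0, by simp⟩

theorem isPrefix_of_mem_pPlus {v w : List Bool} (h : w ∈ G.pPlus v) : w <+: v := by
  simp only [pPlus, Finset.mem_filter] at h
  obtain ⟨_, k, hk⟩ := h
  exact ⟨_, hk.symm⟩

theorem isLinear_xor_isQuadratic (v : List Bool) : Xor' (G.IsLinear v) (G.IsQuadratic v) := by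
  unfold IsLinear IsQuadratic
  rcases Int.units_eq_one_or (G.tree.parity (v ++ [false]) * G.tree.parity (v ++ [true]))
    with h | h
  · rw [h]; exact Or.inr ⟨rfl, by decide⟩
  · rw [h]; exact Or.inl ⟨rfl, by decide⟩

theorem IsLinear.sgn_eq {v : List Bool} (h : G.IsLinear v) :
    G.sgn (v ++ [true]) = -G.sgn (v ++ [false]) := by
  unfold IsLinear at h
  rcases Int.units_eq_one_or (G.tree.parity (v ++ [false])) with h1 | h1 <;>
    rcases Int.units_eq_one_or (G.tree.parity (v ++ [true])) with h2 | h2 <;>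
    rw [h1, h2] at h <;> simp [sgn, h1, h2] <;> exact absurd h (by decide)

theorem IsQuadratic.sgn_eq {v : List Bool} (h : G.IsQuadratic v) :
    G.sgn (v ++ [true]) = G.sgn (v ++ [false]) := by
  unfold IsQuadratic at h
  rcases Int.units_eq_one_or (G.tree.parity (v ++ [false])) with h1 | h1 <;>
    rcases Int.units_eq_one_or (G.tree.parity (v ++ [true])) with h2 | h2 <;>
    rw [h1, h2] at h <;> simp [sgn, h1, h2] <;> exact absurd h (by decide)

theorem disp_sub {d : ℕ} (ω₀ : ℝ) (x y : Space d) :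
    disp ω₀ (x - y) = ω₀ + (‖x‖ ^ 2 - 2 * inner ℝ x y + ‖y‖ ^ 2) / 2 := by
  rw [disp, norm_sub_sq_real]

/-- After elimination of the right frequency, the squares of the left one come with opposite signs
and cancel, and so do two of the three constants `ω₀`. Only an inner product, linear in the left
frequency, is left. -/
theorem IsLinear.resonance_eq {d : ℕ} (ω₀ : ℝ) {ξ : List Bool → Space d} {v : List Bool}
    (h : G.IsLinear v) (hξ : ξ v = ξ (v ++ [false]) + ξ (v ++ [true])) :
    G.resonance ω₀ ξ v = -G.sgn (v ++ [false]) * inner ℝ (ξ v) (ξ (v ++ [false])) +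
      (G.sgn v * ω₀ + (1 / 2) * (G.sgn v + G.sgn (v ++ [false])) * ‖ξ v‖ ^ 2) := by
  rw [resonance, h.sgn_eq, show ξ (v ++ [true]) = ξ v - ξ (v ++ [false]) by rw [hξ]; abel,
    disp_sub, disp, disp]
  ring

/-- After elimination of the right frequency, the squares of the left one now add up instead of
cancelling. -/
theorem IsQuadratic.resonance_eq {d : ℕ} (ω₀ : ℝ) {ξ : List Bool → Space d} {v : List Bool}
    (h : G.IsQuadratic v) (hξ : ξ v = ξ (v ++ [false]) + ξ (v ++ [true])) :
    G.resonance ω₀ ξ v = -G.sgn (v ++ [false]) *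
        inner ℝ (ξ (v ++ [false])) (ξ (v ++ [false]) - ξ v) +
      ((G.sgn v - 2 * G.sgn (v ++ [false])) * ω₀ +
        (1 / 2) * (G.sgn v - G.sgn (v ++ [false])) * ‖ξ v‖ ^ 2) := by
  rw [resonance, h.sgn_eq, show ξ (v ++ [true]) = ξ v - ξ (v ++ [false]) by rw [hξ]; abel,
    disp_sub, disp, disp, inner_sub_right, real_inner_self_eq_norm_sq,
    real_inner_comm (ξ v) (ξ (v ++ [false]))]
  ring

namespace FreeData

variable (D : G.FreeData) (d : ℕ)

/-- A coordinate of a frequency as a polynomial in the coordinates of the free and slow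
variables. -/
def coordPoly (e : List Bool) (a : Fin d) :
    MvPolynomial ((Fin (n + 1) ⊕ G.Pairs) × Fin d) ℝ :=
  ∑ j, MvPolynomial.C (D.coefFree e j : ℝ) * MvPolynomial.X (Sum.inl j, a) +
    ∑ p, MvPolynomial.C (D.coefSlow e p : ℝ) * MvPolynomial.X (Sum.inr p, a)

theorem eval_coordPoly (e : List Bool) (a : Fin d) (ξf : Fin (n + 1) → Space d)
    (η : G.Pairs → Space d) :
    MvPolynomial.eval (fun x => Sum.elim ξf η x.1 x.2) (D.coordPoly d e a) = D.freq ξf η e a := by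
  simp [coordPoly, freq]

theorem totalDegree_coordPoly (e : List Bool) (a : Fin d) :
    (D.coordPoly d e a).totalDegree ≤ 1 := by
  have h : ∀ (c : ℝ) (x : (Fin (n + 1) ⊕ G.Pairs) × Fin d),
      (MvPolynomial.C c * MvPolynomial.X x : MvPolynomial _ ℝ).totalDegree ≤ 1 := by
    intro c x
    refine (MvPolynomial.totalDegree_mul _ _).trans ?_
    rw [MvPolynomial.totalDegree_C, MvPolynomial.totalDegree_X]
  refine (MvPolynomial.totalDegree_add _ _).trans (max_le ?_ ?_)
  · exact (MvPolynomial.totalDegree_finsetSum_le fun j _ => h _ _)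
  · exact (MvPolynomial.totalDegree_finsetSum_le fun j _ => h _ _)

/-- The dispersion relation of a frequency as a polynomial. -/
def dispPoly (ω₀ : ℝ) (e : List Bool) : MvPolynomial ((Fin (n + 1) ⊕ G.Pairs) × Fin d) ℝ :=
  MvPolynomial.C ω₀ + MvPolynomial.C (1 / 2) * ∑ a, D.coordPoly d e a ^ 2

theorem eval_dispPoly (ω₀ : ℝ) (e : List Bool) (ξf : Fin (n + 1) → Space d)
    (η : G.Pairs → Space d) :
    MvPolynomial.eval (fun x => Sum.elim ξf η x.1 x.2) (D.dispPoly d ω₀ e) =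
      disp ω₀ (D.freq ξf η e) := by
  simp only [dispPoly, map_add, map_mul, map_sum, map_pow, eval_coordPoly, MvPolynomial.eval_C,
    disp, EuclideanSpace.norm_sq_eq, Real.norm_eq_abs, sq_abs]
  ring

theorem totalDegree_dispPoly (ω₀ : ℝ) (e : List Bool) : (D.dispPoly d ω₀ e).totalDegree ≤ 2 := by
  refine (MvPolynomial.totalDegree_add _ _).trans (max_le (by simp) ?_)
  refine (MvPolynomial.totalDegree_mul _ _).trans ?_
  rw [MvPolynomial.totalDegree_C, zero_add]
  refine MvPolynomial.totalDegree_finsetSum_le fun a _ => ?_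
  refine (MvPolynomial.totalDegree_pow _ _).trans ?_
  have := D.totalDegree_coordPoly d e a
  omega

/-- That a polynomial involves no early free variable is expressed by membership in a subalgebra,
which is stable under all the operations needed. -/
theorem dispPoly_mem_supported (ω₀ : ℝ) (e : List Bool) (k : Fin (2 * n + 1))
    (h : ∀ j, D.coefFree e j ≠ 0 → k ≤ D.k j) :
    D.dispPoly d ω₀ e ∈ MvPolynomial.supported ℝ
      {x : (Fin (n + 1) ⊕ G.Pairs) × Fin d | ∀ j, x.1 = Sum.inl j → k ≤ D.k j} := by
  have hc : ∀ c : ℝ, (MvPolynomial.C c : MvPolynomial _ ℝ) ∈ MvPolynomial.supported ℝ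
      {x : (Fin (n + 1) ⊕ G.Pairs) × Fin d | ∀ j, x.1 = Sum.inl j → k ≤ D.k j} :=
    fun c => Subalgebra.algebraMap_mem _ c
  refine add_mem (hc _) (mul_mem (hc _) (sum_mem fun a _ => pow_mem (add_mem ?_ ?_) 2))
  · refine sum_mem fun j _ => ?_
    by_cases hj : D.coefFree e j = 0
    · simp [hj]
    · refine mul_mem (hc _) (Algebra.subset_adjoin ⟨_, ?_, rfl⟩)
      rintro j' hj'
      rw [← Sum.inl.inj hj']
      exact h j hj
  · refine sum_mem fun p _ => mul_mem (hc _) (Algebra.subset_adjoin ⟨_, ?_, rfl⟩)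
    rintro j' hj'
    simp at hj'

theorem exists_resonance_poly (ω₀ : ℝ) (v : List Bool) (k : Fin (2 * n + 1))
    (h : ∀ j, D.coefFree v j ≠ 0 → k ≤ D.k j)
    (hl : ∀ j, D.coefFree (v ++ [false]) j ≠ 0 → k ≤ D.k j)
    (hr : ∀ j, D.coefFree (v ++ [true]) j ≠ 0 → k ≤ D.k j) :
    ∃ Q : MvPolynomial ((Fin (n + 1) ⊕ G.Pairs) × Fin d) ℝ,
      Q.totalDegree ≤ 2 ∧ (∀ x ∈ Q.vars, ∀ j, x.1 = Sum.inl j → k ≤ D.k j) ∧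
      ∀ (ξf : Fin (n + 1) → Space d) (η : G.Pairs → Space d),
        G.resonance ω₀ (D.freq ξf η) v = MvPolynomial.eval (fun x => Sum.elim ξf η x.1 x.2) Q := by
  refine ⟨MvPolynomial.C (G.sgn v) * D.dispPoly d ω₀ v -
    MvPolynomial.C (G.sgn (v ++ [false])) * D.dispPoly d ω₀ (v ++ [false]) -
    MvPolynomial.C (G.sgn (v ++ [true])) * D.dispPoly d ω₀ (v ++ [true]), ?_, ?_, ?_⟩
  · have hd : ∀ (c : ℝ) e, (MvPolynomial.C c * D.dispPoly d ω₀ e).totalDegree ≤ 2 := by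
      intro c e
      refine (MvPolynomial.totalDegree_mul _ _).trans ?_
      rw [MvPolynomial.totalDegree_C, zero_add]
      exact D.totalDegree_dispPoly d ω₀ e
    exact (MvPolynomial.totalDegree_sub _ _).trans (max_le
      ((MvPolynomial.totalDegree_sub _ _).trans (max_le (hd _ _) (hd _ _))) (hd _ _))
  · have hc : ∀ c : ℝ, (MvPolynomial.C c : MvPolynomial _ ℝ) ∈ MvPolynomial.supported ℝ
        {x : (Fin (n + 1) ⊕ G.Pairs) × Fin d | ∀ j, x.1 = Sum.inl j → k ≤ D.k j} :=
      fun c => Subalgebra.algebraMap_mem _ c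
    exact MvPolynomial.mem_supported.1 (sub_mem (sub_mem
      (mul_mem (hc _) (D.dispPoly_mem_supported d ω₀ _ k h))
      (mul_mem (hc _) (D.dispPoly_mem_supported d ω₀ _ k hl)))
      (mul_mem (hc _) (D.dispPoly_mem_supported d ω₀ _ k hr)))
  · intro ξf η
    simp only [map_sub, map_mul, eval_dispPoly, MvPolynomial.eval_C, resonance]

end FreeData

namespace IntegrationOrder

theorem freq_add (V : G.IntegrationOrder) {d : ℕ} (x : Fin (n + 1) → Space d)
    {y : G.Pairs → Space d} (hy : ∑ p, y p = 0) {v : List Bool} (hv : v ∈ G.interaction) :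
    V.freeData.freq x y v =
      V.freeData.freq x y (v ++ [false]) + V.freeData.freq x y (v ++ [true]) :=
  (V.kirchhoff_freq x hy).1.1 v hv

/-- The combinatorial and algebraic properties of the free variables. -/
theorem freeData_properties (V : G.IntegrationOrder) :
    StrictMono V.freeData.k ∧
    V.freeData.degreeOne V ⊆ G.interaction ∧
    (V.freeData.degreeOne V).card = n ∧
    (V.freeData.degreeZero V).card = n ∧
    (∀ v ∈ V.freeData.degreeOne V, Xor' (G.IsLinear v) (G.IsQuadratic v)) ∧
    (G.Linked → V.freeData.freeEdge V (Fin.last n) = [false]) ∧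
    (∀ v ∈ G.interaction, v ∈ G.pPlus v) ∧
    (∀ k k' : Fin (2 * n + 1), k < k' → V.at k' ∈ G.interaction →
      V.at k ∉ G.pPlus (V.at k')) ∧
    (∀ e ∈ G.edges, (∀ j, V.freeData.coefFree e j ∈ ({-1, 0, 1} : Set ℤ)) ∧
      ∀ p, V.freeData.coefSlow e p ∈ ({-1, 0, 1} : Set ℤ)) ∧
    (∀ k, V.at k ∈ G.interaction →
      ∀ j, V.freeData.coefFree (V.at k) j ≠ 0 → k < V.freeData.k j) ∧
    ∀ d : ℕ,
      (∀ (ξf : Fin (n + 1) → Space d) (η : G.Pairs → Space d), ∑ p, η p = 0 →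
        G.Kirchhoff (V.freeData.freq ξf η) η ∧
        ∀ i, V.freeData.freq ξf η (V.freeData.freeEdge V i) = ξf i) ∧
      (∀ (ξ : List Bool → Space d) (η : G.Pairs → Space d), G.Kirchhoff ξ η →
        ∀ e ∈ G.edges, ξ e = V.freeData.freq (fun i => ξ (V.freeData.freeEdge V i)) η e) ∧
      Set.BijOn
        (fun q : (Fin (n + 1) → Space d) × (G.Pairs → Space d) =>
          ((fun p => G.pairFreq (V.freeData.freq q.1 q.2) p, q.2) :
            (G.Pairs → Space d) × (G.Pairs → Space d)))
        {q | ∑ p, q.2 p = 0} {q | ∑ p, q.2 p = 0} ∧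
      ∀ ω₀ : ℝ,
        (∀ (i : Fin (n + 1)) (v : List Bool), v = V.at (V.freeData.k i) → v ∈ G.interaction →
          ∀ (ξf : Fin (n + 1) → Space d) (η : G.Pairs → Space d), ∑ p, η p = 0 →
          ∀ (ξt : Space d) (σ σt : ℝ), ξt = V.freeData.freq ξf η v →
            σ = G.sgn (v ++ [false]) → σt = G.sgn v →
            (G.IsLinear v → G.resonance ω₀ (V.freeData.freq ξf η) v =
              -σ * inner ℝ ξt (ξf i) + (σt * ω₀ + (1 / 2) * (σt + σ) * ‖ξt‖ ^ 2)) ∧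
            (G.IsQuadratic v → G.resonance ω₀ (V.freeData.freq ξf η) v =
              -σ * inner ℝ (ξf i) (ξf i - ξt) +
                ((σt - 2 * σ) * ω₀ + (1 / 2) * (σt - σ) * ‖ξt‖ ^ 2))) ∧
        (∀ k, V.at k ∈ V.freeData.degreeZero V →
          ∃ Q : MvPolynomial ((Fin (n + 1) ⊕ G.Pairs) × Fin d) ℝ,
            Q.totalDegree ≤ 2 ∧
            (∀ x ∈ Q.vars, ∀ j, x.1 = Sum.inl j → k ≤ V.freeData.k j) ∧
            ∀ (ξf : Fin (n + 1) → Space d) (η : G.Pairs → Space d), ∑ p, η p = 0 →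
              G.resonance ω₀ (V.freeData.freq ξf η) (V.at k) =
                MvPolynomial.eval (fun x => Sum.elim ξf η x.1 x.2) Q) := by
  refine ⟨V.freeIndex.strictMono, V.degreeOne_subset, V.card_degreeOne, V.card_degreeZero,
    fun v _ => isLinear_xor_isQuadratic v, fun h => ?_, fun v hv => mem_pPlus_self hv,
    fun k k' hk _ h => V.not_isPrefix hk (isPrefix_of_mem_pPlus h),
    fun e _ => ⟨V.coefFree_mem e, V.coefSlow_mem e⟩,
    fun k hk j hj => V.lt_freeIndex_of_coefFree hk hj, fun d => ⟨fun x y hy =>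
      V.kirchhoff_freq x hy, fun ξ η h e he => V.eq_freq_of_kirchhoff h he, V.bijOn_pairFreq d,
      fun ω₀ => ⟨?_, ?_⟩⟩⟩
  · rw [FreeData.freeEdge]
    exact (congrArg (fun k => V.at k ++ [false]) (V.freeIndex_last_of_linked h)).trans
      (by rw [V.at_last]; rfl)
  · rintro i v rfl hv x y hy ξt σ σt rfl rfl rfl
    have hx := (V.kirchhoff_freq x hy).2 i
    rw [FreeData.freeEdge] at hx
    rw [← hx]
    exact ⟨fun h => h.resonance_eq ω₀ (V.freq_add x hy hv),
      fun h => h.resonance_eq ω₀ (V.freq_add x hy hv)⟩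
  · intro k hk
    have hk' := (Finset.mem_sdiff.1 hk).1
    obtain ⟨Q, h1, h2, h3⟩ := V.freeData.exists_resonance_poly d ω₀ (V.at k) k
      (fun j hj => (V.lt_freeIndex_of_coefFree hk' hj).le)
      (fun j hj => V.le_freeIndex_of_coefFree hj) (fun j hj => V.le_freeIndex_of_coefFree hj)
    exact ⟨Q, h1, h2, fun x y _ => h3 x y⟩

end IntegrationOrder

end PairedGraph

/-! ### Enumeration of the trees -/

namespace STree

instance : DecidableEq STree := Classical.decEq _

/-- The trees of a given depth, with arbitrary parities. -/
def ofDepth : ℕ → Finset STree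
  | 0 => {leaf 1, leaf (-1)}
  | n + 1 => Finset.univ.biUnion fun j : Fin (n + 1) =>
      (Finset.univ ×ˢ (ofDepth j ×ˢ ofDepth (n - j))).image fun q : ℤˣ × STree × STree =>
        node q.1 q.2.1 q.2.2
  termination_by n => n
  decreasing_by all_goals omega

theorem mem_ofDepth {n : ℕ} {T : STree} : T ∈ ofDepth n ↔ T.depth = n := by
  induction n using Nat.strong_induction_on generalizing T with
  | _ n ih =>
  rcases n with _ | n
  · rw [ofDepth]
    cases T with
    | leaf σ => rcases Int.units_eq_one_or σ with rfl | rfl <;> simp [depth]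
    | node σ l r => simp [depth]
  · rw [ofDepth]
    simp only [Finset.mem_biUnion, Finset.mem_univ, true_and, Finset.mem_image, Finset.mem_product,
      Prod.exists]
    constructor
    · rintro ⟨j, σ, l, r, ⟨hl, hr⟩, rfl⟩
      rw [ih _ (by omega)] at hl hr
      rw [depth, hl, hr]
      omega
    · intro h
      cases T with
      | leaf σ => simp [depth] at h
      | node σ l r =>
        rw [depth] at h
        refine ⟨⟨l.depth, by omega⟩, σ, l, r, ⟨?_, ?_⟩, rfl⟩
        · exact (ih _ (by omega)).2 rfl
        · rw [ih _ (by omega)]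
          simp only
          omega

/-- Sums over trees by the depths of the two subtrees. -/
theorem sum_ofDepth_succ {M : Type*} [AddCommMonoid M] (n : ℕ) (f : STree → M) :
    ∑ T ∈ ofDepth (n + 1), f T = ∑ j : Fin (n + 1), ∑ σ : ℤˣ, ∑ l ∈ ofDepth j,
      ∑ r ∈ ofDepth (n - j), f (node σ l r) := by
  rw [ofDepth, Finset.sum_biUnion]
  · refine Finset.sum_congr rfl fun j _ => ?_
    rw [Finset.sum_image, Finset.sum_product]
    · refine Finset.sum_congr rfl fun σ _ => ?_
      rw [Finset.sum_product]
    · rintro ⟨_, _, _⟩ _ ⟨_, _, _⟩ _ h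
      simp only [node.injEq] at h
      obtain ⟨rfl, rfl, rfl⟩ := h
      rfl
  · intro i _ j _ hij
    rw [Function.onFun, Finset.disjoint_left]
    intro T hT hT'
    simp only [Finset.mem_image, Finset.mem_product, Prod.exists] at hT hT'
    obtain ⟨σ, l, r, ⟨_, hl, _⟩, rfl⟩ := hT
    obtain ⟨σ', l', r', ⟨_, hl', _⟩, h⟩ := hT'
    simp only [node.injEq] at h
    obtain ⟨_, rfl, _⟩ := h
    rw [mem_ofDepth] at hl hl'
    exact hij (Fin.ext (hl.symm.trans hl'))

theorem flip_flip (T : STree) : T.flip.flip = T := by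
  induction T with
  | leaf σ => simp [flip]
  | node σ l r hl hr => simp [flip, hl, hr]

end STree

instance (n : ℕ) : Fintype (InteractionGraph n) :=
  Fintype.subtype ((STree.ofDepth n).filter fun T => T.parity [] = 1) fun T => by
    rw [Finset.mem_filter, STree.mem_ofDepth]

theorem sum_interactionGraph {M : Type*} [AddCommMonoid M] (n : ℕ) (f : STree → M) :
    ∑ T : InteractionGraph n, f T.1 = ∑ T ∈ (STree.ofDepth n).filter fun T => T.parity [] = 1, f T := by
  refine (Finset.sum_subtype _ (fun T => ?_) f).symm
  rw [Finset.mem_filter, STree.mem_ofDepth]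

instance (n : ℕ) : Finite (PairedGraph n) := by
  refine Finite.of_injective (fun G : PairedGraph n => (G.left, G.right, G.pair)) ?_
  rintro ⟨_, _, _, _, _, _⟩ ⟨_, _, _, _, _, _⟩ h
  simp only [Prod.mk.injEq] at h
  obtain ⟨rfl, rfl, rfl⟩ := h
  rfl

end WaveKinetic

/-! ### The unitary Fourier transform: inversion, Plancherel, conjugation -/

namespace WaveKinetic

open scoped FourierTransform

/-- The normalization `(2π)^{-d/2}` of the Fourier transform. -/
def ftConst (d : ℕ) : ℝ := (2 * Real.pi) ^ (-(d : ℝ) / 2)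

theorem ftConst_pos (d : ℕ) : 0 < ftConst d := Real.rpow_pos_of_pos (by positivity) _

theorem ftConst_sq (d : ℕ) : ftConst d ^ 2 * (2 * Real.pi) ^ d = 1 := by
  rw [ftConst, ← Real.rpow_natCast (_ ^ _) 2, ← Real.rpow_mul (by positivity),
    ← Real.rpow_natCast _ d, ← Real.rpow_add (by positivity)]
  norm_num

theorem ft_def {d : ℕ} (f : Space d → ℂ) (ξ : Space d) : ft f ξ = (ftConst d : ℂ) *
    ∫ x, f x * Complex.exp (-Complex.I * ((inner ℝ x ξ : ℝ) : ℂ)) := rfl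

theorem ift_def {d : ℕ} (f : Space d → ℂ) (x : Space d) : ift f x = (ftConst d : ℂ) *
    ∫ ξ, f ξ * Complex.exp (Complex.I * ((inner ℝ x ξ : ℝ) : ℂ)) := rfl

/-- The transform `𝓕` has `2π` in its phase, so a dilation and the normalizing constant convert one
convention into the other. -/
theorem ft_eq_fourier {d : ℕ} (f : Space d → ℂ) (ξ : Space d) :
    ft f ξ = (ftConst d : ℂ) * 𝓕 f ((2 * Real.pi)⁻¹ • ξ) := by
  rw [ft_def, Real.fourier_eq']
  congr 1
  refine integral_congr_ae (Filter.Eventually.of_forall fun x => ?_)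
  simp only [inner_smul_right, smul_eq_mul]
  rw [mul_comm]
  congr 2
  push_cast
  field_simp

theorem ift_eq_fourierInv {d : ℕ} (f : Space d → ℂ) (x : Space d) :
    ift f x = (ftConst d : ℂ) * 𝓕⁻ f ((2 * Real.pi)⁻¹ • x) := by
  rw [ift_def, Real.fourierInv_eq']
  congr 1
  refine integral_congr_ae (Filter.Eventually.of_forall fun ξ => ?_)
  simp only [inner_smul_right, smul_eq_mul]
  rw [mul_comm, real_inner_comm]
  congr 2
  push_cast
  field_simp

/-- Inversion on Schwartz functions, transported by dilation. The two constants and the Jacobian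
`(2π)^d` multiply to one by `ftConst_sq`. -/
theorem ft_ift {d : ℕ} {f : Space d → ℂ} (hf : ContDiff ℝ (⊤ : ℕ∞) f)
    (hs : HasCompactSupport f) : ft (ift f) = f := by
  have hinv : 𝓕 (𝓕⁻ f) = f := by
    have : 𝓕 (𝓕⁻ (hs.toSchwartzMap hf)) = hs.toSchwartzMap hf :=
      FourierTransform.fourier_fourierInv_eq _
    have h2 := congrArg (fun g : SchwartzMap (Space d) ℂ => (g : Space d → ℂ)) this
    simp only [SchwartzMap.fourier_coe, SchwartzMap.fourierInv_coe] at h2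
    exact h2
  funext ξ
  have h1 : ∀ x, ift f x * Complex.exp (-Complex.I * ((inner ℝ x ξ : ℝ) : ℂ)) =
      (fun y => (ftConst d : ℂ) * 𝓕⁻ f y * Complex.exp (-Complex.I *
        ((2 * Real.pi * inner ℝ y ξ : ℝ) : ℂ))) ((2 * Real.pi)⁻¹ • x) := by
    intro x
    rw [ift_eq_fourierInv]
    simp only [real_inner_smul_left]
    rw [mul_inv_cancel_left₀ (by positivity)]
  rw [ft_def, integral_congr_ae (Filter.Eventually.of_forall h1),
    Measure.integral_comp_inv_smul_of_nonneg volume (fun y => (ftConst d : ℂ) * 𝓕⁻ f y *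
      Complex.exp (-Complex.I * ((2 * Real.pi * inner ℝ y ξ : ℝ) : ℂ)))
      (by positivity : (0 : ℝ) ≤ 2 * Real.pi),
    finrank_euclideanSpace_fin]
  have h2 : ∀ y, (ftConst d : ℂ) * 𝓕⁻ f y * Complex.exp (-Complex.I *
        ((2 * Real.pi * inner ℝ y ξ : ℝ) : ℂ)) = (ftConst d : ℂ) *
      (Complex.exp (((-2 * Real.pi * inner ℝ y ξ : ℝ) : ℂ) * Complex.I) • 𝓕⁻ f y) := by
    intro y
    rw [mul_assoc, smul_eq_mul, mul_comm (𝓕⁻ f y)]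
    congr 3
    push_cast
    ring
  rw [integral_congr_ae (Filter.Eventually.of_forall h2), integral_const_mul,
    ← Real.fourier_eq', hinv, Complex.real_smul, mul_left_comm, ← mul_assoc, ← mul_assoc]
  have := ftConst_sq d
  rw [show ((((2 * Real.pi) ^ d : ℝ) : ℂ) * (ftConst d : ℂ)) * (ftConst d : ℂ) =
    ((ftConst d ^ 2 * (2 * Real.pi) ^ d : ℝ) : ℂ) by push_cast; ring, this]
  simp

theorem integral_norm_sq_ift {d : ℕ} {f : Space d → ℂ} (hf : ContDiff ℝ (⊤ : ℕ∞) f)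
    (hs : HasCompactSupport f) : ∫ x, ‖ift f x‖ ^ 2 = ∫ ξ, ‖f ξ‖ ^ 2 := by
  have h1 : ∀ x, ‖ift f x‖ ^ 2 = (fun y => ftConst d ^ 2 * ‖𝓕⁻ f y‖ ^ 2)
      ((2 * Real.pi)⁻¹ • x) := by
    intro x
    rw [ift_eq_fourierInv, norm_mul, mul_pow, Complex.norm_real, Real.norm_eq_abs, sq_abs]
  rw [integral_congr_ae (Filter.Eventually.of_forall h1),
    Measure.integral_comp_inv_smul_of_nonneg volume (fun y => ftConst d ^ 2 * ‖𝓕⁻ f y‖ ^ 2)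
      (by positivity : (0 : ℝ) ≤ 2 * Real.pi),
    finrank_euclideanSpace_fin, integral_const_mul, smul_eq_mul, ← mul_assoc,
    mul_comm _ (ftConst d ^ 2), ftConst_sq, one_mul]
  have h2 := SchwartzMap.integral_norm_sq_fourier (𝓕⁻ (hs.toSchwartzMap hf))
  rw [FourierTransform.fourier_fourierInv_eq] at h2
  simp only [SchwartzMap.fourierInv_coe] at h2
  exact h2.symm

theorem integrable_norm_sq_ift {d : ℕ} {f : Space d → ℂ} (hf : ContDiff ℝ (⊤ : ℕ∞) f)
    (hs : HasCompactSupport f) : Integrable fun x => ‖ift f x‖ ^ 2 := by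
  have h : Integrable fun x => ‖𝓕⁻ f x‖ ^ 2 := by
    have := (𝓕⁻ (hs.toSchwartzMap hf)).memLp 2 (μ := volume)
    rw [SchwartzMap.fourierInv_coe] at this
    exact this.integrable_norm_pow (by norm_num)
  have h2 : (fun x => ‖ift f x‖ ^ 2) = fun x => ftConst d ^ 2 *
      ‖𝓕⁻ f ((2 * Real.pi)⁻¹ • x)‖ ^ 2 := by
    funext x
    rw [ift_eq_fourierInv, norm_mul, mul_pow, Complex.norm_real, Real.norm_eq_abs, sq_abs]
  rw [h2]
  exact (h.comp_smul (by positivity : (2 * Real.pi : ℝ)⁻¹ ≠ 0)).const_mul _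

theorem conj_ift {d : ℕ} (f : Space d → ℂ) (x : Space d) :
    starRingEnd ℂ (ift f x) = ift (fun ξ => starRingEnd ℂ (f (-ξ))) x := by
  rw [ift_def, ift_def, map_mul, Complex.conj_ofReal, ← integral_conj,
    ← integral_neg_eq_self]
  congr 1
  refine integral_congr_ae (Filter.Eventually.of_forall fun ξ => ?_)
  simp [← Complex.exp_conj]

/-! ### Smoothness of integrals that depend on a parameter -/

theorem hasFDerivAt_setIntegral {E X F : Type} [NormedAddCommGroup E] [NormedSpace ℝ E]
    [FiniteDimensional ℝ E] [NormedAddCommGroup X] [NormedSpace ℝ X] [FiniteDimensional ℝ X]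
    [MeasurableSpace X] [BorelSpace X] [NormedAddCommGroup F] [NormedSpace ℝ F]
    (μ : Measure X) [IsFiniteMeasureOnCompacts μ] {K : Set X} (hK : IsCompact K)
    {H : E × X → F} (hH : ContDiff ℝ 1 H) (e : E) :
    HasFDerivAt (fun e => ∫ x in K, H (e, x) ∂μ)
      (∫ x in K, (fderiv ℝ H (e, x)).comp (ContinuousLinearMap.inl ℝ E X) ∂μ) e := by
  have hfd : Continuous fun q : E × X => (fderiv ℝ H q).comp (ContinuousLinearMap.inl ℝ E X) := by
    have := hH.continuous_fderiv one_ne_zero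
    fun_prop
  obtain ⟨C, hC⟩ := ((isCompact_closedBall e 1).prod hK).exists_bound_of_continuousOn
    hfd.continuousOn
  refine hasFDerivAt_integral_of_dominated_of_fderiv_le (𝕜 := ℝ) (F := fun e x => H (e, x))
    (F' := fun e x => (fderiv ℝ H (e, x)).comp (ContinuousLinearMap.inl ℝ E X)) (s := Metric.closedBall e 1)
    (bound := fun _ => C) (Metric.closedBall_mem_nhds e one_pos) ?_ ?_ ?_ ?_ ?_ ?_
  · refine Filter.Eventually.of_forall fun e' => ?_
    exact (hH.continuous.comp (by fun_prop)).aestronglyMeasurable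
  · exact ((hH.continuous.comp (by fun_prop)).continuousOn.integrableOn_compact hK)
  · exact (hfd.comp (by fun_prop : Continuous fun x : X => (e, x))).aestronglyMeasurable
  · filter_upwards [ae_restrict_mem hK.measurableSet] with x hx e' he'
    exact hC (e', x) ⟨he', hx⟩
  · exact integrableOn_const hK.measure_lt_top.ne
  · refine Filter.Eventually.of_forall fun x e' _ => ?_
    have h1 : HasFDerivAt H (fderiv ℝ H (e', x)) (e', x) :=
      (hH.differentiable one_ne_zero _).hasFDerivAt
    exact h1.comp e' (hasFDerivAt_prodMk_left e' x)

/-- The derivative is again an integral of the same kind, with values in `E →L[ℝ] F`. The induction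
on the order therefore generalizes the target space, which is why all the types live in one
universe. -/
theorem contDiff_setIntegral {E X F : Type} [NormedAddCommGroup E] [NormedSpace ℝ E]
    [FiniteDimensional ℝ E] [NormedAddCommGroup X] [NormedSpace ℝ X] [FiniteDimensional ℝ X]
    [MeasurableSpace X] [BorelSpace X] [NormedAddCommGroup F] [NormedSpace ℝ F]
    (μ : Measure X) [IsFiniteMeasureOnCompacts μ] {K : Set X} (hK : IsCompact K)
    {H : E × X → F} (hH : ContDiff ℝ (⊤ : ℕ∞) H) :
    ContDiff ℝ (⊤ : ℕ∞) fun e => ∫ x in K, H (e, x) ∂μ := by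
  refine contDiff_infty.2 fun n => ?_
  induction n generalizing F with
  | zero =>
    exact contDiff_zero.2 (continuous_iff_continuousAt.2 fun e =>
      (hasFDerivAt_setIntegral μ hK (hH.of_le (by simp)) e).continuousAt)
  | succ n ih =>
    have h1 := fun e => hasFDerivAt_setIntegral μ hK (hH.of_le (by simp)) e
    push_cast
    rw [contDiff_succ_iff_fderiv]
    refine ⟨fun e => (h1 e).differentiableAt, by simp, ?_⟩
    rw [funext fun e => (h1 e).fderiv]
    exact ih (H := fun q => (fderiv ℝ H q).comp (ContinuousLinearMap.inl ℝ E X))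
      ((hH.fderiv_right (by simp)).clm_comp contDiff_const)

end WaveKinetic

namespace WaveKinetic

/-! ### The iterates on the Fourier side -/

/-- The Fourier transform of `f + f̄` in terms of that of `f`. -/
def symPart {d : ℕ} (U : Space d → ℂ) (ξ : Space d) : ℂ := U ξ + starRingEnd ℂ (U (-ξ))

/-- The nonlinearity on the Fourier side. -/
def prodFT {d : ℕ} (ε : ℝ) (m : Space d → ℝ) (U W : Space d → ℂ) (ξ : Space d) : ℂ :=
  ((ftConst d * m (ε • ξ) : ℝ) : ℂ) *
    ∫ ζ, ((m (ε • ζ) * m (ε • (ξ - ζ)) : ℝ) : ℂ) * (symPart U ζ * symPart W (ξ - ζ))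

/-- The Fourier transforms of the iterates, for initial data with Fourier transform `φ`. -/
def profile {d : ℕ} (ε lam ω₀ : ℝ) (m : Space d → ℝ) (φ : Space d → ℂ) :
    ℕ → ℝ → Space d → ℂ
  | 0 => fun t ξ => Complex.exp (Complex.I * ((t * disp ω₀ ξ : ℝ) : ℂ)) * φ ξ
  | n + 1 => fun t ξ => -Complex.I * (lam : ℂ) * ∫ s in (0 : ℝ)..t,
      Complex.exp (Complex.I * (((t - s) * disp ω₀ ξ : ℝ) : ℂ)) *
        ∑ j : Fin (n + 1), prodFT ε m (profile ε lam ω₀ m φ j s)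
          (profile ε lam ω₀ m φ (n - j) s) ξ
  termination_by n => n
  decreasing_by all_goals omega

/-- Functions of time and frequency that are smooth, and supported in a fixed ball. -/
structure IsProfile {d : ℕ} (F : ℝ → Space d → ℂ) : Prop where
  smooth : ContDiff ℝ (⊤ : ℕ∞) (Function.uncurry F)
  support : ∃ R : ℝ, ∀ t ξ, R < ‖ξ‖ → F t ξ = 0

namespace IsProfile

variable {d : ℕ} {F G : ℝ → Space d → ℂ}

theorem contDiff (hF : IsProfile F) (t : ℝ) : ContDiff ℝ (⊤ : ℕ∞) (F t) :=
  hF.smooth.comp (contDiff_const.prodMk contDiff_id)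

theorem hasCompactSupport (hF : IsProfile F) (t : ℝ) : HasCompactSupport (F t) := by
  obtain ⟨R, hR⟩ := hF.support
  refine HasCompactSupport.intro (isCompact_closedBall 0 R) fun ξ hξ => hR t ξ ?_
  simpa using hξ

theorem of_const {f : Space d → ℂ} (hf : ContDiff ℝ (⊤ : ℕ∞) f) (hs : HasCompactSupport f) :
    IsProfile fun _ => f := by
  refine ⟨hf.comp contDiff_snd, ?_⟩
  obtain ⟨R, hR⟩ := hs.isCompact.isBounded.subset_closedBall 0
  refine ⟨R, fun _ ξ hξ => ?_⟩
  by_contra h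
  have := hR (subset_tsupport f h)
  simp only [mem_closedBall_zero_iff] at this
  linarith

theorem mul_left (hF : IsProfile F) {q : ℝ → Space d → ℂ}
    (hq : ContDiff ℝ (⊤ : ℕ∞) (Function.uncurry q)) : IsProfile fun t ξ => q t ξ * F t ξ := by
  refine ⟨hq.mul hF.smooth, ?_⟩
  obtain ⟨R, hR⟩ := hF.support
  exact ⟨R, fun t ξ h => by rw [hR t ξ h, mul_zero]⟩

theorem sum {ι : Type*} {s : Finset ι} {F : ι → ℝ → Space d → ℂ}
    (hF : ∀ i ∈ s, IsProfile (F i)) : IsProfile fun t ξ => ∑ i ∈ s, F i t ξ := by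
  classical
  refine ⟨ContDiff.sum fun i hi => (hF i hi).smooth, ?_⟩
  choose! R hR using fun i hi => (hF i hi).support
  refine ⟨∑ i ∈ s, |R i|, fun t ξ h => Finset.sum_eq_zero fun i hi => hR i hi t ξ ?_⟩
  exact ((le_abs_self _).trans
    (Finset.single_le_sum (f := fun i => |R i|) (fun _ _ => abs_nonneg _) hi)).trans_lt h

theorem conj_neg (hF : IsProfile F) : IsProfile fun t ξ => starRingEnd ℂ (F t (-ξ)) := by
  refine ⟨?_, ?_⟩
  · exact Complex.conjCLE.contDiff.comp
      (hF.smooth.comp (contDiff_fst.prodMk contDiff_snd.neg))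
  · obtain ⟨R, hR⟩ := hF.support
    exact ⟨R, fun t ξ h => by rw [hR t (-ξ) (by simpa using h), map_zero]⟩

theorem symPart (hF : IsProfile F) : IsProfile fun t => symPart (F t) := by
  have := IsProfile.sum (s := Finset.univ)
    (F := fun b : Bool => if b then F else fun t ξ => starRingEnd ℂ (F t (-ξ))) (fun b _ => by
      cases b
      · exact hF.conj_neg
      · exact hF)
  have h : IsProfile fun t ξ => F t ξ + starRingEnd ℂ (F t (-ξ)) := by simpa using this
  exact h

/-- The first factor confines the integration to a ball that does not depend on the parameters, so
that `contDiff_setIntegral` applies. -/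
theorem convolution (hF : IsProfile F) (hG : IsProfile G) :
    IsProfile fun t ξ => ∫ ζ, F t ζ * G t (ξ - ζ) := by
  obtain ⟨R, hR⟩ := hF.support
  obtain ⟨S, hS⟩ := hG.support
  refine ⟨?_, R + S, fun t ξ h => ?_⟩
  · have h : Function.uncurry (fun t ξ => ∫ ζ, F t ζ * G t (ξ - ζ)) =
        fun e : ℝ × Space d => ∫ ζ in Metric.closedBall (0 : Space d) R,
          F e.1 ζ * G e.1 (e.2 - ζ) := by
      funext e
      refine (setIntegral_eq_integral_of_forall_compl_eq_zero fun ζ hζ => ?_).symm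
      rw [hR e.1 ζ (by simpa using hζ), zero_mul]
    rw [h]
    refine contDiff_setIntegral volume (isCompact_closedBall _ _)
      (H := fun q : (ℝ × Space d) × Space d => F q.1.1 q.2 * G q.1.1 (q.1.2 - q.2)) ?_
    refine ContDiff.mul ?_ ?_
    · exact hF.smooth.comp (by fun_prop : ContDiff ℝ (⊤ : ℕ∞)
        fun q : (ℝ × Space d) × Space d => (q.1.1, q.2))
    · exact hG.smooth.comp (by fun_prop : ContDiff ℝ (⊤ : ℕ∞)
        fun q : (ℝ × Space d) × Space d => (q.1.1, q.1.2 - q.2))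
  · have : ∀ ζ, F t ζ * G t (ξ - ζ) = 0 := by
      intro ζ
      by_cases hζ : R < ‖ζ‖
      · rw [hR t ζ hζ, zero_mul]
      · rw [hS t (ξ - ζ), mul_zero]
        have := norm_sub_norm_le ξ ζ
        linarith [not_lt.1 hζ]
    simp [this]

/-- The substitution `s = t r` moves the dependence on the endpoint into a smooth integrand over the
fixed interval `[0, 1]`, for either sign of `t`. -/
theorem timeIntegral (hF : IsProfile F) : IsProfile fun t ξ => ∫ s in (0 : ℝ)..t, F s ξ := by
  obtain ⟨R, hR⟩ := hF.support
  refine ⟨?_, R, fun t ξ h => by simp [hR _ ξ h]⟩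
  have h : Function.uncurry (fun t ξ => ∫ s in (0 : ℝ)..t, F s ξ) =
      fun e : ℝ × Space d => e.1 • ∫ r in Set.Icc (0 : ℝ) 1, F (e.1 * r) e.2 := by
    funext e
    rw [integral_Icc_eq_integral_Ioc, ← intervalIntegral.integral_of_le zero_le_one,
      intervalIntegral.smul_integral_comp_mul_left (fun s => F s e.2)]
    simp [Function.uncurry]
  rw [h]
  refine contDiff_fst.smul (contDiff_setIntegral volume isCompact_Icc
    (H := fun q : (ℝ × Space d) × ℝ => F (q.1.1 * q.2) q.1.2) ?_)
  exact hF.smooth.comp (by fun_prop : ContDiff ℝ (⊤ : ℕ∞)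
        fun q : (ℝ × Space d) × ℝ => (q.1.1 * q.2, q.1.2))

theorem mul_mult (hF : IsProfile F) {m : Space d → ℝ} (hm : ContDiff ℝ (⊤ : ℕ∞) m) (ε : ℝ) :
    IsProfile fun t ξ => (m (ε • ξ) : ℂ) * F t ξ := by
  refine hF.mul_left (q := fun _ ξ => (m (ε • ξ) : ℂ)) ?_
  exact Complex.ofRealCLM.contDiff.comp (hm.comp (contDiff_snd.const_smul ε))

theorem _root_.WaveKinetic.prodFT_eq (ε : ℝ) (m : Space d → ℝ) (U W : Space d → ℂ) :
    prodFT ε m U W = fun ξ => (m (ε • ξ) : ℂ) * ((ftConst d : ℂ) * ∫ ζ,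
      ((m (ε • ζ) : ℂ) * WaveKinetic.symPart U ζ) *
        ((m (ε • (ξ - ζ)) : ℂ) * WaveKinetic.symPart W (ξ - ζ))) := by
  funext ξ
  rw [prodFT]
  push_cast
  rw [mul_comm (ftConst d : ℂ), mul_assoc]
  congr 3
  funext ζ
  ring

theorem prodFT (hF : IsProfile F) (hG : IsProfile G) {m : Space d → ℝ}
    (hm : ContDiff ℝ (⊤ : ℕ∞) m) (ε : ℝ) : IsProfile fun t => prodFT ε m (F t) (G t) := by
  simp only [prodFT_eq]
  exact (((hF.symPart.mul_mult hm ε).convolution (hG.symPart.mul_mult hm ε)).mul_left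
    (q := fun _ _ => (ftConst d : ℂ)) contDiff_const).mul_mult hm ε

end IsProfile

theorem contDiff_phase {d : ℕ} (ω₀ : ℝ) : ContDiff ℝ (⊤ : ℕ∞)
    (Function.uncurry fun (t : ℝ) (ξ : Space d) =>
      Complex.exp (Complex.I * ((t * disp ω₀ ξ : ℝ) : ℂ))) := by
  refine ContDiff.cexp (contDiff_const.mul (Complex.ofRealCLM.contDiff.comp ?_))
  refine contDiff_fst.mul ?_
  unfold disp
  exact contDiff_const.add ((contDiff_snd.norm_sq ℝ).div_const _)

theorem phase_sub {d : ℕ} (ω₀ t s : ℝ) (ξ : Space d) :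
    Complex.exp (Complex.I * (((t - s) * disp ω₀ ξ : ℝ) : ℂ)) =
      Complex.exp (Complex.I * ((t * disp ω₀ ξ : ℝ) : ℂ)) *
        Complex.exp (Complex.I * ((-s * disp ω₀ ξ : ℝ) : ℂ)) := by
  rw [← Complex.exp_add]
  push_cast
  ring_nf

theorem isProfile_profile {d : ℕ} (ε lam ω₀ : ℝ) {m : Space d → ℝ} {φ : Space d → ℂ}
    (hm : ContDiff ℝ (⊤ : ℕ∞) m) (hφ : ContDiff ℝ (⊤ : ℕ∞) φ) (hs : HasCompactSupport φ) (n : ℕ) :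
    IsProfile (profile ε lam ω₀ m φ n) := by
  induction n using Nat.strong_induction_on with
  | _ n ih =>
  rcases n with _ | n
  · have : profile ε lam ω₀ m φ 0 = fun t ξ =>
        Complex.exp (Complex.I * ((t * disp ω₀ ξ : ℝ) : ℂ)) * φ ξ := by rw [profile]
    rw [this]
    exact (IsProfile.of_const hφ hs).mul_left (contDiff_phase ω₀)
  -- The phase at time `t` is taken out of the Duhamel integral, whose integrand then no longer
  -- depends on `t`.
  · have : profile ε lam ω₀ m φ (n + 1) = fun t ξ => (-Complex.I * (lam : ℂ)) *
        (Complex.exp (Complex.I * ((t * disp ω₀ ξ : ℝ) : ℂ)) * ∫ s in (0 : ℝ)..t,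
          Complex.exp (Complex.I * ((-s * disp ω₀ ξ : ℝ) : ℂ)) *
          ∑ j : Fin (n + 1), prodFT ε m (profile ε lam ω₀ m φ j s)
          (profile ε lam ω₀ m φ (n - j) s) ξ) := by
      funext t ξ
      rw [profile]
      simp only [phase_sub, mul_assoc, intervalIntegral.integral_const_mul]
    rw [this]
    have h1 : IsProfile fun s ξ => ∑ j : Fin (n + 1), prodFT ε m (profile ε lam ω₀ m φ j s)
        (profile ε lam ω₀ m φ (n - j) s) ξ := by
      have h0 : ∀ j : Fin (n + 1), IsProfile fun s => prodFT ε m (profile ε lam ω₀ m φ j s)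
          (profile ε lam ω₀ m φ (n - j) s) := by
        intro j
        have hj := ih j (by omega)
        have hnj := ih (n - j) (by omega)
        exact hj.prodFT hnj hm ε
      exact IsProfile.sum (s := Finset.univ) fun j _ => h0 j
    have h2 := h1.mul_left
      (q := fun s ξ => Complex.exp (Complex.I * ((-s * disp ω₀ ξ : ℝ) : ℂ)))
      ((contDiff_phase ω₀).comp (contDiff_fst.neg.prodMk contDiff_snd))
    exact (h2.timeIntegral.mul_left (contDiff_phase ω₀)).mul_left
      (q := fun _ _ => -Complex.I * (lam : ℂ)) contDiff_const

theorem ift_sum {d : ℕ} {ι : Type*} (s : Finset ι) (f : ι → Space d → ℂ)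
    (hf : ∀ i ∈ s, Continuous (f i)) (hs : ∀ i ∈ s, HasCompactSupport (f i)) (x : Space d) :
    ift (fun ξ => ∑ i ∈ s, f i ξ) x = ∑ i ∈ s, ift (f i) x := by
  simp only [ift_def, Finset.sum_mul, ← Finset.mul_sum]
  rw [integral_finsetSum]
  intro i hi
  refine Continuous.integrable_of_hasCompactSupport ?_ (hs i hi).mul_right
  have := hf i hi
  fun_prop

/-- Characters are multiplicative, so twisting both factors by the same one twists their
convolution; the integral of a convolution is the product of the integrals. One of the two
normalizing constants remains on the right. -/
theorem ift_mul_ift {d : ℕ} {U W : Space d → ℂ} (hU : Continuous U) (hW : Continuous W)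
    (hUs : HasCompactSupport U) (hWs : HasCompactSupport W) (x : Space d) :
    ift U x * ift W x = ift (fun ξ => (ftConst d : ℂ) * ∫ ζ, U ζ * W (ξ - ζ)) x := by
  have h := integral_convolution (ContinuousLinearMap.mul ℂ ℂ) (μ := (volume : Measure (Space d)))
    (ν := volume)
    (f := fun ξ => U ξ * Complex.exp (Complex.I * ((inner ℝ x ξ : ℝ) : ℂ)))
    (g := fun ξ => W ξ * Complex.exp (Complex.I * ((inner ℝ x ξ : ℝ) : ℂ)))
    (Continuous.integrable_of_hasCompactSupport (by fun_prop) hUs.mul_right)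
    (Continuous.integrable_of_hasCompactSupport (by fun_prop) hWs.mul_right)
  simp only [ContinuousLinearMap.mul_apply'] at h
  rw [ift_def, ift_def, ift_def, mul_mul_mul_comm, ← h, mul_assoc, ← integral_const_mul]
  congr 2
  funext ξ
  rw [convolution_mul, mul_assoc, ← integral_mul_const]
  congr 2
  funext ζ
  rw [mul_mul_mul_comm, ← Complex.exp_add, ← mul_add, ← Complex.ofReal_add, ← inner_add_right,
    add_sub_cancel]

theorem fourierMul_ift {d : ℕ} {U : Space d → ℂ} (hU : ContDiff ℝ (⊤ : ℕ∞) U)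
    (hs : HasCompactSupport U) (q : Space d → ℂ) :
    fourierMul q (ift U) = ift fun ξ => q ξ * U ξ := by
  rw [fourierMul, ft_ift hU hs]

/-- Conjugation in space is conjugation combined with reflection in frequency, which gives
`symPart`; the product in space becomes a convolution. Smoothness and compact support allow
inversion after each multiplier. -/
theorem nonlin_ift {d : ℕ} {m : Space d → ℝ} (hm : ContDiff ℝ (⊤ : ℕ∞) m) (ε : ℝ)
    {U W : Space d → ℂ} (hU : ContDiff ℝ (⊤ : ℕ∞) U) (hUs : HasCompactSupport U)
    (hW : ContDiff ℝ (⊤ : ℕ∞) W) (hWs : HasCompactSupport W) :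
    nonlin ε m (ift U) (ift W) = ift (prodFT ε m U W) := by
  have hsym : ∀ {U : Space d → ℂ} (hU : ContDiff ℝ (⊤ : ℕ∞) U) (hUs : HasCompactSupport U) x,
      opM ε m (ift U) x + opM ε m (conjFun (ift U)) x =
        ift (fun ξ => (m (ε • ξ) : ℂ) * symPart U ξ) x := by
    intro U hU hUs x
    have hP := IsProfile.of_const hU hUs
    have h1 := hP.mul_mult hm ε
    have h2 := hP.conj_neg
    have h3 := h2.mul_mult hm ε
    have hc : conjFun (ift U) = ift fun ξ => starRingEnd ℂ (U (-ξ)) := funext (conj_ift U)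
    rw [hc, opM, opM, fourierMul_ift hU hUs, fourierMul_ift (h2.contDiff 0) (h2.hasCompactSupport 0)]
    have := ift_sum (d := d) Finset.univ (fun b : Bool => if b then fun ξ => (m (ε • ξ) : ℂ) * U ξ
      else fun ξ => (m (ε • ξ) : ℂ) * starRingEnd ℂ (U (-ξ)))
      (by rintro (_ | _) _
          · exact (h3.contDiff 0).continuous
          · exact (h1.contDiff 0).continuous)
      (by rintro (_ | _) _
          · exact h3.hasCompactSupport 0
          · exact h1.hasCompactSupport 0) x
    simp only [Fintype.sum_bool, if_true, Bool.false_eq_true, if_false] at this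
    rw [← this]
    congr 1
    funext ξ
    rw [symPart, mul_add]
  have hP := (IsProfile.of_const hU hUs).symPart.mul_mult hm ε
  have hQ := (IsProfile.of_const hW hWs).symPart.mul_mult hm ε
  have hPQ := (hP.convolution hQ).mul_left (q := fun _ _ => (ftConst d : ℂ)) contDiff_const
  rw [nonlin]
  have : (fun x => (opM ε m (ift U) x + opM ε m (conjFun (ift U)) x) *
      (opM ε m (ift W) x + opM ε m (conjFun (ift W)) x)) = ift (fun ξ => (ftConst d : ℂ) * ∫ ζ,
      ((m (ε • ζ) : ℂ) * symPart U ζ) * ((m (ε • (ξ - ζ)) : ℂ) * symPart W (ξ - ζ))) := by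
    funext x
    rw [hsym hU hUs, hsym hW hWs]
    exact ift_mul_ift (hP.contDiff 0).continuous (hQ.contDiff 0).continuous
      (hP.hasCompactSupport 0) (hQ.hasCompactSupport 0) x
  rw [this, opM, fourierMul_ift (hPQ.contDiff 0) (hPQ.hasCompactSupport 0), prodFT_eq]

theorem IsProfile.integral_ift {d : ℕ} {F : ℝ → Space d → ℂ} (hF : IsProfile F) (t : ℝ)
    (x : Space d) :
    ∫ s in (0 : ℝ)..t, ift (F s) x = ift (fun ξ => ∫ s in (0 : ℝ)..t, F s ξ) x := by
  simp only [ift_def]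
  rw [intervalIntegral.integral_const_mul]
  congr 1
  rw [intervalIntegral_integral_swap]
  · congr 1
    funext ξ
    rw [intervalIntegral.integral_mul_const]
  · obtain ⟨R, hR⟩ := hF.support
    have hc : Continuous (Function.uncurry fun s ξ =>
        F s ξ * Complex.exp (Complex.I * ((inner ℝ x ξ : ℝ) : ℂ))) := by
      have := hF.smooth.continuous
      exact this.mul (by fun_prop)
    have h1 : IntegrableOn (Function.uncurry fun s ξ =>
        F s ξ * Complex.exp (Complex.I * ((inner ℝ x ξ : ℝ) : ℂ)))
        (Set.uIcc 0 t ×ˢ Metric.closedBall (0 : Space d) R) (volume.prod volume) :=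
      hc.continuousOn.integrableOn_compact (isCompact_uIcc.prod (isCompact_closedBall _ _))
    have h2 : IntegrableOn (Function.uncurry fun s ξ =>
        F s ξ * Complex.exp (Complex.I * ((inner ℝ x ξ : ℝ) : ℂ)))
        (Set.uIoc 0 t ×ˢ Set.univ) (volume.prod volume) := by
      refine IntegrableOn.of_forall_sdiff_eq_zero (h1.mono_set
        (Set.prod_mono_left Set.uIoc_subset_uIcc)) (measurableSet_uIoc.prod MeasurableSet.univ) ?_
      rintro ⟨s, ξ⟩ ⟨⟨hs, -⟩, hξ⟩
      have : R < ‖ξ‖ := by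
        by_contra h
        exact hξ ⟨hs, by simpa using h⟩
      simp [Function.uncurry, hR s ξ this]
    rwa [IntegrableOn, ← Measure.prod_restrict, Measure.restrict_univ] at h2

/-- The iterates are the inverse Fourier transforms of the profiles. -/
theorem iterate_eq_ift {d : ℕ} (ε lam ω₀ : ℝ) {m : Space d → ℝ} {u φ : Space d → ℂ}
    (hm : ContDiff ℝ (⊤ : ℕ∞) m) (hφ : ContDiff ℝ (⊤ : ℕ∞) φ) (hs : HasCompactSupport φ)
    (hu : ft u = φ) (n : ℕ) (t : ℝ) :
    iterate ε lam ω₀ m u n t = ift (profile ε lam ω₀ m φ n t) := by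
  induction n using Nat.strong_induction_on generalizing t with
  | _ n ih =>
  have hP := isProfile_profile ε lam ω₀ hm hφ hs
  rcases n with _ | n
  · simp only [iterate, profile, propagator, fourierMul, hu]
  · funext x
    have hS : IsProfile fun s ξ => ∑ j : Fin (n + 1), prodFT ε m (profile ε lam ω₀ m φ j s)
        (profile ε lam ω₀ m φ (n - j) s) ξ :=
      IsProfile.sum fun j _ => (hP j).prodFT (hP _) hm ε
    have hS' := hS.mul_left (q := fun s ξ =>
      Complex.exp (Complex.I * (((t - s) * disp ω₀ ξ : ℝ) : ℂ)))
      ((contDiff_phase ω₀).comp ((contDiff_const.sub contDiff_fst).prodMk contDiff_snd))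
    have h1 : ∀ s, propagator ω₀ (t - s) (fun y => ∑ j : Fin (n + 1),
          nonlin ε m (iterate ε lam ω₀ m u j s) (iterate ε lam ω₀ m u (n - j) s) y) x =
        ift (fun ξ => Complex.exp (Complex.I * (((t - s) * disp ω₀ ξ : ℝ) : ℂ)) *
          ∑ j : Fin (n + 1), prodFT ε m (profile ε lam ω₀ m φ j s)
          (profile ε lam ω₀ m φ (n - j) s) ξ) x := by
      intro s
      have h2 : (fun y => ∑ j : Fin (n + 1),
          nonlin ε m (iterate ε lam ω₀ m u j s) (iterate ε lam ω₀ m u (n - j) s) y) =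
          ift (fun ξ => ∑ j : Fin (n + 1), prodFT ε m (profile ε lam ω₀ m φ j s)
          (profile ε lam ω₀ m φ (n - j) s) ξ) := by
        funext y
        have hj : ∀ j : Fin (n + 1), IsProfile fun s => prodFT ε m (profile ε lam ω₀ m φ j s)
          (profile ε lam ω₀ m φ (n - j) s) := fun j => (hP j).prodFT (hP _) hm ε
        rw [ift_sum _ _ (fun j _ => ((hj j).contDiff s).continuous)
          (fun j _ => (hj j).hasCompactSupport s)]
        refine Finset.sum_congr rfl fun j _ => ?_
        rw [ih j (by omega), ih (n - j) (by omega), nonlin_ift hm ε ((hP _).contDiff s)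
          ((hP _).hasCompactSupport s) ((hP _).contDiff s) ((hP _).hasCompactSupport s)]
      rw [h2, propagator, fourierMul_ift (hS.contDiff s) (hS.hasCompactSupport s)]
    rw [iterate, profile]
    simp only [h1]
    rw [hS'.integral_ift, ift_def, ift_def, mul_left_comm, ← integral_const_mul]
    congr 2
    funext ξ
    ring

end WaveKinetic

namespace WaveKinetic

open PairedGraph (zeroExtend zeroExtend_coe zeroExtend_of_mem)

/-- Integrability of the amplitudes always has this form: band limitation confines the frequencies
to balls, and the time constraints confine the slices to intervals. -/
theorem integrable_of_bounded {α : Type*} [MeasurableSpace α] {μ : Measure α} {f : α → ℂ}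
    {K : Set α} (hK : μ K ≠ ⊤) (hf : Measurable f) {C : ℝ} (hC : ∀ x, ‖f x‖ ≤ C)
    (h0 : ∀ x, f x ≠ 0 → x ∈ K) : Integrable f μ := by
  have h : IntegrableOn f K μ := Measure.integrableOn_of_bounded (M := C) hK
    hf.aestronglyMeasurable (Filter.Eventually.of_forall hC)
  rwa [integrableOn_iff_integrable_of_support_subset] at h
  exact fun x hx => h0 x hx

/-! ### Splitting of the variables at a node -/

namespace STree

/-- The interaction vertices of a tree are its top vertex and those of the two subtrees. -/
def innerEquiv (σ : ℤˣ) (l r : STree) :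
    Unit ⊕ ({v // v ∈ l.inner} ⊕ {v // v ∈ r.inner}) ≃ {v // v ∈ (node σ l r).inner} where
  toFun
    | Sum.inl _ => ⟨[], by simp⟩
    | Sum.inr (Sum.inl v) => ⟨false :: v.1, by simp⟩
    | Sum.inr (Sum.inr v) => ⟨true :: v.1, by simp⟩
  invFun
    | ⟨[], _⟩ => Sum.inl ()
    | ⟨false :: v, h⟩ => Sum.inr (Sum.inl ⟨v, by simpa using h⟩)
    | ⟨true :: v, h⟩ => Sum.inr (Sum.inr ⟨v, by simpa using h⟩)
  left_inv := by rintro (_ | _ | _) <;> rfl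
  right_inv := by rintro ⟨_ | ⟨_ | _, _⟩, _⟩ <;> rfl

/-- The splitting of variables at the top vertex. -/
def splitEquiv (σ : ℤˣ) (l r : STree) (A : Type) [MeasurableSpace A] :
    ({v // v ∈ (node σ l r).inner} → A) ≃ᵐ
      A × ({v // v ∈ l.inner} → A) × ({v // v ∈ r.inner} → A) :=
  (MeasurableEquiv.piCongrLeft (fun _ => A) (innerEquiv σ l r)).symm.trans
    ((MeasurableEquiv.sumPiEquivProdPi fun _ => A).trans
      ((MeasurableEquiv.funUnique Unit A).prodCongr (MeasurableEquiv.sumPiEquivProdPi fun _ => A)))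

theorem volume_preserving_splitEquiv (σ : ℤˣ) (l r : STree) (A : Type) [MeasureSpace A]
    [SigmaFinite (volume : Measure A)] :
    MeasurePreserving (splitEquiv σ l r A) volume volume :=
  (((volume_preserving_funUnique Unit A).prod (volume_measurePreserving_sumPiEquivProdPi _)).comp
    (volume_measurePreserving_sumPiEquivProdPi _)).comp
    (volume_measurePreserving_piCongrLeft (fun _ => A) (innerEquiv σ l r)).symm

theorem splitEquiv_apply (σ : ℤˣ) (l r : STree) {A : Type} [MeasurableSpace A]
    (x : {v // v ∈ (node σ l r).inner} → A) : splitEquiv σ l r A x =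
      (x ⟨[], by simp⟩, fun v => x ⟨false :: v.1, by simp⟩, fun v => x ⟨true :: v.1, by simp⟩) :=
  rfl

theorem zeroExtend_splitEquiv (σ : ℤˣ) (l r : STree) {A : Type} [MeasurableSpace A] [Zero A]
    (x : {v // v ∈ (node σ l r).inner} → A) :
    zeroExtend x [] = (splitEquiv σ l r A x).1 ∧
    (fun v => zeroExtend x (false :: v)) = zeroExtend (splitEquiv σ l r A x).2.1 ∧
    (fun v => zeroExtend x (true :: v)) = zeroExtend (splitEquiv σ l r A x).2.2 := by
  rw [splitEquiv_apply]
  refine ⟨by simp [PairedGraph.zeroExtend], ?_, ?_⟩ <;>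
  · funext v
    simp [PairedGraph.zeroExtend]

end STree

/-! ### The amplitude of a tree -/

/-- The Fourier transform of `u₀` or of its conjugate, according to the parity. -/
def leafField {d : ℕ} (φ : Space d → ℂ) (σ : ℤˣ) (ξ : Space d) : ℂ :=
  if σ = 1 then φ ξ else starRingEnd ℂ (φ (-ξ))

/-- A parity as a real number. -/
def unitSign (σ : ℤˣ) : ℝ := ((σ : ℤ) : ℝ)

/-- The resonance modulus of an interaction in terms of the parities and frequencies. -/
def phaseMod {d : ℕ} (ω₀ : ℝ) (σ σl σr : ℤˣ) (ξ ζ : Space d) : ℝ :=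
  unitSign σ * disp ω₀ ξ - unitSign σl * disp ω₀ ζ - unitSign σr * disp ω₀ (ξ - ζ)

namespace STree

variable {d : ℕ}

/-- The sum of the time slices on the upright path leading to the top vertex. -/
def topSum : STree → (List Bool → ℝ) → ℝ
  | leaf _, _ => 0
  | node _ l _, s => s [] + l.topSum fun v => s (false :: v)

/-- The time constraints, multipliers and oscillating factors of a tree. -/
def weight (ε ω₀ : ℝ) (m : Space d → ℝ) :
    STree → ℝ → Space d → (List Bool → Space d × ℝ) → ℂ
  | leaf _, _, _, _ => 1
  | node σ l r, τ, ξ, x =>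
    (if 0 ≤ (x []).2 ∧ (node σ l r).topSum (fun v => (x v).2) ≤ τ then 1 else 0) *
    ((m (ε • ξ) * m (ε • (x []).1) * m (ε • (ξ - (x []).1)) : ℝ) : ℂ) *
    Complex.exp (-Complex.I * (((node σ l r).topSum (fun v => (x v).2) *
      phaseMod ω₀ σ (l.parity []) (r.parity []) ξ (x []).1 : ℝ) : ℂ)) *
    (l.weight ε ω₀ m ((node σ l r).topSum fun v => (x v).2) (x []).1 (fun v => x (false :: v)) *
    r.weight ε ω₀ m ((node σ l r).topSum fun v => (x v).2) (ξ - (x []).1) fun v => x (true :: v))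

/-- The product of the fields at the initial vertices. -/
def leafProd (φ : Space d → ℂ) : STree → Space d → (List Bool → Space d × ℝ) → ℂ
  | leaf σ, ξ, _ => leafField φ σ ξ
  | node _ l r, ξ, x => l.leafProd φ (x []).1 (fun v => x (false :: v)) *
      r.leafProd φ (ξ - (x []).1) fun v => x (true :: v)

/-- The constant in front of the amplitude of a tree. -/
def coef (d : ℕ) (lam : ℝ) : STree → ℂ
  | leaf _ => 1
  | node σ l r => (-Complex.I * ((unitSign σ * lam * ftConst d : ℝ) : ℂ)) *
      (l.coef d lam * r.coef d lam)

/-- The integrand of the amplitude of a tree. -/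
def ampIntegrand (ε ω₀ : ℝ) (m : Space d → ℝ) (φ : Space d → ℂ) (T : STree) (τ : ℝ) (ξ : Space d)
    (x : {v // v ∈ T.inner} → Space d × ℝ) : ℂ :=
  T.weight ε ω₀ m τ ξ (zeroExtend x) * T.leafProd φ ξ (zeroExtend x)

/-- The amplitude of a tree. -/
def amp (ε lam ω₀ : ℝ) (m : Space d → ℝ) (φ : Space d → ℂ) (T : STree) (τ : ℝ) (ξ : Space d) : ℂ :=
  T.coef d lam * ∫ x, T.ampIntegrand ε ω₀ m φ τ ξ x

end STree

/-- Bounded measurable functions with support in a ball. -/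
structure IsBandLimited {d : ℕ} (φ : Space d → ℂ) (B R : ℝ) : Prop where
  measurable : Measurable φ
  nonneg : 0 ≤ R
  bound : ∀ ξ, ‖φ ξ‖ ≤ B
  support : ∀ ξ, R < ‖ξ‖ → φ ξ = 0

namespace IsBandLimited

variable {d : ℕ} {φ : Space d → ℂ} {B R : ℝ}

theorem nonneg_bound (h : IsBandLimited φ B R) : 0 ≤ B := (norm_nonneg _).trans (h.bound 0)

theorem norm_leafField_le (h : IsBandLimited φ B R) (σ : ℤˣ) (ξ : Space d) :
    ‖leafField φ σ ξ‖ ≤ B := by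
  unfold leafField
  split_ifs
  · exact h.bound _
  · rw [RCLike.norm_conj]; exact h.bound _

theorem norm_le_of_leafField (h : IsBandLimited φ B R) {σ : ℤˣ} {ξ : Space d}
    (hξ : leafField φ σ ξ ≠ 0) : ‖ξ‖ ≤ R := by
  by_contra hR
  refine hξ ?_
  unfold leafField
  split_ifs
  · exact h.support _ (not_le.1 hR)
  · rw [h.support _ (by simpa using hR), map_zero]

end IsBandLimited

namespace STree

variable {d : ℕ} {φ : Space d → ℂ} {B R : ℝ}

theorem norm_leafProd_le (h : IsBandLimited φ B R) (T : STree) (ξ : Space d)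
    (x : List Bool → Space d × ℝ) : ‖T.leafProd φ ξ x‖ ≤ B ^ (T.depth + 1) := by
  induction T generalizing ξ x with
  | leaf σ => simpa [leafProd, depth] using h.norm_leafField_le σ ξ
  | node σ l r hl hr =>
    rw [leafProd, norm_mul, depth, show l.depth + r.depth + 1 + 1 = (l.depth + 1) + (r.depth + 1) by
      omega, pow_add]
    exact mul_le_mul (hl _ _) (hr _ _) (norm_nonneg _) (pow_nonneg h.nonneg_bound _)

/-- Each frequency is the sum of those at the leaves below, of which there are at most `T.depth +
1`, each of size at most `R`. -/
theorem norm_le_of_leafProd (h : IsBandLimited φ B R) {T : STree} {ξ : Space d}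
    {x : List Bool → Space d × ℝ} (hx : T.leafProd φ ξ x ≠ 0) :
    ‖ξ‖ ≤ (T.depth + 1) * R ∧ ∀ v ∈ T.inner, ‖(x v).1‖ ≤ (T.depth + 1) * R := by
  induction T generalizing ξ x with
  | leaf σ =>
    refine ⟨?_, by simp⟩
    simpa [depth] using h.norm_le_of_leafField hx
  | node σ l r hl hr =>
    rw [leafProd, mul_ne_zero_iff] at hx
    obtain ⟨h1, h2⟩ := hl hx.1
    obtain ⟨h3, h4⟩ := hr hx.2
    have hR := h.nonneg
    have hlr : (0 : ℝ) ≤ l.depth * R := by positivity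
    have hrr : (0 : ℝ) ≤ r.depth * R := by positivity
    have h5 : ((node σ l r).depth + 1 : ℝ) * R = (l.depth + 1) * R + (r.depth + 1) * R := by
      rw [depth]; push_cast; ring
    rw [h5]
    refine ⟨?_, ?_⟩
    · calc ‖ξ‖ = ‖(x []).1 + (ξ - (x []).1)‖ := by rw [add_sub_cancel]
        _ ≤ _ := (norm_add_le _ _).trans (add_le_add h1 h3)
    · rintro (_ | ⟨_ | _, v⟩) hv
      · linarith
      · have := h2 v (by simpa using hv)
        linarith
      · have := h4 v (by simpa using hv)
        linarith

theorem topSum_nonneg_of_weight {ε ω₀ : ℝ} {m : Space d → ℝ} {T : STree} {τ : ℝ} {ξ : Space d}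
    {x : List Bool → Space d × ℝ} (h : T.weight ε ω₀ m τ ξ x ≠ 0) :
    0 ≤ T.topSum fun v => (x v).2 := by
  induction T generalizing τ ξ x with
  | leaf σ => exact le_rfl
  | node σ l r hl hr =>
    simp only [weight, mul_ne_zero_iff, ite_ne_right_iff] at h
    exact add_nonneg h.1.1.1.1.1 (hl h.2.1)

/-- The two subtrees are evaluated with the time of the top interaction as their horizon, which is
nonnegative and at most `τ`, so the bounds propagate downwards. -/
theorem mem_Icc_of_weight {ε ω₀ : ℝ} {m : Space d → ℝ} {T : STree} {τ : ℝ} {ξ : Space d}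
    {x : List Bool → Space d × ℝ} (h : T.weight ε ω₀ m τ ξ x ≠ 0) (hτ : 0 ≤ τ) :
    (T.topSum fun v => (x v).2) ≤ τ ∧ ∀ v ∈ T.inner, (x v).2 ∈ Set.Icc 0 τ := by
  induction T generalizing τ ξ x with
  | leaf σ => exact ⟨hτ, by simp⟩
  | node σ l r hl hr =>
    have hS := topSum_nonneg_of_weight h
    simp only [weight, mul_ne_zero_iff, ite_ne_right_iff] at h
    have hSl := topSum_nonneg_of_weight h.2.1
    have hSτ := h.1.1.1.1.2
    refine ⟨hSτ, ?_⟩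
    rintro (_ | ⟨_ | _, v⟩) hv
    · refine ⟨h.1.1.1.1.1, ?_⟩
      simp only [topSum] at hSτ
      linarith
    · have := (hl h.2.1 hS).2 v (by simpa using hv)
      exact ⟨this.1, this.2.trans hSτ⟩
    · have := (hr h.2.2 hS).2 v (by simpa using hv)
      exact ⟨this.1, this.2.trans hSτ⟩

theorem norm_exp_neg_I (a : ℝ) : ‖Complex.exp (-Complex.I * (a : ℂ))‖ = 1 := by
  rw [show -Complex.I * (a : ℂ) = ((-a : ℝ) : ℂ) * Complex.I by push_cast; ring,
    Complex.norm_exp_ofReal_mul_I]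

/-- The multiplier `m` may be unbounded. Only where the product of the leaf fields does not vanish
are all its arguments in a fixed ball, and each interaction then costs at most `M ^ 3`. -/
theorem norm_weight_le (h : IsBandLimited φ B R) {ε : ℝ} (ω₀ : ℝ) {m : Space d → ℝ} {M L : ℝ}
    (hM : ∀ ζ, ‖ζ‖ ≤ L → |m (ε • ζ)| ≤ M) {T : STree} (hL : (T.depth + 1) * R ≤ L) (τ : ℝ)
    {ξ : Space d} {x : List Bool → Space d × ℝ} (hx : T.leafProd φ ξ x ≠ 0) :
    ‖T.weight ε ω₀ m τ ξ x‖ ≤ (M ^ 3) ^ T.depth := by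
  induction T generalizing τ ξ x with
  | leaf σ => simp [weight, depth]
  | node σ l r hl hr =>
    have h1 := norm_le_of_leafProd h hx
    have h3 := (h1.2 [] (by simp)).trans hL
    rw [leafProd, mul_ne_zero_iff] at hx
    have hR := h.nonneg
    have hlr : (0 : ℝ) ≤ l.depth * R := by positivity
    have hrr : (0 : ℝ) ≤ r.depth * R := by positivity
    have h5 : ((node σ l r).depth + 1 : ℝ) * R = (l.depth + 1) * R + (r.depth + 1) * R := by
      rw [depth]; push_cast; ring
    rw [h5] at hL
    have h4 := (norm_le_of_leafProd h hx.2).1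
    have hl' := hl (by linarith) ((node σ l r).topSum fun v => (x v).2) hx.1
    have hr' := hr (by linarith) ((node σ l r).topSum fun v => (x v).2) hx.2
    have hm1 := hM ξ (by linarith [h1.1])
    have hm2 := hM _ h3
    have hm3 := hM (ξ - (x []).1) (by linarith)
    have hM0 : 0 ≤ M := (abs_nonneg _).trans hm1
    rw [weight, norm_mul, norm_mul, norm_mul, norm_exp_neg_I, norm_mul, Complex.norm_real,
      Real.norm_eq_abs, abs_mul, abs_mul, mul_one, depth, pow_succ, pow_add,
      mul_comm _ (M ^ 3)]
    refine mul_le_mul ?_ (mul_le_mul hl' hr' (norm_nonneg _) (by positivity)) (by positivity)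
      (by positivity)
    have : ‖(if 0 ≤ (x []).2 ∧ (node σ l r).topSum (fun v => (x v).2) ≤ τ then 1 else 0 : ℂ)‖ ≤ 1 := by
      split_ifs <;> simp
    calc _ ≤ 1 * (M * M * M) := by
          refine mul_le_mul this ?_ (by positivity) zero_le_one
          exact mul_le_mul (mul_le_mul hm1 hm2 (abs_nonneg _) hM0) hm3 (abs_nonneg _) (by positivity)
      _ = M ^ 3 := by ring

/-! #### Measurability -/

theorem measurable_disp (ω₀ : ℝ) : Measurable (disp (d := d) ω₀) := by
  unfold disp
  fun_prop

theorem measurable_phaseMod {A : Type*} [MeasurableSpace A] (ω₀ : ℝ) (σ σl σr : ℤˣ)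
    {f g : A → Space d} (hf : Measurable f) (hg : Measurable g) :
    Measurable fun a => phaseMod ω₀ σ σl σr (f a) (g a) := by
  unfold phaseMod
  have h := measurable_disp (d := d) ω₀
  exact (((h.comp hf).const_mul _).sub ((h.comp hg).const_mul _)).sub
    ((h.comp (hf.sub hg)).const_mul _)

theorem measurable_topSum {A : Type*} [MeasurableSpace A] (T : STree) {s : A → List Bool → ℝ}
    (hs : ∀ v, Measurable fun a => s a v) : Measurable fun a => T.topSum (s a) := by
  induction T generalizing s with
  | leaf σ => exact measurable_const
  | node σ l r hl hr => exact (hs []).add (hl fun v => hs (false :: v))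

theorem measurable_weight {A : Type*} [MeasurableSpace A] (ε ω₀ : ℝ) {m : Space d → ℝ}
    (hm : Measurable m) (T : STree) {τ : A → ℝ} {ξ : A → Space d} {x : A → List Bool → Space d × ℝ}
    (hτ : Measurable τ) (hξ : Measurable ξ) (hx : ∀ v, Measurable fun a => x a v) :
    Measurable fun a => T.weight ε ω₀ m (τ a) (ξ a) (x a) := by
  induction T generalizing τ ξ x with
  | leaf σ => exact measurable_const
  | node σ l r hl hr =>
    have hS : Measurable fun a => (node σ l r).topSum fun v => (x a v).2 :=
      measurable_topSum _ fun v => (hx v).snd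
    have h0 := (hx []).fst
    simp only [weight]
    refine (((Measurable.ite ?_ measurable_const measurable_const).mul ?_).mul ?_).mul
      ((hl hS h0 fun v => hx _).mul (hr hS (hξ.sub h0) fun v => hx _))
    · exact (measurableSet_le measurable_const (hx []).snd).inter (measurableSet_le hS hτ)
    · exact Complex.measurable_ofReal.comp (((hm.comp (hξ.const_smul ε)).mul
        (hm.comp (h0.const_smul ε))).mul (hm.comp ((hξ.sub h0).const_smul ε)))
    · exact Complex.measurable_exp.comp ((Complex.measurable_ofReal.comp
        (hS.mul (measurable_phaseMod ω₀ _ _ _ hξ h0))).const_mul _)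

theorem measurable_leafProd {A : Type*} [MeasurableSpace A] {φ : A → Space d → ℂ}
    (hφ : Measurable (Function.uncurry φ)) (T : STree) {ξ : A → Space d}
    {x : A → List Bool → Space d × ℝ} (hξ : Measurable ξ) (hx : ∀ v, Measurable fun a => x a v) :
    Measurable fun a => T.leafProd (φ a) (ξ a) (x a) := by
  induction T generalizing ξ x with
  | leaf σ =>
    simp only [leafProd, leafField]
    split_ifs
    · exact hφ.comp (measurable_id.prodMk hξ)
    · exact Complex.continuous_conj.measurable.comp (hφ.comp (measurable_id.prodMk hξ.neg))
  | node σ l r hl hr =>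
    have h0 := (hx []).fst
    simp only [leafProd]
    exact (hl h0 fun v => hx _).mul (hr (hξ.sub h0) fun v => hx _)

theorem measurable_zeroExtend {A B : Type*} [MeasurableSpace A] [MeasurableSpace B] [Zero B]
    {s : Finset (List Bool)} {f : A → {v // v ∈ s} → B} (hf : Measurable f) (v : List Bool) :
    Measurable fun a => zeroExtend (f a) v := by
  by_cases hv : v ∈ s
  · simp only [zeroExtend_of_mem _ hv]
    exact (measurable_pi_apply _).comp hf
  · simp only [PairedGraph.zeroExtend, hv, dif_neg, not_false_eq_true]
    exact measurable_const

theorem measurable_ampIntegrand {A : Type*} [MeasurableSpace A] (ε ω₀ : ℝ) {m : Space d → ℝ}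
    (hm : Measurable m) {φ : A → Space d → ℂ} (hφ : Measurable (Function.uncurry φ)) (T : STree)
    {τ : A → ℝ} {ξ : A → Space d} {x : A → {v // v ∈ T.inner} → Space d × ℝ}
    (hτ : Measurable τ) (hξ : Measurable ξ) (hx : Measurable x) :
    Measurable fun a => T.ampIntegrand ε ω₀ m (φ a) (τ a) (ξ a) (x a) :=
  (measurable_weight ε ω₀ hm T hτ hξ (measurable_zeroExtend hx)).mul
    (measurable_leafProd hφ T hξ (measurable_zeroExtend hx))

/-- The box that contains the support of the integrand of an amplitude. -/
def box (T : STree) (d : ℕ) (L t : ℝ) : Set ({v // v ∈ T.inner} → Space d × ℝ) :=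
  Set.pi Set.univ fun _ => Metric.closedBall 0 L ×ˢ Set.Icc 0 t

theorem isCompact_box (T : STree) (L t : ℝ) : IsCompact (T.box d L t) :=
  isCompact_univ_pi fun _ => (isCompact_closedBall _ _).prod isCompact_Icc

theorem ampIntegrand_support (h : IsBandLimited φ B R) {ε ω₀ : ℝ} {m : Space d → ℝ} {T : STree}
    {L : ℝ} (hL : (T.depth + 1) * R ≤ L) {τ t : ℝ} (hτ : 0 ≤ τ) (hτt : τ ≤ t) {ξ : Space d}
    {x : {v // v ∈ T.inner} → Space d × ℝ} (hx : T.ampIntegrand ε ω₀ m φ τ ξ x ≠ 0) :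
    ‖ξ‖ ≤ L ∧ x ∈ T.box d L t := by
  rw [ampIntegrand, mul_ne_zero_iff] at hx
  have h1 := norm_le_of_leafProd h hx.2
  have h2 := mem_Icc_of_weight hx.1 hτ
  refine ⟨h1.1.trans hL, fun v _ => ⟨?_, ?_⟩⟩
  · have := h1.2 v.1 v.2
    rw [zeroExtend_coe] at this
    simpa using this.trans hL
  · have := h2.2 v.1 v.2
    rw [zeroExtend_coe] at this
    exact ⟨this.1, this.2.trans hτt⟩

theorem norm_ampIntegrand_le (h : IsBandLimited φ B R) {ε : ℝ} (ω₀ : ℝ) {m : Space d → ℝ}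
    {M L : ℝ} (hM : ∀ ζ, ‖ζ‖ ≤ L → |m (ε • ζ)| ≤ M) {T : STree} (hL : (T.depth + 1) * R ≤ L)
    (τ : ℝ) (ξ : Space d) (x : {v // v ∈ T.inner} → Space d × ℝ) :
    ‖T.ampIntegrand ε ω₀ m φ τ ξ x‖ ≤ (M ^ 3) ^ T.depth * B ^ (T.depth + 1) := by
  have hL0 : 0 ≤ L := le_trans (mul_nonneg (by positivity) h.nonneg) hL
  have hM0 : 0 ≤ M := (abs_nonneg _).trans (hM 0 (by simpa using hL0))
  have hB := h.nonneg_bound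
  rw [ampIntegrand, norm_mul]
  by_cases hx : T.leafProd φ ξ (zeroExtend x) = 0
  · rw [hx, norm_zero, mul_zero]
    positivity
  · exact mul_le_mul (norm_weight_le h ω₀ hM hL τ hx) (norm_leafProd_le h T ξ _) (norm_nonneg _)
      (by positivity)

theorem exists_mult_bound {m : Space d → ℝ} (hm : Continuous m) (ε L : ℝ) :
    ∃ M, ∀ ζ, ‖ζ‖ ≤ L → |m (ε • ζ)| ≤ M := by
  obtain ⟨M, hM⟩ := (isCompact_closedBall (0 : Space d) L).exists_bound_of_continuousOn
    (f := fun ζ => m (ε • ζ)) (by fun_prop)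
  exact ⟨M, fun ζ hζ => hM ζ (by simpa using hζ)⟩

theorem exists_norm_ampIntegrand_le (h : IsBandLimited φ B R) (ε ω₀ : ℝ) {m : Space d → ℝ}
    (hm : Continuous m) (T : STree) :
    ∃ C, ∀ τ ξ x, ‖T.ampIntegrand ε ω₀ m φ τ ξ x‖ ≤ C := by
  obtain ⟨M, hM⟩ := exists_mult_bound hm ε ((T.depth + 1) * R)
  exact ⟨_, norm_ampIntegrand_le h ω₀ hM le_rfl⟩

/-- Without interactions, the integral is over a one-point space with unit mass. -/
theorem amp_leaf (ε lam ω₀ : ℝ) (m : Space d → ℝ) (φ : Space d → ℂ) (σ : ℤˣ) (τ : ℝ)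
    (ξ : Space d) : (leaf σ).amp ε lam ω₀ m φ τ ξ = leafField φ σ ξ := by
  have : IsEmpty {v // v ∈ (leaf σ).inner} := ⟨fun v => mem_inner_leaf _ _ v.2⟩
  rw [amp, coef, one_mul, volume_pi, Measure.pi_of_empty, integral_dirac]
  simp [ampIntegrand, weight, leafProd]

theorem measurable_amp (ε lam ω₀ : ℝ) {m : Space d → ℝ} (hm : Measurable m)
    (hφ : Measurable φ) (T : STree) :
    Measurable (Function.uncurry (T.amp ε lam ω₀ m φ)) := by
  have h : Measurable (Function.uncurry fun (q : ℝ × Space d) x =>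
      T.ampIntegrand ε ω₀ m φ q.1 q.2 x) :=
    measurable_ampIntegrand (A := (ℝ × Space d) × _) ε ω₀ hm (φ := fun _ => φ)
      (hφ.comp measurable_snd) T measurable_fst.fst measurable_fst.snd measurable_snd
  exact (h.stronglyMeasurable.integral_prod_right (ν := volume)).measurable.const_mul _

theorem exists_norm_amp_le (h : IsBandLimited φ B R) (ε lam ω₀ : ℝ) {m : Space d → ℝ}
    (hm : Continuous m) (T : STree) (t : ℝ) :
    ∃ C, ∀ τ ξ, 0 ≤ τ → τ ≤ t → ‖T.amp ε lam ω₀ m φ τ ξ‖ ≤ C := by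
  obtain ⟨C, hC⟩ := exists_norm_ampIntegrand_le h ε ω₀ hm T
  refine ⟨‖T.coef d lam‖ * (C * volume.real (T.box d ((T.depth + 1) * R) t)), fun τ ξ h0 ht => ?_⟩
  rw [amp, norm_mul]
  refine mul_le_mul_of_nonneg_left ?_ (norm_nonneg _)
  rw [← setIntegral_eq_integral_of_forall_compl_eq_zero
    (s := T.box d ((T.depth + 1) * R) t)]
  · exact norm_setIntegral_le_of_norm_le_const (isCompact_box _ _ _).measure_lt_top
      fun x _ => hC _ _ _
  · intro x hx
    by_contra hne
    exact hx (ampIntegrand_support h le_rfl h0 ht hne).2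

theorem norm_le_of_amp (h : IsBandLimited φ B R) {ε lam ω₀ : ℝ} {m : Space d → ℝ}
    {T : STree} {τ : ℝ} {ξ : Space d} (hτ : 0 ≤ τ) (hne : T.amp ε lam ω₀ m φ τ ξ ≠ 0) :
    ‖ξ‖ ≤ (T.depth + 1) * R := by
  by_contra hξ
  refine hne ?_
  rw [amp, integral_eq_zero_of_ae, mul_zero]
  refine Filter.Eventually.of_forall fun x => ?_
  by_contra hx
  exact hξ (ampIntegrand_support h le_rfl hτ le_rfl hx).1

end STree

end WaveKinetic

/-! ### Duhamel's formula for the amplitudes -/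

namespace WaveKinetic

open PairedGraph (zeroExtend zeroExtend_coe zeroExtend_of_mem)

theorem sigmaFinite_volume_prod {α β : Type*} [MeasureSpace α] [MeasureSpace β]
    [SigmaFinite (volume : Measure α)] [SigmaFinite (volume : Measure β)] :
    SigmaFinite (volume : Measure (α × β)) :=
  inferInstanceAs (SigmaFinite ((volume : Measure α).prod volume))

instance sigmaFinite_volume_prod_pi {ι κ A B : Type*} [Fintype ι] [Fintype κ]
    [MeasureSpace A] [MeasureSpace B] [SigmaFinite (volume : Measure A)]
    [SigmaFinite (volume : Measure B)] :
    SigmaFinite (volume : Measure ((ι → A) × (κ → B))) := sigmaFinite_volume_prod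

namespace STree

variable {d : ℕ} {φ : Space d → ℂ} {B R : ℝ}

theorem integrable_ampIntegrand (h : IsBandLimited φ B R) (ε ω₀ : ℝ) {m : Space d → ℝ}
    (hm : Continuous m) (T : STree) {τ : ℝ} (hτ : 0 ≤ τ) (ξ : Space d) :
    Integrable (T.ampIntegrand ε ω₀ m φ τ ξ) := by
  obtain ⟨C, hC⟩ := exists_norm_ampIntegrand_le h ε ω₀ hm T
  refine integrable_of_bounded (K := T.box d ((T.depth + 1) * R) τ)
    (isCompact_box _ _ _).measure_lt_top.ne ?_ (hC τ ξ)
    fun x hx => (ampIntegrand_support h le_rfl hτ le_rfl hx).2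
  exact measurable_ampIntegrand ε ω₀ hm.measurable (φ := fun _ => φ)
    (h.measurable.comp measurable_snd) T measurable_const measurable_const measurable_id

/-- The time and frequency of the top interaction, and the variables of the two subtrees. -/
def splitTop (σ : ℤˣ) (l r : STree) (d : ℕ) (x : {v // v ∈ (node σ l r).inner} → Space d × ℝ) :
    (ℝ × Space d) × ({v // v ∈ l.inner} → Space d × ℝ) × ({v // v ∈ r.inner} → Space d × ℝ) :=
  ((((splitEquiv σ l r _ x).1.2 + l.topSum fun v => (zeroExtend (splitEquiv σ l r _ x).2.1 v).2),
    (splitEquiv σ l r _ x).1.1), (splitEquiv σ l r _ x).2)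

/-- Up to a permutation of factors, the map is a shear: for fixed variables of the left subtree, the
top slice is translated by the time of that subtree. -/
theorem measurePreserving_splitTop (σ : ℤˣ) (l r : STree) (d : ℕ) :
    MeasurePreserving (splitTop σ l r d) := by
  have hS : Measurable fun x : {v // v ∈ l.inner} → Space d × ℝ =>
      l.topSum fun v => (zeroExtend x v).2 :=
    measurable_topSum _ fun v => (measurable_zeroExtend measurable_id v).snd
  have h1 := volume_preserving_splitEquiv σ l r (Space d × ℝ)
  have h2 : MeasurePreserving (Prod.swap : (Space d × ℝ) × ({v // v ∈ l.inner} → Space d × ℝ) ×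
    ({v // v ∈ r.inner} → Space d × ℝ) → _) volume volume := Measure.measurePreserving_swap
  have : (volume : Measure (Space d × ℝ)).IsAddRightInvariant :=
    inferInstanceAs (((volume : Measure (Space d)).prod (volume : Measure ℝ)).IsAddRightInvariant)
  have h3 : MeasurePreserving (fun p : (({v // v ∈ l.inner} → Space d × ℝ) ×
      ({v // v ∈ r.inner} → Space d × ℝ)) × (Space d × ℝ) =>
      (p.1, p.2 + ((0 : Space d), l.topSum fun v => (zeroExtend p.1.1 v).2))) volume volume := by
    refine MeasurePreserving.skew_product (f := id) (g := fun (x : ({v // v ∈ l.inner} → Space d × ℝ) ×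
      ({v // v ∈ r.inner} → Space d × ℝ)) (a : Space d × ℝ) =>
      a + ((0 : Space d), l.topSum fun v => (zeroExtend x.1 v).2)) (MeasurePreserving.id _) ?_ ?_
    · have := hS.comp (measurable_fst.comp measurable_fst : Measurable fun p :
        (({v // v ∈ l.inner} → Space d × ℝ) ×
        ({v // v ∈ r.inner} → Space d × ℝ)) × (Space d × ℝ) => p.1.1)
      exact measurable_snd.add (measurable_const.prodMk this)
    · exact Filter.Eventually.of_forall fun x => map_add_right_eq_self _ _
  have h4 : MeasurePreserving (Prod.swap : (({v // v ∈ l.inner} → Space d × ℝ) ×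
    ({v // v ∈ r.inner} → Space d × ℝ)) × (Space d × ℝ) → _) volume volume :=
    Measure.measurePreserving_swap
  have h5 : MeasurePreserving (Prod.map (Prod.swap : Space d × ℝ → ℝ × Space d)
      (id : ({v // v ∈ l.inner} → Space d × ℝ) × ({v // v ∈ r.inner} → Space d × ℝ) → _))
      volume volume := MeasurePreserving.prod Measure.measurePreserving_swap (.id _)
  have h := h5.comp (h4.comp (h3.comp (h2.comp h1)))
  have he : splitTop σ l r d = (Prod.map Prod.swap id ∘ Prod.swap ∘
      (fun p : (({v // v ∈ l.inner} → Space d × ℝ) ×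
      ({v // v ∈ r.inner} → Space d × ℝ)) × (Space d × ℝ) =>
        (p.1, p.2 + (0, l.topSum fun v => (zeroExtend p.1.1 v).2))) ∘
          Prod.swap ∘ ⇑(splitEquiv σ l r (Space d × ℝ))) := by
    funext x
    refine Prod.ext (Prod.ext ?_ ?_) rfl <;> simp [splitTop]
  rw [he]
  exact h

/-- The integrand of the amplitude of a tree in the variables given by `splitTop`. -/
def nodeIntegrand (ε ω₀ : ℝ) (m : Space d → ℝ) (φ : Space d → ℂ) (σ : ℤˣ) (l r : STree)
    (τ : ℝ) (ξ : Space d)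
    (q : (ℝ × Space d) × ({v // v ∈ l.inner} → Space d × ℝ) ×
      ({v // v ∈ r.inner} → Space d × ℝ)) : ℂ :=
  ((Set.Icc 0 τ).indicator (fun _ => (1 : ℂ)) q.1.1 *
    (((m (ε • ξ) * m (ε • q.1.2) * m (ε • (ξ - q.1.2)) : ℝ) : ℂ) *
    Complex.exp (-Complex.I * ((q.1.1 *
      phaseMod ω₀ σ (l.parity []) (r.parity []) ξ q.1.2 : ℝ) : ℂ)))) *
    (l.ampIntegrand ε ω₀ m φ q.1.1 q.1.2 q.2.1 *
      r.ampIntegrand ε ω₀ m φ q.1.1 (ξ - q.1.2) q.2.2)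

theorem nodeIntegrand_splitTop (ε ω₀ : ℝ) (m : Space d → ℝ) (φ : Space d → ℂ) (σ : ℤˣ)
    (l r : STree) (τ : ℝ) (ξ : Space d) (x : {v // v ∈ (node σ l r).inner} → Space d × ℝ) :
    nodeIntegrand ε ω₀ m φ σ l r τ ξ (splitTop σ l r d x) =
      (node σ l r).ampIntegrand ε ω₀ m φ τ ξ x := by
  obtain ⟨h0, h1, h2⟩ := zeroExtend_splitEquiv σ l r x
  have h1' : (fun v => (zeroExtend x (false :: v)).2) =
      fun v => (zeroExtend ((splitEquiv σ l r _) x).2.1 v).2 := by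
    rw [← h1]
  simp only [nodeIntegrand, splitTop, ampIntegrand, weight, leafProd, topSum, h0, h1, h2, h1']
  set y := (splitEquiv σ l r _) x
  set S := l.topSum fun v => (zeroExtend y.2.1 v).2
  by_cases hw : l.weight ε ω₀ m (y.1.2 + S) y.1.1 (zeroExtend y.2.1) = 0
  · simp [hw]
  have hS := topSum_nonneg_of_weight hw
  -- Nonnegativity of the top slice means that the left subtree interacts no later than the top
  -- vertex. The weight of the left subtree already enforces this, so in the new variables it is
  -- enough to bound the time of the top interaction.
  have hiff : (y.1.2 + S ∈ Set.Icc 0 τ) ↔ (0 ≤ y.1.2 ∧ y.1.2 + S ≤ τ) := by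
    constructor
    · rintro ⟨ha, hb⟩
      have := (mem_Icc_of_weight hw ha).1
      exact ⟨by linarith, hb⟩
    · rintro ⟨ha, hb⟩
      exact ⟨add_nonneg ha hS, hb⟩
  simp only [Set.indicator_apply, hiff]
  ring

theorem measurable_nodeIntegrand (ε ω₀ : ℝ) {m : Space d → ℝ} (hm : Measurable m)
    (hφ : Measurable φ) (σ : ℤˣ) (l r : STree) (τ : ℝ) (ξ : Space d) :
    Measurable (nodeIntegrand ε ω₀ m φ σ l r τ ξ) := by
  have hφ' : ∀ {A : Type}, ∀ [MeasurableSpace A],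
      Measurable (Function.uncurry fun (_ : A) => φ) := fun {A} _ => hφ.comp measurable_snd
  unfold nodeIntegrand
  refine ((Measurable.comp (measurable_const.indicator measurableSet_Icc)
    measurable_fst.fst).mul (Measurable.mul ?_ ?_)).mul (Measurable.mul ?_ ?_)
  · refine Complex.measurable_ofReal.comp ((measurable_const.mul ?_).mul ?_)
    · exact hm.comp (measurable_fst.snd.const_smul ε)
    · exact hm.comp ((measurable_const.sub measurable_fst.snd).const_smul ε)
  · exact Complex.measurable_exp.comp ((Complex.measurable_ofReal.comp
      (measurable_fst.fst.mul (measurable_phaseMod ω₀ _ _ _ measurable_const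
        measurable_fst.snd))).const_mul _)
  · exact measurable_ampIntegrand ε ω₀ hm (φ := fun _ => φ) hφ' l
      measurable_fst.fst measurable_fst.snd measurable_snd.fst
  · exact measurable_ampIntegrand ε ω₀ hm (φ := fun _ => φ) hφ' r
      measurable_fst.fst (measurable_const.sub measurable_fst.snd) measurable_snd.snd

/-- The recursive structure of the amplitudes: Duhamel's formula at the top vertex. -/
theorem amp_node (h : IsBandLimited φ B R) (ε lam ω₀ : ℝ) {m : Space d → ℝ}
    (hm : Continuous m) (σ : ℤˣ) (l r : STree) {τ : ℝ} (hτ : 0 ≤ τ) (ξ : Space d) :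
    (node σ l r).amp ε lam ω₀ m φ τ ξ =
      -Complex.I * ((unitSign σ * lam * ftConst d : ℝ) : ℂ) * (m (ε • ξ) : ℂ) *
      ∫ s in (0 : ℝ)..τ, ∫ ζ, ((m (ε • ζ) * m (ε • (ξ - ζ)) : ℝ) : ℂ) *
        Complex.exp (-Complex.I * ((s *
          phaseMod ω₀ σ (l.parity []) (r.parity []) ξ ζ : ℝ) : ℂ)) *
        (l.amp ε lam ω₀ m φ s ζ * r.amp ε lam ω₀ m φ s (ξ - ζ)) := by
  have hK := measurable_nodeIntegrand ε ω₀ hm.measurable h.measurable σ l r τ ξ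
  have hmp := measurePreserving_splitTop σ l r d
  have hcomp : nodeIntegrand ε ω₀ m φ σ l r τ ξ ∘ splitTop σ l r d =
      (node σ l r).ampIntegrand ε ω₀ m φ τ ξ :=
    funext fun x => nodeIntegrand_splitTop ε ω₀ m φ σ l r τ ξ x
  have hint : Integrable (nodeIntegrand ε ω₀ m φ σ l r τ ξ) := by
    rw [← hmp.integrable_comp hK.aestronglyMeasurable, hcomp]
    exact integrable_ampIntegrand h ε ω₀ hm _ hτ ξ
  have h1 : ∫ x, (node σ l r).ampIntegrand ε ω₀ m φ τ ξ x =
      ∫ q, nodeIntegrand ε ω₀ m φ σ l r τ ξ q := by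
    rw [← hcomp, ← hmp.map_eq, integral_map hmp.measurable.aemeasurable
      hK.aestronglyMeasurable]
    simp only [Function.comp_def]
  have h2 : ∫ q, nodeIntegrand ε ω₀ m φ σ l r τ ξ q = ∫ q : ℝ × Space d,
      ∫ x, nodeIntegrand ε ω₀ m φ σ l r τ ξ (q, x) := integral_prod _ hint
  have h3 : Integrable (fun q : ℝ × Space d => ∫ x, nodeIntegrand ε ω₀ m φ σ l r τ ξ (q, x)) :=
    hint.integral_prod_left
  have h4 : ∀ q : ℝ × Space d, ∫ x, nodeIntegrand ε ω₀ m φ σ l r τ ξ (q, x) =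
      ((Set.Icc 0 τ).indicator (fun _ => (1 : ℂ)) q.1 *
    (((m (ε • ξ) * m (ε • q.2) * m (ε • (ξ - q.2)) : ℝ) : ℂ) *
    Complex.exp (-Complex.I * ((q.1 *
      phaseMod ω₀ σ (l.parity []) (r.parity []) ξ q.2 : ℝ) : ℂ)))) *
    ((∫ x, l.ampIntegrand ε ω₀ m φ q.1 q.2 x) *
      ∫ x, r.ampIntegrand ε ω₀ m φ q.1 (ξ - q.2) x) := by
    intro q
    simp only [nodeIntegrand]
    rw [integral_const_mul]
    congr 1
    exact integral_prod_mul (L := ℂ) _ _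
  have h5 : ∫ q : ℝ × Space d, ∫ x, nodeIntegrand ε ω₀ m φ σ l r τ ξ (q, x) =
      ∫ s, ∫ ζ, ∫ x, nodeIntegrand ε ω₀ m φ σ l r τ ξ ((s, ζ), x) := integral_prod _ h3
  rw [amp, coef, h1, h2, h5]
  simp only [h4]
  have h6 : ∀ s, (∫ ζ, ((Set.Icc 0 τ).indicator (fun _ => (1 : ℂ)) s *
    (((m (ε • ξ) * m (ε • ζ) * m (ε • (ξ - ζ)) : ℝ) : ℂ) *
    Complex.exp (-Complex.I * ((s *
      phaseMod ω₀ σ (l.parity []) (r.parity []) ξ ζ : ℝ) : ℂ)))) *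
    ((∫ x, l.ampIntegrand ε ω₀ m φ s ζ x) *
      ∫ x, r.ampIntegrand ε ω₀ m φ s (ξ - ζ) x)) = (Set.Icc 0 τ).indicator (fun s => (m (ε • ξ) : ℂ) *
      ∫ ζ, ((m (ε • ζ) * m (ε • (ξ - ζ)) : ℝ) : ℂ) *
        Complex.exp (-Complex.I * ((s *
          phaseMod ω₀ σ (l.parity []) (r.parity []) ξ ζ : ℝ) : ℂ)) *
        ((∫ x, l.ampIntegrand ε ω₀ m φ s ζ x) *
      ∫ x, r.ampIntegrand ε ω₀ m φ s (ξ - ζ) x)) s := by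
    intro s
    by_cases hs : s ∈ Set.Icc 0 τ
    · simp only [Set.indicator_of_mem hs, one_mul]
      rw [← integral_const_mul]
      congr 1
      funext ζ
      push_cast
      ring
    · simp only [Set.indicator_of_notMem hs, zero_mul, integral_zero]
  simp only [h6]
  rw [integral_indicator measurableSet_Icc, integral_Icc_eq_integral_Ioc,
    ← intervalIntegral.integral_of_le hτ, intervalIntegral.integral_const_mul]
  rw [mul_assoc (-Complex.I * ((unitSign σ * lam * ftConst d : ℝ) : ℂ)),
    mul_assoc (-Complex.I * ((unitSign σ * lam * ftConst d : ℝ) : ℂ)), mul_left_comm _ (m (ε • ξ) : ℂ),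
    ← intervalIntegral.integral_const_mul]
  congr 3
  funext s
  rw [← integral_const_mul]
  congr 1
  funext ζ
  simp only [amp]
  ring

theorem parity_flip (T : STree) : T.flip.parity [] = -T.parity [] := by
  cases T <;> rfl

theorem leafField_neg (φ : Space d → ℂ) (σ : ℤˣ) (ξ : Space d) :
    leafField φ (-σ) ξ = starRingEnd ℂ (leafField φ σ (-ξ)) := by
  rcases Int.units_eq_one_or σ with rfl | rfl <;> simp [leafField]

theorem unitSign_neg (σ : ℤˣ) : unitSign (-σ) = -unitSign σ := by simp [unitSign]

theorem disp_neg (ω₀ : ℝ) (ξ : Space d) : disp ω₀ (-ξ) = disp ω₀ ξ := by simp [disp]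

/-- Flipping the parities of a tree amounts to complex conjugation. -/
theorem amp_flip (h : IsBandLimited φ B R) (ε lam ω₀ : ℝ) {m : Space d → ℝ}
    (hm : Continuous m) (heven : ∀ ξ, m (-ξ) = m ξ) (T : STree) {τ : ℝ} (hτ : 0 ≤ τ) (ξ : Space d) :
    T.flip.amp ε lam ω₀ m φ τ ξ = starRingEnd ℂ (T.amp ε lam ω₀ m φ τ (-ξ)) := by
  induction T generalizing τ ξ with
  | leaf σ => rw [flip, amp_leaf, amp_leaf, leafField_neg]
  | node σ l r hl hr =>
    rw [flip, amp_node h ε lam ω₀ hm _ _ _ hτ, amp_node h ε lam ω₀ hm _ _ _ hτ]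
    simp only [map_mul, map_neg, Complex.conj_I, Complex.conj_ofReal, unitSign_neg, smul_neg, heven]
    rw [intervalIntegral.integral_of_le hτ, intervalIntegral.integral_of_le hτ, ← integral_conj]
    rw [show -Complex.I * (((-unitSign σ * lam * ftConst d : ℝ)) : ℂ) =
      -(-Complex.I) * ((unitSign σ * lam * ftConst d : ℝ) : ℂ) by push_cast; ring]
    congr 1
    refine setIntegral_congr_fun measurableSet_Ioc fun s hs => ?_
    -- Conjugation reflects the outer frequency; reflecting the integration variable as well
    -- restores the form of the integrand, as `m` and the dispersion relation are even.
    rw [← integral_conj, ← integral_neg_eq_self]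
    congr 1
    funext ζ
    simp only [map_mul, Complex.conj_ofReal, ← Complex.exp_conj, map_neg, Complex.conj_I]
    have e1 : -ξ - ζ = -(ξ - -ζ) := by abel
    rw [hl hs.1.le, hr hs.1.le, e1, neg_neg, smul_neg, smul_neg, heven, heven, parity_flip,
      parity_flip]
    congr 2
    congr 1
    simp only [phaseMod, unitSign_neg, disp_neg, e1]
    push_cast
    ring

end STree

end WaveKinetic

/-! ### Expansion of the iterates over interaction graphs -/

namespace WaveKinetic

open STree

variable {d : ℕ} {φ : Space d → ℂ} {B R : ℝ}

/-- The integrand of Duhamel's formula for the amplitudes. -/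
def duhamelKernel (ε lam ω₀ : ℝ) (m : Space d → ℝ) (φ : Space d → ℂ) (l r : STree) (ξ : Space d)
    (s : ℝ) (ζ : Space d) : ℂ :=
  ((m (ε • ζ) * m (ε • (ξ - ζ)) : ℝ) : ℂ) *
    Complex.exp (-Complex.I * ((s * phaseMod ω₀ 1 (l.parity []) (r.parity []) ξ ζ : ℝ) : ℂ)) *
    (l.amp ε lam ω₀ m φ s ζ * r.amp ε lam ω₀ m φ s (ξ - ζ))

theorem measurable_duhamelKernel (ε lam ω₀ : ℝ) {m : Space d → ℝ} (hm : Measurable m)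
    (hφ : Measurable φ) (l r : STree) (ξ : Space d) :
    Measurable (Function.uncurry (duhamelKernel ε lam ω₀ m φ l r ξ)) := by
  refine (Measurable.mul ?_ ?_).mul (Measurable.mul ?_ ?_)
  · exact Complex.measurable_ofReal.comp ((hm.comp (measurable_snd.const_smul ε)).mul
      (hm.comp ((measurable_const.sub measurable_snd).const_smul ε)))
  · exact Complex.measurable_exp.comp ((Complex.measurable_ofReal.comp
      (measurable_fst.mul (measurable_phaseMod ω₀ _ _ _ measurable_const
        measurable_snd))).const_mul _)
  · exact measurable_amp ε lam ω₀ hm hφ l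
  · exact (measurable_amp ε lam ω₀ hm hφ r).comp
      (measurable_fst.prodMk (measurable_const.sub measurable_snd))

/-- The bound and the ball are uniform in `s` on the time interval, which serves the integrability
in `ζ` as well as in `s`. The ball is that of the left amplitude alone. -/
theorem exists_duhamelKernel_bound (h : IsBandLimited φ B R) (ε lam ω₀ : ℝ) {m : Space d → ℝ}
    (hm : Continuous m) (l r : STree) (ξ : Space d) (t : ℝ) :
    ∃ C L, ∀ s ∈ Set.Icc 0 t, ∀ ζ, ‖duhamelKernel ε lam ω₀ m φ l r ξ s ζ‖ ≤ C ∧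
      (duhamelKernel ε lam ω₀ m φ l r ξ s ζ ≠ 0 → ζ ∈ Metric.closedBall (0 : Space d) L) := by
  obtain ⟨Cl, hCl⟩ := exists_norm_amp_le h ε lam ω₀ hm l t
  obtain ⟨Cr, hCr⟩ := exists_norm_amp_le h ε lam ω₀ hm r t
  set L := (l.depth + 1) * R
  obtain ⟨M, hM⟩ := (isCompact_closedBall (0 : Space d) L).exists_bound_of_continuousOn
    (f := fun ζ => m (ε • ζ) * m (ε • (ξ - ζ))) (by fun_prop)
  have hsupp : ∀ s ∈ Set.Icc 0 t, ∀ ζ, duhamelKernel ε lam ω₀ m φ l r ξ s ζ ≠ 0 →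
      ζ ∈ Metric.closedBall (0 : Space d) L := by
    intro s hs ζ hne
    rw [duhamelKernel, mul_ne_zero_iff, mul_ne_zero_iff (a := l.amp _ _ _ _ _ _ _)] at hne
    simpa using norm_le_of_amp h hs.1 hne.2.1
  refine ⟨|M| * (|Cl| * |Cr|), L, fun s hs ζ => ⟨?_, hsupp s hs ζ⟩⟩
  by_cases hne : duhamelKernel ε lam ω₀ m φ l r ξ s ζ = 0
  · rw [hne, norm_zero]; positivity
  have h1 := hM ζ (hsupp s hs ζ hne)
  rw [duhamelKernel, norm_mul, norm_mul, norm_mul, norm_exp_neg_I, mul_one, Complex.norm_real]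
  gcongr
  · exact h1.trans (le_abs_self _)
  · exact (hCl s ζ hs.1 hs.2).trans (le_abs_self _)
  · exact (hCr s _ hs.1 hs.2).trans (le_abs_self _)

theorem integrable_duhamelKernel (h : IsBandLimited φ B R) (ε lam ω₀ : ℝ) {m : Space d → ℝ}
    (hm : Continuous m) (l r : STree) (ξ : Space d) {s : ℝ} (hs : 0 ≤ s) :
    Integrable (duhamelKernel ε lam ω₀ m φ l r ξ s) := by
  obtain ⟨C, L, hC⟩ := exists_duhamelKernel_bound h ε lam ω₀ hm l r ξ s
  exact integrable_of_bounded (isCompact_closedBall (0 : Space d) L).measure_lt_top.ne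
    (measurable_duhamelKernel ε lam ω₀ hm.measurable h.measurable l r ξ).of_uncurry_left
    (fun ζ => (hC s ⟨hs, le_rfl⟩ ζ).1) fun ζ => (hC s ⟨hs, le_rfl⟩ ζ).2

theorem intervalIntegrable_duhamelKernel (h : IsBandLimited φ B R) (ε lam ω₀ : ℝ)
    {m : Space d → ℝ} (hm : Continuous m) (l r : STree) (ξ : Space d) {t : ℝ} (ht : 0 ≤ t) :
    IntervalIntegrable (fun s => ∫ ζ, duhamelKernel ε lam ω₀ m φ l r ξ s ζ) volume 0 t := by
  obtain ⟨C, L, hC⟩ := exists_duhamelKernel_bound h ε lam ω₀ hm l r ξ t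
  rw [intervalIntegrable_iff_integrableOn_Icc_of_le ht]
  refine Measure.integrableOn_of_bounded (M := C * volume.real (Metric.closedBall (0 : Space d) L))
    isCompact_Icc.measure_lt_top.ne
    (measurable_duhamelKernel ε lam ω₀ hm.measurable h.measurable l r
      ξ).stronglyMeasurable.integral_prod_right.aestronglyMeasurable ?_
  filter_upwards [ae_restrict_mem measurableSet_Icc] with s hs
  rw [← setIntegral_eq_integral_of_forall_compl_eq_zero (s := Metric.closedBall (0 : Space d) L)]
  · exact norm_setIntegral_le_of_norm_le_const (isCompact_closedBall _ _).measure_lt_top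
      fun ζ _ => (hC s hs ζ).1
  · intro ζ hζ
    by_contra hne
    exact hζ ((hC s hs ζ).2 hne)

theorem sum_parity_neg {M : Type*} [AddCommMonoid M] (n : ℕ) (f : STree → M) :
    ∑ T ∈ ofDepth n with T.parity [] = 1, f T.flip =
      ∑ T ∈ ofDepth n with ¬ T.parity [] = 1, f T := by
  refine Finset.sum_bij' (fun T _ => T.flip) (fun T _ => T.flip) ?_ ?_ ?_ ?_ ?_
  · intro T hT
    rw [Finset.mem_filter, mem_ofDepth] at hT ⊢
    rw [depth_flip, parity_flip, hT.2]
    exact ⟨hT.1, by decide⟩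
  · intro T hT
    rw [Finset.mem_filter, mem_ofDepth] at hT ⊢
    rw [depth_flip, parity_flip, (Int.units_eq_one_or _).resolve_left hT.2]
    exact ⟨hT.1, by decide⟩
  · intro T _; exact flip_flip T
  · intro T _; exact flip_flip T
  · intro T _; rfl

/-- The Fourier transform of `u + ū` is the sum over all the trees, whatever their top parity. -/
theorem symPart_eq_sum (h : IsBandLimited φ B R) (ε lam ω₀ : ℝ) {m : Space d → ℝ}
    (hm : Continuous m) (heven : ∀ ξ, m (-ξ) = m ξ) {n : ℕ} {s : ℝ} (hs : 0 ≤ s)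
    {U : Space d → ℂ} (hU : ∀ ξ, U ξ = Complex.exp (Complex.I * ((s * disp ω₀ ξ : ℝ) : ℂ)) *
      ∑ T ∈ ofDepth n with T.parity [] = 1, T.amp ε lam ω₀ m φ s ξ) (ζ : Space d) :
    symPart U ζ = ∑ T ∈ ofDepth n,
      Complex.exp (Complex.I * ((s * (unitSign (T.parity []) * disp ω₀ ζ) : ℝ) : ℂ)) *
        T.amp ε lam ω₀ m φ s ζ := by
  rw [symPart, hU, hU, ← Finset.sum_filter_add_sum_filter_not (ofDepth n)
    (fun T => T.parity [] = 1), map_mul, map_sum, ← sum_parity_neg, disp_neg, Finset.mul_sum,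
    Finset.mul_sum]
  congr 1
  · refine Finset.sum_congr rfl fun T hT => ?_
    rw [(Finset.mem_filter.1 hT).2]
    simp [unitSign]
  · refine Finset.sum_congr rfl fun T hT => ?_
    rw [amp_flip h ε lam ω₀ hm heven T hs, parity_flip, (Finset.mem_filter.1 hT).2,
      ← Complex.exp_conj]
    simp [unitSign]

/-- The Duhamel expansion of the iterates over the interaction graphs. -/
theorem profile_eq_sum_amp (h : IsBandLimited φ B R) (ε lam ω₀ : ℝ) {m : Space d → ℝ}
    (hm : Continuous m) (heven : ∀ ξ, m (-ξ) = m ξ) (n : ℕ) {t : ℝ} (ht : 0 ≤ t) (ξ : Space d) :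
    profile ε lam ω₀ m φ n t ξ = Complex.exp (Complex.I * ((t * disp ω₀ ξ : ℝ) : ℂ)) *
      ∑ T ∈ ofDepth n with T.parity [] = 1, T.amp ε lam ω₀ m φ t ξ := by
  induction n using Nat.strong_induction_on generalizing t ξ with
  | _ n ih =>
  rcases n with _ | n
  · rw [profile, ofDepth, Finset.sum_filter]
    simp [amp_leaf, leafField, parity]
  · rw [profile]
    beta_reduce
    have h1 : ∀ s ∈ Set.uIcc 0 t, Complex.exp (Complex.I * (((t - s) * disp ω₀ ξ : ℝ) : ℂ)) *
        ∑ j : Fin (n + 1), prodFT ε m (profile ε lam ω₀ m φ j s)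
          (profile ε lam ω₀ m φ (n - j) s) ξ =
        Complex.exp (Complex.I * ((t * disp ω₀ ξ : ℝ) : ℂ)) * ((ftConst d * m (ε • ξ) : ℝ) : ℂ) *
          ∑ j : Fin (n + 1), ∑ l ∈ ofDepth j, ∑ r ∈ ofDepth (n - j),
            ∫ ζ, duhamelKernel ε lam ω₀ m φ l r ξ s ζ := by
      intro s hs
      rw [Set.uIcc_of_le ht] at hs
      rw [phase_sub, mul_assoc, mul_assoc]
      congr 1
      rw [Finset.mul_sum, Finset.mul_sum]
      refine Finset.sum_congr rfl fun j _ => ?_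
      rw [prodFT, mul_left_comm]
      congr 1
      have hk := fun l r => integrable_duhamelKernel h ε lam ω₀ hm l r ξ hs.1
      have hsum : ∑ l ∈ ofDepth j, ∑ r ∈ ofDepth (n - j),
            ∫ ζ, duhamelKernel ε lam ω₀ m φ l r ξ s ζ = ∫ ζ, ∑ l ∈ ofDepth j,
              ∑ r ∈ ofDepth (n - j), duhamelKernel ε lam ω₀ m φ l r ξ s ζ := by
        rw [integral_finsetSum _ fun l _ => integrable_finsetSum _ fun r _ => hk l r]
        refine Finset.sum_congr rfl fun l _ => ?_
        rw [integral_finsetSum _ fun r _ => hk l r]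
      rw [hsum, ← integral_const_mul]
      congr 1
      funext ζ
      rw [symPart_eq_sum h ε lam ω₀ hm heven hs.1 (fun ξ => ih j (by omega) hs.1 ξ),
        symPart_eq_sum h ε lam ω₀ hm heven hs.1 (fun ξ => ih (n - j) (by omega) hs.1 ξ),
        Finset.sum_mul_sum, Finset.mul_sum, Finset.mul_sum]
      refine Finset.sum_congr rfl fun l _ => ?_
      rw [Finset.mul_sum, Finset.mul_sum]
      refine Finset.sum_congr rfl fun r _ => ?_
      rw [duhamelKernel]
      -- The free phases carried by the two inputs and the outgoing propagator at time `s` combine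
      -- into the resonance modulus, leaving the outgoing phase at time `t` outside.
      have he : Complex.exp (-Complex.I *
          ((s * phaseMod ω₀ 1 (l.parity []) (r.parity []) ξ ζ : ℝ) : ℂ)) =
          Complex.exp (Complex.I * ((-s * disp ω₀ ξ : ℝ) : ℂ)) *
          (Complex.exp (Complex.I * ((s * (unitSign (l.parity []) * disp ω₀ ζ) : ℝ) : ℂ)) *
          Complex.exp (Complex.I * ((s * (unitSign (r.parity []) * disp ω₀ (ξ - ζ)) : ℝ) : ℂ))) := by
        rw [← Complex.exp_add, ← Complex.exp_add, phaseMod]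
        congr 1
        simp only [unitSign]
        push_cast
        ring
      rw [he]
      ring
    have h2 : ∀ l r, IntervalIntegrable (fun s => ∫ ζ, duhamelKernel ε lam ω₀ m φ l r ξ s ζ)
        volume 0 t := fun l r => intervalIntegrable_duhamelKernel h ε lam ω₀ hm l r ξ ht
    have h3 : (∫ s in (0 : ℝ)..t, ∑ j : Fin (n + 1), ∑ l ∈ ofDepth j, ∑ r ∈ ofDepth (n - j),
        ∫ ζ, duhamelKernel ε lam ω₀ m φ l r ξ s ζ) = ∑ j : Fin (n + 1), ∑ l ∈ ofDepth j,
          ∑ r ∈ ofDepth (n - j), ∫ s in (0 : ℝ)..t,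
            ∫ ζ, duhamelKernel ε lam ω₀ m φ l r ξ s ζ := by
      have h4 : ∀ (j : Fin (n + 1)) l, IntervalIntegrable (fun s => ∑ r ∈ ofDepth (n - j),
          ∫ ζ, duhamelKernel ε lam ω₀ m φ l r ξ s ζ) volume 0 t := by
        intro j l
        have := IntervalIntegrable.sum (ofDepth (n - j)) fun r _ => h2 l r
        simpa only [Finset.sum_fn] using this
      have h5 : ∀ (j : Fin (n + 1)), IntervalIntegrable (fun s => ∑ l ∈ ofDepth j,
          ∑ r ∈ ofDepth (n - j), ∫ ζ, duhamelKernel ε lam ω₀ m φ l r ξ s ζ) volume 0 t := by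
        intro j
        have := IntervalIntegrable.sum (ofDepth j) fun l _ => h4 j l
        simpa only [Finset.sum_fn] using this
      rw [intervalIntegral.integral_finsetSum fun j _ => h5 j]
      refine Finset.sum_congr rfl fun j _ => ?_
      rw [intervalIntegral.integral_finsetSum fun l _ => h4 j l]
      refine Finset.sum_congr rfl fun l _ => ?_
      rw [intervalIntegral.integral_finsetSum fun r _ => h2 l r]
    rw [intervalIntegral.integral_congr h1, intervalIntegral.integral_const_mul, h3,
      Finset.sum_filter, sum_ofDepth_succ, mul_assoc, ← mul_assoc, mul_left_comm, mul_assoc]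
    congr 1
    rw [mul_left_comm, ← mul_assoc, Finset.mul_sum]
    refine Finset.sum_congr rfl fun j _ => ?_
    -- The top parity is fixed to `+1`, while the two subtrees run over trees of either parity, as
    -- `symPart` requires.
    rw [Finset.sum_eq_single (1 : ℤˣ) (fun σ _ hσ => by simp [parity, hσ]) (by simp),
      Finset.mul_sum]
    refine Finset.sum_congr rfl fun l _ => ?_
    rw [Finset.mul_sum]
    refine Finset.sum_congr rfl fun r _ => ?_
    rw [if_pos (by rfl), amp_node h ε lam ω₀ hm _ _ _ ht]
    simp only [duhamelKernel]
    congr 1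
    simp only [unitSign]
    push_cast
    ring

/-- The density of the iterates is a sum over pairs of interaction graphs. -/
theorem norm_profile_sq (h : IsBandLimited φ B R) (ε lam ω₀ : ℝ) {m : Space d → ℝ}
    (hm : Continuous m) (heven : ∀ ξ, m (-ξ) = m ξ) (n : ℕ) {t : ℝ} (ht : 0 ≤ t) (ξ : Space d) :
    ((‖profile ε lam ω₀ m φ n t ξ‖ ^ 2 : ℝ) : ℂ) =
      ∑ Gl : InteractionGraph n, ∑ Gr : InteractionGraph n,
        Gl.1.flip.amp ε lam ω₀ m φ t (-ξ) * Gr.1.amp ε lam ω₀ m φ t ξ := by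
  have hsum : ∑ T ∈ ofDepth n with T.parity [] = 1, T.amp ε lam ω₀ m φ t ξ =
      ∑ G : InteractionGraph n, G.1.amp ε lam ω₀ m φ t ξ :=
    (sum_interactionGraph n fun T => T.amp ε lam ω₀ m φ t ξ).symm
  rw [profile_eq_sum_amp h ε lam ω₀ hm heven n ht, norm_mul,
    show Complex.I * ((t * disp ω₀ ξ : ℝ) : ℂ) = ((t * disp ω₀ ξ : ℝ) : ℂ) * Complex.I by ring,
    Complex.norm_exp_ofReal_mul_I, one_mul, Complex.ofReal_pow, ← Complex.conj_mul', hsum, map_sum,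
    Finset.sum_mul_sum]
  refine Finset.sum_congr rfl fun Gl _ => Finset.sum_congr rfl fun Gr _ => ?_
  rw [amp_flip h ε lam ω₀ hm heven _ ht, neg_neg]

end WaveKinetic

namespace WaveKinetic

/-! ### The Wick formula -/

/-- The identity or the complex conjugation, according to the parity. -/
def signConj (σ : ℤˣ) : ℂ →L[ℝ] ℂ :=
  if σ = 1 then ContinuousLinearMap.id ℝ ℂ else Complex.conjCLE.toContinuousLinearMap

theorem signConj_one (z : ℂ) : signConj 1 z = z := rfl

theorem signConj_neg_one (z : ℂ) : signConj (-1) z = starRingEnd ℂ z := by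
  rw [signConj, if_neg (by decide)]
  rfl

theorem norm_signConj (σ : ℤˣ) (z : ℂ) : ‖signConj σ z‖ = ‖z‖ := by
  rcases Int.units_eq_one_or σ with rfl | rfl
  · rfl
  · rw [signConj_neg_one, RCLike.norm_conj]

/-- The factor of the product measure that involves two independent copies of a random variable,
mixed by a rotation. -/
def mixed {Ω : Type*} (X : Ω → ℂ) (θ : ℝ) (q : Ω × Ω) : ℂ :=
  (Real.cos θ : ℂ) * X q.1 + (Real.sin θ : ℂ) * X q.2

/-- The derivative of `mixed` in the angle. -/
def mixedDeriv {Ω : Type*} (X : Ω → ℂ) (θ : ℝ) (q : Ω × Ω) : ℂ :=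
  -(Real.sin θ : ℂ) * X q.1 + (Real.cos θ : ℂ) * X q.2

/-- The consequence of the rotation invariance of centred Gaussian families that yields the
Wick formula. -/
def IsRotationInvariant {ι Ω : Type*} [MeasurableSpace Ω] (P : Measure Ω) (X : ι → Ω → ℂ) : Prop :=
  ∀ (κ : Type) [Fintype κ] (c : κ → ι) (a : ι) (θ : ℝ),
    ∫ q, mixedDeriv (X a) θ q * ∏ j, mixed (X (c j)) θ q ∂(P.prod P) = 0

/-- A rotation does not change the law of two independent copies of a centred Gaussian vector. So
the rotated family and its angular derivative are again distributed like independent copies, and the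
single derivative factor has mean zero. -/
theorem isRotationInvariant_of_gaussian {T Ω : Type*} [MeasurableSpace Ω] {P : Measure Ω}
    [IsProbabilityMeasure P] {X : T → Ω → ℂ} (hX : IsGaussianProcess X P)
    (hmeas : ∀ x, Measurable (X x)) (hmean : ∀ x, ∫ ω, X x ω ∂P = 0) :
    IsRotationInvariant P fun (i : ℤˣ × T) ω => signConj i.1 (X i.2 ω) := by
  classical
  intro κ _ c a θ
  -- Only finitely many points occur, so a finite-dimensional Gaussian law suffices. Parities act by
  -- real linear maps, which commute with the rotation.
  set I : Finset T := insert a.2 (Finset.univ.image fun j => (c j).2)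
  set Z : Ω → (I → ℂ) := fun ω => I.restrict (X · ω)
  have hZ : Measurable Z := measurable_pi_lambda _ fun i => hmeas i.1
  have hg : IsGaussian (P.map Z) := (hX.hasGaussianLaw I).isGaussian_map
  set μ := P.map Z
  have : IsProbabilityMeasure μ := Measure.isProbabilityMeasure_map hZ.aemeasurable
  have ha : a.2 ∈ I := Finset.mem_insert_self _ _
  have hc : ∀ j, (c j).2 ∈ I := fun j =>
    Finset.mem_insert_of_mem (Finset.mem_image_of_mem _ (Finset.mem_univ j))
  set La : (I → ℂ) →L[ℝ] ℂ := (signConj a.1).comp (ContinuousLinearMap.proj ⟨a.2, ha⟩)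
  set L : κ → (I → ℂ) →L[ℝ] ℂ := fun j => (signConj (c j).1).comp
    (ContinuousLinearMap.proj ⟨(c j).2, hc j⟩)
  have hmean0 : ∀ x : I, ∫ z, z x ∂μ = 0 := by
    intro x
    rw [integral_map hZ.aemeasurable (by fun_prop : Measurable fun z : I → ℂ => z x).aestronglyMeasurable]
    exact hmean x.1
  have hid : μ[id] = 0 := by
    funext x
    have h1 : Integrable (id : (I → ℂ) → (I → ℂ)) μ := IsGaussian.integrable_id
    have h2 := (ContinuousLinearMap.proj (R := ℝ) (φ := fun _ : I => ℂ) x).integral_comp_comm h1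
    simp only [ContinuousLinearMap.proj_apply, id] at h2
    rw [Pi.zero_apply, ← hmean0 x, h2]
    rfl
  have hLa : ∫ z, La z ∂μ = 0 := by
    have h1 : Integrable (id : (I → ℂ) → (I → ℂ)) μ := IsGaussian.integrable_id
    have h2 := La.integral_comp_comm h1
    simp only [id] at h2
    rw [h2]
    have : ∫ z, z ∂μ = 0 := hid
    rw [this, map_zero]
  set G : (I → ℂ) × (I → ℂ) → ℂ := fun z => La z.2 * ∏ j, L j z.1
  have hG : Measurable G := by
    refine Continuous.measurable ?_
    fun_prop
  have hrot := IsGaussian.map_rotation_eq_self hid θ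
  -- Before the rotation, the integrand is a product of functions of the two independent components,
  -- one factor being linear and centred.
  have h1 : ∫ z, G z ∂(μ.prod μ) = 0 := by
    simp only [G, mul_comm (La _)]
    exact (integral_prod_mul (L := ℂ) (fun x => ∏ j, L j x) fun y => La y).trans
      (by rw [hLa, mul_zero])
  have hmap : (P.prod P).map (Prod.map Z Z) = μ.prod μ := (Measure.map_prod_map P P hZ hZ).symm
  have hGR : Measurable fun z => G (ContinuousLinearMap.rotation θ z) :=
    hG.comp (ContinuousLinearMap.continuous _).measurable
  rw [← hrot, integral_map (by fun_prop) hG.aestronglyMeasurable, ← hmap,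
    integral_map (hZ.prodMap hZ).aemeasurable hGR.aestronglyMeasurable] at h1
  rw [← h1]
  congr 1
  funext q
  have hsc : ∀ σ (r : ℝ) (z : ℂ), signConj σ ((r : ℂ) * z) = r * signConj σ z := by
    intro σ r z
    rw [← Complex.real_smul, map_smul, Complex.real_smul]
  simp only [G, ContinuousLinearMap.rotation_apply, La, L, ContinuousLinearMap.comp_apply,
    ContinuousLinearMap.proj_apply, mixed, mixedDeriv, Prod.map_fst, Prod.map_snd, Pi.add_apply,
    Pi.smul_apply, map_add, Complex.real_smul, hsc]
  rw [Complex.ofReal_neg]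
  rfl

/-! #### Integration by parts -/

section Stein

variable {ι Ω : Type*} {X : ι → Ω → ℂ} {Y : Ω → ℝ}

theorem norm_mixed_le (hY : ∀ i ω, ‖X i ω‖ ≤ Y ω) (i : ι) (θ : ℝ) (q : Ω × Ω) :
    ‖mixed (X i) θ q‖ ≤ Y q.1 + Y q.2 := by
  refine (norm_add_le _ _).trans (add_le_add ?_ ?_) <;>
  rw [norm_mul, Complex.norm_real, Real.norm_eq_abs]
  · exact (mul_le_of_le_one_left (norm_nonneg _) (Real.abs_cos_le_one θ)).trans (hY _ _)
  · exact (mul_le_of_le_one_left (norm_nonneg _) (Real.abs_sin_le_one θ)).trans (hY _ _)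

theorem norm_mixedDeriv_le (hY : ∀ i ω, ‖X i ω‖ ≤ Y ω) (i : ι) (θ : ℝ) (q : Ω × Ω) :
    ‖mixedDeriv (X i) θ q‖ ≤ Y q.1 + Y q.2 := by
  refine (norm_add_le _ _).trans (add_le_add ?_ ?_) <;>
  simp only [norm_mul, norm_neg, Complex.norm_real, Real.norm_eq_abs]
  · exact (mul_le_of_le_one_left (norm_nonneg _) (Real.abs_sin_le_one θ)).trans (hY _ _)
  · exact (mul_le_of_le_one_left (norm_nonneg _) (Real.abs_cos_le_one θ)).trans (hY _ _)

theorem hasDerivAt_mixed (x : Ω → ℂ) (θ : ℝ) (q : Ω × Ω) :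
    HasDerivAt (fun θ => mixed x θ q) (mixedDeriv x θ q) θ := by
  have h1 := ((Real.hasDerivAt_cos θ).ofReal_comp.mul_const (x q.1)).add
    ((Real.hasDerivAt_sin θ).ofReal_comp.mul_const (x q.2))
  exact h1.congr_deriv (by simp [mixedDeriv])

theorem hasDerivAt_mixedDeriv (x : Ω → ℂ) (θ : ℝ) (q : Ω × Ω) :
    HasDerivAt (fun θ => mixedDeriv x θ q) (-mixed x θ q) θ := by
  have h1 := ((Real.hasDerivAt_sin θ).ofReal_comp.neg.mul_const (x q.1)).add
    ((Real.hasDerivAt_cos θ).ofReal_comp.mul_const (x q.2))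
  exact h1.congr_deriv (by simp [mixed]; ring)

variable [MeasurableSpace Ω] {P : Measure Ω}

theorem integrable_prod_of_le (hXm : ∀ i, Measurable (X i)) (hY : ∀ i ω, ‖X i ω‖ ≤ Y ω)
    (hYp : ∀ k : ℕ, Integrable (fun ω => Y ω ^ k) P) {κ : Type*} (s : Finset κ) (c : κ → ι) :
    Integrable (fun ω => ∏ j ∈ s, X (c j) ω) P := by
  refine (hYp s.card).mono' (Finset.measurable_fun_prod _ fun j _ => hXm _).aestronglyMeasurable
    (Filter.Eventually.of_forall fun ω => ?_)
  rw [norm_prod]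
  exact (Finset.prod_le_prod (fun _ _ => norm_nonneg _) fun j _ => hY _ _).trans (by simp)

variable [IsProbabilityMeasure P]

theorem integrable_add_pow (hY0 : ∀ ω, 0 ≤ Y ω) (hYm : Measurable Y)
    (hYp : ∀ k : ℕ, Integrable (fun ω => Y ω ^ k) P) (k : ℕ) :
    Integrable (fun q : Ω × Ω => (Y q.1 + Y q.2) ^ k) (P.prod P) := by
  have h1 : Integrable (fun q : Ω × Ω => 2 ^ (k - 1) * (Y q.1 ^ k + Y q.2 ^ k)) (P.prod P) :=
    (((hYp k).comp_fst P).add ((hYp k).comp_snd P)).const_mul _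
  refine h1.mono' (by fun_prop) (Filter.Eventually.of_forall fun q => ?_)
  rw [Real.norm_of_nonneg (pow_nonneg (add_nonneg (hY0 _) (hY0 _)) _)]
  exact add_pow_le (hY0 _) (hY0 _) k

theorem measurable_mixed {x : Ω → ℂ} (hx : Measurable x) (θ : ℝ) : Measurable (mixed x θ) := by
  unfold mixed; fun_prop

theorem measurable_mixedDeriv {x : Ω → ℂ} (hx : Measurable x) (θ : ℝ) :
    Measurable (mixedDeriv x θ) := by
  unfold mixedDeriv; fun_prop

/-- Integration by parts for a rotation invariant family. -/
theorem IsRotationInvariant.integral_mul_prod (hX : IsRotationInvariant P X)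
    (hXm : ∀ i, Measurable (X i)) (hY : ∀ i ω, ‖X i ω‖ ≤ Y ω) (hY0 : ∀ ω, 0 ≤ Y ω)
    (hYm : Measurable Y) (hYp : ∀ k : ℕ, Integrable (fun ω => Y ω ^ k) P)
    {κ : Type} [Fintype κ] [DecidableEq κ] (c : κ → ι) (a : ι) :
    ∫ ω, X a ω * ∏ j, X (c j) ω ∂P =
      ∑ j, (∫ ω, X a ω * X (c j) ω ∂P) * ∫ ω, ∏ i ∈ Finset.univ.erase j, X (c i) ω ∂P := by
  -- The derivative in the angle of the integrand in `IsRotationInvariant`, by the product rule and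
  -- because a second derivative of a rotation is minus the identity.
  set D : ℝ → Ω × Ω → ℂ := fun θ q => -mixed (X a) θ q * ∏ j, mixed (X (c j)) θ q +
    mixedDeriv (X a) θ q * ∑ j, (∏ i ∈ Finset.univ.erase j, mixed (X (c i)) θ q) *
      mixedDeriv (X (c j)) θ q
  have hderiv : ∀ q θ, HasDerivAt (fun θ => mixedDeriv (X a) θ q * ∏ j, mixed (X (c j)) θ q)
      (D θ q) θ := by
    intro q θ
    have h2 := HasDerivAt.fun_finsetProd (u := Finset.univ) (f := fun j θ => mixed (X (c j)) θ q)
      (f' := fun j => mixedDeriv (X (c j)) θ q) (x := θ) fun j _ => hasDerivAt_mixed _ θ q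
    exact (hasDerivAt_mixedDeriv (X a) θ q).mul h2
  set K : ℕ := Fintype.card κ
  have hprod : ∀ (s : Finset κ) θ q, ‖∏ i ∈ s, mixed (X (c i)) θ q‖ ≤ (Y q.1 + Y q.2) ^ s.card := by
    intro s θ q
    rw [norm_prod]
    exact (Finset.prod_le_prod (fun _ _ => norm_nonneg _) fun j _ => norm_mixed_le hY _ _ _).trans
      (by simp)
  have hbound : ∀ q θ, ‖D θ q‖ ≤ (K + 1) * (Y q.1 + Y q.2) ^ (K + 1) := by
    intro q θ
    have hS : 0 ≤ Y q.1 + Y q.2 := add_nonneg (hY0 _) (hY0 _)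
    refine (norm_add_le _ _).trans ?_
    have e1 : ‖-mixed (X a) θ q * ∏ j, mixed (X (c j)) θ q‖ ≤ (Y q.1 + Y q.2) ^ (K + 1) := by
      rw [norm_mul, norm_neg, pow_succ']
      exact mul_le_mul (norm_mixed_le hY _ _ _) ((hprod _ _ _).trans_eq (by simp [K]))
        (norm_nonneg _) hS
    have e2 : ∀ j, ‖(∏ i ∈ Finset.univ.erase j, mixed (X (c i)) θ q) *
        mixedDeriv (X (c j)) θ q‖ ≤ (Y q.1 + Y q.2) ^ K := by
      intro j
      have hK : K = (Finset.univ.erase j).card + 1 := by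
        rw [Finset.card_erase_add_one (Finset.mem_univ j)]; rfl
      rw [norm_mul, hK, pow_succ]
      exact mul_le_mul (hprod _ _ _) (norm_mixedDeriv_le hY _ _ _) (norm_nonneg _) (by positivity)
    have e3 : ‖mixedDeriv (X a) θ q * ∑ j, (∏ i ∈ Finset.univ.erase j, mixed (X (c i)) θ q) *
        mixedDeriv (X (c j)) θ q‖ ≤ (Y q.1 + Y q.2) * (K * (Y q.1 + Y q.2) ^ K) := by
      rw [norm_mul]
      refine mul_le_mul (norm_mixedDeriv_le hY _ _ _) ?_ (norm_nonneg _) hS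
      refine (norm_sum_le _ _).trans ((Finset.sum_le_sum fun j _ => e2 j).trans_eq ?_)
      simp [K]
    calc _ ≤ _ := add_le_add e1 e3
      _ = _ := by ring
  have hmeas : ∀ θ, Measurable fun q => mixedDeriv (X a) θ q * ∏ j, mixed (X (c j)) θ q :=
    fun θ => (measurable_mixedDeriv (hXm _) θ).mul
      (Finset.measurable_fun_prod _ fun j _ => measurable_mixed (hXm _) θ)
  have hmeasD : Measurable (D 0) :=
    ((measurable_mixed (hXm _) 0).neg.mul
      (Finset.measurable_fun_prod _ fun j _ => measurable_mixed (hXm _) 0)).add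
    ((measurable_mixedDeriv (hXm _) 0).mul (Finset.measurable_fun_sum _ fun j _ =>
      (Finset.measurable_fun_prod _ fun i _ => measurable_mixed (hXm _) 0).mul
        (measurable_mixedDeriv (hXm _) 0)))
  have hdom := integrable_add_pow hY0 hYm hYp (K + 1)
  have hint : Integrable (fun q => mixedDeriv (X a) 0 q * ∏ j, mixed (X (c j)) 0 q)
      (P.prod P) := by
    refine hdom.mono' (hmeas 0).aestronglyMeasurable (Filter.Eventually.of_forall fun q => ?_)
    rw [norm_mul, pow_succ']
    exact mul_le_mul (norm_mixedDeriv_le hY _ _ _) ((hprod _ _ _).trans_eq (by simp [K]))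
      (norm_nonneg _) (add_nonneg (hY0 _) (hY0 _))
  have h := hasDerivAt_integral_of_dominated_loc_of_deriv_le (μ := P.prod P) (x₀ := (0 : ℝ))
    (F := fun θ q => mixedDeriv (X a) θ q * ∏ j, mixed (X (c j)) θ q) (F' := D)
    (bound := fun q => (K + 1) * (Y q.1 + Y q.2) ^ (K + 1)) (s := Set.univ) Filter.univ_mem
    (Filter.Eventually.of_forall fun θ => (hmeas θ).aestronglyMeasurable) hint
    hmeasD.aestronglyMeasurable (Filter.Eventually.of_forall fun q θ _ => hbound q θ)
    (hdom.const_mul _) (Filter.Eventually.of_forall fun q θ _ => hderiv q θ)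
  -- The integral is zero for every angle, so its derivative vanishes too.
  have h0 : ∫ q, D 0 q ∂(P.prod P) = 0 := by
    have h2 := h.2
    simp only [hX κ c a] at h2
    exact h2.unique (hasDerivAt_const _ _)
  -- At angle zero, the mixed variable is the first copy and its derivative is the second. Each term
  -- therefore splits by independence, and the covariances come from the second copy.
  have hD0 : ∀ q, D 0 q = -((X a q.1 * ∏ j, X (c j) q.1) * 1) +
      ∑ j, (∏ i ∈ Finset.univ.erase j, X (c i) q.1) * (X a q.2 * X (c j) q.2) := by
    intro q
    simp only [D, mixed, mixedDeriv, Real.cos_zero, Real.sin_zero, Complex.ofReal_one,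
      Complex.ofReal_zero, one_mul, zero_mul, add_zero, neg_zero, zero_add, Finset.mul_sum, mul_one]
    congr 1
    · ring
    · refine Finset.sum_congr rfl fun j _ => ?_
      ring
  have hXX : ∀ i j, Integrable (fun ω => X i ω * X j ω) P := by
    intro i j
    have := integrable_prod_of_le hXm hY hYp (Finset.univ : Finset (Fin 2)) ![i, j]
    simpa using this
  have hi1 : Integrable (fun ω => X a ω * ∏ j, X (c j) ω) P := by
    have := integrable_prod_of_le hXm hY hYp (Finset.univ : Finset (Option κ))
      (fun o => o.elim a c)
    simpa [Fintype.prod_option] using this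
  have hi2 : ∀ j, Integrable (fun q : Ω × Ω => (∏ i ∈ Finset.univ.erase j, X (c i) q.1) *
      (X a q.2 * X (c j) q.2)) (P.prod P) := fun j =>
    (integrable_prod_of_le hXm hY hYp _ c).mul_prod (hXX _ _)
  have hi3 : Integrable (fun q : Ω × Ω => -((X a q.1 * ∏ j, X (c j) q.1) * 1)) (P.prod P) := by
    simpa using (hi1.comp_fst P).neg
  rw [integral_congr_ae (Filter.Eventually.of_forall hD0), integral_add hi3
    (integrable_finsetSum _ fun j _ => hi2 j), integral_neg, integral_finsetSum _ fun j _ => hi2 j,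
    neg_add_eq_zero] at h0
  have e1 : ∫ q : Ω × Ω, (X a q.1 * ∏ j, X (c j) q.1) * 1 ∂(P.prod P) =
      (∫ ω, X a ω * ∏ j, X (c j) ω ∂P) * ∫ _ω, (1 : ℂ) ∂P :=
    integral_prod_mul (L := ℂ) (fun ω => X a ω * ∏ j, X (c j) ω) fun _ => 1
  have e2 : ∀ j, ∫ q : Ω × Ω, (∏ i ∈ Finset.univ.erase j, X (c i) q.1) *
      (X a q.2 * X (c j) q.2) ∂(P.prod P) =
      (∫ ω, ∏ i ∈ Finset.univ.erase j, X (c i) ω ∂P) * ∫ ω, X a ω * X (c j) ω ∂P := fun j =>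
    integral_prod_mul (L := ℂ) (fun ω => ∏ i ∈ Finset.univ.erase j, X (c i) ω)
      fun ω => X a ω * X (c j) ω
  rw [e1] at h0
  simp only [e2, integral_const, probReal_univ, one_smul, mul_one] at h0
  rw [h0]
  exact Finset.sum_congr rfl fun j _ => mul_comm _ _

end Stein

end WaveKinetic

namespace WaveKinetic

/-! ### Pairings of a finite set -/

section Pairings

variable {κ : Type} [Fintype κ] [LinearOrder κ]

/-- The partitions of a finite set into pairs, as the maps that exchange the elements of the
pairs, and fix the elements outside of the set. -/
def pairings (s : Finset κ) : Finset (κ → κ) :=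
  Finset.univ.filter fun f => (∀ i, f (f i) = i) ∧ ∀ i, f i = i ↔ i ∉ s

theorem mem_pairings {s : Finset κ} {f : κ → κ} :
    f ∈ pairings s ↔ (∀ i, f (f i) = i) ∧ ∀ i, f i = i ↔ i ∉ s := by
  simp [pairings]

/-- The sum over all pairings of the products of covariances. -/
def pairSum (C : κ → κ → ℂ) (s : Finset κ) : ℂ :=
  ∑ f ∈ pairings s, ∏ i ∈ s with i < f i, C i (f i)

theorem pairSum_empty (C : κ → κ → ℂ) : pairSum C ∅ = 1 := by
  have : pairings (∅ : Finset κ) = {id} := by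
    ext f
    rw [mem_pairings, Finset.mem_singleton]
    constructor
    · rintro ⟨_, h⟩
      exact funext fun i => (h i).2 (by simp)
    · rintro rfl
      simp
  simp [pairSum, this]

/-- The maps that exchange `a` and `b`, and coincide with `g` elsewhere. -/
def addPair (a b : κ) (g : κ → κ) (i : κ) : κ := if i = a then b else if i = b then a else g i

/-- The maps that fix `a` and `b`, and coincide with `f` elsewhere. -/
def removePair (a b : κ) (f : κ → κ) (i : κ) : κ := if i = a ∨ i = b then i else f i

theorem addPair_mem {s : Finset κ} {a b : κ} (ha : a ∈ s) (hb : b ∈ s.erase a) {g : κ → κ}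
    (hg : g ∈ pairings ((s.erase a).erase b)) : addPair a b g ∈ pairings s := by
  rw [mem_pairings] at hg ⊢
  obtain ⟨h1, h2⟩ := hg
  have hba := Finset.ne_of_mem_erase hb
  have hbs := Finset.mem_of_mem_erase hb
  have ga : g a = a := (h2 a).2 (by simp)
  have gb : g b = b := (h2 b).2 (by simp)
  constructor
  · intro i
    have := h1 i
    unfold addPair
    grind
  · intro i
    have h3 := h2 i
    simp only [Finset.mem_erase] at h3
    unfold addPair
    grind

theorem removePair_mem {s : Finset κ} {a : κ} (ha : a ∈ s) {f : κ → κ}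
    (hf : f ∈ pairings s) : f a ∈ s.erase a ∧
      removePair a (f a) f ∈ pairings ((s.erase a).erase (f a)) := by
  rw [mem_pairings] at hf ⊢
  obtain ⟨h1, h2⟩ := hf
  have hfa : f a ≠ a := fun h => (h2 a).1 h ha
  have h1a := h1 a
  have h2a := h2 (f a)
  have hfas : f a ∈ s.erase a := by
    rw [Finset.mem_erase]
    refine ⟨hfa, ?_⟩
    by_contra h
    exact hfa ((h2a.2 h).symm.trans h1a)
  refine ⟨hfas, ?_, ?_⟩
  · intro i
    have := h1 i
    unfold removePair
    grind
  · intro i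
    have h3 := h2 i
    simp only [Finset.mem_erase]
    unfold removePair
    grind

/-- As `a` is smallest, it is the element of the new pair over which the product runs, and the
covariance appears as `C a b`. No symmetry of `C` is needed. -/
theorem prod_addPair {s : Finset κ} {a b : κ} (ha : a ∈ s) (hmin : ∀ i ∈ s, a ≤ i)
    (hb : b ∈ s.erase a) (C : κ → κ → ℂ) (g : κ → κ) :
    ∏ i ∈ s with i < addPair a b g i, C i (addPair a b g i) =
      C a b * ∏ i ∈ (s.erase a).erase b with i < g i, C i (g i) := by
  have hba := Finset.ne_of_mem_erase hb
  have hbs := Finset.mem_of_mem_erase hb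
  have hab : a < b := lt_of_le_of_ne (hmin b hbs) hba.symm
  have hset : (s.filter fun i => i < addPair a b g i) =
      insert a (((s.erase a).erase b).filter fun i => i < g i) := by
    ext i
    rw [Finset.mem_filter, Finset.mem_insert, Finset.mem_filter, Finset.mem_erase,
      Finset.mem_erase, addPair]
    constructor
    · rintro ⟨hi, hlt⟩
      by_cases h1 : i = a
      · exact Or.inl h1
      · by_cases h2 : i = b
        · subst h2
          simp only [h1, if_false, if_true] at hlt
          exact absurd hlt (not_lt.2 hab.le)
        · simp only [h1, h2, if_false] at hlt
          exact Or.inr ⟨⟨h2, h1, hi⟩, hlt⟩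
    · rintro (rfl | ⟨⟨h2, h1, hi⟩, hlt⟩)
      · exact ⟨ha, by simpa using hab⟩
      · exact ⟨hi, by simpa [h1, h2] using hlt⟩
  rw [hset, Finset.prod_insert (by simp)]
  congr 1
  · simp [addPair]
  · refine Finset.prod_congr rfl fun i hi => ?_
    simp only [Finset.mem_filter, Finset.mem_erase] at hi
    simp [addPair, hi.1.1, hi.1.2.1]

/-- Summation over the partner of the smallest element. -/
theorem pairSum_eq {s : Finset κ} {a : κ} (ha : a ∈ s) (hmin : ∀ i ∈ s, a ≤ i) (C : κ → κ → ℂ) :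
    pairSum C s = ∑ b ∈ s.erase a, C a b * pairSum C ((s.erase a).erase b) := by
  simp only [pairSum, Finset.mul_sum]
  rw [Finset.sum_sigma']
  symm
  -- A pairing is the same as the partner of `a` together with a pairing of the remaining elements.
  refine Finset.sum_bij' (fun q _ => addPair a q.1 q.2) (fun f _ => ⟨f a, removePair a (f a) f⟩)
    ?_ ?_ ?_ ?_ ?_
  · rintro ⟨b, g⟩ hq
    rw [Finset.mem_sigma] at hq
    exact addPair_mem ha hq.1 hq.2
  · intro f hf
    rw [Finset.mem_sigma]
    exact removePair_mem ha hf
  · rintro ⟨b, g⟩ hq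
    rw [Finset.mem_sigma, mem_pairings] at hq
    have h1 : addPair a b g a = b := by simp [addPair]
    have ga : g a = a := (hq.2.2 a).2 (by simp)
    have gb : g b = b := (hq.2.2 b).2 (by simp)
    simp only [h1, Sigma.mk.injEq, heq_eq_eq, true_and]
    funext i
    unfold removePair addPair
    grind
  · intro f hf
    rw [mem_pairings] at hf
    have h1 := hf.1 a
    funext i
    unfold removePair addPair
    grind
  · rintro ⟨b, g⟩ hq
    rw [Finset.mem_sigma] at hq
    exact (prod_addPair ha hmin hq.1 C g).symm

end Pairings

/-- The Wick formula. -/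
theorem IsRotationInvariant.integral_prod_eq {ι Ω : Type*} [MeasurableSpace Ω] {P : Measure Ω}
    [IsProbabilityMeasure P] {X : ι → Ω → ℂ} {Y : Ω → ℝ} (hX : IsRotationInvariant P X)
    (hXm : ∀ i, Measurable (X i)) (hY : ∀ i ω, ‖X i ω‖ ≤ Y ω) (hY0 : ∀ ω, 0 ≤ Y ω)
    (hYm : Measurable Y) (hYp : ∀ k : ℕ, Integrable (fun ω => Y ω ^ k) P)
    {κ : Type} [Fintype κ] [LinearOrder κ] (c : κ → ι) (s : Finset κ) :
    ∫ ω, ∏ i ∈ s, X (c i) ω ∂P = pairSum (fun i j => ∫ ω, X (c i) ω * X (c j) ω ∂P) s := by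
  induction hn : s.card using Nat.strong_induction_on generalizing s with
  | _ n ih =>
  rcases s.eq_empty_or_nonempty with rfl | hs
  · simp [pairSum_empty]
  -- Integration by parts against the smallest variable gives exactly the recursion `pairSum_eq`,
  -- and both lead to a set with two elements fewer.
  set a := s.min' hs
  have ha : a ∈ s := s.min'_mem hs
  rw [pairSum_eq ha fun i hi => s.min'_le i hi]
  have h1 : ∀ ω, ∏ i ∈ s, X (c i) ω = X (c a) ω * ∏ j : {j // j ∈ s.erase a}, X (c j) ω := by
    intro ω
    rw [Finset.prod_coe_sort (s.erase a) fun j => X (c j) ω]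
    exact (Finset.mul_prod_erase s (fun j => X (c j) ω) ha).symm
  simp only [h1]
  rw [hX.integral_mul_prod hXm hY hY0 hYm hYp (fun j : {j // j ∈ s.erase a} => c j) (c a),
    ← Finset.sum_coe_sort (s.erase a)]
  refine Finset.sum_congr rfl fun b _ => ?_
  congr 1
  rw [← ih ((s.erase a).erase b).card ?_ _ rfl]
  · congr 1
    funext ω
    have h2 : (s.erase a).erase b.1 = (Finset.univ.erase b).map (Function.Embedding.subtype _) := by
      ext i
      simp only [Finset.mem_erase, Finset.mem_map, Finset.mem_univ, and_true,
        Function.Embedding.subtype_apply, Subtype.exists]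
      constructor
      · rintro ⟨h3, h4⟩
        exact ⟨i, h4, fun h => h3 (congrArg Subtype.val h), rfl⟩
      · rintro ⟨j, h3, h4, rfl⟩
        exact ⟨fun h => h4 (Subtype.ext h), h3⟩
    rw [h2, Finset.prod_map]
    rfl
  · have h3 := Finset.card_erase_lt_of_mem ha
    have h4 := Finset.card_erase_lt_of_mem b.2
    omega

end WaveKinetic

namespace WaveKinetic

open scoped FourierTransform

/-! ### Decay of the envelope -/

section Envelope

variable {d : ℕ} {ahat : Space d × Space d → ℂ}

theorem exists_support_ball (hs : HasCompactSupport ahat) :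
    ∃ R, 0 ≤ R ∧ ∀ q : Space d × Space d, ahat q ≠ 0 → ‖q.1‖ ≤ R ∧ ‖q.2‖ ≤ R := by
  obtain ⟨R, hR⟩ := hs.isCompact.isBounded.subset_closedBall 0
  refine ⟨max R 0, le_max_right _ _, fun q hq => ?_⟩
  have h := hR (subset_tsupport _ hq)
  rw [mem_closedBall_zero_iff] at h
  exact ⟨((norm_fst_le q).trans h).trans (le_max_left _ _),
    ((norm_snd_le q).trans h).trans (le_max_left _ _)⟩

theorem contDiff_slice (ha : ContDiff ℝ (⊤ : ℕ∞) ahat) (ξ : Space d) :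
    ContDiff ℝ (⊤ : ℕ∞) fun η => ahat (η, ξ) :=
  ha.comp (contDiff_id.prodMk contDiff_const)

theorem tsupport_slice {R : ℝ} (hR : ∀ q : Space d × Space d, ahat q ≠ 0 → ‖q.1‖ ≤ R ∧ ‖q.2‖ ≤ R)
    (ξ : Space d) : tsupport (fun η => ahat (η, ξ)) ⊆ Metric.closedBall 0 R :=
  closure_minimal (fun η hη => by simpa using (hR _ hη).1) Metric.isClosed_closedBall

theorem hasCompactSupport_slice (hs : HasCompactSupport ahat) (ξ : Space d) :
    HasCompactSupport fun η => ahat (η, ξ) := by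
  obtain ⟨R, -, hR⟩ := exists_support_ball hs
  exact (isCompact_closedBall (0 : Space d) R).of_isClosed_subset (isClosed_tsupport _)
    (tsupport_slice hR ξ)

/-- A slice is a translate of `ahat` restricted to a fixed subspace, so its derivatives are
controlled by those of `ahat`, uniformly in `ξ`. -/
theorem exists_iteratedFDeriv_slice_bound (ha : ContDiff ℝ (⊤ : ℕ∞) ahat)
    (hs : HasCompactSupport ahat) (q : ℕ) :
    ∃ C, 0 ≤ C ∧ ∀ ξ η, ‖iteratedFDeriv ℝ q (fun η => ahat (η, ξ)) η‖ ≤ C := by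
  obtain ⟨C, hC⟩ := (hs.iteratedFDeriv (𝕜 := ℝ) q).exists_bound_of_continuous
    (ha.continuous_iteratedFDeriv (by exact_mod_cast le_top))
  have hC0 : 0 ≤ C := (norm_nonneg _).trans (hC 0)
  refine ⟨C * ‖ContinuousLinearMap.inl ℝ (Space d) (Space d)‖ ^ q, by positivity, fun ξ η => ?_⟩
  have h1 : (fun η => ahat (η, ξ)) = (fun p => ahat (p + (0, ξ))) ∘
      ContinuousLinearMap.inl ℝ (Space d) (Space d) := by
    funext η
    simp
  have h2 : ContDiff ℝ q fun p => ahat (p + (0, ξ)) :=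
    (ha.of_le (by exact_mod_cast le_top)).comp (contDiff_id.add contDiff_const)
  rw [h1, ContinuousLinearMap.iteratedFDeriv_comp_right _ h2 _ le_rfl, iteratedFDeriv_comp_add_right]
  refine (ContinuousMultilinearMap.norm_compContinuousLinearMap_le _ _).trans ?_
  simp only [Finset.prod_const, Finset.card_univ, Fintype.card_fin]
  exact mul_le_mul_of_nonneg_right (hC _) (by positivity)

/-- Powers of `x` on the inverse transform are paid for by derivatives in `η`. The bounds on these
and the radius of their support do not depend on `ξ`. -/
theorem exists_pow_mul_envelope_le (ha : ContDiff ℝ (⊤ : ℕ∞) ahat)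
    (hs : HasCompactSupport ahat) (N : ℕ) :
    ∃ C, ∀ x ξ, ‖x‖ ^ N * ‖envelope ahat x ξ‖ ≤ C := by
  obtain ⟨R, -, hR⟩ := exists_support_ball hs
  choose M hM0 hM using exists_iteratedFDeriv_slice_bound ha hs
  refine ⟨ftConst d * ((2 * Real.pi) ^ N * (2 ^ N * ∑ p ∈ Finset.range 1 ×ˢ Finset.range (N + 1),
    M p.2 * volume.real (Metric.closedBall (0 : Space d) R))), fun x ξ => ?_⟩
  set f : Space d → ℂ := fun η => ahat (η, ξ)
  have hf := contDiff_slice ha ξ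
  have hfs := hasCompactSupport_slice hs ξ
  have hcont : ∀ n : ℕ, Continuous (iteratedFDeriv ℝ n f) := fun n =>
    hf.continuous_iteratedFDeriv (by exact_mod_cast le_top)
  have hint : ∀ k n : ℕ, (k : ℕ∞) ≤ 0 → (n : ℕ∞) ≤ ⊤ →
      Integrable fun v => ‖v‖ ^ k * ‖iteratedFDeriv ℝ n f v‖ := by
    intro k n _ _
    refine Continuous.integrable_of_hasCompactSupport ?_ ?_
    · exact (continuous_norm.pow k).mul (hcont n).norm
    · exact (hfs.iteratedFDeriv (𝕜 := ℝ) n).norm.mul_left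
  have h1 := Real.pow_mul_norm_iteratedFDeriv_fourier_le hf hint (k := 0) (n := N) (by simp)
    le_top ((2 * Real.pi)⁻¹ • -x)
  have h2 : ∀ q, ∫ v, ‖v‖ ^ 0 * ‖iteratedFDeriv ℝ q f v‖ ≤
      M q * volume.real (Metric.closedBall (0 : Space d) R) := by
    intro q
    simp only [pow_zero, one_mul]
    rw [← setIntegral_eq_integral_of_forall_compl_eq_zero
      (s := Metric.closedBall (0 : Space d) R)]
    · refine (Real.le_norm_self _).trans (norm_setIntegral_le_of_norm_le_const
        (isCompact_closedBall _ _).measure_lt_top fun v _ => ?_)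
      rw [norm_norm]
      exact hM q ξ v
    · intro v hv
      by_contra hne
      exact hv (tsupport_slice hR ξ (support_iteratedFDeriv_subset q (norm_ne_zero_iff.1 hne)))
  have h3 : ‖envelope ahat x ξ‖ = ftConst d * ‖𝓕 f ((2 * Real.pi)⁻¹ • -x)‖ := by
    rw [envelope, ift_eq_fourierInv, norm_mul, Complex.norm_real, Real.norm_of_nonneg
      (ftConst_pos d).le, Real.fourierInv_eq_fourier_neg, smul_neg]
  have h4 : ‖x‖ ^ N = (2 * Real.pi) ^ N * ‖(2 * Real.pi)⁻¹ • -x‖ ^ N := by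
    rw [norm_smul, norm_neg, Real.norm_of_nonneg (by positivity), ← mul_pow, ← mul_assoc,
      mul_inv_cancel₀ (by positivity), one_mul]
  rw [h3, h4]
  simp only [norm_iteratedFDeriv_zero, pow_zero, CharP.cast_eq_zero, mul_zero, zero_add,
    one_mul] at h1
  calc _ = ftConst d * ((2 * Real.pi) ^ N * (‖(2 * Real.pi)⁻¹ • -x‖ ^ N *
        ‖𝓕 f ((2 * Real.pi)⁻¹ • -x)‖)) := by ring
    _ ≤ _ := by
      refine mul_le_mul_of_nonneg_left (mul_le_mul_of_nonneg_left (h1.trans ?_) (by positivity))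
        (ftConst_pos d).le
      refine mul_le_mul_of_nonneg_left (Finset.sum_le_sum fun p hp => ?_) (by positivity)
      have hp0 : p.1 = 0 := by
        have := (Finset.mem_product.1 hp).1
        simpa using this
      have := h2 p.2
      rwa [← hp0] at this

theorem exists_envelope_decay (ha : ContDiff ℝ (⊤ : ℕ∞) ahat)
    (hs : HasCompactSupport ahat) (N : ℕ) :
    ∃ C, 0 ≤ C ∧ ∀ x ξ, (1 + ‖x‖) ^ N * ‖envelope ahat x ξ‖ ≤ C := by
  obtain ⟨C0, h0⟩ := exists_pow_mul_envelope_le ha hs 0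
  obtain ⟨C1, h1⟩ := exists_pow_mul_envelope_le ha hs N
  have hb : ∀ x ξ, (1 + ‖x‖) ^ N * ‖envelope ahat x ξ‖ ≤ 2 ^ (N - 1) * (C0 + C1) := by
    intro x ξ
    have h2 := add_pow_le zero_le_one (norm_nonneg x) N
    calc _ ≤ (2 ^ (N - 1) * (1 ^ N + ‖x‖ ^ N)) * ‖envelope ahat x ξ‖ :=
          mul_le_mul_of_nonneg_right h2 (norm_nonneg _)
      _ = 2 ^ (N - 1) * (‖x‖ ^ 0 * ‖envelope ahat x ξ‖ + ‖x‖ ^ N * ‖envelope ahat x ξ‖) := by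
          rw [one_pow, pow_zero]; ring
      _ ≤ _ := mul_le_mul_of_nonneg_left (add_le_add (h0 x ξ) (h1 x ξ)) (by positivity)
  exact ⟨_, (by positivity : (0 : ℝ) ≤ _).trans (hb 0 0), hb⟩

theorem envelope_eq_zero {R : ℝ}
    (hR : ∀ q : Space d × Space d, ahat q ≠ 0 → ‖q.1‖ ≤ R ∧ ‖q.2‖ ≤ R) {x ξ : Space d}
    (hξ : R < ‖ξ‖) : envelope ahat x ξ = 0 := by
  have : (fun η => ahat (η, ξ)) = fun _ => 0 := by
    funext η
    by_contra h
    exact absurd (hR _ h).2 (not_le.2 hξ)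
  rw [envelope, this, ift_def]
  simp

end Envelope

/-! ### Moments of the field -/

theorem lintegral_enorm_pow_gaussianReal (v : NNReal) (k : ℕ) :
    ∫⁻ y, ‖y‖ₑ ^ (2 * k) ∂(gaussianReal 0 v) =
      (v : ENNReal) ^ k * ∫⁻ y, ‖y‖ₑ ^ (2 * k) ∂(gaussianReal 0 1) := by
  have h := gaussianReal_map_const_mul (μ := 0) (v := 1) (Real.sqrt v)
  have hv : NNReal.mk (Real.sqrt v ^ 2) (sq_nonneg _) * 1 = v := by
    ext
    simp
  rw [mul_zero, hv] at h
  rw [← h, lintegral_map (by fun_prop) (by fun_prop), ← lintegral_const_mul _ (by fun_prop)]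
  refine lintegral_congr fun y => ?_
  rw [enorm_mul, mul_pow]
  congr 1
  rw [pow_mul]
  congr 1
  rw [Real.enorm_eq_ofReal (Real.sqrt_nonneg _), ← ENNReal.ofReal_pow (Real.sqrt_nonneg _),
    Real.sq_sqrt v.coe_nonneg, ENNReal.ofReal_coe_nnreal]

theorem lintegral_gaussianReal_pow_lt_top (k : ℕ) :
    ∫⁻ y, ‖y‖ₑ ^ (2 * k) ∂(gaussianReal 0 1) < ⊤ := by
  have h := (memLp_id_gaussianReal (μ := 0) (v := 1) ((2 * k : ℕ) : NNReal))
  rcases k.eq_zero_or_pos with rfl | hk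
  · simp
  have h2 := lintegral_rpow_enorm_lt_top_of_eLpNorm_lt_top (p := ((2 * k : ℕ) : ENNReal))
    (by simp; omega) (ENNReal.natCast_ne_top _) (by simpa using h.2)
  simpa [← ENNReal.rpow_natCast] using h2

/-- Moments of a centred complex Gaussian variable in terms of its second moment. -/
theorem exists_lintegral_pow_le (k : ℕ) : ∃ C : NNReal, ∀ {Ω : Type*} [MeasurableSpace Ω]
    {P : Measure Ω} [IsProbabilityMeasure P] {X : Ω → ℂ}, HasGaussianLaw X P → ∫ ω, X ω ∂P = 0 →
    ∫⁻ ω, ‖X ω‖ₑ ^ (2 * k) ∂P ≤ C * ENNReal.ofReal (∫ ω, ‖X ω‖ ^ 2 ∂P) ^ k := by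
  set A := ∫⁻ y, ‖y‖ₑ ^ (2 * k) ∂(gaussianReal 0 1)
  have hA : A < ⊤ := lintegral_gaussianReal_pow_lt_top k
  refine ⟨2 ^ (2 * k) * (2 * A.toNNReal), fun {Ω} _ {P} _ {X} hX hmean => ?_⟩
  -- Real and imaginary part are centred real Gaussian variables whose variances are at most the
  -- second moment of `X`. Scaling to unit variance leaves a universal constant.
  have hpart : ∀ L : ℂ →L[ℝ] ℝ, (∀ z, ‖L z‖ ≤ ‖z‖) → ∫⁻ ω, ‖L (X ω)‖ₑ ^ (2 * k) ∂P ≤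
      ENNReal.ofReal (∫ ω, ‖X ω‖ ^ 2 ∂P) ^ k * A := by
    intro L hL
    have hg := hX.map_fun L
    have hm : ∫ ω, L (X ω) ∂P = 0 := by
      rw [L.integral_comp_comm hX.integrable, hmean, map_zero]
    have hlaw := hg.map_eq_gaussianReal
    rw [hm] at hlaw
    have h1 : ∫⁻ ω, ‖L (X ω)‖ₑ ^ (2 * k) ∂P =
        ∫⁻ y, ‖y‖ₑ ^ (2 * k) ∂(P.map fun ω => L (X ω)) := by
      rw [lintegral_map' (by fun_prop) hg.aemeasurable]
    rw [h1, hlaw, lintegral_enorm_pow_gaussianReal]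
    gcongr
    have hX2 : Integrable (fun ω => ‖X ω‖ ^ 2) P := hX.memLp_two.integrable_norm_pow (by norm_num)
    rw [variance_of_integral_eq_zero hg.aemeasurable hm]
    refine ENNReal.ofReal_le_ofReal (integral_mono_of_nonneg
      (Filter.Eventually.of_forall fun _ => sq_nonneg _) hX2
      (Filter.Eventually.of_forall fun ω => ?_))
    have := hL (X ω)
    simp only [← sq_abs (L (X ω))]
    gcongr
    exact this
  have hre := hpart Complex.reCLM Complex.abs_re_le_norm
  have him := hpart Complex.imCLM Complex.abs_im_le_norm
  have hpt : ∀ ω, ‖X ω‖ₑ ^ (2 * k) ≤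
      2 ^ (2 * k) * (‖Complex.reCLM (X ω)‖ₑ ^ (2 * k) + ‖Complex.imCLM (X ω)‖ₑ ^ (2 * k)) := by
    intro ω
    have h1 : ‖X ω‖ₑ ≤ ‖Complex.reCLM (X ω)‖ₑ + ‖Complex.imCLM (X ω)‖ₑ := by
      simp only [← ofReal_norm]
      rw [← ENNReal.ofReal_add (norm_nonneg _) (norm_nonneg _)]
      exact ENNReal.ofReal_le_ofReal (Complex.norm_le_abs_re_add_abs_im _)
    have h2 : ∀ a b : ENNReal, (a + b) ^ (2 * k) ≤ 2 ^ (2 * k) * (a ^ (2 * k) + b ^ (2 * k)) := by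
      intro a b
      rcases le_total a b with h | h
      · calc (a + b) ^ (2 * k) ≤ (2 * b) ^ (2 * k) := by
              gcongr; rw [two_mul]; gcongr
          _ = 2 ^ (2 * k) * b ^ (2 * k) := mul_pow _ _ _
          _ ≤ _ := by gcongr; exact le_add_self
      · calc (a + b) ^ (2 * k) ≤ (2 * a) ^ (2 * k) := by
              gcongr; rw [two_mul]; gcongr
          _ = 2 ^ (2 * k) * a ^ (2 * k) := mul_pow _ _ _
          _ ≤ _ := by gcongr; exact le_self_add
    exact (pow_le_pow_left' h1 _).trans (h2 _ _)
  have hX1 := hX.aemeasurable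
  calc ∫⁻ ω, ‖X ω‖ₑ ^ (2 * k) ∂P ≤ ∫⁻ ω, 2 ^ (2 * k) * (‖Complex.reCLM (X ω)‖ₑ ^ (2 * k) +
        ‖Complex.imCLM (X ω)‖ₑ ^ (2 * k)) ∂P := lintegral_mono hpt
    _ = 2 ^ (2 * k) * (∫⁻ ω, ‖Complex.reCLM (X ω)‖ₑ ^ (2 * k) ∂P +
        ∫⁻ ω, ‖Complex.imCLM (X ω)‖ₑ ^ (2 * k) ∂P) := by
      rw [lintegral_const_mul'' _ (by fun_prop), lintegral_add_left' (by fun_prop)]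
    _ ≤ 2 ^ (2 * k) * (ENNReal.ofReal (∫ ω, ‖X ω‖ ^ 2 ∂P) ^ k * A +
        ENNReal.ofReal (∫ ω, ‖X ω‖ ^ 2 ∂P) ^ k * A) := by gcongr
    _ = _ := by
      push_cast
      rw [ENNReal.coe_toNNReal hA.ne]
      ring

end WaveKinetic

namespace WaveKinetic

/-! ### The random initial data -/

/-- The `L¹` norm of the field. -/
def fieldNorm {d : ℕ} {Ω : Type*} (u₀ : Ω → Space d → ℂ) (ω : Ω) : ℝ := ∫ x, ‖u₀ ω x‖

theorem fieldNorm_nonneg {d : ℕ} {Ω : Type*} (u₀ : Ω → Space d → ℂ) (ω : Ω) :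
    0 ≤ fieldNorm u₀ ω := integral_nonneg fun _ => norm_nonneg _

theorem norm_ft_le {d : ℕ} {f : Space d → ℂ} (ξ : Space d) :
    ‖ft f ξ‖ ≤ ftConst d * ∫ x, ‖f x‖ := by
  rw [ft_def, norm_mul, Complex.norm_real, Real.norm_of_nonneg (ftConst_pos d).le]
  refine mul_le_mul_of_nonneg_left ((norm_integral_le_integral_norm _).trans_eq ?_)
    (ftConst_pos d).le
  simp only [norm_mul, STree.norm_exp_neg_I, mul_one]

namespace IsInitialField

variable {d : ℕ} {ahat : Space d × Space d → ℂ} {Ω : Type*} [MeasurableSpace Ω] {P : Measure Ω}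
  {ε : ℝ} {u₀ : Ω → Space d → ℂ}

theorem measurable_eval (hu : IsInitialField P ε (envelope ahat) u₀) (x : Space d) :
    Measurable fun ω => u₀ ω x := hu.measurable.of_uncurry_right

theorem measurable_path (hu : IsInitialField P ε (envelope ahat) u₀) (ω : Ω) :
    Measurable (u₀ ω) := hu.measurable.of_uncurry_left

/-- On the diagonal, the covariance is the integral of the squared envelope over a fixed ball in
`ξ`, and inherits its decay. -/
theorem exists_second_moment_le (hu : IsInitialField P ε (envelope ahat) u₀)
    (ha : ContDiff ℝ (⊤ : ℕ∞) ahat) (hs : HasCompactSupport ahat) (N : ℕ) :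
    ∃ C, 0 ≤ C ∧ ∀ x, ∫ ω, ‖u₀ ω x‖ ^ 2 ∂P ≤ C * ((1 + ‖x‖) ^ N)⁻¹ := by
  obtain ⟨R, -, hR⟩ := exists_support_ball hs
  obtain ⟨C, hC0, hC⟩ := exists_envelope_decay ha hs N
  refine ⟨C ^ 2 * volume.real (Metric.closedBall (0 : Space d) R), by positivity, fun x => ?_⟩
  have hx : (1 : ℝ) ≤ (1 + ‖x‖) ^ N := one_le_pow₀ (by linarith [norm_nonneg x])
  have h1 : ((∫ ω, ‖u₀ ω x‖ ^ 2 ∂P : ℝ) : ℂ) = ∫ ξ, starRingEnd ℂ (envelope ahat x ξ) *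
      envelope ahat x ξ * Complex.exp (-Complex.I * ((inner ℝ (ε⁻¹ • ξ) (x - x) : ℝ) : ℂ)) := by
    rw [← hu.covariance, ← integral_complex_ofReal]
    refine integral_congr_ae (Filter.Eventually.of_forall fun ω => ?_)
    simp only
    rw [Complex.conj_mul', Complex.ofReal_pow]
  have h2 : ‖((∫ ω, ‖u₀ ω x‖ ^ 2 ∂P : ℝ) : ℂ)‖ ≤
      (C ^ 2 * ((1 + ‖x‖) ^ N)⁻¹) * volume.real (Metric.closedBall (0 : Space d) R) := by
    rw [h1, ← setIntegral_eq_integral_of_forall_compl_eq_zero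
      (s := Metric.closedBall (0 : Space d) R)]
    · refine norm_setIntegral_le_of_norm_le_const (isCompact_closedBall _ _).measure_lt_top
        fun ξ _ => ?_
      have h3 : ‖envelope ahat x ξ‖ ≤ C * ((1 + ‖x‖) ^ N)⁻¹ := by
        rw [← div_eq_mul_inv, le_div_iff₀ (by positivity), mul_comm]
        exact hC x ξ
      rw [norm_mul, norm_mul, RCLike.norm_conj, STree.norm_exp_neg_I, mul_one]
      calc _ ≤ (C * ((1 + ‖x‖) ^ N)⁻¹) * (C * ((1 + ‖x‖) ^ N)⁻¹) :=
            mul_le_mul h3 h3 (norm_nonneg _) (by positivity)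
        _ = (C ^ 2 * ((1 + ‖x‖) ^ N)⁻¹) * ((1 + ‖x‖) ^ N)⁻¹ := by ring
        _ ≤ (C ^ 2 * ((1 + ‖x‖) ^ N)⁻¹) * 1 := by
          refine mul_le_mul_of_nonneg_left (inv_le_one_of_one_le₀ hx) (by positivity)
        _ = _ := mul_one _
    · intro ξ hξ
      rw [envelope_eq_zero hR (by simpa using hξ)]
      simp
  rw [Complex.norm_real] at h2
  calc _ ≤ _ := (Real.le_norm_self _).trans h2
    _ = _ := by ring

theorem measurable_fieldNorm (hu : IsInitialField P ε (envelope ahat) u₀) :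
    Measurable (fieldNorm u₀) :=
  hu.measurable.norm.stronglyMeasurable.integral_prod_right.measurable

variable [IsProbabilityMeasure P]

/-- Gaussian moments are powers of the second moment. The decay factor is at most one, so its `k`-th
power with `k ≠ 0` is no larger, and any rate `N` is available. -/
theorem exists_moment_le (hu : IsInitialField P ε (envelope ahat) u₀)
    (ha : ContDiff ℝ (⊤ : ℕ∞) ahat) (hs : HasCompactSupport ahat) {k : ℕ} (hk : k ≠ 0) (N : ℕ) :
    ∃ C, 0 ≤ C ∧ ∀ x, ∫⁻ ω, ‖u₀ ω x‖ₑ ^ (2 * k) ∂P ≤ ENNReal.ofReal (C * ((1 + ‖x‖) ^ N)⁻¹) := by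
  obtain ⟨C, hC0, hC⟩ := hu.exists_second_moment_le ha hs N
  obtain ⟨K, hK⟩ := exists_lintegral_pow_le k
  refine ⟨K * C ^ k, by positivity, fun x => ?_⟩
  have hx : (1 : ℝ) ≤ (1 + ‖x‖) ^ N := one_le_pow₀ (by linarith [norm_nonneg x])
  have hx0 : 0 ≤ ((1 + ‖x‖) ^ N)⁻¹ := by positivity
  refine (hK (hu.gaussian.hasGaussianLaw_eval x) (hu.mean x)).trans ?_
  rw [mul_assoc, ENNReal.ofReal_mul K.coe_nonneg, ENNReal.ofReal_coe_nnreal]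
  gcongr
  rw [← ENNReal.ofReal_pow (integral_nonneg fun _ => by positivity)]
  refine ENNReal.ofReal_le_ofReal ?_
  calc _ ≤ (C * ((1 + ‖x‖) ^ N)⁻¹) ^ k :=
        pow_le_pow_left₀ (integral_nonneg fun _ => by positivity) (hC x) k
    _ = C ^ k * ((1 + ‖x‖) ^ N)⁻¹ ^ k := mul_pow _ _ _
    _ ≤ _ := mul_le_mul_of_nonneg_left
      (pow_le_of_le_one hx0 (inv_le_one_of_one_le₀ hx) hk) (by positivity)

theorem lintegral_inv_pow_lt_top (d : ℕ) {r : ℕ} (hr : d < r) :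
    ∫⁻ x : Space d, ENNReal.ofReal (((1 + ‖x‖) ^ r)⁻¹) < ⊤ := by
  have h := finite_integral_one_add_norm (E := Space d) (μ := volume) (r := r)
    (by rw [finrank_euclideanSpace_fin]; exact_mod_cast hr)
  simpa [Real.rpow_neg, add_nonneg] using h

/-- All weighted `L¹` norms of the field have moments. -/
theorem lintegral_weighted_pow_lt_top (hu : IsInitialField P ε (envelope ahat) u₀)
    (ha : ContDiff ℝ (⊤ : ℕ∞) ahat) (hs : HasCompactSupport ahat) (q : ℕ) {k : ℕ} (hk : k ≠ 0) :
    ∫⁻ ω, (∫⁻ x, ‖u₀ ω x‖ₑ * ENNReal.ofReal ((1 + ‖x‖) ^ q)) ^ (2 * k) ∂P < ⊤ := by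
  set r := d + 1
  -- Hölder's inequality in `x` for the product `F * H`: the exponent `r = d + 1` makes `H`
  -- integrable, at the price of a larger weight in `F`.
  set F : Ω → Space d → ENNReal := fun ω x => ‖u₀ ω x‖ₑ * ENNReal.ofReal ((1 + ‖x‖) ^ (q + r))
  set H : Space d → ENNReal := fun x => ENNReal.ofReal (((1 + ‖x‖) ^ r)⁻¹)
  have hw : ∀ n : ℕ, Measurable fun x : Space d => ENNReal.ofReal ((1 + ‖x‖) ^ n) := by
    intro n; fun_prop
  have hH : Measurable H := by fun_prop
  have hFm : Measurable (Function.uncurry F) :=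
    hu.measurable.enorm.mul ((hw _).comp measurable_snd)
  have hFω : ∀ ω, Measurable (F ω) := fun ω => hFm.of_uncurry_left
  set p : ℝ := ((2 * k : ℕ) : ℝ)
  have hp1 : 1 < p := by
    have : 1 ≤ k := Nat.one_le_iff_ne_zero.2 hk
    simp only [p]
    exact_mod_cast (by omega : 1 < 2 * k)
  have hpq := Real.HolderConjugate.conjExponent hp1
  set q' := p.conjExponent
  set D : ENNReal := (∫⁻ x, H x ^ q') ^ (1 / q' * p)
  have hH1 : ∀ x, H x ^ q' ≤ H x := by
    intro x
    refine ENNReal.rpow_le_self_of_le_one ?_ hpq.symm.lt.le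
    rw [← ENNReal.ofReal_one]
    exact ENNReal.ofReal_le_ofReal (inv_le_one_of_one_le₀
      (one_le_pow₀ (by linarith [norm_nonneg x])))
  have hD : D < ⊤ := by
    refine ENNReal.rpow_lt_top_of_nonneg ?_ ?_
    · exact mul_nonneg (one_div_nonneg.2 hpq.symm.nonneg) (by linarith)
    · exact ((lintegral_mono hH1).trans_lt (lintegral_inv_pow_lt_top d (Nat.lt_succ_self d))).ne
  have hle : ∀ ω, (∫⁻ x, ‖u₀ ω x‖ₑ * ENNReal.ofReal ((1 + ‖x‖) ^ q)) ^ (2 * k) ≤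
      (∫⁻ x, F ω x ^ (2 * k)) * D := by
    intro ω
    have h1 : ∀ x, ‖u₀ ω x‖ₑ * ENNReal.ofReal ((1 + ‖x‖) ^ q) = (F ω * H) x := by
      intro x
      have hx : (0 : ℝ) < (1 + ‖x‖) ^ r := by positivity
      simp only [F, H, Pi.mul_apply]
      rw [mul_assoc, ← ENNReal.ofReal_mul (by positivity), pow_add, mul_assoc,
        mul_inv_cancel₀ hx.ne', mul_one]
    have h2 := ENNReal.lintegral_mul_le_Lp_mul_Lq volume hpq (hFω ω).aemeasurable hH.aemeasurable
    simp only [h1]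
    calc (∫⁻ x, (F ω * H) x) ^ (2 * k) ≤
          ((∫⁻ x, F ω x ^ p) ^ (1 / p) * (∫⁻ x, H x ^ q') ^ (1 / q')) ^ (2 * k) :=
          pow_le_pow_left' h2 _
      _ = (∫⁻ x, F ω x ^ (2 * k)) * D := by
        rw [mul_pow, ← ENNReal.rpow_natCast, ← ENNReal.rpow_natCast, ← ENNReal.rpow_mul,
          ← ENNReal.rpow_mul]
        have : 1 / p * ((2 * k : ℕ) : ℝ) = 1 := by
          rw [one_div]; exact inv_mul_cancel₀ (by linarith)
        rw [this, ENNReal.rpow_one]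
        congr 1
        refine lintegral_congr fun x => ?_
        rw [ENNReal.rpow_natCast]
  -- The rate `2k(q+r)` absorbs the weight in the power of `F`, and the remaining `r` makes the
  -- integral over space converge.
  obtain ⟨C, hC0, hC⟩ := hu.exists_moment_le ha hs hk (2 * k * (q + r) + r)
  calc _ ≤ ∫⁻ ω, (∫⁻ x, F ω x ^ (2 * k)) * D ∂P := lintegral_mono hle
    _ = (∫⁻ ω, (∫⁻ x, F ω x ^ (2 * k)) ∂P) * D := by
      rw [lintegral_mul_const]
      exact (hFm.pow_const _).lintegral_prod_right'
    _ = (∫⁻ x, ∫⁻ ω, F ω x ^ (2 * k) ∂P) * D := by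
      rw [lintegral_lintegral_swap (f := fun ω x => F ω x ^ (2 * k))
        (hFm.pow_const _).aemeasurable]
    _ ≤ (∫⁻ x, ENNReal.ofReal C * H x) * D := by
      gcongr with x
      have hx : (0 : ℝ) < 1 + ‖x‖ := by positivity
      simp only [F, mul_pow]
      rw [lintegral_mul_const _ ((hu.measurable_eval x).enorm.pow_const _)]
      calc _ ≤ ENNReal.ofReal (C * ((1 + ‖x‖) ^ (2 * k * (q + r) + r))⁻¹) *
            ENNReal.ofReal ((1 + ‖x‖) ^ (q + r)) ^ (2 * k) := by gcongr; exact hC x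
        _ = _ := by
          rw [← ENNReal.ofReal_pow (by positivity), ← ENNReal.ofReal_mul (by positivity),
            ← ENNReal.ofReal_mul hC0]
          congr 1
          rw [pow_add, mul_comm (2 * k), pow_mul]
          field_simp
    _ = ENNReal.ofReal C * (∫⁻ x, H x) * D := by rw [lintegral_const_mul _ hH]
    _ < ⊤ := ENNReal.mul_lt_top (ENNReal.mul_lt_top ENNReal.ofReal_lt_top
      (lintegral_inv_pow_lt_top d (Nat.lt_succ_self d))) hD

/-- Almost surely, the field decays fast in the mean. -/
theorem ae_integrable_pow (hu : IsInitialField P ε (envelope ahat) u₀)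
    (ha : ContDiff ℝ (⊤ : ℕ∞) ahat) (hs : HasCompactSupport ahat) :
    ∀ᵐ ω ∂P, ∀ q : ℕ, Integrable fun x => ‖x‖ ^ q * ‖u₀ ω x‖ := by
  rw [ae_all_iff]
  intro q
  have h := hu.lintegral_weighted_pow_lt_top ha hs q one_ne_zero
  have hm : Measurable fun ω => (∫⁻ x, ‖u₀ ω x‖ₑ * ENNReal.ofReal ((1 + ‖x‖) ^ q)) ^ (2 * 1) := by
    have hw : Measurable fun x : Space d => ENNReal.ofReal ((1 + ‖x‖) ^ q) := by fun_prop
    exact (hu.measurable.enorm.mul (hw.comp measurable_snd)).lintegral_prod_right'.pow_const _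
  filter_upwards [ae_lt_top hm h.ne] with ω hω
  have hω' : ∫⁻ x, ‖u₀ ω x‖ₑ * ENNReal.ofReal ((1 + ‖x‖) ^ q) < ⊤ := by
    by_contra hne
    rw [not_lt, top_le_iff] at hne
    rw [hne] at hω
    simp at hω
  have hmω := hu.measurable_path ω
  refine ⟨by fun_prop, lt_of_le_of_lt (lintegral_mono fun x => ?_) hω'⟩
  rw [enorm_mul, mul_comm, enorm_norm]
  gcongr
  rw [Real.enorm_eq_ofReal (by positivity)]
  refine ENNReal.ofReal_le_ofReal (pow_le_pow_left₀ (norm_nonneg _) (by linarith) _)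

/-- The even powers are the unweighted case of the moment bound; any power `y ^ k` is at most `y ^
(2 * k) + 1`. -/
theorem integrable_fieldNorm_pow (hu : IsInitialField P ε (envelope ahat) u₀)
    (ha : ContDiff ℝ (⊤ : ℕ∞) ahat) (hs : HasCompactSupport ahat) (k : ℕ) :
    Integrable (fun ω => fieldNorm u₀ ω ^ k) P := by
  rcases eq_or_ne k 0 with rfl | hk
  · simp
  have hY0 := fieldNorm_nonneg u₀
  have hYm := hu.measurable_fieldNorm
  have h2 : Integrable (fun ω => fieldNorm u₀ ω ^ (2 * k)) P := by
    refine ⟨by fun_prop, lt_of_le_of_lt (lintegral_mono fun ω => ?_)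
      (hu.lintegral_weighted_pow_lt_top ha hs 0 hk)⟩
    rw [enorm_pow]
    gcongr
    rw [Real.enorm_eq_ofReal (hY0 ω), fieldNorm,
      integral_norm_eq_lintegral_enorm (hu.measurable_path ω).aestronglyMeasurable]
    simpa using ENNReal.ofReal_toReal_le
  refine (h2.add (integrable_const (1 : ℝ))).mono' (by fun_prop)
    (Filter.Eventually.of_forall fun ω => ?_)
  rw [Real.norm_of_nonneg (pow_nonneg (hY0 ω) _)]
  simp only [Pi.add_apply, mul_comm 2 k, pow_mul]
  nlinarith [sq_nonneg (fieldNorm u₀ ω ^ k - 1), pow_nonneg (hY0 ω) k]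

end IsInitialField

end WaveKinetic

namespace WaveKinetic

/-! ### The Fourier transform of the field -/

theorem measurable_apply₂ {A B C D : Type*} [MeasurableSpace A] [MeasurableSpace B]
    [MeasurableSpace C] [MeasurableSpace D] {f : A → B → C} (hf : Measurable (Function.uncurry f))
    {g : D → A} {h : D → B} (hg : Measurable g) (hh : Measurable h) :
    Measurable fun x => f (g x) (h x) := hf.comp (hg.prodMk hh)

section Fubini

variable {Q κ : Type*} [MeasurableSpace Q] {μ : Measure Q} [Fintype κ] {d : ℕ}
  {f : κ → Q → Space d → ℂ} {g : Q → Space d → ℝ} {G : Q → ℝ}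

/-- For a fixed parameter the norm of the product integrates to a product of integrals, at most the
power of `G` whose order is the number of factors. -/
theorem integrable_prod_pi (hf : ∀ i, Measurable (Function.uncurry (f i)))
    (hfg : ∀ i q x, ‖f i q x‖ ≤ g q x) (hg : ∀ᵐ q ∂μ, Integrable (g q) ∧ ∫ x, g q x = G q)
    (hg2 : Integrable (fun q => G q ^ Fintype.card κ) μ) :
    Integrable (fun p : Q × (κ → Space d) => ∏ i, f i p.1 (p.2 i)) (μ.prod volume) := by
  have hm : Measurable fun p : Q × (κ → Space d) => ∏ i, f i p.1 (p.2 i) :=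
    Finset.measurable_fun_prod _ fun i _ => (hf i).comp
      (measurable_fst.prodMk ((measurable_pi_apply i).comp measurable_snd))
  have hfi : ∀ q, Integrable (g q) → ∀ i, Integrable (f i q) := fun q hq i =>
    hq.mono' (hf i).of_uncurry_left.aestronglyMeasurable (Filter.Eventually.of_forall (hfg i q))
  rw [integrable_prod_iff hm.aestronglyMeasurable]
  constructor
  · filter_upwards [hg] with q hq
    exact Integrable.fintype_prod (hfi q hq.1)
  · refine hg2.mono' (hm.norm.stronglyMeasurable.integral_prod_right.aestronglyMeasurable) ?_
    filter_upwards [hg] with q hq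
    rw [Real.norm_of_nonneg (integral_nonneg fun _ => norm_nonneg _)]
    simp only [norm_prod]
    have h1 := integral_fintype_prod_volume_eq_prod (𝕜 := ℝ) (fun i x => ‖f i q x‖)
    rw [h1, ← Finset.card_univ, ← Finset.prod_const, ← hq.2]
    refine Finset.prod_le_prod (fun i _ => integral_nonneg fun _ => norm_nonneg _) fun i _ => ?_
    exact integral_mono (hfi q hq.1 i).norm hq.1 (hfg i q)

variable [SFinite μ]

/-- Fubini's theorem for products of integrals that depend on a parameter. -/
theorem integral_prod_integral (hf : ∀ i, Measurable (Function.uncurry (f i)))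
    (hfg : ∀ i q x, ‖f i q x‖ ≤ g q x) (hg : ∀ᵐ q ∂μ, Integrable (g q) ∧ ∫ x, g q x = G q)
    (hg2 : Integrable (fun q => G q ^ Fintype.card κ) μ) :
    ∫ q, (∏ i, ∫ x, f i q x) ∂μ = ∫ z : κ → Space d, ∫ q, ∏ i, f i q (z i) ∂μ := by
  have h := integrable_prod_pi hf hfg hg hg2
  rw [← integral_integral_swap (f := fun q (z : κ → Space d) => ∏ i, f i q (z i)) h]
  refine integral_congr_ae (Filter.Eventually.of_forall fun q => ?_)
  exact (integral_fintype_prod_volume_eq_prod (𝕜 := ℂ) (fun i x => f i q x)).symm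

end Fubini

/-- The factor `(2π)^{-d/2} e^{-ix·ξ}` of the Fourier transform. -/
def wave {d : ℕ} (ξ x : Space d) : ℂ :=
  (ftConst d : ℂ) * Complex.exp (-Complex.I * ((inner ℝ x ξ : ℝ) : ℂ))

theorem norm_wave {d : ℕ} (ξ x : Space d) : ‖wave ξ x‖ = ftConst d := by
  rw [wave, norm_mul, STree.norm_exp_neg_I, mul_one, Complex.norm_real,
    Real.norm_of_nonneg (ftConst_pos d).le]

theorem measurable_wave {d : ℕ} : Measurable (Function.uncurry (wave (d := d))) := by
  unfold wave Function.uncurry; fun_prop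

theorem ft_eq_wave {d : ℕ} (f : Space d → ℂ) (ξ : Space d) : ft f ξ = ∫ x, f x * wave ξ x := by
  rw [ft_def, ← integral_const_mul]
  congr 1
  funext x
  rw [wave]
  ring

/-- The reflection in `leafField` makes the plane wave the same for both parities; the parity then
acts on the field alone. -/
theorem leafField_ft {d : ℕ} (f : Space d → ℂ) (σ : ℤˣ) (ξ : Space d) :
    leafField (ft f) σ ξ = ∫ x, signConj σ (f x) * wave ξ x := by
  rcases Int.units_eq_one_or σ with rfl | rfl
  · simp only [signConj_one]
    rw [leafField, if_pos rfl, ft_eq_wave]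
  · simp only [signConj_neg_one]
    rw [leafField, if_neg (by decide), ft_eq_wave, ← integral_conj]
    congr 1
    funext x
    simp [wave, ← Complex.exp_conj]

theorem measurable_signConj (σ : ℤˣ) : Measurable (signConj σ) := (signConj σ).continuous.measurable

namespace IsInitialField

variable {d : ℕ} {ahat : Space d × Space d → ℂ} {Ω : Type*} [MeasurableSpace Ω] {P : Measure Ω}
  {ε : ℝ} {u₀ : Ω → Space d → ℂ}

theorem measurable_ft (hu : IsInitialField P ε (envelope ahat) u₀) :
    Measurable (Function.uncurry fun ω => ft (u₀ ω)) := by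
  have h0 : (Function.uncurry fun ω => ft (u₀ ω)) = fun q => ∫ x, u₀ q.1 x * wave q.2 x :=
    funext fun q => ft_eq_wave _ _
  rw [h0]
  have h : Measurable fun p : (Ω × Space d) × Space d => u₀ p.1.1 p.2 * wave p.1.2 p.2 :=
    (measurable_apply₂ hu.measurable measurable_fst.fst measurable_snd).mul
      (measurable_apply₂ measurable_wave measurable_fst.snd measurable_snd)
  exact h.stronglyMeasurable.integral_prod_right.measurable

theorem measurable_leafField (hu : IsInitialField P ε (envelope ahat) u₀) (σ : ℤˣ) :
    Measurable fun q : Ω × Space d => leafField (ft (u₀ q.1)) σ q.2 := by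
  simp only [leafField]
  split_ifs
  · exact hu.measurable_ft
  · exact Complex.continuous_conj.measurable.comp
      (measurable_apply₂ hu.measurable_ft measurable_fst measurable_snd.neg)

theorem norm_leafField_ft_le (ω : Ω) (σ : ℤˣ) (ξ : Space d) :
    ‖leafField (ft (u₀ ω)) σ ξ‖ ≤ ftConst d * fieldNorm u₀ ω := by
  unfold leafField
  split_ifs
  · exact norm_ft_le _
  · rw [RCLike.norm_conj]; exact norm_ft_le _

variable [IsProbabilityMeasure P]

theorem ae_integrable (hu : IsInitialField P ε (envelope ahat) u₀)
    (ha : ContDiff ℝ (⊤ : ℕ∞) ahat) (hs : HasCompactSupport ahat) :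
    ∀ᵐ ω ∂P, Integrable (u₀ ω) := by
  filter_upwards [hu.ae_integrable_pow ha hs] with ω hω
  rw [← integrable_norm_iff (hu.measurable_path ω).aestronglyMeasurable]
  simpa using hω 0

/-- The identity is multilinear in the family, so it can be integrated against plane waves in each
of the space variables. Fubini's theorem is justified by the moments of the `L¹` norm of the field.
-/
theorem isRotationInvariant_ft (hu : IsInitialField P ε (envelope ahat) u₀)
    (ha : ContDiff ℝ (⊤ : ℕ∞) ahat) (hs : HasCompactSupport ahat) :
    IsRotationInvariant P fun (i : ℤˣ × Space d) ω => leafField (ft (u₀ ω)) i.1 i.2 := by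
  intro κ _ c a θ
  have hpt := isRotationInvariant_of_gaussian hu.gaussian hu.measurable_eval hu.mean
  set X : ℤˣ × Space d → Ω → ℂ := fun i ω => signConj i.1 (u₀ ω i.2)
  -- The index `none` carries the derivative factor, so that all factors form one product for
  -- `integral_prod_integral`.
  set f : Option κ → Ω × Ω → Space d → ℂ := fun o q x => o.elim
    (mixedDeriv (X (a.1, x)) θ q * wave a.2 x) fun j => mixed (X ((c j).1, x)) θ q * wave (c j).2 x
  set g : Ω × Ω → Space d → ℝ := fun q x => ftConst d * (‖u₀ q.1 x‖ + ‖u₀ q.2 x‖)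
  have hXY : ∀ x (σ : ℤˣ) ω, ‖X (σ, x) ω‖ ≤ ‖u₀ ω x‖ := fun x σ ω => (norm_signConj _ _).le
  have hX1 : ∀ σ, Measurable fun p : (Ω × Ω) × Space d => X (σ, p.2) p.1.1 := fun σ =>
    (measurable_signConj σ).comp (measurable_apply₂ hu.measurable measurable_fst.fst measurable_snd)
  have hX2 : ∀ σ, Measurable fun p : (Ω × Ω) × Space d => X (σ, p.2) p.1.2 := fun σ =>
    (measurable_signConj σ).comp (measurable_apply₂ hu.measurable measurable_fst.snd measurable_snd)
  have hwave : ∀ ξ, Measurable fun p : (Ω × Ω) × Space d => wave ξ p.2 := fun ξ =>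
    measurable_apply₂ measurable_wave measurable_const measurable_snd
  have hf : ∀ o, Measurable (Function.uncurry (f o)) := by
    rintro (_ | j)
    · have h : Measurable fun p : (Ω × Ω) × Space d => mixedDeriv (X (a.1, p.2)) θ p.1 := by
        unfold mixedDeriv
        exact ((hX1 a.1).const_mul _).add ((hX2 a.1).const_mul _)
      exact h.mul (hwave _)
    · have h : Measurable fun p : (Ω × Ω) × Space d => mixed (X ((c j).1, p.2)) θ p.1 := by
        unfold mixed
        exact ((hX1 _).const_mul _).add ((hX2 _).const_mul _)
      exact h.mul (hwave _)
  have hfg : ∀ o q x, ‖f o q x‖ ≤ g q x := by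
    rintro (_ | j) q x
    · simp only [f, g, Option.elim, norm_mul, norm_wave]
      rw [mul_comm]
      exact mul_le_mul_of_nonneg_left (norm_mixedDeriv_le (X := fun σ => X (σ, x)) (fun σ ω => hXY x σ ω)
        a.1 θ q) (ftConst_pos d).le
    · simp only [f, g, Option.elim, norm_mul, norm_wave]
      rw [mul_comm]
      exact mul_le_mul_of_nonneg_left (norm_mixed_le (X := fun σ => X (σ, x)) (fun σ ω => hXY x σ ω)
        (c j).1 θ q) (ftConst_pos d).le
  have hae := hu.ae_integrable ha hs
  have h1 : ∀ᵐ q ∂(P.prod P), Integrable (u₀ q.1) :=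
    Measure.quasiMeasurePreserving_fst.ae hae
  have h2 : ∀ᵐ q ∂(P.prod P), Integrable (u₀ q.2) :=
    Measure.quasiMeasurePreserving_snd.ae hae
  have hg : ∀ᵐ q ∂(P.prod P), Integrable (g q) ∧
      ∫ x, g q x = ftConst d * (fieldNorm u₀ q.1 + fieldNorm u₀ q.2) := by
    filter_upwards [h1, h2] with q hq1 hq2
    refine ⟨(hq1.norm.add hq2.norm).const_mul _, ?_⟩
    simp only [g, fieldNorm]
    rw [integral_const_mul, integral_add hq1.norm hq2.norm]
  have hg2 : Integrable (fun q : Ω × Ω => (ftConst d * (fieldNorm u₀ q.1 + fieldNorm u₀ q.2)) ^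
      Fintype.card (Option κ)) (P.prod P) := by
    simp only [mul_pow]
    exact (integrable_add_pow (P := P) (fieldNorm_nonneg u₀) hu.measurable_fieldNorm
      (hu.integrable_fieldNorm_pow ha hs) (Fintype.card (Option κ))).const_mul _
  have hmain := integral_prod_integral hf hfg hg hg2
  have hz : ∀ z : Option κ → Space d, ∫ q, ∏ o, f o q (z o) ∂(P.prod P) = 0 := by
    intro z
    have h3 := hpt κ (fun j => ((c j).1, z (some j))) (a.1, z none) θ
    have h4 : ∀ q, ∏ o, f o q (z o) = (wave a.2 (z none) * ∏ j, wave (c j).2 (z (some j))) *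
        (mixedDeriv (X (a.1, z none)) θ q * ∏ j, mixed (X ((c j).1, z (some j))) θ q) := by
      intro q
      rw [Fintype.prod_option]
      simp only [f, Option.elim, Finset.prod_mul_distrib]
      ring
    simp only [h4]
    rw [integral_const_mul, h3, mul_zero]
  simp only [hz, integral_zero] at hmain
  rw [← hmain]
  refine integral_congr_ae ?_
  filter_upwards [h1, h2] with q hq1 hq2
  have hX : ∀ ω, Integrable (u₀ ω) → ∀ σ ξ, Integrable fun x => X (σ, x) ω * wave ξ x := by
    intro ω hω σ ξ
    refine (hω.norm.mul_const (ftConst d)).mono' ?_ (Filter.Eventually.of_forall fun x => ?_)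
    · exact (((measurable_signConj σ).comp (hu.measurable_path ω)).mul
        measurable_wave.of_uncurry_left).aestronglyMeasurable
    · rw [norm_mul, norm_wave]
      exact mul_le_mul_of_nonneg_right (hXY x σ ω) (ftConst_pos d).le
  rw [Fintype.prod_option]
  have hlin : ∀ (α β : ℂ) σ ξ, ∫ x, (α * X (σ, x) q.1 + β * X (σ, x) q.2) * wave ξ x =
      α * leafField (ft (u₀ q.1)) σ ξ + β * leafField (ft (u₀ q.2)) σ ξ := by
    intro α β σ ξ
    rw [leafField_ft, leafField_ft, ← integral_const_mul, ← integral_const_mul,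
      ← integral_add ((hX _ hq1 σ ξ).const_mul _) ((hX _ hq2 σ ξ).const_mul _)]
    congr 1
    funext x
    simp only [X]
    ring
  simp only [f, Option.elim, mixed, mixedDeriv, hlin]

theorem integrable_scaled_fieldNorm_pow (hu : IsInitialField P ε (envelope ahat) u₀)
    (ha : ContDiff ℝ (⊤ : ℕ∞) ahat) (hs : HasCompactSupport ahat) (k : ℕ) :
    Integrable (fun ω => (ftConst d * fieldNorm u₀ ω) ^ k) P := by
  simp only [mul_pow]
  exact (hu.integrable_fieldNorm_pow ha hs k).const_mul _

/-- The Wick formula for the Fourier transform of the field. -/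
theorem wick (hu : IsInitialField P ε (envelope ahat) u₀)
    (ha : ContDiff ℝ (⊤ : ℕ∞) ahat) (hs : HasCompactSupport ahat)
    {κ : Type} [Fintype κ] [LinearOrder κ] (σ : κ → ℤˣ) (ξ : κ → Space d) :
    ∫ ω, ∏ i, leafField (ft (u₀ ω)) (σ i) (ξ i) ∂P =
      pairSum (fun i j => ∫ ω, leafField (ft (u₀ ω)) (σ i) (ξ i) *
        leafField (ft (u₀ ω)) (σ j) (ξ j) ∂P) Finset.univ :=
  (hu.isRotationInvariant_ft ha hs).integral_prod_eq
    (fun i => (hu.measurable_leafField i.1).of_uncurry_right (f := fun ω ξ => leafField (ft (u₀ ω)) i.1 ξ))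
    (fun i ω => norm_leafField_ft_le ω i.1 i.2)
    (fun ω => mul_nonneg (ftConst_pos d).le (fieldNorm_nonneg u₀ ω))
    (hu.measurable_fieldNorm.const_mul _) (hu.integrable_scaled_fieldNorm_pow ha hs)
    (fun i => (σ i, ξ i)) Finset.univ

/-- Covariances in frequency as integrals of covariances in space. -/
theorem integral_leafField_mul (hu : IsInitialField P ε (envelope ahat) u₀)
    (ha : ContDiff ℝ (⊤ : ℕ∞) ahat) (hs : HasCompactSupport ahat) (σ σ' : ℤˣ) (ξ ξ' : Space d) :
    ∫ ω, leafField (ft (u₀ ω)) σ ξ * leafField (ft (u₀ ω)) σ' ξ' ∂P =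
      ∫ z : Fin 2 → Space d, (∫ ω, signConj σ (u₀ ω (z 0)) * signConj σ' (u₀ ω (z 1)) ∂P) *
        (wave ξ (z 0) * wave ξ' (z 1)) := by
  have hXm : ∀ σ, Measurable fun q : Ω × Space d => signConj σ (u₀ q.1 q.2) := fun σ =>
    (measurable_signConj σ).comp hu.measurable
  have hwave : ∀ ξ, Measurable fun p : Ω × Space d => wave ξ p.2 := fun ξ =>
    measurable_apply₂ measurable_wave measurable_const measurable_snd
  have hb : ∀ σ ξ ω x, ‖signConj σ (u₀ ω x) * wave ξ x‖ ≤ ftConst d * ‖u₀ ω x‖ := by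
    intro σ ξ ω x
    rw [norm_mul, norm_signConj, norm_wave, mul_comm]
  have h := integral_prod_integral (μ := P) (κ := Fin 2)
    (f := ![fun ω x => signConj σ (u₀ ω x) * wave ξ x, fun ω x => signConj σ' (u₀ ω x) * wave ξ' x])
    (g := fun ω x => ftConst d * ‖u₀ ω x‖)
    (by rw [Fin.forall_fin_two]; exact ⟨(hXm σ).mul (hwave ξ), (hXm σ').mul (hwave ξ')⟩)
    (by rw [Fin.forall_fin_two]; exact ⟨hb σ ξ, hb σ' ξ'⟩)
    (by filter_upwards [hu.ae_integrable ha hs] with ω hω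
        exact ⟨hω.norm.const_mul _, integral_const_mul _ _⟩)
    (hu.integrable_scaled_fieldNorm_pow ha hs _)
  simp only [Fin.prod_univ_two, Matrix.cons_val_zero, Matrix.cons_val_one, ← leafField_ft] at h
  rw [h]
  refine integral_congr_ae (Filter.Eventually.of_forall fun z => ?_)
  simp only
  rw [← integral_mul_const]
  congr 1
  funext ω
  ring

/-- Covariances vanish for equal parities. -/
theorem integral_leafField_mul_self (hu : IsInitialField P ε (envelope ahat) u₀)
    (ha : ContDiff ℝ (⊤ : ℕ∞) ahat) (hs : HasCompactSupport ahat) (σ : ℤˣ) (ξ ξ' : Space d) :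
    ∫ ω, leafField (ft (u₀ ω)) σ ξ * leafField (ft (u₀ ω)) σ ξ' ∂P = 0 := by
  rw [hu.integral_leafField_mul ha hs]
  have : ∀ x x', ∫ ω, signConj σ (u₀ ω x) * signConj σ (u₀ ω x') ∂P = 0 := by
    intro x x'
    rcases Int.units_eq_one_or σ with rfl | rfl
    · exact hu.pseudocovariance x x'
    · simp only [signConj_neg_one, ← map_mul]
      rw [integral_conj, hu.pseudocovariance, map_zero]
  simp [this]

end IsInitialField

end WaveKinetic

namespace WaveKinetic

/-! ### The field is band limited -/

open scoped FourierTransform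

theorem measurable_envelope {d : ℕ} {ahat : Space d × Space d → ℂ} (ha : Continuous ahat) :
    Measurable (Function.uncurry (envelope ahat)) := by
  have h : Measurable fun p : (Space d × Space d) × Space d => ahat (p.2, p.1.2) *
      Complex.exp (Complex.I * ((inner ℝ p.1.1 p.2 : ℝ) : ℂ)) := by
    have := ha.measurable
    fun_prop
  have h2 : Function.uncurry (envelope ahat) = fun p => (ftConst d : ℂ) * ∫ η, ahat (η, p.2) *
      Complex.exp (Complex.I * ((inner ℝ p.1 η : ℝ) : ℂ)) := funext fun p => ift_def _ _
  rw [h2]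
  exact h.stronglyMeasurable.integral_prod_right.measurable.const_mul _

theorem contDiff_ft {d : ℕ} {f : Space d → ℂ}
    (hf : ∀ q : ℕ, Integrable fun x => ‖x‖ ^ q * ‖f x‖) : ContDiff ℝ (⊤ : ℕ∞) (ft f) := by
  have h : ft f = fun ξ => (ftConst d : ℂ) * 𝓕 f ((2 * Real.pi)⁻¹ • ξ) := funext (ft_eq_fourier f)
  rw [h]
  exact contDiff_const.mul ((Real.contDiff_fourier fun n _ => hf n).comp
    (contDiff_const_smul _))

namespace IsInitialField

variable {d : ℕ} {ahat : Space d × Space d → ℂ} {Ω : Type*} [MeasurableSpace Ω] {P : Measure Ω}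
  {ε : ℝ} {u₀ : Ω → Space d → ℂ} [IsProbabilityMeasure P]

/-- The variance of the Fourier transform. -/
theorem integral_conj_ft_mul_ft (hu : IsInitialField P ε (envelope ahat) u₀)
    (ha : ContDiff ℝ (⊤ : ℕ∞) ahat) (hs : HasCompactSupport ahat) (ξ : Space d) :
    ∫ ω, starRingEnd ℂ (ft (u₀ ω) ξ) * ft (u₀ ω) ξ ∂P =
      ∫ ζ, starRingEnd ℂ (ahat (ξ - ε⁻¹ • ζ, ζ)) * ahat (ξ - ε⁻¹ • ζ, ζ) := by
  obtain ⟨R, hR0, hR⟩ := exists_support_ball hs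
  obtain ⟨C, hC0, hC⟩ := exists_envelope_decay ha hs (d + 1)
  have h0 : ∀ ω, starRingEnd ℂ (ft (u₀ ω) ξ) * ft (u₀ ω) ξ =
      leafField (ft (u₀ ω)) (-1) (-ξ) * leafField (ft (u₀ ω)) 1 ξ := by
    intro ω
    rw [leafField, if_neg (by decide), leafField, if_pos rfl, neg_neg]
  simp only [h0]
  rw [hu.integral_leafField_mul ha hs]
  -- For fixed `ζ`, the carrier wave of the covariance shifts the frequency by `ε⁻¹ • ζ`, and
  -- integration in `x` recovers `ahat` there. The integral over `ζ` is kept outside, as the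
  -- parameter in `integral_prod_integral`.
  set b : Space d → Space d → ℂ := fun ζ x => envelope ahat x ζ * wave (ξ - ε⁻¹ • ζ) x
  set f : Fin 2 → Space d → Space d → ℂ := ![fun ζ x => starRingEnd ℂ (b ζ x), b]
  set g : Space d → Space d → ℝ := fun ζ x =>
    (Metric.closedBall (0 : Space d) R).indicator (fun _ => (1 : ℝ)) ζ *
      (C * ftConst d * ((1 + ‖x‖) ^ (d + 1))⁻¹)
  have hbm : Measurable (Function.uncurry b) := by
    have h1 : Measurable fun p : Space d × Space d => ξ - ε⁻¹ • p.1 := by fun_prop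
    exact (measurable_apply₂ (measurable_envelope ha.continuous) measurable_snd measurable_fst).mul
      (measurable_apply₂ measurable_wave h1 measurable_snd)
  have hbg : ∀ ζ x, ‖b ζ x‖ ≤ g ζ x := by
    intro ζ x
    by_cases hζ : ‖ζ‖ ≤ R
    · simp only [b, g]
      rw [Set.indicator_of_mem (by simpa using hζ), one_mul, norm_mul, norm_wave, mul_right_comm]
      refine mul_le_mul_of_nonneg_right ?_ (ftConst_pos d).le
      rw [← div_eq_mul_inv, le_div_iff₀ (by positivity), mul_comm]
      exact hC x ζ
    · simp only [b, g]
      rw [envelope_eq_zero hR (not_le.1 hζ), Set.indicator_of_notMem (by simpa using hζ)]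
      simp
  have hw : Integrable fun x : Space d => ((1 + ‖x‖) ^ (d + 1))⁻¹ := by
    refine ⟨by fun_prop, ?_⟩
    refine lt_of_le_of_lt (lintegral_mono fun x => ?_)
      (lintegral_inv_pow_lt_top d (Nat.lt_succ_self d))
    rw [Real.enorm_eq_ofReal (by positivity)]
  have h := integral_prod_integral (μ := (volume : Measure (Space d))) (f := f) (g := g)
    (G := fun ζ => ∫ x, g ζ x)
    (by rw [Fin.forall_fin_two]; exact ⟨Complex.continuous_conj.measurable.comp hbm, hbm⟩)
    (by rw [Fin.forall_fin_two]
        exact ⟨fun ζ x => (RCLike.norm_conj _).trans_le (hbg ζ x), hbg⟩)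
    (Filter.Eventually.of_forall fun ζ => ⟨(hw.const_mul _).const_mul _, rfl⟩)
    (by
      simp only [g, integral_const_mul, mul_pow]
      refine Integrable.mul_const ?_ _
      have : ∀ ζ : Space d, (Metric.closedBall (0 : Space d) R).indicator (fun _ => (1 : ℝ)) ζ ^
          Fintype.card (Fin 2) = (Metric.closedBall (0 : Space d) R).indicator (fun _ => (1 : ℝ)) ζ := by
        intro ζ
        by_cases hζ : ζ ∈ Metric.closedBall (0 : Space d) R <;> simp [hζ]
      simp only [this]
      exact (integrable_indicator_iff Metric.isClosed_closedBall.measurableSet).2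
        (integrableOn_const (isCompact_closedBall _ _).measure_lt_top.ne))
  have hb : ∀ ζ, ∫ x, b ζ x = ahat (ξ - ε⁻¹ • ζ, ζ) := by
    intro ζ
    have h2 := congrFun (ft_ift (contDiff_slice ha ζ) (hasCompactSupport_slice hs ζ)) (ξ - ε⁻¹ • ζ)
    rw [ft_eq_wave] at h2
    exact h2
  simp only [Fin.prod_univ_two, f, Matrix.cons_val_zero, Matrix.cons_val_one, integral_conj,
    hb] at h
  rw [h]
  refine integral_congr_ae (Filter.Eventually.of_forall fun z => ?_)
  simp only [signConj_one, signConj_neg_one]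
  rw [hu.covariance, ← integral_mul_const]
  congr 1
  funext ζ
  simp only [b, wave, map_mul, ← Complex.exp_conj, Complex.conj_ofReal, map_neg, Complex.conj_I]
  have h3 : ∀ A B c e1 e2 e3 e4 e5 : ℂ, e1 * (e2 * e3) = e4 * e5 →
      A * B * e1 * (c * e2 * (c * e3)) = A * (c * e4) * (B * (c * e5)) := by
    intro A B c e1 e2 e3 e4 e5 h
    linear_combination A * B * c * c * h
  refine h3 _ _ _ _ _ _ _ _ ?_
  rw [← Complex.exp_add, ← Complex.exp_add, ← Complex.exp_add]
  congr 1
  simp only [inner_sub_right, inner_neg_right, real_inner_comm (z 0), real_inner_comm (z 1)]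
  push_cast
  ring

/-- Almost surely, the Fourier transform of the field is smooth and supported in a fixed ball. -/
theorem exists_band (hu : IsInitialField P ε (envelope ahat) u₀)
    (ha : ContDiff ℝ (⊤ : ℕ∞) ahat) (hs : HasCompactSupport ahat) :
    ∃ R, 0 ≤ R ∧ (∀ ξ, R < ‖ξ‖ → ∀ᵐ ω ∂P, ft (u₀ ω) ξ = 0) ∧
      ∀ᵐ ω ∂P, ContDiff ℝ (⊤ : ℕ∞) (ft (u₀ ω)) ∧ HasCompactSupport (ft (u₀ ω)) ∧
        IsBandLimited (ft (u₀ ω)) (ftConst d * fieldNorm u₀ ω) R := by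
  obtain ⟨R, hR0, hR⟩ := exists_support_ball hs
  -- Both arguments of `ahat` in the variance are at most `R` where it is nonzero, hence the radius.
  -- Beyond it the variance is zero.
  have hz : ∀ ξ, R + |ε⁻¹| * R < ‖ξ‖ → ∀ᵐ ω ∂P, ft (u₀ ω) ξ = 0 := by
    intro ξ hξ
    have h1 : ∀ ζ, ahat (ξ - ε⁻¹ • ζ, ζ) = 0 := by
      intro ζ
      by_contra hne
      obtain ⟨h2, h3⟩ := hR _ hne
      have h4 : ‖ξ‖ ≤ ‖ξ - ε⁻¹ • ζ‖ + ‖ε⁻¹ • ζ‖ := norm_le_norm_sub_add _ _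
      rw [norm_smul, Real.norm_eq_abs] at h4
      have h5 := mul_le_mul_of_nonneg_left h3 (abs_nonneg ε⁻¹)
      simp only at h2 h5
      linarith
    have h2 := hu.integral_conj_ft_mul_ft ha hs ξ
    simp only [h1, mul_zero, integral_zero, Complex.conj_mul', ← Complex.ofReal_pow] at h2
    rw [integral_complex_ofReal, Complex.ofReal_eq_zero] at h2
    have h3 : Measurable fun ω => ft (u₀ ω) ξ :=
      hu.measurable_ft.of_uncurry_right (f := fun ω => ft (u₀ ω))
    rw [integral_eq_zero_iff_of_nonneg (fun _ => by positivity)] at h2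
    · filter_upwards [h2] with ω hω
      simpa using hω
    · refine (hu.integrable_scaled_fieldNorm_pow ha hs 2).mono' (h3.norm.pow_const 2).aestronglyMeasurable
        (Filter.Eventually.of_forall fun ω => ?_)
      rw [Real.norm_of_nonneg (by positivity)]
      exact pow_le_pow_left₀ (norm_nonneg _) (norm_ft_le _) 2
  have hR0' : 0 ≤ R + |ε⁻¹| * R := by positivity
  refine ⟨R + |ε⁻¹| * R, hR0', hz, ?_⟩
  set U : Set (Space d) := (Metric.closedBall 0 (R + |ε⁻¹| * R))ᶜ
  have hU : IsOpen U := Metric.isClosed_closedBall.isOpen_compl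
  -- The exceptional null set depends on the frequency, so countably many frequencies are used, and
  -- continuity of the transform extends the vanishing to the whole exterior of the ball.
  obtain ⟨S, hSc, hSd⟩ := TopologicalSpace.exists_countable_dense (Space d)
  have hS : ∀ᵐ ω ∂P, ∀ ξ ∈ S, ξ ∈ U → ft (u₀ ω) ξ = 0 := by
    rw [ae_ball_iff hSc]
    intro ξ _
    by_cases hξ : ξ ∈ U
    · filter_upwards [hz ξ (by simpa [U] using hξ)] with ω hω _ using hω
    · exact Filter.Eventually.of_forall fun ω h => absurd h hξ
  filter_upwards [hS, hu.ae_integrable_pow ha hs] with ω h1 h2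
  have hc := contDiff_ft h2
  have hzero : ∀ ξ, R + |ε⁻¹| * R < ‖ξ‖ → ft (u₀ ω) ξ = 0 := by
    intro ξ hξ
    have h3 : U ⊆ closure (U ∩ S) := hSd.open_subset_closure_inter hU
    have h4 : IsClosed {ξ | ft (u₀ ω) ξ = 0} := isClosed_eq hc.continuous continuous_const
    exact closure_minimal (fun x hx => h1 x hx.2 hx.1) h4 (h3 (by simpa [U] using hξ))
  refine ⟨hc, ?_, hc.continuous.measurable, hR0', fun ξ => norm_ft_le ξ, hzero⟩
  refine HasCompactSupport.of_support_subset_isCompact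
    (isCompact_closedBall (0 : Space d) (R + |ε⁻¹| * R)) fun ξ hξ => ?_
  rw [mem_closedBall_zero_iff]
  by_contra hne
  exact hξ (hzero ξ (not_le.1 hne))

end IsInitialField

end WaveKinetic

namespace WaveKinetic

/-! ### The Wigner transform in frequency -/

section ChangeOfVariables

variable {d : ℕ}

theorem map_add_smul (a : Space d) {c : ℝ} (hc : c ≠ 0) :
    (volume : Measure (Space d)).map (fun y => a + c • y) =
      ENNReal.ofReal |(c ^ d)⁻¹| • (volume : Measure (Space d)) := by
  have h : (fun y : Space d => a + c • y) = (fun y => a + y) ∘ fun y => c • y := rfl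
  rw [h, ← Measure.map_map (measurable_const_add a) (measurable_const_smul c),
    Measure.map_addHaar_smul _ hc, Measure.map_smul, map_add_left_eq_self,
    finrank_euclideanSpace_fin]

theorem lintegral_add_smul (a : Space d) {c : ℝ} (hc : c ≠ 0) {f : Space d → ENNReal}
    (hf : Measurable f) :
    ∫⁻ y, f (a + c • y) = ENNReal.ofReal |(c ^ d)⁻¹| * ∫⁻ y, f y := by
  rw [← lintegral_map hf (by fun_prop : Measurable fun y : Space d => a + c • y),
    map_add_smul a hc, lintegral_smul_measure, smul_eq_mul]

/-- The change of variables `(x, y) ↦ (x + εy/2, x - εy/2)`. -/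
theorem map_wigner {ε : ℝ} (hε : 0 < ε) :
    (volume : Measure (Space d × Space d)).map
      (fun q => (q.1 + (ε / 2) • q.2, q.1 - (ε / 2) • q.2)) =
      ENNReal.ofReal (ε ^ d)⁻¹ • (volume : Measure (Space d × Space d)) := by
  refine Measure.ext_of_lintegral _ fun f hf => ?_
  rw [lintegral_map hf (by fun_prop), lintegral_smul_measure, Measure.volume_eq_prod,
    lintegral_prod _ (by fun_prop : AEMeasurable _ _), lintegral_prod _ hf.aemeasurable]
  -- First `y` is replaced by the first new variable `X`, then `x` by the second one, `2x - X`. The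
  -- factors `(ε/2)^{-d}` and `2^{-d}` combine to `ε^{-d}`.
  have h1 : ∀ x : Space d, ∫⁻ y, f (x + (ε / 2) • y, x - (ε / 2) • y) =
      ENNReal.ofReal |((ε / 2) ^ d)⁻¹| * ∫⁻ X, f (X, (-X) + (2 : ℝ) • x) := by
    intro x
    rw [← lintegral_add_smul x (by positivity)
      (by fun_prop : Measurable fun X => f (X, (-X) + (2 : ℝ) • x))]
    congr 1
    funext y
    congr 2
    rw [two_smul]
    abel
  simp only [h1]
  rw [lintegral_const_mul _ (by fun_prop), lintegral_lintegral_swap (by fun_prop)]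
  have h2 : ∀ X : Space d, ∫⁻ x, f (X, (-X) + (2 : ℝ) • x) =
      ENNReal.ofReal |((2 : ℝ) ^ d)⁻¹| * ∫⁻ x, f (X, x) := fun X =>
    lintegral_add_smul (-X) two_ne_zero (by fun_prop : Measurable fun x => f (X, x))
  simp only [h2]
  rw [lintegral_const_mul _ (by fun_prop), ← mul_assoc, ← ENNReal.ofReal_mul (abs_nonneg _),
    ← abs_mul, ← mul_inv, ← mul_pow, div_mul_cancel₀ _ two_ne_zero,
    abs_of_pos (by positivity), smul_eq_mul]

end ChangeOfVariables

namespace IsInitialField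

variable {d : ℕ} {ahat : Space d × Space d → ℂ} {Ω : Type*} [MeasurableSpace Ω] {P : Measure Ω}
  {ε : ℝ} {u₀ : Ω → Space d → ℂ} [IsProbabilityMeasure P]

theorem integrable_conj_mul (hu : IsInitialField P ε (envelope ahat) u₀)
    (ha : ContDiff ℝ (⊤ : ℕ∞) ahat) (hs : HasCompactSupport ahat) :
    Integrable (fun q : Ω × (Space d × Space d) =>
      starRingEnd ℂ (u₀ q.1 q.2.1) * u₀ q.1 q.2.2) (P.prod volume) := by
  have hm : Measurable fun q : Ω × (Space d × Space d) =>
      starRingEnd ℂ (u₀ q.1 q.2.1) * u₀ q.1 q.2.2 :=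
    (Complex.continuous_conj.measurable.comp
      (measurable_apply₂ hu.measurable measurable_fst measurable_snd.fst)).mul
      (measurable_apply₂ hu.measurable measurable_fst measurable_snd.snd)
  rw [integrable_prod_iff hm.aestronglyMeasurable]
  have hae := hu.ae_integrable ha hs
  constructor
  · filter_upwards [hae] with ω hω
    have h := (Complex.conjLIE.toContinuousLinearEquiv.toContinuousLinearMap.integrable_comp
      hω).mul_prod hω
    exact h
  · have h : ∀ ω, ∫ q : Space d × Space d, ‖starRingEnd ℂ (u₀ ω q.1) * u₀ ω q.2‖ =
        fieldNorm u₀ ω ^ 2 := by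
      intro ω
      simp only [norm_mul, RCLike.norm_conj]
      rw [Measure.volume_eq_prod, integral_prod_mul (fun x => ‖u₀ ω x‖) fun x => ‖u₀ ω x‖,
        sq, fieldNorm]
    simp only [h]
    exact hu.integrable_fieldNorm_pow ha hs 2

/-- The Fourier transform of the Wigner transform as a covariance in frequency. -/
theorem wignerHat_eq (hu : IsInitialField P ε (envelope ahat) u₀) (hε : 0 < ε)
    (ha : ContDiff ℝ (⊤ : ℕ∞) ahat) (hs : HasCompactSupport ahat) (η v : Space d) :
    wignerHat P ε u₀ η v = (ftConst d : ℂ) * ((ε ^ d : ℝ) : ℂ)⁻¹ *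
      ∫ ω, starRingEnd ℂ (ft (u₀ ω) (ε⁻¹ • v - (2 : ℝ)⁻¹ • η)) *
        ft (u₀ ω) (ε⁻¹ • v + (2 : ℝ)⁻¹ • η) ∂P := by
  -- The two frequencies for which the plane waves at `x ± (ε/2) y` multiply to the phase in `v·y -
  -- x·η`.
  set α := ε⁻¹ • v - (2 : ℝ)⁻¹ • η
  set β := ε⁻¹ • v + (2 : ℝ)⁻¹ • η
  set Ψ : Space d × Space d → Space d × Space d :=
    fun q => (q.1 + (ε / 2) • q.2, q.1 - (ε / 2) • q.2)
  have hΨm : Measurable Ψ := by fun_prop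
  set H : Ω → Space d × Space d → ℂ := fun ω q =>
    starRingEnd ℂ (u₀ ω q.1 * wave α q.1) * (u₀ ω q.2 * wave β q.2)
  have hHm : Measurable (Function.uncurry H) := by
    have h1 : ∀ ξ : Space d, Measurable fun q : Ω × Space d => u₀ q.1 q.2 * wave ξ q.2 := fun ξ =>
      hu.measurable.mul (measurable_apply₂ measurable_wave measurable_const measurable_snd)
    exact (Complex.continuous_conj.measurable.comp ((h1 α).comp
      (measurable_fst.prodMk measurable_snd.fst))).mul
      ((h1 β).comp (measurable_fst.prodMk measurable_snd.snd))
  have hHi : Integrable (Function.uncurry H) (P.prod volume) := by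
    refine ((hu.integrable_conj_mul ha hs).norm.mul_const (ftConst d ^ 2)).mono'
      hHm.aestronglyMeasurable (Filter.Eventually.of_forall fun q => le_of_eq ?_)
    simp only [Function.uncurry, H, norm_mul, RCLike.norm_conj, norm_wave]
    ring
  have hK : Integrable (fun q : Ω × (Space d × Space d) => H q.1 (Ψ q.2)) (P.prod volume) := by
    have h1 : (P.prod (volume : Measure (Space d × Space d))).map (Prod.map id Ψ) =
        ENNReal.ofReal (ε ^ d)⁻¹ • P.prod volume := by
      rw [← Measure.map_prod_map _ _ measurable_id hΨm, Measure.map_id, map_wigner hε,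
        Measure.prod_smul_right]
    have h2 : Integrable (Function.uncurry H)
        ((P.prod (volume : Measure (Space d × Space d))).map (Prod.map id Ψ)) := by
      rw [h1]
      exact hHi.smul_measure ENNReal.ofReal_ne_top
    exact h2.comp_measurable (measurable_id.prodMap hΨm)
  have hpath : ∀ ω, ∫ q, H ω (Ψ q) = ((ε ^ d : ℝ) : ℂ)⁻¹ *
      (starRingEnd ℂ (ft (u₀ ω) α) * ft (u₀ ω) β) := by
    intro ω
    have h1 := integral_map (μ := (volume : Measure (Space d × Space d))) hΨm.aemeasurable
      (hHm.of_uncurry_left (x := ω)).aestronglyMeasurable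
    rw [← h1, map_wigner hε, integral_smul_measure, ENNReal.toReal_ofReal (by positivity),
      Measure.volume_eq_prod, integral_prod_mul (fun x => starRingEnd ℂ (u₀ ω x * wave α x))
      (fun x => u₀ ω x * wave β x), integral_conj, ← ft_eq_wave, ← ft_eq_wave, Complex.real_smul,
      Complex.ofReal_inv]
  have hsum : ∫ ω, (∫ q, H ω (Ψ q)) ∂P = ∫ x, ∫ ω, (∫ y, H ω (Ψ (x, y))) ∂P := by
    have hK2 : Integrable (fun q : (Ω × Space d) × Space d => H q.1.1 (Ψ (q.1.2, q.2)))
        ((P.prod volume).prod volume) :=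
      (measurePreserving_prodAssoc P volume volume).integrable_comp_of_integrable hK
    rw [← integral_prod _ hK, ← integral_integral_swap hK2.integral_prod_left,
      ← integral_prod _ hK2.integral_prod_left, ← integral_prod _ hK2]
    exact ((measurePreserving_prodAssoc P volume volume).integral_comp
      MeasurableEquiv.prodAssoc.measurableEmbedding (fun q => H q.1 (Ψ q.2))).symm
  have hconst : (((2 * Real.pi) ^ (-(d : ℝ)) : ℝ) : ℂ) = (ftConst d : ℂ) ^ 2 := by
    rw [← Complex.ofReal_pow, ftConst, ← Real.rpow_natCast, ← Real.rpow_mul (by positivity)]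
    congr 2
    push_cast
    ring
  have hpt : ∀ x, wigner P ε u₀ x v * Complex.exp (-Complex.I * ((inner ℝ x η : ℝ) : ℂ)) =
      ∫ ω, (∫ y, H ω (Ψ (x, y))) ∂P := by
    intro x
    rw [wigner, hconst, mul_assoc, ← integral_mul_const, ← integral_const_mul]
    congr 1
    funext ω
    rw [← integral_mul_const, ← integral_const_mul]
    congr 1
    funext y
    have h3 : ∀ c A B e1 e2 e3 e4 : ℂ, e1 * e2 = e3 * e4 →
        c ^ 2 * (A * B * e1 * e2) = A * (c * e3) * (B * (c * e4)) := by
      intro c A B e1 e2 e3 e4 h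
      linear_combination c ^ 2 * A * B * h
    simp only [H, Ψ, wave, map_mul, ← Complex.exp_conj, Complex.conj_ofReal, map_neg,
      Complex.conj_I]
    refine h3 _ _ _ _ _ _ _ ?_
    rw [← Complex.exp_add, ← Complex.exp_add]
    congr 1
    have h4 : (inner ℝ v y : ℝ) - inner ℝ x η = inner ℝ (x + (ε / 2) • y) α -
        inner ℝ (x - (ε / 2) • y) β := by
      simp only [α, β, inner_add_left, inner_sub_left, inner_add_right, inner_sub_right,
        real_inner_smul_left, real_inner_smul_right, real_inner_comm y v]
      field_simp
      ring
    have h5 := congrArg (fun r : ℝ => Complex.I * (r : ℂ)) h4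
    push_cast at h5
    linear_combination h5
  rw [wignerHat, ft_def]
  simp only [hpt]
  rw [← hsum]
  simp only [hpath]
  rw [integral_const_mul, mul_assoc]

/-- Solving `wignerHat_eq` for the covariance: the sum of the two leaf frequencies is the slow
variable, and their signed combination, scaled by `ε/2`, is the velocity. -/
theorem integral_leafField_mul_neg (hu : IsInitialField P ε (envelope ahat) u₀) (hε : 0 < ε)
    (ha : ContDiff ℝ (⊤ : ℕ∞) ahat) (hs : HasCompactSupport ahat) (σ : ℤˣ) (ξ ξ' : Space d) :
    ∫ ω, leafField (ft (u₀ ω)) σ ξ * leafField (ft (u₀ ω)) (-σ) ξ' ∂P =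
      (ftConst d : ℂ)⁻¹ * ((ε ^ d : ℝ) : ℂ) * wignerHat P ε u₀ (ξ + ξ')
        ((ε / 2) • (unitSign σ • ξ + unitSign (-σ) • ξ')) := by
  have hc0 : (ftConst d : ℂ) ≠ 0 := Complex.ofReal_ne_zero.2 (ftConst_pos d).ne'
  have he0 : ((ε ^ d : ℝ) : ℂ) ≠ 0 := Complex.ofReal_ne_zero.2 (by positivity)
  have key : ∀ α β : Space d, ∫ ω, leafField (ft (u₀ ω)) (-1) α * leafField (ft (u₀ ω)) 1 β ∂P =
      (ftConst d : ℂ)⁻¹ * ((ε ^ d : ℝ) : ℂ) * wignerHat P ε u₀ (α + β)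
        ((ε / 2) • (-α + β)) := by
    intro α β
    rw [hu.wignerHat_eq hε ha hs]
    have h1 : ε⁻¹ • (ε / 2) • (-α + β) - (2 : ℝ)⁻¹ • (α + β) = -α := by
      rw [smul_smul, show ε⁻¹ * (ε / 2) = (2 : ℝ)⁻¹ by field_simp, ← smul_sub,
        show -α + β - (α + β) = (2 : ℝ) • (-α) by rw [two_smul]; abel,
        inv_smul_smul₀ two_ne_zero]
    have h2 : ε⁻¹ • (ε / 2) • (-α + β) + (2 : ℝ)⁻¹ • (α + β) = β := by
      rw [smul_smul, show ε⁻¹ * (ε / 2) = (2 : ℝ)⁻¹ by field_simp, ← smul_add,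
        show -α + β + (α + β) = (2 : ℝ) • β by rw [two_smul]; abel,
        inv_smul_smul₀ two_ne_zero]
    rw [h1, h2]
    simp only [leafField, if_neg (by decide : ¬ (-1 : ℤˣ) = 1), if_true]
    field_simp
  rcases Int.units_eq_one_or σ with rfl | rfl
  · have := key ξ' ξ
    simp only [mul_comm (leafField _ 1 _)]
    rw [this, add_comm ξ', add_comm (-ξ')]
    simp [unitSign]
  · rw [neg_neg, key]
    simp [unitSign]

end IsInitialField

end WaveKinetic

namespace WaveKinetic

/-! ### Integer changes of variables -/

section Unimodular

variable {d : ℕ}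

/-- The linear map with given integer coefficients. -/
def intMap {ι κ : Type*} [Fintype κ] (d : ℕ) (A : ι → κ → ℤ) : (κ → Space d) →ₗ[ℝ] (ι → Space d) where
  toFun x i := ∑ k, (A i k : ℝ) • x k
  map_add' x y := by funext i; simp [Finset.sum_add_distrib]
  map_smul' c x := by funext i; simp [Finset.smul_sum, smul_comm c]

/-- In the standard basis the matrix is the tensor product of `A` with the identity of `ℝᵈ`, so its
entries are integers. -/
theorem exists_det_intMap {ι : Type*} [Fintype ι] (A : ι → ι → ℤ) :
    ∃ N : ℤ, LinearMap.det (intMap d A) = N := by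
  classical
  let b : Module.Basis (Σ _ : ι, Fin d) ℝ (ι → Space d) :=
    Pi.basis fun _ => (EuclideanSpace.basisFun (Fin d) ℝ).toBasis
  let M : Matrix (Σ _ : ι, Fin d) (Σ _ : ι, Fin d) ℤ :=
    Matrix.of fun p q => if p.2 = q.2 then A p.1 q.1 else 0
  refine ⟨M.det, ?_⟩
  rw [← LinearMap.det_toMatrix b, Int.cast_det]
  congr 1
  ext p q
  rw [LinearMap.toMatrix_apply]
  simp only [b, Pi.basis_repr, Pi.basis_apply, intMap, LinearMap.coe_mk, AddHom.coe_mk,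
    Matrix.map_apply, Matrix.of_apply, M]
  rw [Finset.sum_eq_single q.1]
  · by_cases h : p.2 = q.2 <;> simp [h]
  · intro k _ hk
    simp [Pi.single_eq_of_ne hk]
  · simp

/-- Two integers with product one have absolute value one, and these are the two determinants. -/
theorem measurePreserving_intMap_of_square {ι : Type*} [Fintype ι] {A B : ι → ι → ℤ}
    (h : ∀ x, intMap d A (intMap d B x) = x) :
    MeasurePreserving (intMap d A) volume volume := by
  obtain ⟨a, ha⟩ := exists_det_intMap (d := d) A
  obtain ⟨b, hb⟩ := exists_det_intMap (d := d) B
  have h1 : intMap d A ∘ₗ intMap d B = LinearMap.id := LinearMap.ext h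
  have h2 := congrArg LinearMap.det h1
  rw [LinearMap.det_comp, LinearMap.det_id, ha, hb] at h2
  have h3 : a * b = 1 := by exact_mod_cast h2
  have h4 : |(a : ℝ)| = 1 := by exact_mod_cast Int.isUnit_iff_abs_eq.1 (IsUnit.of_mul_eq_one _ h3)
  have h5 : LinearMap.det (intMap d A) ≠ 0 := by
    rw [ha]
    intro h0
    rw [h0, abs_zero] at h4
    exact zero_ne_one h4
  refine ⟨(LinearMap.continuous_of_finiteDimensional _).measurable, ?_⟩
  rw [Measure.map_linearMap_addHaar_eq_smul_addHaar _ h5, ha, abs_inv, h4]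
  simp

/-- Linear maps with integer coefficients which have an inverse with integer coefficients
preserve the volume. -/
theorem measurePreserving_intMap {ι κ : Type*} [Fintype ι] [Fintype κ]
    (hc : Fintype.card ι = Fintype.card κ) {A : ι → κ → ℤ} {B : κ → ι → ℤ}
    (h : ∀ x, intMap d A (intMap d B x) = x) :
    MeasurePreserving (intMap d A) volume volume := by
  have e : ι ≃ κ := Fintype.equivOfCardEq hc
  have h1 : ∀ x : ι → Space d, intMap d (fun i j => A i (e j)) x = intMap d A (x ∘ e.symm) := by
    intro x
    funext i
    exact Fintype.sum_equiv e _ _ fun j => by simp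
  have h2 : MeasurePreserving (intMap d fun i j => A i (e j)) volume volume := by
    refine measurePreserving_intMap_of_square (B := fun i j => B (e i) j) fun x => ?_
    rw [h1]
    conv_rhs => rw [← h x]
    congr 1
    funext k
    simp [intMap]
  have h3 := (volume_measurePreserving_piCongrLeft (fun _ => Space d) e).symm
  have h4 : ⇑(intMap d A) = (intMap d fun i j => A i (e j)) ∘
      (MeasurableEquiv.piCongrLeft (fun _ => Space d) e).symm := by
    funext x
    rw [Function.comp_apply, h1]
    congr 1
    funext k
    exact congrArg x (e.apply_symm_apply k).symm
  rw [h4]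
  exact h2.comp h3

end Unimodular

namespace PairedGraph

variable {n : ℕ} {G : PairedGraph n}

/-- The slow variable of the first pair restored. -/
def extendSlow (G : PairedGraph n) {d : ℕ} (η : {p : G.Pairs // p ≠ G.firstPair} → Space d)
    (p : G.Pairs) : Space d :=
  if h : p = G.firstPair then -∑ q, η q else η ⟨p, h⟩

theorem extendSlow_coe {d : ℕ} (η : {p : G.Pairs // p ≠ G.firstPair} → Space d)
    (p : {p : G.Pairs // p ≠ G.firstPair}) : G.extendSlow η p.1 = η p := dif_neg p.2

theorem sum_eq_first_add {M : Type*} [AddCommMonoid M] (f : G.Pairs → M) :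
    ∑ p, f p = f G.firstPair + ∑ q : {p : G.Pairs // p ≠ G.firstPair}, f q.1 := by
  rw [← Finset.add_sum_erase _ _ (Finset.mem_univ G.firstPair)]
  congr 1
  exact Finset.sum_subtype _ (fun p => by simp) f

theorem extendSlow_first {d : ℕ} (η : {p : G.Pairs // p ≠ G.firstPair} → Space d) :
    G.extendSlow η G.firstPair = -∑ q, η q := dif_pos rfl

theorem sum_extendSlow {d : ℕ} (η : {p : G.Pairs // p ≠ G.firstPair} → Space d) :
    ∑ p, G.extendSlow η p = 0 := by
  rw [sum_eq_first_add, extendSlow_first]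
  simp [extendSlow_coe]

theorem measurable_extendSlow (d : ℕ) : Measurable (G.extendSlow (d := d)) := by
  refine measurable_pi_lambda _ fun p => ?_
  unfold extendSlow
  split_ifs
  · exact (Finset.measurable_sum _ fun q _ => measurable_pi_apply q).neg
  · exact measurable_pi_apply _

namespace IntegrationOrder

variable (V : G.IntegrationOrder)

/-- The frequencies of the left edges as functions of the free variables. -/
def leftFreq {d : ℕ} (q : ({p : G.Pairs // p ≠ G.firstPair} → Space d) × (Fin (n + 1) → Space d))
    (v : {v // v ∈ G.tree.inner}) : Space d :=
  V.freeData.freq q.2 (G.extendSlow q.1) (v.1 ++ [false])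

/-- This reconciles the two descriptions of a frequency: by fluxes through cuts, as in the
statement, and by descent from the root along left edges, as in the amplitudes. -/
theorem freq_eq_freqOf {d : ℕ}
    (q : ({p : G.Pairs // p ≠ G.firstPair} → Space d) × (Fin (n + 1) → Space d)) {e : List Bool}
    (he : e ∈ G.edges) : V.freeData.freq q.2 (G.extendSlow q.1) e =
      freqOf 0 (zeroExtend (V.leftFreq q)) e := by
  obtain ⟨z, hz, hzx, h⟩ := V.isFlow_freq q.2 (sum_extendSlow q.1)
  rw [h e he]
  refine freqOf_congr 0 (T := G.tree) (fun v hv => ?_) (mem_edges.1 he).2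
  rw [zeroExtend_of_mem _ hv, leftFreq, h _ (append_mem_edges hv _), freqOf_append_false]

/-- The free variables are coordinates for the frequencies of the left edges. -/
theorem measurePreserving_leftFreq (d : ℕ) :
    MeasurePreserving (V.leftFreq (d := d)) volume volume := by
  classical
  let κ := {p : G.Pairs // p ≠ G.firstPair} ⊕ Fin (n + 1)
  -- The slow variable of the first pair is minus the sum of the others, so its coefficient is
  -- subtracted from each of theirs.
  let A : {v // v ∈ G.tree.inner} → κ → ℤ := fun v => Sum.elim
    (fun p => V.freeData.coefSlow (v.1 ++ [false]) p.1 -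
      V.freeData.coefSlow (v.1 ++ [false]) G.firstPair)
    fun j => V.freeData.coefFree (v.1 ++ [false]) j
  -- The inverse matrix reads off slow and free variables from the left edges. Its columns are the
  -- integer flows with a unit value on a single left edge.
  let B : κ → {v // v ∈ G.tree.inner} → ℤ := fun k v => Sum.elim
    (fun p => freqOf (0 : ℤ) (Pi.single v.1 1) (G.initial p.1.1) +
      freqOf (0 : ℤ) (Pi.single v.1 1) (G.initial (G.pair p.1.1)))
    (fun j => freqOf (0 : ℤ) (Pi.single v.1 1) (V.at (V.freeIndex j) ++ [false])) k
  let e : (κ → Space d) ≃ᵐ _ := MeasurableEquiv.sumPiEquivProdPi fun _ => Space d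
  have hA : ∀ x : κ → Space d, intMap d A x = V.leftFreq (e x) := by
    intro x
    funext v
    have he : e x = (fun p => x (Sum.inl p), fun j => x (Sum.inr j)) := rfl
    refine (Fintype.sum_sum_type fun k => (A v k : ℝ) • x k).trans ?_
    simp only [leftFreq, FreeData.freq, he, A, Sum.elim_inl, Sum.elim_inr]
    rw [add_comm, sum_eq_first_add (fun p => (V.freeData.coefSlow (v.1 ++ [false]) p : ℝ) •
      G.extendSlow (fun p => x (Sum.inl p)) p), extendSlow_first]
    congr 1
    simp only [extendSlow_coe, Int.cast_sub, sub_smul, Finset.sum_sub_distrib, smul_neg,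
      ← Finset.smul_sum]
    abel
  have hB : ∀ z : {v // v ∈ G.tree.inner} → Space d, e (intMap d B z) =
      (fun p => freqOf 0 (zeroExtend z) (G.initial p.1.1) +
        freqOf 0 (zeroExtend z) (G.initial (G.pair p.1.1)),
      fun j => freqOf 0 (zeroExtend z) (V.freeData.freeEdge V j)) := by
    intro z
    have hs : ∀ v ∈ G.edges, freqOf 0 (zeroExtend z) v = ∑ w : {v // v ∈ G.tree.inner},
        ((freqOf (0 : ℤ) (Pi.single w.1 1) v : ℤ) : ℝ) • z w := by
      intro v hv
      rw [freqOf_eq_sum _ (mem_edges.1 hv).2, ← Finset.sum_coe_sort]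
      refine Finset.sum_congr rfl fun w _ => ?_
      rw [zeroExtend_coe, Int.cast_smul_eq_zsmul]
    refine Prod.ext (funext fun p => ?_) (funext fun j => ?_)
    · change ∑ v, ((_ + _ : ℤ) : ℝ) • z v =
        freqOf 0 (zeroExtend z) (G.initial p.1.1) +
          freqOf 0 (zeroExtend z) (G.initial (G.pair p.1.1))
      rw [hs _ (initial_mem_edges _), hs _ (initial_mem_edges _), ← Finset.sum_add_distrib]
      refine Finset.sum_congr rfl fun v _ => ?_
      rw [Int.cast_add, add_smul]
    · exact (hs _ (append_mem_edges (V.at_mem _) _)).symm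
  have hcard : Fintype.card {v // v ∈ G.tree.inner} = Fintype.card κ := by
    rw [Fintype.card_coe, G.card_inner, Fintype.card_sum, card_slow, Fintype.card_fin]
    omega
  have hAB : ∀ z, intMap d A (intMap d B z) = z := by
    intro z
    rw [hA, hB]
    have hfl : G.IsFlow (freqOf 0 (zeroExtend z)) (G.extendSlow fun p =>
        freqOf 0 (zeroExtend z) (G.initial p.1.1) +
        freqOf 0 (zeroExtend z) (G.initial (G.pair p.1.1))) := by
      have h1 := isFlow_freqOf (G := G) (zeroExtend z)
      convert h1 using 1
      refine eq_of_sum_eq_zero (sum_extendSlow _) h1.sum_eq_zero fun p hp => ?_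
      exact extendSlow_coe _ ⟨p, hp⟩
    funext v
    have h2 := V.eq_freq hfl (append_mem_edges v.2 false)
    rw [freqOf_append_false, zeroExtend_coe] at h2
    exact h2.symm
  have h1 := measurePreserving_intMap hcard hAB
  have h2 := (volume_measurePreserving_sumPiEquivProdPi
    (fun _ : κ => Space d)).symm (MeasurableEquiv.sumPiEquivProdPi fun _ => Space d)
  have h3 : V.leftFreq (d := d) = intMap d A ∘ e.symm := by
    funext q
    rw [Function.comp_apply, hA, e.apply_symm_apply]
  rw [h3]
  exact h1.comp h2

end IntegrationOrder

end PairedGraph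

end WaveKinetic

namespace WaveKinetic

/-! ### The weight of a tree in closed form -/

namespace STree

variable {d : ℕ}

open Classical in
/-- The sum of the time slices along the upright path leading to a vertex. -/
def upSum (T : STree) (s : List Bool → ℝ) (v : List Bool) : ℝ :=
  ∑ w ∈ T.inner, if ∃ k : ℕ, w = v ++ List.replicate k false then s w else 0

theorem upSum_node_nil (σ : ℤˣ) (l r : STree) (s : List Bool → ℝ) :
    (node σ l r).upSum s [] = s [] + l.upSum (fun v => s (false :: v)) [] := by
  classical
  have h1 : ∃ k : ℕ, ([] : List Bool) = [] ++ List.replicate k false := ⟨0, rfl⟩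
  have h2 : ∀ w : List Bool, ¬ ∃ k : ℕ, true :: w = [] ++ List.replicate k false := by
    rintro w ⟨k, hk⟩
    cases k <;> simp [List.replicate_succ] at hk
  have h3 : ∀ w : List Bool, (∃ k : ℕ, false :: w = [] ++ List.replicate k false) ↔
      ∃ k : ℕ, w = [] ++ List.replicate k false := by
    intro w
    constructor
    · rintro ⟨k, hk⟩
      cases k with
      | zero => simp at hk
      | succ k => exact ⟨k, by simpa [List.replicate_succ] using hk⟩
    · rintro ⟨k, rfl⟩
      exact ⟨k + 1, by simp [List.replicate_succ]⟩
  simp only [upSum, sum_inner_node, if_pos h1, h2, h3, if_false, Finset.sum_const_zero, add_zero]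

theorem upSum_node_false (σ : ℤˣ) (l r : STree) (s : List Bool → ℝ) (v : List Bool) :
    (node σ l r).upSum s (false :: v) = l.upSum (fun v => s (false :: v)) v := by
  classical
  simp [upSum, sum_inner_node]

theorem upSum_node_true (σ : ℤˣ) (l r : STree) (s : List Bool → ℝ) (v : List Bool) :
    (node σ l r).upSum s (true :: v) = r.upSum (fun v => s (true :: v)) v := by
  classical
  simp [upSum, sum_inner_node]

theorem topSum_eq_upSum (T : STree) (s : List Bool → ℝ) : T.topSum s = T.upSum s [] := by
  induction T generalizing s with
  | leaf σ => simp [topSum, upSum, inner]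
  | node σ l r hl hr => rw [topSum, upSum_node_nil, hl]

theorem upSum_nonneg {T : STree} {s : List Bool → ℝ} (hs : ∀ v ∈ T.inner, 0 ≤ s v)
    (v : List Bool) : 0 ≤ T.upSum s v :=
  Finset.sum_nonneg fun w hw => by split_ifs; exacts [hs w hw, le_rfl]

/-- The time constraints. -/
def Admissible (T : STree) (τ : ℝ) (s : List Bool → ℝ) : Prop :=
  (∀ v ∈ T.inner, 0 ≤ s v) ∧ (∀ v ∈ T.inner, T.upSum s (v ++ [true]) ≤ T.upSum s v) ∧
    T.upSum s [] ≤ τ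

theorem forall_inner_node {σ : ℤˣ} {l r : STree} {p : List Bool → Prop} :
    (∀ v ∈ (node σ l r).inner, p v) ↔
      p [] ∧ (∀ v ∈ l.inner, p (false :: v)) ∧ ∀ v ∈ r.inner, p (true :: v) := by
  simp only [inner, Finset.forall_mem_insert, Finset.forall_mem_union, Finset.forall_mem_image]

/-- The horizon condition for the left subtree is a consequence of `0 ≤ s []`, whereas that for the
right one is the genuine constraint attached to the top vertex. -/
theorem admissible_node (σ : ℤˣ) (l r : STree) (τ : ℝ) (s : List Bool → ℝ) :
    (node σ l r).Admissible τ s ↔ (0 ≤ s [] ∧ (node σ l r).upSum s [] ≤ τ) ∧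
      l.Admissible ((node σ l r).upSum s []) (fun v => s (false :: v)) ∧
      r.Admissible ((node σ l r).upSum s []) fun v => s (true :: v) := by
  simp only [Admissible, forall_inner_node, List.nil_append, List.cons_append, upSum_node_false,
    upSum_node_true]
  have h := upSum_node_nil σ l r s
  constructor
  · rintro ⟨⟨h1, h2, h3⟩, ⟨h4, h5, h6⟩, h7⟩
    exact ⟨⟨h1, h7⟩, ⟨h2, h5, by linarith⟩, h3, h6, h4⟩
  · rintro ⟨⟨h1, h7⟩, ⟨h2, h5, -⟩, h3, h6, h4⟩
    exact ⟨⟨h1, h2, h3⟩, ⟨h4, h5, h6⟩, h7⟩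

/-- The resonance modulus of a vertex of a tree. -/
def phase (T : STree) (ω₀ : ℝ) (ξ : List Bool → Space d) (v : List Bool) : ℝ :=
  unitSign (T.parity v) * disp ω₀ (ξ v) -
    unitSign (T.parity (v ++ [false])) * disp ω₀ (ξ (v ++ [false])) -
    unitSign (T.parity (v ++ [true])) * disp ω₀ (ξ (v ++ [true]))

/-- The Fourier multipliers of an interaction. -/
def mult (ε : ℝ) (m : Space d → ℝ) (ξ : List Bool → Space d) (v : List Bool) : ℝ :=
  m (ε • ξ v) * m (ε • ξ (v ++ [false])) * m (ε • ξ (v ++ [true]))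

-- Unfolding the recursion, each interaction contributes its multiplier and a phase equal to its
-- time, `upSum`, multiplied by its resonance modulus.
open Classical in
theorem weight_eq (ε ω₀ : ℝ) (m : Space d → ℝ) (T : STree) {τ : ℝ} (hτ : 0 ≤ τ) (ξ : Space d)
    (x : List Bool → Space d × ℝ) :
    T.weight ε ω₀ m τ ξ x = (if T.Admissible τ fun v => (x v).2 then 1 else 0) *
      ((∏ v ∈ T.inner, mult ε m (freqOf ξ fun v => (x v).1) v : ℝ) : ℂ) *
      Complex.exp (-Complex.I * ((∑ v ∈ T.inner, T.upSum (fun v => (x v).2) v *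
        T.phase ω₀ (freqOf ξ fun v => (x v).1) v : ℝ) : ℂ)) := by
  induction T generalizing τ ξ x with
  | leaf σ => simp [weight, Admissible, inner, upSum, hτ]
  | node σ l r hl hr =>
    -- The induction hypothesis needs a nonnegative horizon for the subtrees. When some slice is
    -- negative, both sides vanish.
    by_cases hs : ∀ v ∈ (node σ l r).inner, 0 ≤ (x v).2
    · have h0 : 0 ≤ (node σ l r).upSum (fun v => (x v).2) [] := upSum_nonneg hs []
      rw [weight, topSum_eq_upSum, hl h0, hr h0, prod_inner_node, sum_inner_node, admissible_node]
      simp only [upSum_node_false, upSum_node_true]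
      have hite : ∀ (p q r : Prop) (_ : Decidable (p ∧ q ∧ r)), (if p ∧ q ∧ r then (1 : ℂ) else 0) =
          (if p then 1 else 0) * ((if q then 1 else 0) * if r then 1 else 0) := by
        intro p q r _
        by_cases hp : p <;> by_cases hq : q <;> simp [hp, hq]
      have hph : phaseMod ω₀ σ (l.parity []) (r.parity []) ξ (x []).1 =
        (node σ l r).phase ω₀ (freqOf ξ fun v => (x v).1) [] := rfl
      have hmu : m (ε • ξ) * m (ε • (x []).1) * m (ε • (ξ - (x []).1)) =
        mult ε m (freqOf ξ fun v => (x v).1) [] := rfl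
      have hfm : ∀ v, mult ε m (freqOf ξ fun v => (x v).1) (false :: v) =
        mult ε m (freqOf (x []).1 fun v => (x (false :: v)).1) v := fun _ => rfl
      have htm : ∀ v, mult ε m (freqOf ξ fun v => (x v).1) (true :: v) =
        mult ε m (freqOf (ξ - (x []).1) fun v => (x (true :: v)).1) v := fun _ => rfl
      have hfp : ∀ v, (node σ l r).phase ω₀ (freqOf ξ fun v => (x v).1) (false :: v) =
        l.phase ω₀ (freqOf (x []).1 fun v => (x (false :: v)).1) v := fun _ => rfl
      have htp : ∀ v, (node σ l r).phase ω₀ (freqOf ξ fun v => (x v).1) (true :: v) =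
        r.phase ω₀ (freqOf (ξ - (x []).1) fun v => (x (true :: v)).1) v := fun _ => rfl
      simp only [hph, hmu, hfm, htm, hfp, htp, Complex.ofReal_mul, Complex.ofReal_add, mul_add,
        Complex.exp_add, hite]
      by_cases hp : 0 ≤ (x []).2 ∧ (node σ l r).upSum (fun v => (x v).2) [] ≤ τ
      · simp only [if_pos hp]
        ring
      · simp only [if_neg hp, zero_mul]
    · have h1 : (node σ l r).weight ε ω₀ m τ ξ x = 0 := by
        by_contra hne
        exact hs fun v hv => ((mem_Icc_of_weight hne hτ).2 v hv).1
      rw [h1, if_neg fun h => hs h.1]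
      simp

end STree

end WaveKinetic

namespace WaveKinetic

open PairedGraph (zeroExtend zeroExtend_coe zeroExtend_of_mem)

/-! ### Pairs of trees -/

section Shuffle

variable {A B C D E : Type*} [MeasureSpace A] [MeasureSpace B] [MeasureSpace C] [MeasureSpace D]
  [MeasureSpace E] [SFinite (volume : Measure A)] [SFinite (volume : Measure B)]
  [SFinite (volume : Measure C)] [SFinite (volume : Measure D)] [SFinite (volume : Measure E)]

theorem measurePreserving_prodProdProdComm :
    MeasurePreserving (fun q : (B × C) × (D × E) => ((q.1.1, q.2.1), (q.1.2, q.2.2)))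
      ((volume.prod volume).prod (volume.prod volume))
      ((volume.prod volume).prod (volume.prod volume)) := by
  have h1 := measurePreserving_prodAssoc (volume : Measure B) (volume : Measure C)
    ((volume : Measure D).prod (volume : Measure E))
  have h2 := (measurePreserving_prodAssoc (volume : Measure C) (volume : Measure D)
    (volume : Measure E)).symm
  have h3 := (Measure.measurePreserving_swap (μ := (volume : Measure C))
    (ν := (volume : Measure D))).prod (MeasurePreserving.id (volume : Measure E))
  have h4 := measurePreserving_prodAssoc (volume : Measure D) (volume : Measure C)
    (volume : Measure E)
  have h5 := (measurePreserving_prodAssoc (volume : Measure B) (volume : Measure D)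
    ((volume : Measure C).prod (volume : Measure E))).symm
  exact h5.comp (((MeasurePreserving.id (volume : Measure B)).prod
    (h4.comp (h3.comp h2))).comp h1)

theorem measurePreserving_shuffle :
    MeasurePreserving (fun q : (A × (B × C)) × (D × E) =>
        (q.1.1, ((q.1.2.1, q.2.1), (q.1.2.2, q.2.2))))
      ((volume.prod (volume.prod volume)).prod (volume.prod volume))
      (volume.prod ((volume.prod volume).prod (volume.prod volume))) := by
  have h1 := measurePreserving_prodAssoc (volume : Measure A)
    ((volume : Measure B).prod (volume : Measure C)) ((volume : Measure D).prod (volume : Measure E))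
  exact ((MeasurePreserving.id (volume : Measure A)).prod measurePreserving_prodProdProdComm).comp h1

end Shuffle

namespace STree

variable {d : ℕ}

/-- The variables of the amplitude of a tree. -/
abbrev Vars (T : STree) (d : ℕ) : Type := {v // v ∈ T.inner} → Space d × ℝ

/-- The product of the integrands of the amplitudes of two trees at opposite frequencies. -/
def joint (ε ω₀ : ℝ) (m : Space d → ℝ) (φ : Space d → ℂ) (L R : STree) (t : ℝ)
    (q : Space d × L.Vars d × R.Vars d) : ℂ :=
  L.ampIntegrand ε ω₀ m φ t q.1 q.2.1 * R.ampIntegrand ε ω₀ m φ t (-q.1) q.2.2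

/-- The product of the weights of two trees at opposite frequencies. -/
def jointWeight (ε ω₀ : ℝ) (m : Space d → ℝ) (L R : STree) (t : ℝ)
    (q : Space d × L.Vars d × R.Vars d) : ℂ :=
  L.weight ε ω₀ m t q.1 (zeroExtend q.2.1) * R.weight ε ω₀ m t (-q.1) (zeroExtend q.2.2)

/-- The frequencies of the left edges of the merged tree. -/
def jointLeft {L R : STree} (q : Space d × L.Vars d × R.Vars d) : List Bool → Space d
  | [] => q.1
  | false :: v => (zeroExtend q.2.1 v).1
  | true :: v => (zeroExtend q.2.2 v).1

/-- The frequencies of the edges of the merged tree. -/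
def jointFreq {L R : STree} (q : Space d × L.Vars d × R.Vars d) : List Bool → Space d :=
  freqOf 0 (jointLeft q)

theorem leafProd_eq (φ : Space d → ℂ) (T : STree) (ξ : Space d) (x : List Bool → Space d × ℝ) :
    T.leafProd φ ξ x = (T.leaves.map fun v =>
      leafField φ (T.parity v) (freqOf ξ (fun v => (x v).1) v)).prod := by
  induction T generalizing ξ x with
  | leaf σ => simp [leafProd, leaves, parity, freqOf]
  | node σ l r hl hr =>
    rw [leafProd, leaves, hl, hr, List.map_append, List.prod_append, List.map_map, List.map_map]
    rfl

/-- Two trees with opposite top frequencies hang below a root of frequency zero, so the two leaf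
products form the leaf product of the merged tree. -/
theorem joint_eq (ε ω₀ : ℝ) (m : Space d → ℝ) (φ : Space d → ℂ) (L R : STree) (t : ℝ)
    (q : Space d × L.Vars d × R.Vars d) : joint ε ω₀ m φ L R t q =
      jointWeight ε ω₀ m L R t q * ((node 1 L R).leaves.map fun v =>
        leafField φ ((node 1 L R).parity v) (jointFreq q v)).prod := by
  have h : ((node 1 L R).leaves.map fun v =>
      leafField φ ((node 1 L R).parity v) (jointFreq q v)).prod =
      L.leafProd φ q.1 (zeroExtend q.2.1) * R.leafProd φ (-q.1) (zeroExtend q.2.2) := by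
    rw [leafProd_eq, leafProd_eq, leaves, List.map_append, List.prod_append, List.map_map,
      List.map_map]
    congr 3
    funext v
    simp only [Function.comp_apply, jointFreq, freqOf, jointLeft, zero_sub]
    rfl
  rw [h, joint, ampIntegrand, ampIntegrand, jointWeight]
  ring

theorem measurable_joint {A : Type*} [MeasurableSpace A] (ε ω₀ : ℝ) {m : Space d → ℝ}
    (hm : Measurable m) {φ : A → Space d → ℂ} (hφ : Measurable (Function.uncurry φ))
    (L R : STree) (t : ℝ) :
    Measurable fun p : A × (Space d × L.Vars d × R.Vars d) => joint ε ω₀ m (φ p.1) L R t p.2 := by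
  have h : Measurable (Function.uncurry fun p : A × (Space d × L.Vars d × R.Vars d) => φ p.1) :=
    measurable_apply₂ hφ measurable_fst.fst measurable_snd
  exact (measurable_ampIntegrand ε ω₀ hm h L measurable_const measurable_snd.fst
    measurable_snd.snd.fst).mul (measurable_ampIntegrand ε ω₀ hm h R measurable_const
    measurable_snd.fst.neg measurable_snd.snd.snd)

theorem measurable_jointWeight (ε ω₀ : ℝ) {m : Space d → ℝ} (hm : Measurable m) (L R : STree)
    (t : ℝ) : Measurable (jointWeight ε ω₀ m L R t) :=
  (measurable_weight ε ω₀ hm L measurable_const measurable_fst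
    (measurable_zeroExtend measurable_snd.fst)).mul
    (measurable_weight ε ω₀ hm R measurable_const measurable_fst.neg
    (measurable_zeroExtend measurable_snd.snd))

theorem measurable_freqOf {A : Type*} [MeasurableSpace A] {z : A → List Bool → Space d}
    (hz : ∀ v, Measurable fun a => z a v) (v : List Bool) : Measurable fun a => freqOf 0 (z a) v := by
  induction v using List.reverseRecOn with
  | nil => simp
  | append_singleton v b ih =>
    cases b
    · simpa using hz v
    · simp only [freqOf_append_true]
      exact Measurable.sub ih (hz v)

theorem measurable_jointFreq {L R : STree} (v : List Bool) :
    Measurable fun q : Space d × L.Vars d × R.Vars d => jointFreq q v := by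
  refine measurable_freqOf (fun w => ?_) v
  rcases w with _ | ⟨_ | _, w⟩
  · exact measurable_fst
  · exact (measurable_zeroExtend measurable_snd.fst w).fst
  · exact (measurable_zeroExtend measurable_snd.snd w).fst

variable {φ : Space d → ℂ} {B R₀ : ℝ}

theorem integrable_joint (h : IsBandLimited φ B R₀) (ε ω₀ : ℝ) {m : Space d → ℝ}
    (hm : Continuous m) (L R : STree) {t : ℝ} (ht : 0 ≤ t) :
    Integrable (joint ε ω₀ m φ L R t) := by
  obtain ⟨C, hC⟩ := exists_norm_ampIntegrand_le h ε ω₀ hm L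
  obtain ⟨C', hC'⟩ := exists_norm_ampIntegrand_le h ε ω₀ hm R
  have hC0 : 0 ≤ C := (norm_nonneg _).trans (hC 0 0 0)
  refine integrable_of_bounded (C := C * C') (K := Metric.closedBall 0 ((L.depth + 1) * R₀) ×ˢ
    (L.box d ((L.depth + 1) * R₀) t ×ˢ R.box d ((R.depth + 1) * R₀) t)) ?_ ?_ ?_ ?_
  · rw [Measure.volume_eq_prod, Measure.prod_prod, Measure.volume_eq_prod, Measure.prod_prod]
    exact ENNReal.mul_ne_top (isCompact_closedBall _ _).measure_lt_top.ne
      (ENNReal.mul_ne_top (isCompact_box _ _ _).measure_lt_top.ne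
        (isCompact_box _ _ _).measure_lt_top.ne)
  · exact (measurable_joint (A := Unit) ε ω₀ hm.measurable (φ := fun _ => φ)
      (h.measurable.comp measurable_snd) L R t).comp (measurable_const (a := ()).prodMk measurable_id)
  · intro q
    rw [joint, norm_mul]
    exact mul_le_mul (hC _ _ _) (hC' _ _ _) (norm_nonneg _) hC0
  · intro q hq
    rw [joint, mul_ne_zero_iff] at hq
    have h1 := ampIntegrand_support h le_rfl ht le_rfl hq.1
    have h2 := ampIntegrand_support h le_rfl ht le_rfl hq.2
    exact ⟨by simpa using h1.1, h1.2, h2.2⟩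

/-- The reflection of `ξ` makes the frequency above the left tree the positive one, in agreement
with the left edge below the root of the merged tree. -/
theorem integral_amp_mul_amp (h : IsBandLimited φ B R₀) (ε lam ω₀ : ℝ) {m : Space d → ℝ}
    (hm : Continuous m) (L R : STree) {t : ℝ} (ht : 0 ≤ t) :
    Integrable (fun ξ => L.amp ε lam ω₀ m φ t (-ξ) * R.amp ε lam ω₀ m φ t ξ) ∧
    ∫ ξ, L.amp ε lam ω₀ m φ t (-ξ) * R.amp ε lam ω₀ m φ t ξ =
      (L.coef d lam * R.coef d lam) * ∫ q, joint ε ω₀ m φ L R t q := by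
  have hJ := integrable_joint h ε ω₀ hm L R ht
  have h1 : ∀ ξ, L.amp ε lam ω₀ m φ t ξ * R.amp ε lam ω₀ m φ t (-ξ) =
      (L.coef d lam * R.coef d lam) *
        ∫ x : L.Vars d × R.Vars d, joint ε ω₀ m φ L R t (ξ, x) := by
    intro ξ
    simp only [joint]
    rw [Measure.volume_eq_prod, integral_prod_mul (fun x => L.ampIntegrand ε ω₀ m φ t ξ x)
      (fun x => R.ampIntegrand ε ω₀ m φ t (-ξ) x), amp, amp]
    ring
  constructor
  · have h2 : Integrable fun ξ => L.amp ε lam ω₀ m φ t ξ * R.amp ε lam ω₀ m φ t (-ξ) := by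
      simp only [h1]
      exact hJ.integral_prod_left.const_mul _
    simpa using h2.comp_neg
  · rw [← integral_neg_eq_self]
    simp only [neg_neg, h1]
    rw [integral_const_mul]
    exact congrArg _ (integral_prod _ hJ).symm

/-- The indicator function of a ball. -/
def ballInd (d : ℕ) (R : ℝ) : Space d → ℂ := (Metric.closedBall 0 R).indicator 1

/-- As initial data, the indicator of a ball turns `joint` into a deterministic dominating function,
both for the random amplitudes and for the products of covariances. -/
theorem isBandLimited_ballInd {R : ℝ} (hR : 0 ≤ R) : IsBandLimited (ballInd d R) 1 R where
  measurable := measurable_one.indicator Metric.isClosed_closedBall.measurableSet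
  nonneg := hR
  bound ξ := by
    refine (norm_indicator_le_norm_self _ _).trans ?_
    simp
  support ξ hξ := Set.indicator_of_notMem (by simpa using hξ) _

theorem leafField_ballInd (R : ℝ) (σ : ℤˣ) (ξ : Space d) :
    leafField (ballInd d R) σ ξ = ballInd d R ξ := by
  have h : ballInd d R (-ξ) = ballInd d R ξ := by
    by_cases hξ : ξ ∈ Metric.closedBall (0 : Space d) R
    · have hξ' : -ξ ∈ Metric.closedBall (0 : Space d) R := by simpa using hξ
      simp only [ballInd, Set.indicator_of_mem hξ, Set.indicator_of_mem hξ', Pi.one_apply]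
    · have hξ' : -ξ ∉ Metric.closedBall (0 : Space d) R := by simpa using hξ
      simp only [ballInd, Set.indicator_of_notMem hξ, Set.indicator_of_notMem hξ']
  unfold leafField
  rw [h]
  split_ifs
  · rfl
  · unfold ballInd
    by_cases hξ : ξ ∈ Metric.closedBall (0 : Space d) R <;> simp [hξ]

end STree

end WaveKinetic

namespace WaveKinetic

open PairedGraph (zeroExtend zeroExtend_coe zeroExtend_of_mem)

namespace PairedGraph

open STree

variable {n : ℕ} (G : PairedGraph n) {d : ℕ}

/-! ### The variables of a paired graph -/

/-- The left tree, with its parities flipped. -/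
abbrev leftTree : STree := G.left.1.flip

/-- The right tree. -/
abbrev rightTree : STree := G.right.1

theorem tree_eq : G.tree = node 1 G.leftTree G.rightTree := rfl

variable {G}

theorem false_mem_interaction {v : List Bool} :
    false :: v ∈ G.interaction ↔ v ∈ G.leftTree.inner := by
  rw [mem_interaction, tree_eq]; simp

theorem true_mem_interaction {v : List Bool} :
    true :: v ∈ G.interaction ↔ v ∈ G.rightTree.inner := by
  rw [mem_interaction, tree_eq]; simp

theorem false_mem_inner {v : List Bool} : false :: v ∈ G.tree.inner ↔ v ∈ G.leftTree.inner := by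
  rw [tree_eq]; simp

theorem true_mem_inner {v : List Bool} : true :: v ∈ G.tree.inner ↔ v ∈ G.rightTree.inner := by
  rw [tree_eq]; simp

theorem nil_notMem_interaction : [] ∉ G.interaction := fun h => (mem_interaction.1 h).1 rfl

variable (G)

theorem prod_interaction {M : Type*} [CommMonoid M] (f : List Bool → M) :
    ∏ v ∈ G.interaction, f v =
      (∏ v ∈ G.leftTree.inner, f (false :: v)) * ∏ v ∈ G.rightTree.inner, f (true :: v) := by
  have h : G.interaction = G.leftTree.inner.image (List.cons false) ∪
      G.rightTree.inner.image (List.cons true) := by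
    ext v
    rcases v with _ | ⟨_ | _, v⟩
    · simp [nil_notMem_interaction]
    · rw [false_mem_interaction]; simp
    · rw [true_mem_interaction]; simp
  rw [h, Finset.prod_union, Finset.prod_image List.cons_injective.injOn,
    Finset.prod_image List.cons_injective.injOn]
  rw [Finset.disjoint_left]
  simp

theorem sum_interaction {M : Type*} [AddCommMonoid M] (f : List Bool → M) :
    ∑ v ∈ G.interaction, f v =
      (∑ v ∈ G.leftTree.inner, f (false :: v)) + ∑ v ∈ G.rightTree.inner, f (true :: v) :=
  G.prod_interaction (M := Multiplicative M) f

variable {G}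

theorem forall_interaction {p : List Bool → Prop} : (∀ v ∈ G.interaction, p v) ↔
    (∀ v ∈ G.leftTree.inner, p (false :: v)) ∧ ∀ v ∈ G.rightTree.inner, p (true :: v) := by
  constructor
  · exact fun h => ⟨fun v hv => h _ (false_mem_interaction.2 hv),
      fun v hv => h _ (true_mem_interaction.2 hv)⟩
  · rintro ⟨h1, h2⟩ (_ | ⟨_ | _, v⟩) hv
    · exact absurd hv nil_notMem_interaction
    · exact h1 v (false_mem_interaction.1 hv)
    · exact h2 v (true_mem_interaction.1 hv)

variable (G)

/-- The interaction vertices are those of the left and of the right tree. -/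
def interactionEquiv :
    {v // v ∈ G.leftTree.inner} ⊕ {v // v ∈ G.rightTree.inner} ≃ {v // v ∈ G.interaction} where
  toFun
    | Sum.inl v => ⟨false :: v.1, false_mem_interaction.2 v.2⟩
    | Sum.inr v => ⟨true :: v.1, true_mem_interaction.2 v.2⟩
  invFun
    | ⟨[], h⟩ => absurd h nil_notMem_interaction
    | ⟨false :: v, h⟩ => Sum.inl ⟨v, false_mem_interaction.1 h⟩
    | ⟨true :: v, h⟩ => Sum.inr ⟨v, true_mem_interaction.1 h⟩
  left_inv := by rintro (_ | _) <;> rfl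
  right_inv := by
    rintro ⟨_ | ⟨_ | _, _⟩, h⟩
    · exact absurd h nil_notMem_interaction
    · rfl
    · rfl

/-- The time slices of the left and of the right tree. -/
def splitSlices : G.Slices ≃ᵐ
    ({v // v ∈ G.leftTree.inner} → ℝ) × ({v // v ∈ G.rightTree.inner} → ℝ) :=
  (MeasurableEquiv.piCongrLeft (fun _ => ℝ) G.interactionEquiv).symm.trans
    (MeasurableEquiv.sumPiEquivProdPi fun _ => ℝ)

theorem measurePreserving_splitSlices : MeasurePreserving G.splitSlices volume volume :=
  (volume_measurePreserving_sumPiEquivProdPi _).comp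
    (volume_measurePreserving_piCongrLeft (fun _ => ℝ) G.interactionEquiv).symm

/-- The variables of the two trees in terms of the frequencies of the left edges and of the
time slices. -/
def toJoint (q : ({v // v ∈ G.tree.inner} → Space d) × G.Slices) :
    Space d × G.leftTree.Vars d × G.rightTree.Vars d :=
  (q.1 ⟨[], G.nil_mem_inner⟩,
    fun v => (q.1 ⟨false :: v.1, false_mem_inner.2 v.2⟩,
      q.2 ⟨false :: v.1, false_mem_interaction.2 v.2⟩),
    fun v => (q.1 ⟨true :: v.1, true_mem_inner.2 v.2⟩,
      q.2 ⟨true :: v.1, true_mem_interaction.2 v.2⟩))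

theorem measurePreserving_toJoint :
    MeasurePreserving (G.toJoint (d := d)) (volume.prod volume) volume := by
  have h1 : MeasurePreserving (splitEquiv 1 G.leftTree G.rightTree (Space d)) volume volume :=
    volume_preserving_splitEquiv 1 G.leftTree G.rightTree (Space d)
  have h2 := h1.prod G.measurePreserving_splitSlices
  have h3 := measurePreserving_shuffle (A := Space d) (B := {v // v ∈ G.leftTree.inner} → Space d)
    (C := {v // v ∈ G.rightTree.inner} → Space d) (D := {v // v ∈ G.leftTree.inner} → ℝ)
    (E := {v // v ∈ G.rightTree.inner} → ℝ)
  have h4 := fun T : STree => (volume_measurePreserving_arrowProdEquivProdArrow (Space d) ℝ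
    {v // v ∈ T.inner}).symm
  have h5 := (MeasurePreserving.id (volume : Measure (Space d))).prod
    ((h4 G.leftTree).prod (h4 G.rightTree))
  exact (h5.comp h3).comp h2

theorem jointLeft_toJoint (q : ({v // v ∈ G.tree.inner} → Space d) × G.Slices) :
    jointLeft (G.toJoint q) = zeroExtend q.1 := by
  funext v
  rcases v with _ | ⟨_ | _, v⟩
  · exact (zeroExtend_of_mem _ _).symm
  · by_cases hv : v ∈ G.leftTree.inner
    · rw [zeroExtend_of_mem _ (false_mem_inner.2 hv), jointLeft, zeroExtend_of_mem _ hv]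
      rfl
    · rw [jointLeft, zeroExtend, zeroExtend, dif_neg hv, dif_neg fun h => hv (false_mem_inner.1 h)]
      rfl
  · by_cases hv : v ∈ G.rightTree.inner
    · rw [zeroExtend_of_mem _ (true_mem_inner.2 hv), jointLeft, zeroExtend_of_mem _ hv]
      rfl
    · rw [jointLeft, zeroExtend, zeroExtend, dif_neg hv, dif_neg fun h => hv (true_mem_inner.1 h)]
      rfl

theorem left_slices_toJoint (q : ({v // v ∈ G.tree.inner} → Space d) × G.Slices) :
    (fun v => (zeroExtend (G.toJoint q).2.1 v).2) = fun v => zeroExtend q.2 (false :: v) := by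
  funext v
  by_cases hv : v ∈ G.leftTree.inner
  · rw [zeroExtend_of_mem _ (false_mem_interaction.2 hv), zeroExtend_of_mem _ hv]
    rfl
  · rw [zeroExtend, zeroExtend, dif_neg hv, dif_neg fun h => hv (false_mem_interaction.1 h)]
    rfl

theorem right_slices_toJoint (q : ({v // v ∈ G.tree.inner} → Space d) × G.Slices) :
    (fun v => (zeroExtend (G.toJoint q).2.2 v).2) = fun v => zeroExtend q.2 (true :: v) := by
  funext v
  by_cases hv : v ∈ G.rightTree.inner
  · rw [zeroExtend_of_mem _ (true_mem_interaction.2 hv), zeroExtend_of_mem _ hv]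
    rfl
  · rw [zeroExtend, zeroExtend, dif_neg hv, dif_neg fun h => hv (true_mem_interaction.1 h)]
    rfl

open Classical in
theorem sliceSum_eq (s : G.Slices) (v : List Bool) : G.sliceSum s v =
    ∑ w ∈ G.interaction, if ∃ k : ℕ, w = v ++ List.replicate k false then zeroExtend s w else 0 := by
  rw [sliceSum, ← Finset.sum_coe_sort G.interaction]
  refine Finset.sum_congr rfl fun w _ => ?_
  rw [zeroExtend_coe]
  refine if_congr ?_ rfl rfl
  simp only [pMinus, Finset.mem_filter, w.2, true_and]

theorem sliceSum_false (s : G.Slices) (v : List Bool) : G.sliceSum s (false :: v) =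
    G.leftTree.upSum (fun v => zeroExtend s (false :: v)) v := by
  classical
  rw [sliceSum_eq, sum_interaction]
  simp [upSum]

theorem sliceSum_true (s : G.Slices) (v : List Bool) : G.sliceSum s (true :: v) =
    G.rightTree.upSum (fun v => zeroExtend s (true :: v)) v := by
  classical
  rw [sliceSum_eq, sum_interaction]
  simp [upSum]

theorem timeConstraint_iff (t : ℝ) (s : G.Slices) : G.TimeConstraint t s ↔
    G.leftTree.Admissible t (fun v => zeroExtend s (false :: v)) ∧
      G.rightTree.Admissible t fun v => zeroExtend s (true :: v) := by
  have h1 : (∀ v, 0 ≤ s v) ↔ ∀ v ∈ G.interaction, 0 ≤ zeroExtend s v :=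
    ⟨fun h v hv => by rw [zeroExtend_of_mem _ hv]; exact h _,
      fun h v => by rw [← zeroExtend_coe s v]; exact h v.1 v.2⟩
  rw [TimeConstraint, h1, forall_interaction, forall_interaction]
  simp only [List.cons_append, sliceSum_false, sliceSum_true, Admissible]
  tauto

/-- The relations `w ∈ 𝓅⁺(v)` and `v ∈ 𝓅⁻(w)` coincide, so exchanging the sums turns slices weighted
by accumulated moduli into interaction times weighted by single moduli. -/
theorem sum_pPlus (s : G.Slices) (Ω : List Bool → ℝ) :
    ∑ v : {v // v ∈ G.interaction}, s v * ∑ w ∈ G.pPlus v.1, Ω w =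
      ∑ w ∈ G.interaction, G.sliceSum s w * Ω w := by
  classical
  have h1 : ∀ v : {v // v ∈ G.interaction}, s v * ∑ w ∈ G.pPlus v.1, Ω w =
      ∑ w ∈ G.interaction, if v.1 ∈ G.pMinus w then s v * Ω w else 0 := by
    intro v
    have h2 : G.pPlus v.1 = G.interaction.filter fun w => v.1 ∈ G.pMinus w := by
      refine Finset.filter_congr fun w _ => ?_
      simp only [pMinus, Finset.mem_filter, v.2, true_and]
    rw [Finset.mul_sum, h2, Finset.sum_filter]
  simp only [h1]
  rw [Finset.sum_comm]
  refine Finset.sum_congr rfl fun w _ => ?_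
  rw [sliceSum, Finset.sum_mul]
  refine Finset.sum_congr rfl fun v _ => ?_
  rw [ite_mul, zero_mul]

open Classical in
/-- The weights of the two trees are the factors of the integrand of a paired graph. -/
theorem jointWeight_toJoint (ε ω₀ : ℝ) (m : Space d → ℝ) {t : ℝ} (ht : 0 ≤ t)
    (q : ({v // v ∈ G.tree.inner} → Space d) × G.Slices) :
    jointWeight ε ω₀ m G.leftTree G.rightTree t (G.toJoint q) =
      (if G.TimeConstraint t q.2 then 1 else 0) *
      (G.multiplier ε m (freqOf 0 (zeroExtend q.1)) : ℂ) *
      ∏ v : {v // v ∈ G.interaction}, Complex.exp (-Complex.I *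
        ((q.2 v * ∑ w ∈ G.pPlus v.1, G.resonance ω₀ (freqOf 0 (zeroExtend q.1)) w : ℝ) : ℂ)) := by
  have hexp : ∏ v : {v // v ∈ G.interaction}, Complex.exp (-Complex.I *
      ((q.2 v * ∑ w ∈ G.pPlus v.1, G.resonance ω₀ (freqOf 0 (zeroExtend q.1)) w : ℝ) : ℂ)) =
      Complex.exp (-Complex.I * ((∑ w ∈ G.interaction,
        G.sliceSum q.2 w * G.resonance ω₀ (freqOf 0 (zeroExtend q.1)) w : ℝ) : ℂ)) := by
    rw [← sum_pPlus, ← Complex.exp_sum, ← Finset.mul_sum, Complex.ofReal_sum]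
  have hz := G.jointLeft_toJoint q
  have hF : ∀ v, freqOf 0 (zeroExtend q.1) (false :: v) =
      freqOf (G.toJoint q).1 (fun v => (zeroExtend (G.toJoint q).2.1 v).1) v := by
    intro v; rw [← hz]; rfl
  have hT : ∀ v, freqOf 0 (zeroExtend q.1) (true :: v) =
      freqOf (-(G.toJoint q).1) (fun v => (zeroExtend (G.toJoint q).2.2 v).1) v := by
    intro v; rw [← hz, ← zero_sub]; rfl
  rw [jointWeight, weight_eq _ _ _ _ ht, weight_eq _ _ _ _ ht, hexp, multiplier, sum_interaction,
    prod_interaction]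
  simp only [left_slices_toJoint, right_slices_toJoint, sliceSum_false, sliceSum_true]
  have hm1 : ∀ v, mult ε m (freqOf (G.toJoint q).1 fun v => (zeroExtend (G.toJoint q).2.1 v).1) v =
      m (ε • freqOf 0 (zeroExtend q.1) (false :: v)) *
      m (ε • freqOf 0 (zeroExtend q.1) (false :: v ++ [false])) *
      m (ε • freqOf 0 (zeroExtend q.1) (false :: v ++ [true])) := by
    intro v; rw [List.cons_append, List.cons_append, hF, hF, hF]; rfl
  have hm2 : ∀ v, mult ε m (freqOf (-(G.toJoint q).1) fun v => (zeroExtend (G.toJoint q).2.2 v).1) v =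
      m (ε • freqOf 0 (zeroExtend q.1) (true :: v)) *
      m (ε • freqOf 0 (zeroExtend q.1) (true :: v ++ [false])) *
      m (ε • freqOf 0 (zeroExtend q.1) (true :: v ++ [true])) := by
    intro v; rw [List.cons_append, List.cons_append, hT, hT, hT]; rfl
  have hp1 : ∀ v, G.leftTree.phase ω₀ (freqOf (G.toJoint q).1 fun v =>
      (zeroExtend (G.toJoint q).2.1 v).1) v =
      G.resonance ω₀ (freqOf 0 (zeroExtend q.1)) (false :: v) := by
    intro v; rw [resonance, List.cons_append, List.cons_append, hF, hF, hF]; rfl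
  have hp2 : ∀ v, G.rightTree.phase ω₀ (freqOf (-(G.toJoint q).1) fun v =>
      (zeroExtend (G.toJoint q).2.2 v).1) v =
      G.resonance ω₀ (freqOf 0 (zeroExtend q.1)) (true :: v) := by
    intro v; rw [resonance, List.cons_append, List.cons_append, hT, hT, hT]; rfl
  simp only [hm1, hm2, hp1, hp2, Complex.ofReal_mul, Complex.ofReal_add, mul_add, Complex.exp_add]
  have hite : (if G.TimeConstraint t q.2 then (1 : ℂ) else 0) =
      (if G.leftTree.Admissible t (fun v => zeroExtend q.2 (false :: v)) then 1 else 0) *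
      if G.rightTree.Admissible t (fun v => zeroExtend q.2 (true :: v)) then 1 else 0 := by
    rw [if_congr (G.timeConstraint_iff t q.2) rfl rfl]
    split_ifs <;> simp_all
  rw [hite]
  ring

end PairedGraph

end WaveKinetic

namespace WaveKinetic

open PairedGraph (zeroExtend zeroExtend_coe zeroExtend_of_mem)

/-! ### Covariances in frequency -/

/-- The covariance of the Fourier transforms of the field and of its conjugate. -/
def leafCov {d : ℕ} {Ω : Type*} [MeasurableSpace Ω] (P : Measure Ω) (u : Ω → Space d → ℂ)
    (σ σ' : ℤˣ) (ξ ξ' : Space d) : ℂ :=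
  ∫ ω, leafField (ft (u ω)) σ ξ * leafField (ft (u ω)) σ' ξ' ∂P

namespace IsInitialField

variable {d : ℕ} {ahat : Space d × Space d → ℂ} {Ω : Type*} [MeasurableSpace Ω] {P : Measure Ω}
  {ε : ℝ} {u₀ : Ω → Space d → ℂ} [IsProbabilityMeasure P]

theorem measurable_leafCov (hu : IsInitialField P ε (envelope ahat) u₀) (σ σ' : ℤˣ) :
    Measurable (Function.uncurry (leafCov P u₀ σ σ')) := by
  have h : ∀ σ, Measurable (Function.uncurry fun ω ξ => leafField (ft (u₀ ω)) σ ξ) := fun σ =>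
    hu.measurable_leafField σ
  have h2 : Measurable fun p : (Space d × Space d) × Ω => leafField (ft (u₀ p.2)) σ p.1.1 *
      leafField (ft (u₀ p.2)) σ' p.1.2 :=
    (measurable_apply₂ (h σ) measurable_snd measurable_fst.fst).mul
      (measurable_apply₂ (h σ') measurable_snd measurable_fst.snd)
  exact h2.stronglyMeasurable.integral_prod_right.measurable

theorem leafCov_neg (hu : IsInitialField P ε (envelope ahat) u₀) (hε : 0 < ε)
    (ha : ContDiff ℝ (⊤ : ℕ∞) ahat) (hs : HasCompactSupport ahat) (σ : ℤˣ) (ξ ξ' : Space d) :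
    leafCov P u₀ σ (-σ) ξ ξ' = (ftConst d : ℂ)⁻¹ * ((ε ^ d : ℝ) : ℂ) * wignerHat P ε u₀ (ξ + ξ')
        ((ε / 2) • (unitSign σ • ξ + unitSign (-σ) • ξ')) :=
  hu.integral_leafField_mul_neg hε ha hs σ ξ ξ'

theorem leafCov_self (hu : IsInitialField P ε (envelope ahat) u₀)
    (ha : ContDiff ℝ (⊤ : ℕ∞) ahat) (hs : HasCompactSupport ahat) (σ : ℤˣ) (ξ ξ' : Space d) :
    leafCov P u₀ σ σ ξ ξ' = 0 := hu.integral_leafField_mul_self ha hs σ ξ ξ'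

/-- Covariances are bounded and supported in a ball. -/
theorem exists_leafCov_bound (hu : IsInitialField P ε (envelope ahat) u₀)
    (ha : ContDiff ℝ (⊤ : ℕ∞) ahat) (hs : HasCompactSupport ahat) :
    ∃ C R, 0 ≤ C ∧ 0 ≤ R ∧ ∀ σ σ' ξ ξ',
      ‖leafCov P u₀ σ σ' ξ ξ'‖ ≤ C * (‖STree.ballInd d R ξ‖ * ‖STree.ballInd d R ξ'‖) := by
  obtain ⟨R, hR0, hR, -⟩ := hu.exists_band ha hs
  have hC0 : 0 ≤ ∫ ω, (ftConst d * fieldNorm u₀ ω) ^ 2 ∂P := integral_nonneg fun _ => by positivity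
  refine ⟨_, R, hC0, hR0, fun σ σ' ξ ξ' => ?_⟩
  have hz : ∀ σ (ξ : Space d), R < ‖ξ‖ → ∀ᵐ ω ∂P, leafField (ft (u₀ ω)) σ ξ = 0 := by
    intro σ ξ hξ
    unfold leafField
    split_ifs
    · exact hR ξ hξ
    · filter_upwards [hR (-ξ) (by rwa [norm_neg])] with ω hω
      rw [hω, map_zero]
  by_cases h1 : R < ‖ξ‖
  · have : leafCov P u₀ σ σ' ξ ξ' = 0 := by
      refine integral_eq_zero_of_ae ?_
      filter_upwards [hz σ ξ h1] with ω hω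
      rw [hω, zero_mul, Pi.zero_apply]
    rw [this, norm_zero]
    positivity
  by_cases h2 : R < ‖ξ'‖
  · have : leafCov P u₀ σ σ' ξ ξ' = 0 := by
      refine integral_eq_zero_of_ae ?_
      filter_upwards [hz σ' ξ' h2] with ω hω
      rw [hω, mul_zero, Pi.zero_apply]
    rw [this, norm_zero]
    positivity
  have h3 : ∀ ξ : Space d, ¬ R < ‖ξ‖ → ‖STree.ballInd d R ξ‖ = 1 := by
    intro ξ hξ
    rw [STree.ballInd, Set.indicator_of_mem (by simpa using hξ)]
    simp
  rw [h3 ξ h1, h3 ξ' h2, mul_one, mul_one]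
  refine (norm_integral_le_integral_norm _).trans (integral_mono_of_nonneg
    (Filter.Eventually.of_forall fun _ => norm_nonneg _)
    (hu.integrable_scaled_fieldNorm_pow ha hs 2) (Filter.Eventually.of_forall fun ω => ?_))
  simp only
  rw [norm_mul, sq]
  exact mul_le_mul (norm_leafField_ft_le ω _ _) (norm_leafField_ft_le ω _ _) (norm_nonneg _)
    (mul_nonneg (ftConst_pos d).le (fieldNorm_nonneg u₀ ω))

end IsInitialField

namespace PairedGraph

open STree

variable {n : ℕ} (G : PairedGraph n) {d : ℕ}

/-- The contribution of a paired graph, as a function of the variables of the two trees. -/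
def pairTerm {Ω : Type*} [MeasurableSpace Ω] (P : Measure Ω) (u : Ω → Space d → ℂ) (ε ω₀ : ℝ)
    (m : Space d → ℝ) (t : ℝ) (q : Space d × G.leftTree.Vars d × G.rightTree.Vars d) : ℂ :=
  jointWeight ε ω₀ m G.leftTree G.rightTree t q * ∏ p : G.Pairs,
    leafCov P u (G.tree.parity (G.initial p.1)) (G.tree.parity (G.initial (G.pair p.1)))
      (jointFreq q (G.initial p.1)) (jointFreq q (G.initial (G.pair p.1)))

variable {Ω : Type*} [MeasurableSpace Ω] {P : Measure Ω} {u₀ : Ω → Space d → ℂ}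
  [IsProbabilityMeasure P] {ahat : Space d × Space d → ℂ} {ε : ℝ}

theorem measurable_pairTerm (hu : IsInitialField P ε (envelope ahat) u₀) (ω₀ : ℝ)
    {m : Space d → ℝ} (hm : Measurable m) (t : ℝ) : Measurable (G.pairTerm P u₀ ε ω₀ m t) :=
  (measurable_jointWeight ε ω₀ hm _ _ t).mul (Finset.measurable_fun_prod _ fun _ _ =>
    measurable_apply₂ (hu.measurable_leafCov _ _) (measurable_jointFreq _) (measurable_jointFreq _))

/-- Each covariance is bounded and vanishes outside a product of balls. The term is thus dominated
by `C ^ (n + 1)` times the norm of `joint` for the indicator of the ball. -/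
theorem integrable_pairTerm (hu : IsInitialField P ε (envelope ahat) u₀)
    (ha : ContDiff ℝ (⊤ : ℕ∞) ahat) (hs : HasCompactSupport ahat) (ω₀ : ℝ)
    {m : Space d → ℝ} (hm : Continuous m) {t : ℝ} (ht : 0 ≤ t) :
    Integrable (G.pairTerm P u₀ ε ω₀ m t) := by
  obtain ⟨C, R, hC0, hR0, hC⟩ := hu.exists_leafCov_bound ha hs
  have hJ := integrable_joint (isBandLimited_ballInd (d := d) hR0) ε ω₀ hm G.leftTree G.rightTree ht
  refine (hJ.norm.const_mul (C ^ (n + 1))).mono'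
    (G.measurable_pairTerm hu ω₀ hm.measurable t).aestronglyMeasurable
    (Filter.Eventually.of_forall fun q => ?_)
  have h1 : joint ε ω₀ m (ballInd d R) G.leftTree G.rightTree t q =
      jointWeight ε ω₀ m G.leftTree G.rightTree t q *
        ∏ i, ballInd d R (jointFreq q (G.initial i)) := by
    rw [joint_eq, ← G.prod_map_leaves (fun v => ballInd d R (jointFreq q v))]
    simp only [leafField_ballInd]
    rfl
  rw [h1, pairTerm, norm_mul, norm_mul, mul_left_comm]
  refine mul_le_mul_of_nonneg_left ?_ (norm_nonneg _)
  rw [norm_prod, norm_prod, G.prod_pairs, ← G.card_pairs, ← Finset.card_univ,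
    ← Finset.prod_const, ← Finset.prod_mul_distrib]
  exact Finset.prod_le_prod (fun _ _ => norm_nonneg _) fun p _ => hC _ _ _ _

/-- The parametrization of the variables of the two trees by the free variables. -/
def parametrize (V : G.IntegrationOrder)
    (q : ({p : G.Pairs // p ≠ G.firstPair} → Space d) × (Fin (n + 1) → Space d) × G.Slices) :
    Space d × G.leftTree.Vars d × G.rightTree.Vars d :=
  G.toJoint (V.leftFreq (q.1, q.2.1), q.2.2)

theorem measurePreserving_parametrize (V : G.IntegrationOrder) :
    MeasurePreserving (G.parametrize (d := d) V)
      (volume.prod (volume.prod volume)) volume := by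
  have h1 := (measurePreserving_prodAssoc
    (volume : Measure ({p : G.Pairs // p ≠ G.firstPair} → Space d))
    (volume : Measure (Fin (n + 1) → Space d)) (volume : Measure G.Slices)).symm
  have h2 := (V.measurePreserving_leftFreq d).prod (MeasurePreserving.id (volume : Measure G.Slices))
  have h3 : MeasurePreserving (Prod.map (V.leftFreq (d := d)) (id : G.Slices → G.Slices))
      ((volume.prod volume).prod volume) (volume.prod volume) := h2
  have h4 := G.measurePreserving_toJoint.comp (h3.comp h1)
  exact h4

/-- On edges, the two descriptions of the frequencies agree, and each of the `n+1` covariances is a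
Wigner transform up to the constant `ftConst⁻¹ ε^d`. -/
theorem pairTerm_parametrize (hu : IsInitialField P ε (envelope ahat) u₀) (hε : 0 < ε)
    (ha : ContDiff ℝ (⊤ : ℕ∞) ahat) (hs : HasCompactSupport ahat) (ω₀ : ℝ)
    (m : Space d → ℝ) {t : ℝ} (ht : 0 ≤ t) (V : G.IntegrationOrder)
    (q : ({p : G.Pairs // p ≠ G.firstPair} → Space d) × (Fin (n + 1) → Space d) × G.Slices) :
    G.pairTerm P u₀ ε ω₀ m t (G.parametrize V q) =
      ((ftConst d : ℂ)⁻¹ * ((ε ^ d : ℝ) : ℂ)) ^ (n + 1) *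
        G.integrand V.freeData ε ω₀ m (wignerHat P ε u₀) t (G.extendSlow q.1, q.2) := by
  set z := V.leftFreq (q.1, q.2.1)
  have hfreq : ∀ e ∈ G.edges, V.freeData.freq q.2.1 (G.extendSlow q.1) e =
      freqOf 0 (zeroExtend z) e := fun e he => V.freq_eq_freqOf (q.1, q.2.1) he
  have hfl : G.IsFlow (freqOf 0 (zeroExtend z)) (G.extendSlow q.1) := by
    obtain ⟨y, hy, -, h⟩ := V.isFlow_freq q.2.1 (sum_extendSlow q.1)
    refine ⟨by simp, fun v hv => by simp, fun p => ?_⟩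
    rw [← hfreq _ (initial_mem_edges _), ← hfreq _ (initial_mem_edges _),
      h _ (initial_mem_edges _), h _ (initial_mem_edges _), hy.pair]
  have hjf : ∀ v, jointFreq (G.parametrize V q) v = freqOf 0 (zeroExtend z) v := by
    intro v
    rw [jointFreq, parametrize, jointLeft_toJoint]
  have hcov : ∀ p : G.Pairs, leafCov P u₀ (G.tree.parity (G.initial p.1))
      (G.tree.parity (G.initial (G.pair p.1))) (freqOf 0 (zeroExtend z) (G.initial p.1))
      (freqOf 0 (zeroExtend z) (G.initial (G.pair p.1))) =
      ((ftConst d : ℂ)⁻¹ * ((ε ^ d : ℝ) : ℂ)) * wignerHat P ε u₀ (G.extendSlow q.1 p)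
        ((ε / 2) • G.pairFreq (V.freeData.freq q.2.1 (G.extendSlow q.1)) p) := by
    intro p
    have h1 : G.tree.parity (G.initial (G.pair p.1)) = -G.tree.parity (G.initial p.1) :=
      G.consistent p.1
    rw [h1, hu.leafCov_neg hε ha hs, hfl.pair, pairFreq, hfreq _ (initial_mem_edges _),
      hfreq _ (initial_mem_edges _), ← h1]
    rfl
  have hmult : G.multiplier ε m (freqOf 0 (zeroExtend z)) =
      G.multiplier ε m (V.freeData.freq q.2.1 (G.extendSlow q.1)) := by
    refine Finset.prod_congr rfl fun v hv => ?_
    have hv' := (mem_interaction.1 hv).2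
    rw [hfreq v (Finset.mem_union_left _ hv), hfreq _ (append_mem_edges hv' _),
      hfreq _ (append_mem_edges hv' _)]
  have hres : ∀ v, ∑ w ∈ G.pPlus v, G.resonance ω₀ (freqOf 0 (zeroExtend z)) w =
      ∑ w ∈ G.pPlus v, G.resonance ω₀ (V.freeData.freq q.2.1 (G.extendSlow q.1)) w := by
    intro v
    refine Finset.sum_congr rfl fun w hw => ?_
    have hw1 : w ∈ G.interaction := by
      classical
      unfold pPlus at hw
      exact (Finset.mem_filter.1 hw).1
    have hw' := (mem_interaction.1 hw1).2
    rw [resonance, resonance, hfreq w (Finset.mem_union_left _ hw1),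
      hfreq _ (append_mem_edges hw' _), hfreq _ (append_mem_edges hw' _)]
  rw [pairTerm]
  simp only [hjf, hcov]
  rw [parametrize, jointWeight_toJoint _ _ _ _ ht, Finset.prod_mul_distrib, Finset.prod_const,
    Finset.card_univ, G.card_pairs, integrand]
  simp only [hmult, hres, z]
  ring

theorem paramMeasure_eq : G.paramMeasure d = ((volume : Measure
    ({p : G.Pairs // p ≠ G.firstPair} → Space d)).prod
      ((volume : Measure (Fin (n + 1) → Space d)).prod volume)).map
        (Prod.map G.extendSlow id) := by
  rw [← Measure.map_prod_map _ _ (measurable_extendSlow d) measurable_id, Measure.map_id]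
  rfl

/-- The measure on the hyperplane of slow variables is an image measure by definition. Pulled back,
the integrand is a multiple of `pairTerm` composed with a measure preserving map, so integrability
and value are both transported. -/
theorem integral_pairTerm (hu : IsInitialField P ε (envelope ahat) u₀) (hε : 0 < ε)
    (ha : ContDiff ℝ (⊤ : ℕ∞) ahat) (hs : HasCompactSupport ahat) (ω₀ : ℝ)
    {m : Space d → ℝ} (hm : Continuous m) {t : ℝ} (ht : 0 ≤ t) (V : G.IntegrationOrder) :
    Integrable (G.integrand V.freeData ε ω₀ m (wignerHat P ε u₀) t) (G.paramMeasure d) ∧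
    ∫ q, G.pairTerm P u₀ ε ω₀ m t q = ((ftConst d : ℂ)⁻¹ * ((ε ^ d : ℝ) : ℂ)) ^ (n + 1) *
      ∫ q, G.integrand V.freeData ε ω₀ m (wignerHat P ε u₀) t q ∂(G.paramMeasure d) := by
  set c : ℂ := ((ftConst d : ℂ)⁻¹ * ((ε ^ d : ℝ) : ℂ)) ^ (n + 1)
  have hc : c ≠ 0 := by
    refine pow_ne_zero _ (mul_ne_zero (inv_ne_zero ?_) ?_)
    · exact_mod_cast (ftConst_pos d).ne'
    · exact_mod_cast (pow_pos hε d).ne'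
  set F := G.integrand V.freeData ε ω₀ m (wignerHat P ε u₀) t
  have hF : ∀ q : ({p : G.Pairs // p ≠ G.firstPair} → Space d) × (Fin (n + 1) → Space d) ×
      G.Slices, F (G.extendSlow q.1, q.2) = c⁻¹ * G.pairTerm P u₀ ε ω₀ m t (G.parametrize V q) := by
    intro q
    rw [G.pairTerm_parametrize hu hε ha hs ω₀ m ht V q, inv_mul_cancel_left₀ hc]
  have hpm := G.measurable_pairTerm hu ω₀ hm.measurable t
  have hV := G.measurePreserving_parametrize (d := d) V
  have he : Measurable (Prod.map (G.extendSlow (d := d))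
      (id : (Fin (n + 1) → Space d) × G.Slices → (Fin (n + 1) → Space d) × G.Slices)) :=
    (measurable_extendSlow d).prodMap measurable_id
  have hr : Measurable fun q : (G.Pairs → Space d) × (Fin (n + 1) → Space d) × G.Slices =>
      ((fun p : {p : G.Pairs // p ≠ G.firstPair} => q.1 p.1, q.2) :
        ({p : G.Pairs // p ≠ G.firstPair} → Space d) × (Fin (n + 1) → Space d) × G.Slices) :=
    (measurable_pi_lambda _ fun p => (measurable_pi_apply p.1).comp measurable_fst).prodMk
      measurable_snd
  -- No measurability of the integrand off the hyperplane is used. The measure is carried by the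
  -- hyperplane, where the integrand equals a measurable function of the slow variables other than
  -- the first.
  have hFm : AEStronglyMeasurable F (G.paramMeasure d) := by
    refine ⟨_, ((hpm.comp (hV.measurable.comp hr)).const_mul c⁻¹).stronglyMeasurable, ?_⟩
    have hset : MeasurableSet {q : (G.Pairs → Space d) × (Fin (n + 1) → Space d) × G.Slices |
        ∑ p, q.1 p = 0} := by
      refine measurableSet_eq_fun ?_ measurable_const
      exact Finset.measurable_sum _ fun p _ => (measurable_pi_apply p).comp measurable_fst
    have h0 : ∀ᵐ q ∂(G.paramMeasure d), ∑ p, q.1 p = 0 := by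
      rw [paramMeasure_eq, ae_map_iff he.aemeasurable hset]
      exact Filter.Eventually.of_forall fun q => sum_extendSlow q.1
    filter_upwards [h0] with q hq
    have h1 : G.extendSlow (fun p : {p : G.Pairs // p ≠ G.firstPair} => q.1 p.1) = q.1 :=
      eq_of_sum_eq_zero (sum_extendSlow _) hq fun p hp => extendSlow_coe _ ⟨p, hp⟩
    have h2 := hF (fun p => q.1 p.1, q.2)
    rw [h1] at h2
    exact h2
  rw [paramMeasure_eq] at hFm ⊢
  have hcomp : F ∘ Prod.map G.extendSlow id =
      fun q => c⁻¹ * G.pairTerm P u₀ ε ω₀ m t (G.parametrize V q) := funext hF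
  have hpi := G.integrable_pairTerm hu ha hs ω₀ hm ht
  constructor
  · rw [integrable_map_measure hFm he.aemeasurable, hcomp]
    exact (hV.integrable_comp_of_integrable hpi).const_mul _
  · rw [integral_map he.aemeasurable hFm]
    have h1 : ∀ q, F (Prod.map G.extendSlow id q) =
      c⁻¹ * G.pairTerm P u₀ ε ω₀ m t (G.parametrize V q) := hF
    simp only [h1]
    rw [integral_const_mul, mul_inv_cancel_left₀ hc, ← hV.map_eq,
      integral_map hV.measurable.aemeasurable hpm.aestronglyMeasurable]

end PairedGraph

end WaveKinetic

namespace WaveKinetic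

open PairedGraph (zeroExtend zeroExtend_coe zeroExtend_of_mem)

/-! ### Expectations of products of amplitudes -/

theorem norm_list_prod_le {α : Type*} (l : List α) {f g : α → ℂ} {B : ℝ} (hB : 0 ≤ B)
    (h : ∀ v, ‖f v‖ ≤ B * ‖g v‖) : ‖(l.map f).prod‖ ≤ B ^ l.length * ‖(l.map g).prod‖ := by
  induction l with
  | nil => simp
  | cons a l ih =>
    rw [List.map_cons, List.prod_cons, List.map_cons, List.prod_cons, norm_mul, norm_mul,
      List.length_cons, pow_succ', mul_mul_mul_comm]
    exact mul_le_mul (h a) ih (norm_nonneg _) (mul_nonneg hB (norm_nonneg _))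

namespace IsBandLimited

open STree

variable {d : ℕ} {φ : Space d → ℂ} {B R : ℝ}

theorem norm_leafField_le_ballInd (h : IsBandLimited φ B R) (σ : ℤˣ) (ξ : Space d) :
    ‖leafField φ σ ξ‖ ≤ B * ‖ballInd d R ξ‖ := by
  by_cases hξ : R < ‖ξ‖
  · have : leafField φ σ ξ = 0 := by
      unfold leafField
      split_ifs
      · exact h.support ξ hξ
      · rw [h.support (-ξ) (by rwa [norm_neg]), map_zero]
    rw [this, norm_zero]
    exact mul_nonneg h.nonneg_bound (norm_nonneg _)
  · rw [ballInd, Set.indicator_of_mem (by simpa using hξ), Pi.one_apply, norm_one, mul_one]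
    exact h.norm_leafField_le σ ξ

/-- The randomness is confined to a power of the bound `B`, for which all moments are available; the
other factor is deterministic and integrable. -/
theorem norm_joint_le (h : IsBandLimited φ B R) (ε ω₀ : ℝ) (m : Space d → ℝ) (L T : STree)
    (t : ℝ) (q : Space d × L.Vars d × T.Vars d) : ‖joint ε ω₀ m φ L T t q‖ ≤
      B ^ (node 1 L T).leaves.length * ‖joint ε ω₀ m (ballInd d R) L T t q‖ := by
  rw [joint_eq, joint_eq, norm_mul, norm_mul, mul_left_comm]
  refine mul_le_mul_of_nonneg_left (norm_list_prod_le _ h.nonneg_bound fun v => ?_) (norm_nonneg _)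
  rw [leafField_ballInd]
  exact h.norm_leafField_le_ballInd _ _

end IsBandLimited

section Expectation

open STree

variable {d : ℕ} {ahat : Space d × Space d → ℂ} {Ω : Type*} [MeasurableSpace Ω] {P : Measure Ω}
  {ε : ℝ} {u₀ : Ω → Space d → ℂ} {n : ℕ}

instance (L T : STree) :
    SFinite (volume : Measure (Space d × L.Vars d × T.Vars d)) :=
  have : SigmaFinite (volume : Measure (L.Vars d × T.Vars d)) := sigmaFinite_volume_prod_pi
  have : SigmaFinite (volume : Measure (Space d × L.Vars d × T.Vars d)) := sigmaFinite_volume_prod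
  inferInstance

/-- The contribution of a pairing of the initial vertices of two interaction graphs. -/
def pairingTerm (P : Measure Ω) (u : Ω → Space d → ℂ) (ε ω₀ : ℝ) (m : Space d → ℝ) (t : ℝ)
    (Gl Gr : InteractionGraph n) (f : Fin (2 * n + 2) → Fin (2 * n + 2))
    (q : Space d × Gl.1.flip.Vars d × Gr.1.Vars d) : ℂ :=
  jointWeight ε ω₀ m Gl.1.flip Gr.1 t q * ∏ i with i < f i,
    leafCov P u ((mergedTree Gl Gr).parity (initialVertex Gl Gr i))
      ((mergedTree Gl Gr).parity (initialVertex Gl Gr (f i)))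
      (jointFreq q (initialVertex Gl Gr i)) (jointFreq q (initialVertex Gl Gr (f i)))

theorem pairingTerm_pair (ω₀ : ℝ) (m : Space d → ℝ) (t : ℝ) (G : PairedGraph n) :
    pairingTerm P u₀ ε ω₀ m t G.left G.right G.pair = G.pairTerm P u₀ ε ω₀ m t := by
  funext q
  rw [pairingTerm, PairedGraph.pairTerm, Finset.prod_subtype (p := fun i => i < G.pair i)]
  · rfl
  · simp

variable [IsProbabilityMeasure P]

theorem IsInitialField.integrable_joint (hu : IsInitialField P ε (envelope ahat) u₀)
    (ha : ContDiff ℝ (⊤ : ℕ∞) ahat) (hs : HasCompactSupport ahat) (ω₀ : ℝ)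
    {m : Space d → ℝ} (hm : Continuous m) (L T : STree) {t : ℝ} (ht : 0 ≤ t) :
    Integrable (fun p : Ω × (Space d × L.Vars d × T.Vars d) =>
      joint ε ω₀ m (ft (u₀ p.1)) L T t p.2) (P.prod volume) := by
  obtain ⟨R, hR0, -, hR⟩ := hu.exists_band ha hs
  have h1 := (hu.integrable_scaled_fieldNorm_pow ha hs (node 1 L T).leaves.length).mul_prod
    (STree.integrable_joint (isBandLimited_ballInd (d := d) hR0) ε ω₀ hm L T ht).norm
  refine h1.mono' (measurable_joint ε ω₀ hm.measurable (φ := fun ω => ft (u₀ ω))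
    hu.measurable_ft L T t).aestronglyMeasurable ?_
  filter_upwards [Measure.quasiMeasurePreserving_fst.ae hR] with p hp
  exact hp.2.2.norm_joint_le ε ω₀ m L T t p.2

theorem prod_map_leaves_mergedTree {M : Type*} [CommMonoid M] (Gl Gr : InteractionGraph n)
    (f : List Bool → M) :
    ((mergedTree Gl Gr).leaves.map f).prod = ∏ i, f (initialVertex Gl Gr i) := by
  rw [← Fin.prod_univ_fun_getElem]
  exact Fintype.prod_equiv (finCongr (length_leaves_mergedTree Gl Gr)) _ _ fun i => rfl

theorem IsInitialField.integral_joint (hu : IsInitialField P ε (envelope ahat) u₀)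
    (ha : ContDiff ℝ (⊤ : ℕ∞) ahat) (hs : HasCompactSupport ahat) (ω₀ : ℝ)
    (m : Space d → ℝ) (Gl Gr : InteractionGraph n) (t : ℝ)
    (q : Space d × Gl.1.flip.Vars d × Gr.1.Vars d) :
    ∫ ω, joint ε ω₀ m (ft (u₀ ω)) Gl.1.flip Gr.1 t q ∂P =
      ∑ f ∈ pairings Finset.univ, pairingTerm P u₀ ε ω₀ m t Gl Gr f q := by
  have h1 : ∀ ω, joint ε ω₀ m (ft (u₀ ω)) Gl.1.flip Gr.1 t q =
      jointWeight ε ω₀ m Gl.1.flip Gr.1 t q * ∏ i, leafField (ft (u₀ ω))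
        ((mergedTree Gl Gr).parity (initialVertex Gl Gr i))
        (jointFreq q (initialVertex Gl Gr i)) := by
    intro ω
    rw [joint_eq, ← prod_map_leaves_mergedTree Gl Gr fun v => leafField (ft (u₀ ω))
      ((mergedTree Gl Gr).parity v) (jointFreq q v)]
    rfl
  simp only [h1]
  rw [integral_const_mul, hu.wick ha hs, pairSum, Finset.mul_sum]
  rfl

theorem pair_mem_pairings (G : PairedGraph n) : G.pair ∈ pairings Finset.univ := by
  rw [mem_pairings]
  exact ⟨G.pair_pair, fun i => ⟨fun h => absurd h (G.pair_ne i), fun h => absurd (Finset.mem_univ i) h⟩⟩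

/-- A pairing that violates the parity condition has a pair of equal parities, whose covariance is
zero; otherwise it is part of a paired graph. -/
theorem exists_pairedGraph (hu : IsInitialField P ε (envelope ahat) u₀)
    (ha : ContDiff ℝ (⊤ : ℕ∞) ahat) (hs : HasCompactSupport ahat) (ω₀ : ℝ)
    (m : Space d → ℝ) (t : ℝ) (Gl Gr : InteractionGraph n)
    {f : Fin (2 * n + 2) → Fin (2 * n + 2)} (hf : f ∈ pairings Finset.univ) :
    (∃ G : PairedGraph n, G.left = Gl ∧ G.right = Gr ∧ G.pair = f) ∨
      pairingTerm P u₀ ε ω₀ m t Gl Gr f = 0 := by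
  rw [mem_pairings] at hf
  have hne : ∀ i, f i ≠ i := fun i h => (hf.2 i).1 h (Finset.mem_univ i)
  by_cases hc : ∀ i, (mergedTree Gl Gr).parity (initialVertex Gl Gr (f i)) =
    -(mergedTree Gl Gr).parity (initialVertex Gl Gr i)
  · exact Or.inl ⟨⟨Gl, Gr, f, hf.1, hne, hc⟩, rfl, rfl, rfl⟩
  · right
    obtain ⟨i, hi⟩ := not_forall.1 hc
    have hi' : (mergedTree Gl Gr).parity (initialVertex Gl Gr (f i)) =
        (mergedTree Gl Gr).parity (initialVertex Gl Gr i) := by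
      rcases Int.units_eq_one_or ((mergedTree Gl Gr).parity (initialVertex Gl Gr i)) with h | h <;>
      rcases Int.units_eq_one_or ((mergedTree Gl Gr).parity (initialVertex Gl Gr (f i))) with h' | h' <;>
      simp_all
    -- The index found may be the larger element of its pair, whereas the product runs over the
    -- smaller elements.
    have hex : ∃ j, j < f j ∧ (mergedTree Gl Gr).parity (initialVertex Gl Gr (f j)) =
        (mergedTree Gl Gr).parity (initialVertex Gl Gr j) := by
      rcases lt_or_gt_of_ne (hne i) with h | h
      · exact ⟨f i, by rwa [hf.1], by rw [hf.1, hi']⟩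
      · exact ⟨i, h, hi'⟩
    obtain ⟨j, hj, hj'⟩ := hex
    funext q
    rw [pairingTerm, Finset.prod_eq_zero (i := j) (by simpa using hj), mul_zero, Pi.zero_apply]
    rw [hj']
    exact hu.leafCov_self ha hs _ _ _

theorem integrable_pairingTerm (hu : IsInitialField P ε (envelope ahat) u₀)
    (ha : ContDiff ℝ (⊤ : ℕ∞) ahat) (hs : HasCompactSupport ahat) (ω₀ : ℝ)
    {m : Space d → ℝ} (hm : Continuous m) {t : ℝ} (ht : 0 ≤ t) (Gl Gr : InteractionGraph n)
    {f : Fin (2 * n + 2) → Fin (2 * n + 2)} (hf : f ∈ pairings Finset.univ) :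
    Integrable (pairingTerm P u₀ ε ω₀ m t Gl Gr f) := by
  rcases exists_pairedGraph hu ha hs ω₀ m t Gl Gr hf with ⟨G, rfl, rfl, rfl⟩ | h
  · rw [pairingTerm_pair]
    exact G.integrable_pairTerm hu ha hs ω₀ hm ht
  · rw [h]
    exact integrable_zero _ _ _

theorem IsInitialField.integral_integral_joint (hu : IsInitialField P ε (envelope ahat) u₀)
    (ha : ContDiff ℝ (⊤ : ℕ∞) ahat) (hs : HasCompactSupport ahat) (ω₀ : ℝ)
    {m : Space d → ℝ} (hm : Continuous m) {t : ℝ} (ht : 0 ≤ t) (Gl Gr : InteractionGraph n) :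
    ∫ ω, (∫ q, joint ε ω₀ m (ft (u₀ ω)) Gl.1.flip Gr.1 t q) ∂P =
      ∑ f ∈ pairings Finset.univ, ∫ q, pairingTerm P u₀ ε ω₀ m t Gl Gr f q := by
  refine (integral_integral_swap (f := fun ω q => joint ε ω₀ m (ft (u₀ ω)) Gl.1.flip Gr.1 t q)
    (hu.integrable_joint ha hs ω₀ hm Gl.1.flip Gr.1 ht)).trans ?_
  simp only [hu.integral_joint ha hs]
  exact integral_finsetSum _ fun f hf => integrable_pairingTerm hu ha hs ω₀ hm ht Gl Gr hf

/-- Sums over two interaction graphs and a pairing are sums over paired graphs. -/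
theorem sum_pairings_eq (hu : IsInitialField P ε (envelope ahat) u₀)
    (ha : ContDiff ℝ (⊤ : ℕ∞) ahat) (hs : HasCompactSupport ahat) (ω₀ : ℝ)
    (m : Space d → ℝ) (t : ℝ) (c : InteractionGraph n → InteractionGraph n → ℂ) :
    ∑ Gl : InteractionGraph n, ∑ Gr : InteractionGraph n, c Gl Gr *
      ∑ f ∈ pairings Finset.univ, ∫ q, pairingTerm P u₀ ε ω₀ m t Gl Gr f q =
    ∑ᶠ G : PairedGraph n, c G.left G.right * ∫ q, G.pairTerm P u₀ ε ω₀ m t q := by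
  classical
  let _ : Fintype (PairedGraph n) := Fintype.ofFinite _
  rw [finsum_eq_sum_of_fintype]
  simp only [Finset.mul_sum, ← Finset.sum_product']
  symm
  refine Finset.sum_of_injOn (fun G : PairedGraph n => ((G.left, G.right, G.pair) :
    InteractionGraph n × InteractionGraph n × (Fin (2 * n + 2) → Fin (2 * n + 2)))) ?_ ?_ ?_ ?_
  · rintro ⟨_, _, _, _, _, _⟩ - ⟨_, _, _, _, _, _⟩ - h
    simp only [Prod.mk.injEq] at h
    obtain ⟨rfl, rfl, rfl⟩ := h
    rfl
  · intro G _
    simp [pair_mem_pairings G]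
  · rintro ⟨Gl, Gr, f⟩ hx hx'
    have hf : f ∈ pairings Finset.univ := by simpa using hx
    rcases exists_pairedGraph hu ha hs ω₀ m t Gl Gr hf with ⟨G, rfl, rfl, rfl⟩ | h
    · exact absurd ⟨G, by simp, rfl⟩ hx'
    · simp [h]
  · intro G _
    rw [pairingTerm_pair]

end Expectation

/-! ### Constants -/

namespace STree

theorem interactionSign_flip (T : STree) :
    T.flip.interactionSign = (-1) ^ T.depth * T.interactionSign := by
  induction T with
  | leaf σ => rfl
  | node σ l r hl hr =>
    rw [flip, interactionSign, interactionSign, hl, hr, depth, pow_succ, pow_add]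
    simp only [neg_mul, mul_neg, mul_one, neg_inj]
    simp only [mul_assoc, mul_left_comm]

theorem coef_eq (d : ℕ) (lam : ℝ) (T : STree) : T.coef d lam =
    (-Complex.I) ^ T.depth * ((T.interactionSign : ℤ) : ℂ) * (lam : ℂ) ^ T.depth *
      (ftConst d : ℂ) ^ T.depth := by
  induction T with
  | leaf σ => simp [coef, interactionSign, depth]
  | node σ l r hl hr =>
    rw [coef, hl, hr, interactionSign, depth, pow_succ, pow_succ, pow_succ, pow_add, pow_add, pow_add]
    simp only [unitSign]
    push_cast
    ring

end STree

theorem ftConst_pow_mul (d n : ℕ) : ftConst d ^ (2 * n) * (ftConst d)⁻¹ ^ (n + 1) =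
    (2 * Real.pi) ^ ((d : ℝ) * (1 - (n : ℝ)) / 2) := by
  have hp : (0 : ℝ) < 2 * Real.pi := by positivity
  rw [ftConst, ← Real.rpow_natCast, ← Real.rpow_natCast, ← Real.rpow_neg hp.le, ← Real.rpow_mul hp.le,
    ← Real.rpow_mul hp.le, ← Real.rpow_add hp]
  congr 1
  push_cast
  ring

/-- The `2n` factors `-i` give `(-1)^n`, which the flip of the left parities compensates, so only
the unflipped parities survive. The constants `(2π)^{-d/2}` occur `2n` times in the interactions and
`-(n+1)` times in the covariances. -/
theorem PairedGraph.coef_mul_coef {n : ℕ} (G : PairedGraph n) (d : ℕ) (lam ε : ℝ) :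
    G.leftTree.coef d lam * G.rightTree.coef d lam *
      ((ftConst d : ℂ)⁻¹ * ((ε ^ d : ℝ) : ℂ)) ^ (n + 1) =
    ((G.totalSign * (2 * Real.pi) ^ ((d : ℝ) * (1 - (n : ℝ)) / 2) *
      lam ^ (2 * n) * ε ^ (d * (n + 1)) : ℝ) : ℂ) := by
  have hI : (-Complex.I) ^ n * (-Complex.I) ^ n * (-1) ^ n = 1 := by
    rw [← mul_pow, ← mul_pow]
    simp
  rw [STree.coef_eq, STree.coef_eq, STree.interactionSign_flip, STree.depth_flip, G.left.2.1,
    G.right.2.1, ← ftConst_pow_mul, totalSign, pow_mul ε]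
  push_cast
  rw [two_mul, pow_add _ n n, pow_add _ n n, mul_pow]
  linear_combination ((G.left.1.interactionSign : ℤ) : ℂ) * ((G.right.1.interactionSign : ℤ) : ℂ) *
    (lam : ℂ) ^ n * (lam : ℂ) ^ n * (ftConst d : ℂ) ^ n * (ftConst d : ℂ) ^ n *
    ((ftConst d : ℂ)⁻¹ ^ (n + 1) * ((ε : ℂ) ^ d) ^ (n + 1)) * hI

end WaveKinetic

namespace WaveKinetic

/-! ### The expectation of the squared norm of the iterates -/

section Main

open STree

variable {d : ℕ} {ahat : Space d × Space d → ℂ} {Ω : Type*} [MeasurableSpace Ω] {P : Measure Ω}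
  {ε : ℝ} {u₀ : Ω → Space d → ℂ} {n : ℕ} {m : Space d → ℝ} {t : ℝ}

theorem IsInitialField.measurable_amp (hu : IsInitialField P ε (envelope ahat) u₀)
    (hm : Measurable m) (lam ω₀ t : ℝ) (T : STree) :
    Measurable fun p : Ω × Space d => T.amp ε lam ω₀ m (ft (u₀ p.1)) t p.2 := by
  have h : Measurable (Function.uncurry fun (p : Ω × Space d) x =>
      T.ampIntegrand ε ω₀ m (ft (u₀ p.1)) t p.2 x) :=
    measurable_ampIntegrand (A := (Ω × Space d) × _) ε ω₀ hm
      (φ := fun a => ft (u₀ a.1.1))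
      (measurable_apply₂ hu.measurable_ft measurable_fst.fst.fst measurable_snd) T
      measurable_const measurable_fst.snd measurable_snd
  exact (h.stronglyMeasurable.integral_prod_right.measurable).const_mul _

theorem measurable_ift {A : Type*} [MeasurableSpace A] {g : A → Space d → ℂ}
    (hg : Measurable (Function.uncurry g)) :
    Measurable fun p : A × Space d => ift (g p.1) p.2 := by
  have h : Measurable (Function.uncurry fun (p : A × Space d) (ξ : Space d) =>
      g p.1 ξ * Complex.exp (Complex.I * ((inner ℝ p.2 ξ : ℝ) : ℂ))) := by
    refine (measurable_apply₂ hg measurable_fst.fst measurable_snd).mul ?_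
    have h2 : Continuous fun q : Space d × Space d =>
        Complex.exp (Complex.I * ((inner ℝ q.1 q.2 : ℝ) : ℂ)) := by fun_prop
    have h3 : Measurable (Function.uncurry fun x ξ : Space d =>
        Complex.exp (Complex.I * ((inner ℝ x ξ : ℝ) : ℂ))) := h2.measurable
    exact measurable_apply₂ h3 (measurable_snd.comp measurable_fst) measurable_snd
  exact (h.stronglyMeasurable.integral_prod_right.measurable).const_mul _

variable [IsProbabilityMeasure P]

/-- Everything deterministic is applied to a sample path with smooth, compactly supported Fourier
transform; almost every path is of this kind. -/
theorem IsInitialField.ae_iterate (hu : IsInitialField P ε (envelope ahat) u₀)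
    (ha : ContDiff ℝ (⊤ : ℕ∞) ahat) (hs : HasCompactSupport ahat)
    (hm : ContDiff ℝ (⊤ : ℕ∞) m) (heven : ∀ ξ, m (-ξ) = m ξ) (lam ω₀ : ℝ) (n : ℕ) (ht : 0 ≤ t) :
    ∀ᵐ ω ∂P, iterate ε lam ω₀ m (u₀ ω) n t = ift (profile ε lam ω₀ m (ft (u₀ ω)) n t) ∧
      (∀ ξ, profile ε lam ω₀ m (ft (u₀ ω)) n t ξ =
        Complex.exp (Complex.I * ((t * disp ω₀ ξ : ℝ) : ℂ)) *
        ∑ T ∈ ofDepth n with T.parity [] = 1, T.amp ε lam ω₀ m (ft (u₀ ω)) t ξ) ∧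
      Integrable (fun x => ‖iterate ε lam ω₀ m (u₀ ω) n t x‖ ^ 2) ∧
      ((∫ x, ‖iterate ε lam ω₀ m (u₀ ω) n t x‖ ^ 2 : ℝ) : ℂ) =
        ∑ Gl : InteractionGraph n, ∑ Gr : InteractionGraph n,
          (Gl.1.flip.coef d lam * Gr.1.coef d lam) *
            ∫ q, joint ε ω₀ m (ft (u₀ ω)) Gl.1.flip Gr.1 t q := by
  obtain ⟨R, -, -, hR⟩ := hu.exists_band ha hs
  filter_upwards [hR] with ω hω
  obtain ⟨h1, h2, h3⟩ := hω
  have hi := iterate_eq_ift ε lam ω₀ hm h1 h2 rfl n t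
  have hp := isProfile_profile ε lam ω₀ hm h1 h2 n
  refine ⟨hi, profile_eq_sum_amp h3 ε lam ω₀ hm.continuous heven n ht, ?_, ?_⟩
  · rw [hi]
    exact integrable_norm_sq_ift (hp.contDiff t) (hp.hasCompactSupport t)
  · have hj := fun L T => integral_amp_mul_amp h3 ε lam ω₀ hm.continuous L T ht
    rw [hi, integral_norm_sq_ift (hp.contDiff t) (hp.hasCompactSupport t), ← integral_complex_ofReal]
    simp only [norm_profile_sq h3 ε lam ω₀ hm.continuous heven n ht]
    rw [integral_finsetSum _ fun Gl _ => integrable_finsetSum _ fun Gr _ => (hj _ _).1]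
    refine Finset.sum_congr rfl fun Gl _ => ?_
    rw [integral_finsetSum _ fun Gr _ => (hj _ _).1]
    exact Finset.sum_congr rfl fun Gr _ => (hj _ _).2

/-- For almost every path the squared norm is the real part of a finite combination of integrals of
`joint`, which are integrable in the sample point. -/
theorem IsInitialField.integrable_iterate (hu : IsInitialField P ε (envelope ahat) u₀)
    (ha : ContDiff ℝ (⊤ : ℕ∞) ahat) (hs : HasCompactSupport ahat)
    (hm : ContDiff ℝ (⊤ : ℕ∞) m) (heven : ∀ ξ, m (-ξ) = m ξ) (lam ω₀ : ℝ) (n : ℕ) (ht : 0 ≤ t) :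
    Integrable (fun q : Ω × Space d => ‖iterate ε lam ω₀ m (u₀ q.1) n t q.2‖ ^ 2)
      (P.prod volume) := by
  have h := hu.ae_iterate ha hs hm heven lam ω₀ n ht
  -- The iterate is compared with a jointly measurable function: the inverse transform of the tree
  -- expansion, which agrees with it for almost every path.
  have hmeas : AEStronglyMeasurable
      (fun q : Ω × Space d => ‖iterate ε lam ω₀ m (u₀ q.1) n t q.2‖ ^ 2) (P.prod volume) := by
    have hg : Measurable (Function.uncurry fun (ω : Ω) (ξ : Space d) =>
        Complex.exp (Complex.I * ((t * disp ω₀ ξ : ℝ) : ℂ)) *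
        ∑ T ∈ ofDepth n with T.parity [] = 1, T.amp ε lam ω₀ m (ft (u₀ ω)) t ξ) := by
      refine Measurable.mul ?_ (Finset.measurable_sum _ fun T _ =>
        hu.measurable_amp hm.continuous.measurable lam ω₀ t T)
      have : Continuous fun ξ : Space d => Complex.exp (Complex.I * ((t * disp ω₀ ξ : ℝ) : ℂ)) := by
        unfold disp
        fun_prop
      exact this.measurable.comp measurable_snd
    refine ⟨_, ((measurable_ift hg).norm.pow_const 2).stronglyMeasurable, ?_⟩
    filter_upwards [Measure.quasiMeasurePreserving_fst.ae h] with q hq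
    rw [hq.1]
    congr 3
    funext ξ
    exact hq.2.1 ξ
  rw [integrable_prod_iff hmeas]
  refine ⟨h.mono fun ω hω => hω.2.2.1, ?_⟩
  have h1 : Integrable (fun ω => ∑ Gl : InteractionGraph n, ∑ Gr : InteractionGraph n,
      (Gl.1.flip.coef d lam * Gr.1.coef d lam) *
        ∫ q, joint ε ω₀ m (ft (u₀ ω)) Gl.1.flip Gr.1 t q) P :=
    integrable_finsetSum _ fun Gl _ => integrable_finsetSum _ fun Gr _ =>
      ((hu.integrable_joint ha hs ω₀ hm.continuous _ _ ht).integral_prod_left).const_mul _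
  refine h1.re.congr ?_
  filter_upwards [h] with ω hω
  rw [← hω.2.2.2]
  simp

theorem IsInitialField.integral_iterate (hu : IsInitialField P ε (envelope ahat) u₀) (hε : 0 < ε)
    (ha : ContDiff ℝ (⊤ : ℕ∞) ahat) (hs : HasCompactSupport ahat)
    (hm : ContDiff ℝ (⊤ : ℕ∞) m) (heven : ∀ ξ, m (-ξ) = m ξ) (lam ω₀ : ℝ) (ht : 0 ≤ t)
    (V : (G : PairedGraph n) → G.IntegrationOrder) :
    ((∫ ω, (∫ x, ‖iterate ε lam ω₀ m (u₀ ω) n t x‖ ^ 2) ∂P : ℝ) : ℂ) =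
      ∑ᶠ G : PairedGraph n,
        G.graphIntegral (V G).freeData ε lam ω₀ m (wignerHat P ε u₀) t := by
  have hj := fun L T => hu.integrable_joint ha hs ω₀ hm.continuous L T ht
  have hint : ∀ Gl Gr : InteractionGraph n, Integrable (fun ω =>
      (Gl.1.flip.coef d lam * Gr.1.coef d lam) *
        ∫ q, joint ε ω₀ m (ft (u₀ ω)) Gl.1.flip Gr.1 t q) P := fun Gl Gr =>
    (hj Gl.1.flip Gr.1).integral_prod_left.const_mul _
  have h1 : ((∫ ω, (∫ x, ‖iterate ε lam ω₀ m (u₀ ω) n t x‖ ^ 2) ∂P : ℝ) : ℂ) =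
      ∑ Gl : InteractionGraph n, ∑ Gr : InteractionGraph n,
        (Gl.1.flip.coef d lam * Gr.1.coef d lam) *
          ∑ f ∈ pairings Finset.univ, ∫ q, pairingTerm P u₀ ε ω₀ m t Gl Gr f q := by
    rw [← integral_complex_ofReal, integral_congr_ae
      ((hu.ae_iterate ha hs hm heven lam ω₀ n ht).mono fun ω hω => hω.2.2.2),
      integral_finsetSum _ fun Gl _ => integrable_finsetSum _ fun Gr _ => hint Gl Gr]
    refine Finset.sum_congr rfl fun Gl _ => ?_
    rw [integral_finsetSum _ fun Gr _ => hint Gl Gr]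
    refine Finset.sum_congr rfl fun Gr _ => ?_
    rw [integral_const_mul, hu.integral_integral_joint ha hs ω₀ hm.continuous ht]
  rw [h1, sum_pairings_eq hu ha hs ω₀ m t fun Gl Gr : InteractionGraph n =>
    Gl.1.flip.coef d lam * Gr.1.coef d lam]
  refine finsum_congr fun G => ?_
  rw [(G.integral_pairTerm hu hε ha hs ω₀ hm.continuous ht (V G)).2, PairedGraph.graphIntegral,
    ← G.coef_mul_coef]
  exact (mul_assoc _ _ _).symm

end Main

end WaveKinetic

end

/-! ### The complete statement -/

open WaveKinetic in
theorem proposition6p1 (n : ℕ) :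
    -- the set of paired graphs is finite
    Finite (PairedGraph n) ∧
    -- for any choice of integration orders there is a choice of free variables
    ∀ V : (G : PairedGraph n) → G.IntegrationOrder,
    ∃ D : (G : PairedGraph n) → G.FreeData,
      -- combinatorial and algebraic properties, for each graph
      (∀ G : PairedGraph n,
        StrictMono (D G).k ∧
        -- degree one and degree zero vertices, linear and quadratic ones
        (D G).degreeOne (V G) ⊆ G.interaction ∧
        ((D G).degreeOne (V G)).card = n ∧
        ((D G).degreeZero (V G)).card = n ∧
        (∀ v ∈ (D G).degreeOne (V G), Xor' (G.IsLinear v) (G.IsQuadratic v)) ∧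
        -- the last free edge is the left root edge if the two subtrees are linked
        (G.Linked → (D G).freeEdge (V G) (Fin.last n) = [false]) ∧
        -- the paths `𝓅⁺`
        (∀ v ∈ G.interaction, v ∈ G.pPlus v) ∧
        (∀ k k' : Fin (2 * n + 1), k < k' → (V G).at k' ∈ G.interaction →
          (V G).at k ∉ G.pPlus ((V G).at k')) ∧
        -- the coefficients of all frequencies are in `{-1, 0, 1}`
        (∀ e ∈ G.edges, (∀ j, (D G).coefFree e j ∈ ({-1, 0, 1} : Set ℤ)) ∧
          ∀ p, (D G).coefSlow e p ∈ ({-1, 0, 1} : Set ℤ)) ∧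
        -- the frequency above `v_k` only depends on later interaction free variables
        (∀ k, (V G).at k ∈ G.interaction →
          ∀ j, (D G).coefFree ((V G).at k) j ≠ 0 → k < (D G).k j) ∧
        ∀ d : ℕ,
          -- the free variables parametrize the frequencies that satisfy the Kirchhoff laws
          (∀ (ξf : Fin (n + 1) → Space d) (η : G.Pairs → Space d), ∑ p, η p = 0 →
            G.Kirchhoff ((D G).freq ξf η) η ∧
            ∀ i, (D G).freq ξf η ((D G).freeEdge (V G) i) = ξf i) ∧
          (∀ (ξ : List Bool → Space d) (η : G.Pairs → Space d), G.Kirchhoff ξ η →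
            ∀ e ∈ G.edges, ξ e = (D G).freq (fun i => ξ ((D G).freeEdge (V G) i)) η e) ∧
          -- the arguments of the Wigner transforms are coordinates as well
          Set.BijOn
            (fun q : (Fin (n + 1) → Space d) × (G.Pairs → Space d) =>
              ((fun p => G.pairFreq ((D G).freq q.1 q.2) p, q.2) :
                (G.Pairs → Space d) × (G.Pairs → Space d)))
            {q | ∑ p, q.2 p = 0} {q | ∑ p, q.2 p = 0} ∧
          ∀ ω₀ : ℝ,
            -- resonance moduli of the vertices `v_{kᵢ}`
            (∀ (i : Fin (n + 1)) (v : List Bool), v = (V G).at ((D G).k i) → v ∈ G.interaction →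
              ∀ (ξf : Fin (n + 1) → Space d) (η : G.Pairs → Space d), ∑ p, η p = 0 →
              ∀ (ξt : Space d) (σ σt : ℝ), ξt = (D G).freq ξf η v →
                σ = G.sgn (v ++ [false]) → σt = G.sgn v →
                (G.IsLinear v → G.resonance ω₀ ((D G).freq ξf η) v =
                  -σ * inner ℝ ξt (ξf i) + (σt * ω₀ + (1 / 2) * (σt + σ) * ‖ξt‖ ^ 2)) ∧
                (G.IsQuadratic v → G.resonance ω₀ ((D G).freq ξf η) v =
                  -σ * inner ℝ (ξf i) (ξf i - ξt) +
                    ((σt - 2 * σ) * ω₀ + (1 / 2) * (σt - σ) * ‖ξt‖ ^ 2))) ∧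
            -- resonance moduli of the degree zero vertices
            (∀ k, (V G).at k ∈ (D G).degreeZero (V G) →
              ∃ Q : MvPolynomial ((Fin (n + 1) ⊕ G.Pairs) × Fin d) ℝ,
                Q.totalDegree ≤ 2 ∧
                (∀ x ∈ Q.vars, ∀ j, x.1 = Sum.inl j → k ≤ (D G).k j) ∧
                ∀ (ξf : Fin (n + 1) → Space d) (η : G.Pairs → Space d), ∑ p, η p = 0 →
                  G.resonance ω₀ ((D G).freq ξf η) ((V G).at k) =
                    MvPolynomial.eval (fun x => Sum.elim ξf η x.1 x.2) Q)) ∧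
      -- the expansion of the expectation
      ∀ (d : ℕ) (ε lam ω₀ : ℝ) (m : Space d → ℝ) (ahat : Space d × Space d → ℂ),
        0 < ε → 0 < lam → (ω₀ = 0 ∨ ω₀ = (ε ^ 2)⁻¹) →
        ContDiff ℝ (⊤ : ℕ∞) m → (∀ ξ, m (-ξ) = m ξ) →
        ContDiff ℝ (⊤ : ℕ∞) ahat → HasCompactSupport ahat →
        ∀ (Ω : Type*) [MeasurableSpace Ω] (P : Measure Ω) [IsProbabilityMeasure P]
          (u₀ : Ω → Space d → ℂ), IsInitialField P ε (envelope ahat) u₀ →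
        ∀ t : ℝ, 0 ≤ t →
          Integrable (fun q : Ω × Space d => ‖iterate ε lam ω₀ m (u₀ q.1) n t q.2‖ ^ 2)
            (P.prod volume) ∧
          (∀ G : PairedGraph n, Integrable
            (G.integrand (D G) ε ω₀ m (wignerHat P ε u₀) t) (G.paramMeasure d)) ∧
          ((∫ ω, (∫ x, ‖iterate ε lam ω₀ m (u₀ ω) n t x‖ ^ 2) ∂P : ℝ) : ℂ) =
            ∑ᶠ G : PairedGraph n,
              G.graphIntegral (D G) ε lam ω₀ m (wignerHat P ε u₀) t := by
  refine ⟨inferInstance, fun V => ⟨fun G => (V G).freeData, fun G => (V G).freeData_properties, ?_⟩⟩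
  intro d ε lam ω₀ m ahat hε _ _ hm heven ha hs Ω _ P _ u₀ hu t ht
  exact ⟨hu.integrable_iterate ha hs hm heven lam ω₀ n ht,
    fun G => (G.integral_pairTerm hu hε ha hs ω₀ hm.continuous ht (V G)).1,
    hu.integral_iterate hε ha hs hm heven lam ω₀ ht V⟩
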